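/- All categories below are $\mathbb C$-linear and all $C^*$-algebras are unital. A *$C^*$-category* is a small $\mathbb C$-linear category with a conjugate-linear, involutive, contravariant endofunctor $*$ which is the identity on objects, such that every $\mathrm{Hom}(X,Y)$ is a Banach space, $\|g\circ f\|\le\|g\|\,\|f\|$, $\|f^*\circ f\|=\|f\|^2$, and for every $f\colon X\to Y$ there is $g\in\mathrm{End}(X)$ with $f^*\circ f=g^*\circ g$. (The norm is determined by the $*$-category.) A *$*$-functor* is a $\mathbb C$-linear functor which preserves $*$. Let $\mathrm{Clin}$ be the $(2,1)$-category whose objects are the $C^*$-categories which have finite orthogonal direct sums (including a zero object) and which are Karoubi complete (every projection $p=p^*=p^2$ splits through an isometry), whose 1-morphisms are the $*$-functors and whose 2-morphisms are the unitary natural isomorphisms. For $A,B\in\mathrm{Clin}$ let $A\boxtimes B$ be the $C^*$-category whose objects are the pairs $X\boxtimes Y$ with $X\in A$, $Y\in B$, with $\mathrm{End}(X\boxtimes Y)=\mathrm{End}_A(X)\otimes_{\max}\mathrm{End}_B(Y)$, and in which $\mathrm{Hom}(X\boxtimes Y,X'\boxtimes Y')$ is the closure of the image of $\mathrm{Hom}_A(X,X')\otimes\mathrm{Hom}_B(Y,Y')$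 in $\mathrm{End}_A(X\oplus X')\otimes_{\max}\mathrm{End}_B(Y\oplus Y')$; equivalently, it is the completion of $\mathrm{Hom}_A(X,X')\otimes\mathrm{Hom}_B(Y,Y')$ for the norm with $\|t\|^2=\|t^*\circ t\|_{\max}$. Let $A\boxtimes_{\max}B$ be the Karoubi completion of $A\boxtimes B$. With the evident action on $*$-functors and on unitary natural isomorphisms, $\boxtimes_{\max}$ is a pseudofunctor $\mathrm{Clin}\times\mathrm{Clin}\to\mathrm{Clin}$. **Theorem A.** 1. $\boxtimes_{\max}$ is the tensor product of a monoidal structure on the $(2,1)$-category $\mathrm{Clin}$ (that is, of a monoidal bicategory): there are a unit object, associators $(A\boxtimes_{\max}B)\boxtimes_{\max}C\to A\boxtimes_{\max}(B\boxtimes_{\max}C)$ and left and right unitors, which are pseudonatural equivalences, together with invertible modifications filling the pentagon and the three unit triangles, which satisfy the coherence axioms of a monoidal bicategory. 2. This monoidal structure is cocontinuous: for every $A\in\mathrm{Clin}$ the pseudofunctors $A\boxtimes_{\max}-$ and $-\boxtimes_{\max}A$ preserve the colimits of small diagrams. That is, let $I$ be a small category, let $V\colon I\to\mathrm{Clin}$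 be a pseudofunctor, and let $\sigma$ be a cocone under $V$ with vertex $X$ which exhibits $X$ as the colimit of $V$, i.e. such that for every $W\in\mathrm{Clin}$ composition with $\sigma$ is an equivalence of categories $$\mathrm{Clin}(X,W)\simeq[I,\mathrm{Clin}](V,\Delta W),$$ where $\Delta W$ is the constant diagram. Then the cocone $A\boxtimes_{\max}\sigma$ exhibits $A\boxtimes_{\max}X$ as the colimit of $(A\boxtimes_{\max}V_i)_{i\in I}$, so that $A\boxtimes_{\max}(\varinjlim V_i)\simeq\varinjlim(A\boxtimes_{\max}V_i)$, and likewise for $-\boxtimes_{\max}A$. -/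

import Mathlib

universe w v u u'

noncomputable section

open CategoryTheory
open scoped TensorProduct

namespace CStarLin

/-- A `*`-structure on a `ℂ`-linear category: an involutive, conjugate-linear, contravariant
endofunctor which is the identity on objects. -/
class StarCategory (C : Type u) [Category.{v} C] [Preadditive C] [Linear ℂ C] where
  dag {X Y : C} : (X ⟶ Y) → (Y ⟶ X)
  dag_dag {X Y : C} (f : X ⟶ Y) : dag (dag f) = f
  dag_comp {X Y Z : C} (f : X ⟶ Y) (g : Y ⟶ Z) : dag (f ≫ g) = dag g ≫ dag f
  dag_add {X Y : C} (f g : X ⟶ Y) : dag (f + g) = dag f + dag g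
  dag_smul {X Y : C} (c : ℂ) (f : X ⟶ Y) : dag (c • f) = star c • dag f

open StarCategory

/-- A Banach `*`-category with the C*-identity: the hom-spaces are complex Banach spaces,
composition is bilinear and contractive, and `‖f* ∘ f‖ = ‖f‖ ^ 2`
(in diagrammatic order, `f* ∘ f` is `f ≫ dag f`). -/
class CStarCategoryCore (C : Type u) [Category.{v} C] where
  homGroup (X Y : C) : NormedAddCommGroup (X ⟶ Y)
  homSpace (X Y : C) : NormedSpace ℂ (X ⟶ Y)
  homComplete (X Y : C) : CompleteSpace (X ⟶ Y)
  add_comp {X Y Z : C} (f f' : X ⟶ Y) (g : Y ⟶ Z) : (f + f') ≫ g = f ≫ g + f' ≫ g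
  comp_add {X Y Z : C} (f : X ⟶ Y) (g g' : Y ⟶ Z) : f ≫ (g + g') = f ≫ g + f ≫ g'
  smul_comp {X Y Z : C} (c : ℂ) (f : X ⟶ Y) (g : Y ⟶ Z) : (c • f) ≫ g = c • (f ≫ g)
  comp_smul {X Y Z : C} (c : ℂ) (f : X ⟶ Y) (g : Y ⟶ Z) : f ≫ (c • g) = c • (f ≫ g)
  adj {X Y : C} : (X ⟶ Y) → (Y ⟶ X)
  adj_adj {X Y : C} (f : X ⟶ Y) : adj (adj f) = f
  adj_comp {X Y Z : C} (f : X ⟶ Y) (g : Y ⟶ Z) : adj (f ≫ g) = adj g ≫ adj f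
  adj_add {X Y : C} (f g : X ⟶ Y) : adj (f + g) = adj f + adj g
  adj_smul {X Y : C} (c : ℂ) (f : X ⟶ Y) : adj (c • f) = star c • adj f
  norm_comp_le {X Y Z : C} (f : X ⟶ Y) (g : Y ⟶ Z) : ‖f ≫ g‖ ≤ ‖f‖ * ‖g‖
  norm_comp_adj {X Y : C} (f : X ⟶ Y) : ‖f ≫ adj f‖ = ‖f‖ ^ 2

attribute [reducible, instance] CStarCategoryCore.homGroup CStarCategoryCore.homSpace
attribute [instance] CStarCategoryCore.homComplete

/-- A C*-category: a Banach `*`-category with the C*-identity in which `f* ∘ f` is of the form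
`g* ∘ g` with `g` an endomorphism. The norm is data, but it is determined by the `*`-category:
by the C*-identity `‖f‖ ^ 2` is the norm, hence the spectral radius, of the self-adjoint
element `f* ∘ f` of the C*-algebra of endomorphisms of the source of `f`. -/
class CStarCategory (C : Type u) [Category.{v} C] extends CStarCategoryCore C where
  exists_comp_adj_eq {X Y : C} (f : X ⟶ Y) : ∃ g : X ⟶ X, f ≫ adj f = g ≫ adj g

section CoreInstances

variable {C : Type u} [Category.{v} C] [CStarCategoryCore C]

instance instPreadditive : Preadditive C where
  homGroup _ _ := inferInstance
  add_comp _ _ _ f f' g := CStarCategoryCore.add_comp f f' g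
  comp_add _ _ _ f g g' := CStarCategoryCore.comp_add f g g'

instance instLinear : Linear ℂ C where
  homModule _ _ := inferInstance
  smul_comp _ _ _ c f g := CStarCategoryCore.smul_comp c f g
  comp_smul _ _ _ f c g := CStarCategoryCore.comp_smul c f g

instance instStarCategory : StarCategory C where
  dag := CStarCategoryCore.adj
  dag_dag := CStarCategoryCore.adj_adj
  dag_comp := CStarCategoryCore.adj_comp
  dag_add := CStarCategoryCore.adj_add
  dag_smul := CStarCategoryCore.adj_smul

theorem norm_comp_le {X Y Z : C} (f : X ⟶ Y) (g : Y ⟶ Z) : ‖f ≫ g‖ ≤ ‖f‖ * ‖g‖ :=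
  CStarCategoryCore.norm_comp_le f g

theorem norm_comp_dag {X Y : C} (f : X ⟶ Y) : ‖f ≫ dag f‖ = ‖f‖ ^ 2 :=
  CStarCategoryCore.norm_comp_adj f

theorem norm_dag {X Y : C} (f : X ⟶ Y) : ‖dag f‖ = ‖f‖ := by
  have key : ∀ {X Y : C} (f : X ⟶ Y), ‖f‖ ≤ ‖dag f‖ := by
    intro X Y f
    have h1 := norm_comp_le f (dag f)
    rw [norm_comp_dag] at h1
    rcases (norm_nonneg f).eq_or_lt with h | h
    · rw [← h]; exact norm_nonneg _
    · nlinarith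
  apply le_antisymm
  · have := key (dag f)
    rwa [dag_dag] at this
  · exact key f

end CoreInstances

section StarLemmas

variable {C : Type u} [Category.{v} C] [Preadditive C] [Linear ℂ C] [StarCategory C]

attribute [simp] dag_dag dag_comp dag_add

@[simp] theorem dag_id (X : C) : dag (𝟙 X) = 𝟙 X := by
  have h := dag_comp (dag (𝟙 X)) (𝟙 X)
  simp only [Category.comp_id, dag_dag] at h
  exact h.symm

@[simp] theorem dag_zero (X Y : C) : dag (0 : X ⟶ Y) = 0 := by
  have h := dag_add (0 : X ⟶ Y) 0
  simpa using h

@[simp] theorem dag_neg {X Y : C} (f : X ⟶ Y) : dag (-f) = -dag f := by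
  have h := dag_add f (-f)
  rw [add_neg_cancel, dag_zero] at h
  exact (neg_eq_of_add_eq_zero_right h.symm).symm

@[simp] theorem dag_sub {X Y : C} (f g : X ⟶ Y) : dag (f - g) = dag f - dag g := by
  simp [sub_eq_add_neg]

theorem dag_sum {X Y : C} {ι : Type*} (s : Finset ι) (f : ι → (X ⟶ Y)) :
    dag (∑ i ∈ s, f i) = ∑ i ∈ s, dag (f i) := by
  classical
  induction s using Finset.induction_on with
  | empty => simp
  | insert a s ha ih => simp [Finset.sum_insert ha, ih]

instance instStarEnd (X : C) : StarRing (End X) where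
  star f := dag (X := X) (Y := X) f
  star_involutive f := dag_dag (X := X) (Y := X) f
  star_mul f g := dag_comp (X := X) (Y := X) (Z := X) g f
  star_add f g := dag_add (X := X) (Y := X) f g

instance instStarModuleEnd (X : C) : StarModule ℂ (End X) where
  star_smul c f := dag_smul (X := X) (Y := X) c f

theorem star_end_def {X : C} (f : End X) : star f = dag (X := X) (Y := X) f := rfl

/-- A unitary morphism. -/
def IsUnitary {X Y : C} (f : X ⟶ Y) : Prop := f ≫ dag f = 𝟙 X ∧ dag f ≫ f = 𝟙 Y

end StarLemmas

section EndAlgebra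

variable {C : Type u} [Category.{v} C] [CStarCategoryCore C]

instance instNormEnd (X : C) : Norm (End X) := ⟨fun f => ‖(show X ⟶ X from f)‖⟩

instance instMetricEnd (X : C) : MetricSpace (End X) :=
  inferInstanceAs (MetricSpace (X ⟶ X))

instance instNormedRingEnd (X : C) : NormedRing (End X) where
  toRing := inferInstance
  toMetricSpace := instMetricEnd X
  dist_eq f g := (CStarCategoryCore.homGroup X X).dist_eq f g
  norm_mul_le f g := by
    rw [mul_comm]
    exact norm_comp_le (X := X) (Y := X) (Z := X) g f

/-- The endomorphism algebra of an object is a C*-algebra. -/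
instance instCStarAlgebraEnd (X : C) : CStarAlgebra (End X) where
  toStarRing := instStarEnd X
  toCompleteSpace := CStarCategoryCore.homComplete X X
  norm_mul_self_le f := by
    have h := norm_comp_dag (X := X) (Y := X) f
    have h2 : ‖f‖ * ‖f‖ = ‖star f * f‖ := by
      rw [← sq]; exact h.symm
    exact h2.le
  toAlgebra := inferInstance
  norm_smul_le c f := norm_smul_le (β := (X ⟶ X)) c f
  toStarModule := instStarModuleEnd X

end EndAlgebra

section Completion

/-- A C*-seminorm on a linear `*`-category in which every `f* ∘ f` is a sum of squares of
endomorphisms. -/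
structure CStarSeminorm (T : Type u) [Category.{v} T] [Preadditive T] [Linear ℂ T]
    [StarCategory T] where
  nrm {X Y : T} : (X ⟶ Y) → ℝ
  nonneg {X Y : T} (f : X ⟶ Y) : 0 ≤ nrm f
  add_le {X Y : T} (f g : X ⟶ Y) : nrm (f + g) ≤ nrm f + nrm g
  smul_eq {X Y : T} (c : ℂ) (f : X ⟶ Y) : nrm (c • f) = ‖c‖ * nrm f
  comp_le {X Y Z : T} (f : X ⟶ Y) (g : Y ⟶ Z) : nrm (f ≫ g) ≤ nrm f * nrm g
  comp_dag {X Y : T} (f : X ⟶ Y) : nrm (f ≫ dag f) = nrm f ^ 2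
  sum_sq {X Y : T} (f : X ⟶ Y) :
    ∃ (k : ℕ) (g : Fin k → (X ⟶ X)), f ≫ dag f = ∑ i, g i ≫ dag (g i)

namespace CStarSeminorm

variable {T : Type u} [Category.{v} T] [Preadditive T] [Linear ℂ T] [StarCategory T]
  (N : CStarSeminorm T)

theorem nrm_dag {X Y : T} (f : X ⟶ Y) : N.nrm (dag f) = N.nrm f := by
  have key : ∀ {X Y : T} (f : X ⟶ Y), N.nrm f ≤ N.nrm (dag f) := by
    intro X Y f
    have h1 := N.comp_le f (dag f)
    rw [N.comp_dag] at h1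
    rcases (N.nonneg f).eq_or_lt with h | h
    · rw [← h]; exact N.nonneg _
    · nlinarith
  apply le_antisymm
  · have := key (dag f)
    rwa [dag_dag] at this
  · exact key f

/-- A hom-space, seminormed by `N`. -/
def Hom (_N : CStarSeminorm T) (X Y : T) : Type v := X ⟶ Y

/-- The seminorm, as a `Norm` instance on the hom-spaces. -/
abbrev homNorm (X Y : T) : Norm (X ⟶ Y) := ⟨fun f => N.nrm f⟩

theorem core (X Y : T) : @SeminormedSpace.Core ℂ (X ⟶ Y) _ _ (N.homNorm X Y) _ :=
  letI := N.homNorm X Y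
  { norm_nonneg := fun f => N.nonneg f
    norm_smul := fun c f => N.smul_eq c f
    norm_triangle := fun f g => N.add_le f g }

instance (X Y : T) : SeminormedAddCommGroup (N.Hom X Y) :=
  @SeminormedAddCommGroup.ofCore ℂ (X ⟶ Y) _ _ (N.homNorm X Y) _ (N.core X Y)

instance (X Y : T) : NormedSpace ℂ (N.Hom X Y) where
  toModule := inferInstanceAs (Module ℂ (X ⟶ Y))
  norm_smul_le c f := (N.smul_eq (X := X) (Y := Y) c f).le

/-- The completed hom-spaces. -/
def CHom (X Y : T) : Type v := UniformSpace.Completion (N.Hom X Y)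

instance (X Y : T) : NormedAddCommGroup (N.CHom X Y) :=
  inferInstanceAs (NormedAddCommGroup (UniformSpace.Completion (N.Hom X Y)))
instance (X Y : T) : NormedSpace ℂ (N.CHom X Y) :=
  inferInstanceAs (NormedSpace ℂ (UniformSpace.Completion (N.Hom X Y)))
instance (X Y : T) : CompleteSpace (N.CHom X Y) :=
  inferInstanceAs (CompleteSpace (UniformSpace.Completion (N.Hom X Y)))

variable {N} in
/-- The canonical map to the completion. -/
def coe {X Y : T} (f : X ⟶ Y) : N.CHom X Y :=
  UniformSpace.Completion.coe' (α := N.Hom X Y) f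

/-- The canonical map to the completion, as a continuous linear map. -/
def coeL (X Y : T) : N.Hom X Y →L[ℂ] N.CHom X Y where
  toFun f := coe (N := N) (X := X) (Y := Y) f
  map_add' f g := UniformSpace.Completion.coe_add (α := N.Hom X Y) f g
  map_smul' c f := UniformSpace.Completion.coe_smul (M := ℂ) (X := N.Hom X Y) c f
  cont := UniformSpace.Completion.continuous_coe (N.Hom X Y)

theorem norm_coe {X Y : T} (f : X ⟶ Y) : ‖(coe f : N.CHom X Y)‖ = N.nrm f :=
  UniformSpace.Completion.norm_coe (E := N.Hom X Y) f

theorem coe_add {X Y : T} (f g : X ⟶ Y) : (coe (f + g) : N.CHom X Y) = coe f + coe g :=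
  UniformSpace.Completion.coe_add (α := N.Hom X Y) f g

theorem coe_smul {X Y : T} (c : ℂ) (f : X ⟶ Y) : (coe (c • f) : N.CHom X Y) = c • coe f :=
  UniformSpace.Completion.coe_smul (M := ℂ) (X := N.Hom X Y) c f

theorem coe_zero (X Y : T) : (coe (0 : X ⟶ Y) : N.CHom X Y) = 0 :=
  UniformSpace.Completion.coe_zero (α := N.Hom X Y)

variable {N} in
theorem ind {X Y : T} {p : N.CHom X Y → Prop} (a : N.CHom X Y) (hp : IsClosed {a | p a})
    (h : ∀ f : X ⟶ Y, p (coe f)) : p a :=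
  UniformSpace.Completion.induction_on a hp h

/-- Composition, as a bounded bilinear map into the completed hom-spaces. -/
def compAux (X Y Z : T) : N.Hom X Y →L[ℂ] N.Hom Y Z →L[ℂ] N.CHom X Z :=
  LinearMap.mkContinuous₂
    (LinearMap.mk₂ ℂ (fun (f : N.Hom X Y) (g : N.Hom Y Z) =>
        (coe ((show X ⟶ Y from f) ≫ (show Y ⟶ Z from g)) : N.CHom X Z))
      (fun f f' g => by
        rw [← coe_add]; congr 1; exact Preadditive.add_comp _ _ _ _ _ _)
      (fun c f g => by
        rw [← coe_smul]; congr 1; exact Linear.smul_comp _ _ _ _ _ _)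
      (fun f g g' => by
        rw [← coe_add]; congr 1; exact Preadditive.comp_add _ _ _ _ _ _)
      (fun c f g => by
        rw [← coe_smul]; congr 1; exact Linear.comp_smul _ _ _ _ _ _))
    1 (fun f g => by
      rw [one_mul]
      exact (N.norm_coe _).le.trans (N.comp_le (X := X) (Y := Y) (Z := Z) f g))

/-- The extension to the completion of a bounded linear map. -/
def ext {X Y : T} {F : Type*} [SeminormedAddCommGroup F] [NormedSpace ℂ F] [CompleteSpace F]
    [T2Space F]
    (L : N.Hom X Y →L[ℂ] F) : N.CHom X Y →L[ℂ] F :=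
  L.extend (N.coeL X Y)

theorem ext_coe {X Y : T} {F : Type*} [SeminormedAddCommGroup F] [NormedSpace ℂ F] [T2Space F]
    [CompleteSpace F] (L : N.Hom X Y →L[ℂ] F) (f : X ⟶ Y) :
    N.ext L (coe f) = L (show N.Hom X Y from f) :=
  L.extend_eq (e := N.coeL X Y) (UniformSpace.Completion.denseRange_coe (α := N.Hom X Y))
    (UniformSpace.Completion.isUniformInducing_coe (N.Hom X Y)) _

/-- Composition, extended to the completion in the first variable. -/
def compAux₁ (X Y Z : T) : N.CHom X Y →L[ℂ] N.Hom Y Z →L[ℂ] N.CHom X Z :=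
  N.ext (F := N.Hom Y Z →L[ℂ] N.CHom X Z) (N.compAux X Y Z)

/-- Composition, extended to the completion in both variables, with the variables flipped. -/
def compAux₂ (X Y Z : T) : N.CHom Y Z →L[ℂ] N.CHom X Y →L[ℂ] N.CHom X Z :=
  N.ext (F := N.CHom X Y →L[ℂ] N.CHom X Z) (ContinuousLinearMap.flip (N.compAux₁ X Y Z))

/-- Composition on the completed hom-spaces. -/
def compL (X Y Z : T) : N.CHom X Y →L[ℂ] N.CHom Y Z →L[ℂ] N.CHom X Z :=
  ContinuousLinearMap.flip (N.compAux₂ X Y Z)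

theorem compL_coe {X Y Z : T} (f : X ⟶ Y) (g : Y ⟶ Z) :
    N.compL X Y Z (coe f) (coe g) = coe (f ≫ g) := by
  have h1 : N.compAux₂ X Y Z (coe g) =
      ContinuousLinearMap.flip (N.compAux₁ X Y Z) (show N.Hom Y Z from g) :=
    N.ext_coe (F := N.CHom X Y →L[ℂ] N.CHom X Z) _ g
  have h2 : N.compAux₁ X Y Z (coe f) = N.compAux X Y Z (show N.Hom X Y from f) :=
    N.ext_coe (F := N.Hom Y Z →L[ℂ] N.CHom X Z) _ f
  have h3 : N.compL X Y Z (coe f) (coe g) = N.compAux₂ X Y Z (coe g) (coe f) := rfl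
  rw [h3, h1]
  exact congrArg (fun L => L (show N.Hom Y Z from g)) h2

/-- The adjoint on the completed hom-spaces. -/
def dagC {X Y : T} : N.CHom X Y → N.CHom Y X :=
  UniformSpace.Completion.map (fun f : N.Hom X Y => (show N.Hom Y X from dag (X := X) (Y := Y) f))

theorem uc_dag (X Y : T) :
    UniformContinuous (fun f : N.Hom X Y => (show N.Hom Y X from dag (X := X) (Y := Y) f)) := by
  apply Isometry.uniformContinuous
  apply Isometry.of_dist_eq
  intro f g
  rw [dist_eq_norm, dist_eq_norm]
  have : ‖(f - g : N.Hom X Y)‖ = N.nrm (dag (X := X) (Y := Y) (f - g : N.Hom X Y)) :=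
    (N.nrm_dag (X := X) (Y := Y) _).symm
  rw [this]
  have h2 := dag_sub (X := X) (Y := Y) f g
  exact congrArg N.nrm h2.symm

theorem dagC_coe {X Y : T} (f : X ⟶ Y) : N.dagC (coe f) = coe (dag f) :=
  UniformSpace.Completion.map_coe (N.uc_dag X Y) _

theorem continuous_dagC (X Y : T) : Continuous (N.dagC : N.CHom X Y → N.CHom Y X) :=
  UniformSpace.Completion.continuous_map

@[fun_prop]
theorem continuous_dagC' {α : Type*} [TopologicalSpace α] {X Y : T} {f : α → N.CHom X Y}
    (hf : Continuous f) : Continuous (fun a => N.dagC (f a)) :=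
  (N.continuous_dagC X Y).comp hf

theorem id_compC {X Y : T} (f : N.CHom X Y) : N.compL X X Y (coe (𝟙 X)) f = f := by
  refine ind (p := fun f => N.compL X X Y (coe (𝟙 X)) f = f) f
    (isClosed_eq (by fun_prop) (by fun_prop)) fun f => ?_
  rw [N.compL_coe, Category.id_comp]

theorem comp_idC {X Y : T} (f : N.CHom X Y) : N.compL X Y Y f (coe (𝟙 Y)) = f := by
  refine ind (p := fun f => N.compL X Y Y f (coe (𝟙 Y)) = f) f
    (isClosed_eq (by fun_prop) (by fun_prop)) fun f => ?_
  rw [N.compL_coe, Category.comp_id]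

theorem assocC {W X Y Z : T} (f : N.CHom W X) (g : N.CHom X Y) (h : N.CHom Y Z) :
    N.compL W Y Z (N.compL W X Y f g) h = N.compL W X Z f (N.compL X Y Z g h) := by
  refine ind (p := fun f => N.compL W Y Z (N.compL W X Y f g) h =
    N.compL W X Z f (N.compL X Y Z g h)) f (isClosed_eq (by fun_prop) (by fun_prop)) fun f => ?_
  refine ind (p := fun g => N.compL W Y Z (N.compL W X Y (coe f) g) h =
    N.compL W X Z (coe f) (N.compL X Y Z g h)) g
    (isClosed_eq (by fun_prop) (by fun_prop)) fun g => ?_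
  refine ind (p := fun h => N.compL W Y Z (N.compL W X Y (coe f) (coe g)) h =
    N.compL W X Z (coe f) (N.compL X Y Z (coe g) h)) h
    (isClosed_eq (by fun_prop) (by fun_prop)) fun h => ?_
  simp only [N.compL_coe, Category.assoc]

theorem dag_dagC {X Y : T} (f : N.CHom X Y) : N.dagC (N.dagC f) = f := by
  refine ind (p := fun f => N.dagC (N.dagC f) = f) f
    (isClosed_eq (by fun_prop) (by fun_prop)) fun f => ?_
  rw [N.dagC_coe, N.dagC_coe, dag_dag]

theorem dag_compC {X Y Z : T} (f : N.CHom X Y) (g : N.CHom Y Z) :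
    N.dagC (N.compL X Y Z f g) = N.compL Z Y X (N.dagC g) (N.dagC f) := by
  refine ind (p := fun f => N.dagC (N.compL X Y Z f g) =
    N.compL Z Y X (N.dagC g) (N.dagC f)) f (isClosed_eq (by fun_prop) (by fun_prop)) fun f => ?_
  refine ind (p := fun g => N.dagC (N.compL X Y Z (coe f) g) =
    N.compL Z Y X (N.dagC g) (N.dagC (coe f))) g
    (isClosed_eq (by fun_prop) (by fun_prop)) fun g => ?_
  simp only [N.compL_coe, N.dagC_coe, dag_comp]

theorem dag_addC {X Y : T} (f g : N.CHom X Y) : N.dagC (f + g) = N.dagC f + N.dagC g := by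
  refine ind (p := fun f => N.dagC (f + g) = N.dagC f + N.dagC g) f
    (isClosed_eq (by fun_prop) (by fun_prop)) fun f => ?_
  refine ind (p := fun g => N.dagC (coe f + g) = N.dagC (coe f) + N.dagC g) g
    (isClosed_eq (by fun_prop) (by fun_prop)) fun g => ?_
  simp only [N.dagC_coe, dag_add, ← N.coe_add]

theorem dag_smulC {X Y : T} (c : ℂ) (f : N.CHom X Y) :
    N.dagC (c • f) = star c • N.dagC f := by
  refine ind (p := fun f => N.dagC (c • f) = star c • N.dagC f) f
    (isClosed_eq ((N.continuous_dagC X Y).comp (continuous_const_smul c))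
      (Continuous.const_smul (N.continuous_dagC X Y) (star c))) fun f => ?_
  simp only [N.dagC_coe, dag_smul, ← N.coe_smul]

theorem norm_compC_le {X Y Z : T} (f : N.CHom X Y) (g : N.CHom Y Z) :
    ‖N.compL X Y Z f g‖ ≤ ‖f‖ * ‖g‖ := by
  refine ind (p := fun f => ‖N.compL X Y Z f g‖ ≤ ‖f‖ * ‖g‖) f
    (isClosed_le (by fun_prop) (by fun_prop)) fun f => ?_
  refine ind (p := fun g => ‖N.compL X Y Z (coe f) g‖ ≤ ‖(coe f : N.CHom X Y)‖ * ‖g‖) g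
    (isClosed_le (by fun_prop) (by fun_prop)) fun g => ?_
  rw [N.compL_coe, N.norm_coe, N.norm_coe, N.norm_coe]
  exact N.comp_le f g

theorem norm_comp_dagC {X Y : T} (f : N.CHom X Y) :
    ‖N.compL X Y X f (N.dagC f)‖ = ‖f‖ ^ 2 := by
  refine ind (p := fun f => ‖N.compL X Y X f (N.dagC f)‖ = ‖f‖ ^ 2) f
    (isClosed_eq (by fun_prop) (by fun_prop)) fun f => ?_
  rw [N.dagC_coe, N.compL_coe, N.norm_coe, N.norm_coe]
  exact N.comp_dag f

end CStarSeminorm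

open CStarSeminorm

/-- The completion of a linear `*`-category with respect to a C*-seminorm: the objects are the
same, the hom-spaces are the (separated) completions. -/
structure CStarCompletion {T : Type u} [Category.{v} T] [Preadditive T] [Linear ℂ T]
    [StarCategory T] (N : CStarSeminorm T) : Type u where
  as : T

namespace CStarCompletion

variable {T : Type u} [Category.{v} T] [Preadditive T] [Linear ℂ T] [StarCategory T]
  (N : CStarSeminorm T)

instance : Category.{v} (CStarCompletion N) where
  Hom X Y := N.CHom X.as Y.as
  id X := coe (𝟙 X.as)
  comp f g := N.compL _ _ _ f g
  id_comp f := N.id_compC f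
  comp_id f := N.comp_idC f
  assoc f g h := N.assocC f g h

instance : CStarCategoryCore (CStarCompletion N) where
  homGroup X Y := inferInstanceAs (NormedAddCommGroup (N.CHom X.as Y.as))
  homSpace X Y := inferInstanceAs (NormedSpace ℂ (N.CHom X.as Y.as))
  homComplete X Y := inferInstanceAs (CompleteSpace (N.CHom X.as Y.as))
  add_comp {X Y Z} f f' g := congrArg (fun L => L g) ((N.compL X.as Y.as Z.as).map_add f f')
  comp_add {X Y Z} f g g' := (N.compL X.as Y.as Z.as f).map_add g g'
  smul_comp {X Y Z} c f g := congrArg (fun L => L g) ((N.compL X.as Y.as Z.as).map_smul c f)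
  comp_smul {X Y Z} c f g := (N.compL X.as Y.as Z.as f).map_smul c g
  adj f := N.dagC f
  adj_adj f := N.dag_dagC f
  adj_comp f g := N.dag_compC f g
  adj_add f g := N.dag_addC f g
  adj_smul c f := N.dag_smulC c f
  norm_comp_le f g := N.norm_compC_le f g
  norm_comp_adj f := N.norm_comp_dagC f

variable {N} in
/-- The image of a morphism in the completion. -/
def ofHom {X Y : T} (f : X ⟶ Y) :
    (CStarCompletion.mk X : CStarCompletion N) ⟶ CStarCompletion.mk Y :=
  coe (N := N) f

section ofHom
variable {N}
variable {X Y Z : T}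

theorem ofHom_comp (f : X ⟶ Y) (g : Y ⟶ Z) :
    (ofHom (f ≫ g) : (CStarCompletion.mk X : CStarCompletion N) ⟶ _) = ofHom f ≫ ofHom g :=
  (N.compL_coe f g).symm

theorem ofHom_id (X : T) :
    (ofHom (𝟙 X) : (CStarCompletion.mk X : CStarCompletion N) ⟶ _) = 𝟙 _ := rfl

theorem ofHom_dag (f : X ⟶ Y) :
    (ofHom (dag f) : (CStarCompletion.mk Y : CStarCompletion N) ⟶ _) = dag (ofHom f) :=
  (N.dagC_coe f).symm

theorem ofHom_add (f g : X ⟶ Y) :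
    (ofHom (f + g) : (CStarCompletion.mk X : CStarCompletion N) ⟶ _) = ofHom f + ofHom g :=
  N.coe_add f g

theorem ofHom_smul (c : ℂ) (f : X ⟶ Y) :
    (ofHom (c • f) : (CStarCompletion.mk X : CStarCompletion N) ⟶ _) = c • ofHom f :=
  N.coe_smul c f

theorem ofHom_zero :
    (ofHom (0 : X ⟶ Y) : (CStarCompletion.mk X : CStarCompletion N) ⟶ _) = 0 :=
  N.coe_zero X Y

theorem norm_ofHom (f : X ⟶ Y) :
    ‖(ofHom f : (CStarCompletion.mk X : CStarCompletion N) ⟶ CStarCompletion.mk Y)‖ = N.nrm f :=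
  N.norm_coe f

/-- To prove a closed property for all morphisms of the completion, it suffices to prove it for
the images of the original morphisms. -/
theorem hom_ind {X Y : CStarCompletion N} {p : (X ⟶ Y) → Prop} (a : X ⟶ Y)
    (hp : IsClosed {a | p a}) (h : ∀ f : X.as ⟶ Y.as, p (ofHom f)) : p a :=
  UniformSpace.Completion.induction_on (α := N.Hom X.as Y.as) a hp h

end ofHom

@[fun_prop]
theorem continuous_dag {C : Type u} [Category.{v} C] [CStarCategoryCore C] {α : Type*}
    [TopologicalSpace α] {X Y : C} {f : α → (X ⟶ Y)} (hf : Continuous f) :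
    Continuous (fun a => dag (f a)) := by
  have h : Isometry (fun f : X ⟶ Y => dag f) := by
    apply Isometry.of_dist_eq
    intro f g
    rw [dist_eq_norm, dist_eq_norm, ← dag_sub]
    exact norm_dag _
  exact h.continuous.comp hf

@[fun_prop]
theorem continuous_comp {C : Type u} [Category.{v} C] [CStarCategoryCore C] {α : Type*}
    [TopologicalSpace α] {X Y Z : C} {f : α → (X ⟶ Y)} {g : α → (Y ⟶ Z)} (hf : Continuous f)
    (hg : Continuous g) : Continuous (fun a => f a ≫ g a) := by
  let L : (X ⟶ Y) →L[ℂ] (Y ⟶ Z) →L[ℂ] (X ⟶ Z) :=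
    LinearMap.mkContinuous₂ (LinearMap.mk₂ ℂ (fun f g => f ≫ g)
      (fun _ _ _ => Preadditive.add_comp _ _ _ _ _ _) (fun _ _ _ => Linear.smul_comp _ _ _ _ _ _)
      (fun _ _ _ => Preadditive.comp_add _ _ _ _ _ _) (fun _ _ _ => Linear.comp_smul _ _ _ _ _ _))
      1 (fun f g => by rw [one_mul]; exact norm_comp_le f g)
  exact (L.continuous.comp hf).clm_apply hg

theorem ofHom_sum {X Y : T} {ι : Type*} (s : Finset ι) (f : ι → (X ⟶ Y)) :
    (ofHom (∑ i ∈ s, f i) : (CStarCompletion.mk X : CStarCompletion N) ⟶ CStarCompletion.mk Y) =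
      ∑ i ∈ s, ofHom (f i) := by
  classical
  induction s using Finset.induction_on with
  | empty => simp [ofHom_zero]
  | insert a s ha ih => rw [Finset.sum_insert ha, Finset.sum_insert ha, ofHom_add, ih]

attribute [local instance] CStarAlgebra.spectralOrder CStarAlgebra.spectralOrderedRing

theorem comp_dag_nonneg {X Y : CStarCompletion N} (f : X ⟶ Y) :
    (0 : End X) ≤ End.of (f ≫ dag f) := by
  refine hom_ind (p := fun f => (0 : End X) ≤ End.of (f ≫ dag f)) f ?_ fun f => ?_
  · have h : Continuous (fun f : X ⟶ Y => f ≫ dag f) := by fun_prop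
    exact IsClosed.preimage h (CStarAlgebra.isClosed_nonneg (A := End X))
  obtain ⟨k, g, hg⟩ := N.sum_sq f
  have h : End.of (ofHom (N := N) f ≫ dag (ofHom (N := N) f)) =
      ∑ i, star (End.of (ofHom (N := N) (g i))) * End.of (ofHom (N := N) (g i)) := by
    rw [← ofHom_dag, ← ofHom_comp, hg]
    refine (ofHom_sum N _ _).trans (Finset.sum_congr rfl fun i _ => ?_)
    rw [ofHom_comp, ofHom_dag]
    rfl
  exact h ▸ Finset.sum_nonneg fun i _ => star_mul_self_nonneg _

instance : CStarCategory (CStarCompletion N) where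
  exists_comp_adj_eq f := by
    obtain ⟨g, hg⟩ := CStarAlgebra.nonneg_iff_eq_star_mul_self.mp (comp_dag_nonneg N f)
    exact ⟨g, hg⟩

end CStarCompletion
end Completion

section DirectSums

/-- `i : X ⟶ S` and `j : Y ⟶ S` exhibit `S` as an orthogonal direct sum of `X` and `Y`. -/
structure IsDirectSum {C : Type u} [Category.{v} C] [Preadditive C] [Linear ℂ C] [StarCategory C]
    {X Y S : C} (i : X ⟶ S) (j : Y ⟶ S) : Prop where
  left : i ≫ dag i = 𝟙 X
  right : j ≫ dag j = 𝟙 Y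
  orth : i ≫ dag j = 0
  total : dag i ≫ i + dag j ≫ j = 𝟙 S

/-- Existence of finite direct sums: a zero object and binary orthogonal direct sums. -/
class HasDirectSums (C : Type u) [Category.{v} C] [Preadditive C] [Linear ℂ C]
    [StarCategory C] : Prop where
  exists_zero : ∃ Z : C, 𝟙 Z = 0
  exists_sum (X Y : C) : ∃ (S : C) (i : X ⟶ S) (j : Y ⟶ S), IsDirectSum i j

variable {C : Type u} [Category.{v} C] [Preadditive C] [Linear ℂ C] [StarCategory C]

theorem IsDirectSum.orth' {X Y S : C} {i : X ⟶ S} {j : Y ⟶ S} (h : IsDirectSum i j) :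
    j ≫ dag i = 0 := by
  have := congrArg dag h.orth
  simpa using this

/-- Finite orthogonal sums of copies of an object. -/
theorem exists_copies [HasDirectSums C] (X : C) (n : ℕ) :
    ∃ (S : C) (i : Fin n → (X ⟶ S)), (∀ a b, i a ≫ dag (i b) = if a = b then 𝟙 X else 0) ∧
      ∑ a, dag (i a) ≫ i a = 𝟙 S := by
  induction n with
  | zero =>
    obtain ⟨Z, hZ⟩ := HasDirectSums.exists_zero (C := C)
    exact ⟨Z, fun a => a.elim0, fun a => a.elim0, by simp [hZ]⟩
  | succ n ih =>
    obtain ⟨S, i, h1, h2⟩ := ih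
    obtain ⟨R, s, t, hst⟩ := HasDirectSums.exists_sum X S
    refine ⟨R, Fin.cons s (fun a => i a ≫ t), ?_, ?_⟩
    · intro a b
      refine Fin.cases ?_ (fun a => ?_) a <;> refine Fin.cases ?_ (fun b => ?_) b
      · simp [hst.left]
      · have h3 : s ≫ dag t ≫ dag (i b) = 0 := by rw [← Category.assoc, hst.orth]; simp
        simp [h3, (Fin.succ_ne_zero b).symm]
      · simp [hst.orth']
      · have h3 : i a ≫ t ≫ dag t ≫ dag (i b) = i a ≫ dag (i b) := by
          rw [← Category.assoc t, hst.right]; simp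
        simp [h3, h1]
    · rw [Fin.sum_univ_succ]
      simp only [Fin.cons_zero, Fin.cons_succ, dag_comp, Category.assoc]
      rw [← hst.total]
      congr 1
      have h3 : ∀ a, dag t ≫ dag (i a) ≫ i a ≫ t = dag t ≫ (dag (i a) ≫ i a) ≫ t := by simp
      simp only [h3]
      rw [← Preadditive.comp_sum, ← Preadditive.sum_comp, h2, Category.id_comp]

/-- The Gram matrix of a finite family of morphisms with common source is positive. -/
theorem exists_gram {C : Type u} [Category.{v} C] [CStarCategory C] [HasDirectSums C] {X Y : C}
    {n : ℕ} (f : Fin n → (X ⟶ Y)) :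
    ∃ a : Fin n → Fin n → (X ⟶ X), ∀ p q, f p ≫ dag (f q) = ∑ k, a p k ≫ dag (a q k) := by
  obtain ⟨S, i, h1, h2⟩ := exists_copies X n
  obtain ⟨g, hg⟩ := CStarCategory.exists_comp_adj_eq (∑ p, dag (i p) ≫ f p)
  change (∑ p, dag (i p) ≫ f p) ≫ dag (∑ p, dag (i p) ≫ f p) = g ≫ dag g at hg
  refine ⟨fun p k => i p ≫ g ≫ dag (i k), fun p q => ?_⟩
  have h3 : ∀ p, i p ≫ (∑ p, dag (i p) ≫ f p) = f p := by
    intro p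
    rw [Preadditive.comp_sum, Finset.sum_eq_single p]
    · rw [← Category.assoc, h1]; simp
    · intro b _ hb
      rw [← Category.assoc, h1, if_neg hb.symm]; simp
    · simp
  have h4 : f p ≫ dag (f q) = i p ≫ (g ≫ dag g) ≫ dag (i q) := by
    have h6 : (i p ≫ ∑ p, dag (i p) ≫ f p) ≫ dag (i q ≫ ∑ p, dag (i p) ≫ f p) =
        i p ≫ (g ≫ dag g) ≫ dag (i q) := by
      rw [← hg, dag_comp (i q)]
      simp only [Category.assoc]
    rwa [h3, h3] at h6
  rw [h4]
  have h5 : ∀ k, (i p ≫ g ≫ dag (i k)) ≫ dag (i q ≫ g ≫ dag (i k)) =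
      i p ≫ g ≫ (dag (i k) ≫ i k) ≫ dag g ≫ dag (i q) := by
    intro k; simp
  simp only [h5]
  rw [← Preadditive.comp_sum, ← Preadditive.comp_sum, ← Preadditive.sum_comp, h2]
  simp

end DirectSums

section AlgTensor

/-- The objects `X ⊠ Y` of the algebraic tensor product of two linear categories. -/
structure AlgTensor (A : Type u) (B : Type u') : Type (max u u') where
  fst : A
  snd : B

namespace AlgTensor

variable {A : Type u} [Category.{v} A] [Preadditive A] [Linear ℂ A]
  {B : Type u'} [Category.{w} B] [Preadditive B] [Linear ℂ B]

/-- Composition of morphisms, as a bilinear map. -/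
def compLin {C : Type u} [Category.{v} C] [Preadditive C] [Linear ℂ C] (X Y Z : C) :
    (X ⟶ Y) →ₗ[ℂ] (Y ⟶ Z) →ₗ[ℂ] (X ⟶ Z) :=
  LinearMap.mk₂ ℂ (fun f g => f ≫ g)
    (fun _ _ _ => Preadditive.add_comp _ _ _ _ _ _) (fun _ _ _ => Linear.smul_comp _ _ _ _ _ _)
    (fun _ _ _ => Preadditive.comp_add _ _ _ _ _ _) (fun _ _ _ => Linear.comp_smul _ _ _ _ _ _)

/-- Composition in the algebraic tensor product:
`(f ⊗ g) ≫ (f' ⊗ g') = (f ≫ f') ⊗ (g ≫ g')`. -/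
def compT (P Q R : AlgTensor A B) :
    (P.fst ⟶ Q.fst) ⊗[ℂ] (P.snd ⟶ Q.snd) →ₗ[ℂ] (Q.fst ⟶ R.fst) ⊗[ℂ] (Q.snd ⟶ R.snd) →ₗ[ℂ]
      (P.fst ⟶ R.fst) ⊗[ℂ] (P.snd ⟶ R.snd) :=
  TensorProduct.map₂ (compLin P.fst Q.fst R.fst) (compLin P.snd Q.snd R.snd)

theorem compT_tmul (P Q R : AlgTensor A B) (f : P.fst ⟶ Q.fst) (g : P.snd ⟶ Q.snd)
    (f' : Q.fst ⟶ R.fst) (g' : Q.snd ⟶ R.snd) :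
    compT P Q R (f ⊗ₜ g) (f' ⊗ₜ g') = (f ≫ f') ⊗ₜ (g ≫ g') := rfl

instance : Category.{max v w} (AlgTensor A B) where
  Hom P Q := (P.fst ⟶ Q.fst) ⊗[ℂ] (P.snd ⟶ Q.snd)
  id P := 𝟙 P.fst ⊗ₜ 𝟙 P.snd
  comp f g := compT _ _ _ f g
  id_comp f := by
    induction f using TensorProduct.induction_on with
    | zero => simp
    | tmul f g => rw [compT_tmul]; simp
    | add f g hf hg => rw [map_add, hf, hg]
  comp_id f := by
    induction f using TensorProduct.induction_on with
    | zero => simp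
    | tmul f g => rw [compT_tmul]; simp
    | add f g hf hg => rw [map_add, LinearMap.add_apply, hf, hg]
  assoc f g h := by
    induction f using TensorProduct.induction_on with
    | zero => simp
    | add f f' hf hf' => simp only [map_add, LinearMap.add_apply, hf, hf']
    | tmul f f' =>
    induction g using TensorProduct.induction_on with
    | zero => simp
    | add f f' hf hf' => simp only [map_add, LinearMap.add_apply, hf, hf']
    | tmul g g' =>
    induction h using TensorProduct.induction_on with
    | zero => simp
    | add f f' hf hf' => simp only [map_add, hf, hf']
    | tmul h h' => simp only [compT_tmul, Category.assoc]

instance : Preadditive (AlgTensor A B) where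
  homGroup P Q := inferInstanceAs (AddCommGroup ((P.fst ⟶ Q.fst) ⊗[ℂ] (P.snd ⟶ Q.snd)))
  add_comp P Q R f f' g := by
    exact congrArg (fun L => L g) ((compT P Q R).map_add f f')
  comp_add P Q R f g g' := (compT P Q R f).map_add g g'

instance : Linear ℂ (AlgTensor A B) where
  homModule P Q := inferInstanceAs (Module ℂ ((P.fst ⟶ Q.fst) ⊗[ℂ] (P.snd ⟶ Q.snd)))
  smul_comp P Q R c f g := congrArg (fun L => L g) ((compT P Q R).map_smul c f)
  comp_smul P Q R f c g := (compT P Q R f).map_smul c g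

/-- The morphism `f ⊗ g`. -/
def tmul {P Q : AlgTensor A B} (f : P.fst ⟶ Q.fst) (g : P.snd ⟶ Q.snd) : P ⟶ Q :=
  f ⊗ₜ[ℂ] g

theorem tmul_comp {P Q R : AlgTensor A B} (f : P.fst ⟶ Q.fst) (g : P.snd ⟶ Q.snd)
    (f' : Q.fst ⟶ R.fst) (g' : Q.snd ⟶ R.snd) :
    (tmul f g : P ⟶ Q) ≫ (tmul f' g' : Q ⟶ R) = tmul (f ≫ f') (g ≫ g') := rfl

theorem id_eq (P : AlgTensor A B) : 𝟙 P = tmul (𝟙 P.fst) (𝟙 P.snd) := rfl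

theorem tmul_add {P Q : AlgTensor A B} (f : P.fst ⟶ Q.fst) (g g' : P.snd ⟶ Q.snd) :
    (tmul f (g + g') : P ⟶ Q) = tmul f g + tmul f g' := TensorProduct.tmul_add _ _ _

theorem add_tmul {P Q : AlgTensor A B} (f f' : P.fst ⟶ Q.fst) (g : P.snd ⟶ Q.snd) :
    (tmul (f + f') g : P ⟶ Q) = tmul f g + tmul f' g := TensorProduct.add_tmul _ _ _

theorem tmul_sub {P Q : AlgTensor A B} (f : P.fst ⟶ Q.fst) (g g' : P.snd ⟶ Q.snd) :
    (tmul f (g - g') : P ⟶ Q) = tmul f g - tmul f g' := TensorProduct.tmul_sub _ _ _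

theorem sub_tmul {P Q : AlgTensor A B} (f f' : P.fst ⟶ Q.fst) (g : P.snd ⟶ Q.snd) :
    (tmul (f - f') g : P ⟶ Q) = tmul f g - tmul f' g := TensorProduct.sub_tmul _ _ _

theorem smul_tmul {P Q : AlgTensor A B} (c : ℂ) (f : P.fst ⟶ Q.fst) (g : P.snd ⟶ Q.snd) :
    (tmul (c • f) g : P ⟶ Q) = c • tmul f g := rfl

theorem tmul_smul {P Q : AlgTensor A B} (c : ℂ) (f : P.fst ⟶ Q.fst) (g : P.snd ⟶ Q.snd) :
    (tmul f (c • g) : P ⟶ Q) = c • tmul f g := TensorProduct.tmul_smul _ _ _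

@[elab_as_elim]
theorem hom_ind {P Q : AlgTensor A B} {p : (P ⟶ Q) → Prop} (t : P ⟶ Q) (zero : p 0)
    (tmul : ∀ f g, p (tmul f g)) (add : ∀ s t, p s → p t → p (s + t)) : p t :=
  TensorProduct.induction_on t zero tmul add

/-- Every morphism is a finite sum of elementary tensors. -/
theorem exists_sum {P Q : AlgTensor A B} (t : P ⟶ Q) :
    ∃ (n : ℕ) (f : Fin n → (P.fst ⟶ Q.fst)) (g : Fin n → (P.snd ⟶ Q.snd)),
      t = ∑ i, tmul (f i) (g i) := by
  induction t using hom_ind with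
  | zero => exact ⟨0, fun i => i.elim0, fun i => i.elim0, by simp⟩
  | tmul f g => exact ⟨1, fun _ => f, fun _ => g, by simp⟩
  | add s t hs ht =>
    obtain ⟨n, f, g, rfl⟩ := hs
    obtain ⟨m, f', g', rfl⟩ := ht
    refine ⟨n + m, Fin.append f f', Fin.append g g', ?_⟩
    simp [Fin.sum_univ_add]

section Star

variable [StarCategory A] [StarCategory B]

/-- The adjoint, as a conjugate-linear map. -/
def dagLin {C : Type u} [Category.{v} C] [Preadditive C] [Linear ℂ C] [StarCategory C] (X Y : C) :
    (X ⟶ Y) →ₗ⋆[ℂ] (Y ⟶ X) where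
  toFun := dag
  map_add' := dag_add
  map_smul' := dag_smul

/-- The adjoint in the algebraic tensor product: `(f ⊗ g)* = f* ⊗ g*`. -/
def dagT (P Q : AlgTensor A B) : (P ⟶ Q) →ₗ⋆[ℂ] (Q ⟶ P) :=
  TensorProduct.map (dagLin P.fst Q.fst) (dagLin P.snd Q.snd)

theorem dagT_tmul {P Q : AlgTensor A B} (f : P.fst ⟶ Q.fst) (g : P.snd ⟶ Q.snd) :
    dagT P Q (tmul f g) = tmul (dag f) (dag g) := rfl

instance : StarCategory (AlgTensor A B) where
  dag {P Q} f := dagT P Q f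
  dag_dag {P Q} f := by
    induction f using hom_ind with
    | zero => rw [map_zero, map_zero]
    | tmul f g => rw [dagT_tmul, dagT_tmul, dag_dag, dag_dag]
    | add s t hs ht => rw [map_add, map_add, hs, ht]
  dag_add {P Q} f g := map_add _ _ _
  dag_smul {P Q} c f := map_smulₛₗ _ _ _
  dag_comp {P Q R} f g := by
    induction f using hom_ind with
    | zero => rw [Limits.zero_comp, map_zero, map_zero, Limits.comp_zero]
    | add s t hs ht => rw [Preadditive.add_comp, map_add, map_add, hs, ht, Preadditive.comp_add]
    | tmul f f' =>
      induction g using hom_ind with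
      | zero => rw [Limits.comp_zero, map_zero, map_zero, Limits.zero_comp]
      | add s t hs ht => rw [Preadditive.comp_add, map_add, map_add, hs, ht, Preadditive.add_comp]
      | tmul g g' => simp only [dagT_tmul, tmul_comp, dag_comp]

theorem dag_tmul {P Q : AlgTensor A B} (f : P.fst ⟶ Q.fst) (g : P.snd ⟶ Q.snd) :
    dag (tmul f g : P ⟶ Q) = tmul (dag f) (dag g) := rfl

end Star

end AlgTensor
end AlgTensor

section SumsOfSquares

variable {T : Type u} [Category.{v} T] [Preadditive T] [Linear ℂ T] [StarCategory T]

/-- Finite sums of elements `w* ∘ w`, for `w` a morphism with source `P`. -/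
def sqCone (P : T) : AddSubmonoid (P ⟶ P) :=
  AddSubmonoid.closure {x | ∃ (Q : T) (w : P ⟶ Q), x = w ≫ dag w}

theorem sq_mem {P Q : T} (w : P ⟶ Q) : w ≫ dag w ∈ sqCone P :=
  AddSubmonoid.subset_closure ⟨Q, w, rfl⟩

theorem real_smul_sq {P Q : T} {c : ℝ} (hc : 0 ≤ c) (w : P ⟶ Q) :
    (c : ℂ) • (w ≫ dag w) = (((Real.sqrt c : ℝ) : ℂ) • w) ≫ dag (((Real.sqrt c : ℝ) : ℂ) • w) := by
  rw [dag_smul, Linear.smul_comp, Linear.comp_smul, smul_smul]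
  congr 1
  rw [Complex.star_def, Complex.conj_ofReal, ← Complex.ofReal_mul, Real.mul_self_sqrt hc]

theorem smul_mem_sqCone {P : T} {c : ℝ} (hc : 0 ≤ c) {x : P ⟶ P} (hx : x ∈ sqCone P) :
    (c : ℂ) • x ∈ sqCone P := by
  induction hx using AddSubmonoid.closure_induction with
  | mem x hx =>
    obtain ⟨Q, w, rfl⟩ := hx
    rw [real_smul_sq hc]
    exact sq_mem _
  | zero => rw [smul_zero]; exact zero_mem _
  | add x y _ _ hx hy => rw [smul_add]; exact add_mem hx hy

theorem conj_mem_sqCone {P Q : T} (t : P ⟶ Q) {x : Q ⟶ Q} (hx : x ∈ sqCone Q) :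
    t ≫ x ≫ dag t ∈ sqCone P := by
  induction hx using AddSubmonoid.closure_induction with
  | mem x hx =>
    obtain ⟨R, w, rfl⟩ := hx
    have : t ≫ (w ≫ dag w) ≫ dag t = (t ≫ w) ≫ dag (t ≫ w) := by simp
    rw [this]
    exact sq_mem _
  | zero => simp
  | add x y _ _ hx hy =>
    rw [Preadditive.add_comp, Preadditive.comp_add]; exact add_mem hx hy

/-- `t* ∘ t ≤ r ^ 2` in the order given by sums of squares. -/
def SqBound {P Q : T} (t : P ⟶ Q) (r : ℝ) : Prop :=
  ((r ^ 2 : ℝ) : ℂ) • 𝟙 P - t ≫ dag t ∈ sqCone P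

theorem real_smul_id_mem {P : T} {c : ℝ} (hc : 0 ≤ c) : (c : ℂ) • 𝟙 P ∈ sqCone P := by
  apply smul_mem_sqCone hc
  have := sq_mem (𝟙 P)
  simpa using this

theorem SqBound.mono {P Q : T} {t : P ⟶ Q} {r s : ℝ} (h : SqBound t r) (hr : 0 ≤ r)
    (hrs : r ≤ s) : SqBound t s := by
  have h1 : ((s ^ 2 : ℝ) : ℂ) • 𝟙 P - t ≫ dag t =
      ((s ^ 2 - r ^ 2 : ℝ) : ℂ) • 𝟙 P + (((r ^ 2 : ℝ) : ℂ) • 𝟙 P - t ≫ dag t) := by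
    rw [Complex.ofReal_sub, sub_smul]; abel
  unfold SqBound
  rw [h1]
  exact add_mem (real_smul_id_mem (by nlinarith)) h

theorem SqBound.add {P Q : T} {s t : P ⟶ Q} {a b : ℝ} (ha : 0 < a) (hb : 0 < b)
    (hs : SqBound s a) (ht : SqBound t b) : SqBound (s + t) (a + b) := by
  have hab : 0 ≤ b / a := by positivity
  have hba : 0 ≤ a / b := by positivity
  let z : P ⟶ Q := ((Real.sqrt (b / a) : ℝ) : ℂ) • s - ((Real.sqrt (a / b) : ℝ) : ℂ) • t
  have hmul : ((Real.sqrt (b / a) : ℝ) : ℂ) * ((Real.sqrt (a / b) : ℝ) : ℂ) = 1 := by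
    rw [← Complex.ofReal_mul, ← Real.sqrt_mul hab]
    have : b / a * (a / b) = 1 := by field_simp
    simp [this]
  have hz : z ≫ dag z = ((b / a : ℝ) : ℂ) • (s ≫ dag s) + ((a / b : ℝ) : ℂ) • (t ≫ dag t)
      - s ≫ dag t - t ≫ dag s := by
    rw [real_smul_sq hab, real_smul_sq hba]
    simp only [z, dag_sub, dag_smul, Preadditive.sub_comp, Preadditive.comp_sub,
      Linear.smul_comp, Linear.comp_smul, Complex.star_def, Complex.conj_ofReal, smul_smul,
      smul_sub]
    rw [hmul, mul_comm ((Real.sqrt (a / b) : ℝ) : ℂ), hmul, one_smul, one_smul]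
    abel
  have h1 : (((a + b) ^ 2 : ℝ) : ℂ) • 𝟙 P - (s + t) ≫ dag (s + t) =
      ((1 + b / a : ℝ) : ℂ) • (((a ^ 2 : ℝ) : ℂ) • 𝟙 P - s ≫ dag s) +
      ((1 + a / b : ℝ) : ℂ) • (((b ^ 2 : ℝ) : ℂ) • 𝟙 P - t ≫ dag t) + z ≫ dag z := by
    have h2 : (((a + b) ^ 2 : ℝ) : ℂ) = ((1 + b / a : ℝ) : ℂ) * ((a ^ 2 : ℝ) : ℂ) +
        ((1 + a / b : ℝ) : ℂ) * ((b ^ 2 : ℝ) : ℂ) := by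
      rw [← Complex.ofReal_mul, ← Complex.ofReal_mul, ← Complex.ofReal_add]
      congr 1
      field_simp
      ring
    rw [hz, h2]
    simp only [dag_add, Preadditive.add_comp, Preadditive.comp_add, smul_sub, smul_smul,
      Complex.ofReal_add, Complex.ofReal_one, add_smul, add_mul, one_smul, one_mul]
    abel
  unfold SqBound
  rw [h1]
  exact add_mem (add_mem (smul_mem_sqCone (by positivity) hs)
    (smul_mem_sqCone (by positivity) ht)) (sq_mem z)

theorem SqBound.smul {P Q : T} {t : P ⟶ Q} {r : ℝ} (h : SqBound t r) (c : ℂ) :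
    SqBound (c • t) (‖c‖ * r) := by
  have h1 : (((‖c‖ * r) ^ 2 : ℝ) : ℂ) • 𝟙 P - (c • t) ≫ dag (c • t) =
      ((‖c‖ ^ 2 : ℝ) : ℂ) • (((r ^ 2 : ℝ) : ℂ) • 𝟙 P - t ≫ dag t) := by
    rw [dag_smul, Linear.smul_comp, Linear.comp_smul, smul_smul, smul_sub, smul_smul, mul_pow,
      Complex.ofReal_mul, Complex.star_def, Complex.mul_conj, Complex.normSq_eq_norm_sq]
  unfold SqBound
  rw [h1]
  exact smul_mem_sqCone (by positivity) h

theorem SqBound.comp {P Q R : T} {s : P ⟶ Q} {t : Q ⟶ R} {a b : ℝ} (hs : SqBound s a)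
    (ht : SqBound t b) : SqBound (s ≫ t) (a * b) := by
  have h1 : (((a * b) ^ 2 : ℝ) : ℂ) • 𝟙 P - (s ≫ t) ≫ dag (s ≫ t) =
      ((b ^ 2 : ℝ) : ℂ) • (((a ^ 2 : ℝ) : ℂ) • 𝟙 P - s ≫ dag s) +
      s ≫ (((b ^ 2 : ℝ) : ℂ) • 𝟙 Q - t ≫ dag t) ≫ dag s := by
    simp only [dag_comp, Preadditive.sub_comp, Preadditive.comp_sub, Linear.smul_comp,
      Linear.comp_smul, Category.id_comp, smul_sub, smul_smul, Category.assoc]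
    rw [mul_pow, mul_comm, Complex.ofReal_mul]
    abel
  unfold SqBound
  rw [h1]
  exact add_mem (smul_mem_sqCone (by positivity) hs) (conj_mem_sqCone s ht)

theorem SqBound.sqrt {P Q : T} {t : P ⟶ Q} {r : ℝ} (hr : 0 < r) (h : SqBound (t ≫ dag t) r) :
    SqBound t (Real.sqrt r) := by
  let y : P ⟶ P := (r : ℂ) • 𝟙 P - t ≫ dag t
  have hy : y ≫ dag y = ((r ^ 2 : ℝ) : ℂ) • 𝟙 P - (2 * r : ℂ) • (t ≫ dag t) +
      (t ≫ dag t) ≫ dag (t ≫ dag t) := by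
    have h2 : dag (t ≫ dag t) = t ≫ dag t := by simp
    simp only [y, dag_sub, dag_smul, h2, dag_id, Preadditive.sub_comp, Preadditive.comp_sub,
      Linear.smul_comp, Linear.comp_smul, Complex.star_def, Complex.conj_ofReal,
      Category.id_comp, Category.comp_id]
    rw [Complex.ofReal_pow]
    module
  have hne : (r : ℂ) ≠ 0 := by exact_mod_cast hr.ne'
  have h1 : (((Real.sqrt r) ^ 2 : ℝ) : ℂ) • 𝟙 P - t ≫ dag t =
      ((1 / (2 * r) : ℝ) : ℂ) • (y ≫ dag y +
        (((r ^ 2 : ℝ) : ℂ) • 𝟙 P - (t ≫ dag t) ≫ dag (t ≫ dag t))) := by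
    have h3 : y ≫ dag y + (((r ^ 2 : ℝ) : ℂ) • 𝟙 P - (t ≫ dag t) ≫ dag (t ≫ dag t)) =
        (2 * r : ℂ) • ((r : ℂ) • 𝟙 P - t ≫ dag t) := by
      rw [hy, smul_sub, smul_smul]
      have : (2 * r * r : ℂ) = ((r ^ 2 : ℝ) : ℂ) + ((r ^ 2 : ℝ) : ℂ) := by push_cast; ring
      rw [this, add_smul]
      abel
    rw [h3, smul_smul, Real.sq_sqrt hr.le]
    have : ((1 / (2 * r) : ℝ) : ℂ) * (2 * r : ℂ) = 1 := by
      push_cast; field_simp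
    rw [this, one_smul]
  unfold SqBound
  rw [h1]
  exact smul_mem_sqCone (by positivity) (add_mem (sq_mem y) h)

/-- The seminorm determined by the sums of squares. -/
def sqNorm {P Q : T} (t : P ⟶ Q) : ℝ := sInf {r : ℝ | 0 < r ∧ SqBound t r}

theorem sqNorm_nonneg {P Q : T} (t : P ⟶ Q) : 0 ≤ sqNorm t :=
  Real.sInf_nonneg fun _ hr => hr.1.le

theorem sqNorm_le {P Q : T} {t : P ⟶ Q} {r : ℝ} (hr : 0 < r) (h : SqBound t r) :
    sqNorm t ≤ r :=
  csInf_le ⟨0, fun _ hs => hs.1.le⟩ ⟨hr, h⟩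

/-- Every morphism is bounded with respect to the sums of squares. -/
class SqBounded (T : Type u) [Category.{v} T] [Preadditive T] [Linear ℂ T]
    [StarCategory T] : Prop where
  exists_bound {P Q : T} (t : P ⟶ Q) : ∃ r : ℝ, 0 < r ∧ SqBound t r

variable [SqBounded T]

theorem SqBound.of_lt {P Q : T} {t : P ⟶ Q} {r : ℝ} (h : sqNorm t < r) : SqBound t r := by
  obtain ⟨s, ⟨hs0, hs⟩, hsr⟩ := exists_lt_of_csInf_lt (SqBounded.exists_bound t) h
  exact hs.mono hs0.le hsr.le

theorem sqNorm_add_le {P Q : T} (s t : P ⟶ Q) : sqNorm (s + t) ≤ sqNorm s + sqNorm t := by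
  refine le_of_forall_pos_le_add fun ε hε => ?_
  have hs := sqNorm_nonneg s
  have ht := sqNorm_nonneg t
  have h := sqNorm_le (by positivity) (SqBound.add (s := s) (t := t) (a := sqNorm s + ε / 2)
    (b := sqNorm t + ε / 2) (by positivity) (by positivity) (.of_lt (by linarith))
    (.of_lt (by linarith)))
  linarith

theorem sqNorm_smul_le {P Q : T} (c : ℂ) (t : P ⟶ Q) : sqNorm (c • t) ≤ ‖c‖ * sqNorm t := by
  have ht := sqNorm_nonneg t
  refine le_of_forall_pos_le_add fun ε hε => ?_
  have h1 : SqBound (c • t) (‖c‖ * (sqNorm t + ε / (‖c‖ + 1))) :=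
    SqBound.smul (.of_lt (by linarith [div_pos hε (by positivity : 0 < ‖c‖ + 1)])) c
  have h2 : ‖c‖ * (sqNorm t + ε / (‖c‖ + 1)) ≤ ‖c‖ * sqNorm t + ε := by
    have : ‖c‖ * (ε / (‖c‖ + 1)) ≤ ε := by
      rw [mul_div_assoc', div_le_iff₀ (by positivity)]
      nlinarith [norm_nonneg c]
    linarith
  exact sqNorm_le (by positivity) (h1.mono (by positivity) h2)

theorem sqNorm_smul {P Q : T} (c : ℂ) (t : P ⟶ Q) : sqNorm (c • t) = ‖c‖ * sqNorm t := by
  refine le_antisymm (sqNorm_smul_le c t) ?_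
  by_cases hc : c = 0
  · simp [hc, sqNorm_nonneg]
  · have h := sqNorm_smul_le c⁻¹ (c • t)
    rw [smul_smul, inv_mul_cancel₀ hc, one_smul, norm_inv] at h
    have : 0 < ‖c‖ := norm_pos_iff.mpr hc
    rwa [← div_eq_inv_mul, le_div_iff₀' this] at h

theorem sqNorm_comp_le {P Q R : T} (s : P ⟶ Q) (t : Q ⟶ R) :
    sqNorm (s ≫ t) ≤ sqNorm s * sqNorm t := by
  have hs := sqNorm_nonneg s
  have ht := sqNorm_nonneg t
  have key : ∀ ε > 0, sqNorm (s ≫ t) ≤ (sqNorm s + ε) * (sqNorm t + ε) := fun ε hε =>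
    sqNorm_le (by positivity) (SqBound.comp (.of_lt (by linarith)) (.of_lt (by linarith)))
  have hc : Filter.Tendsto (fun ε : ℝ => (sqNorm s + ε) * (sqNorm t + ε))
      (nhdsWithin 0 (Set.Ioi 0)) (nhds ((sqNorm s + 0) * (sqNorm t + 0))) := by
    apply Filter.Tendsto.mono_left _ nhdsWithin_le_nhds
    apply Continuous.tendsto
    fun_prop
  rw [add_zero, add_zero] at hc
  exact ge_of_tendsto hc (eventually_nhdsWithin_of_forall fun ε hε => key ε hε)

theorem sqNorm_sq_le {P Q : T} (t : P ⟶ Q) : sqNorm t ^ 2 ≤ sqNorm (t ≫ dag t) := by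
  refine le_of_forall_pos_le_add fun ε hε => ?_
  have h0 := sqNorm_nonneg (t ≫ dag t)
  have h : sqNorm t ≤ Real.sqrt (sqNorm (t ≫ dag t) + ε) :=
    sqNorm_le (by positivity) (SqBound.sqrt (by positivity) (.of_lt (by linarith)))
  calc sqNorm t ^ 2 ≤ Real.sqrt (sqNorm (t ≫ dag t) + ε) ^ 2 := by
        gcongr; exact sqNorm_nonneg t
    _ = _ := Real.sq_sqrt (by positivity)

theorem sqNorm_dag {P Q : T} (t : P ⟶ Q) : sqNorm (dag t) = sqNorm t := by
  have key : ∀ {P Q : T} (t : P ⟶ Q), sqNorm t ≤ sqNorm (dag t) := by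
    intro P Q t
    have h1 := (sqNorm_sq_le t).trans (sqNorm_comp_le t (dag t))
    rcases (sqNorm_nonneg t).eq_or_lt with h | h
    · rw [← h]; exact sqNorm_nonneg _
    · nlinarith
  apply le_antisymm
  · have := key (dag t)
    rwa [dag_dag] at this
  · exact key t

theorem sqNorm_comp_dag {P Q : T} (t : P ⟶ Q) : sqNorm (t ≫ dag t) = sqNorm t ^ 2 := by
  refine le_antisymm ?_ (sqNorm_sq_le t)
  have := sqNorm_comp_le t (dag t)
  rwa [sqNorm_dag, ← sq] at this

end SumsOfSquares

section MaxNorm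

/-- The maximal C*-norm on the algebraic tensor product of two unital C*-algebras: the supremum
of `‖π x‖` over all `*`-homomorphisms `π` from the algebraic tensor product to C*-algebras. -/
def maxNorm {A B : Type v} [CStarAlgebra A] [CStarAlgebra B] (x : A ⊗[ℂ] B) : ℝ :=
  sSup {r : ℝ | ∃ (D : Type v) (_ : CStarAlgebra D) (π : A ⊗[ℂ] B →⋆ₐ[ℂ] D), r = ‖π x‖}

variable {A : Type u} [Category.{v} A] {B : Type u'} [Category.{v} B]

section
variable [CStarCategoryCore A] [CStarCategoryCore B]

/-- An endomorphism of `X ⊠ Y`, as an element of `End X ⊗ End Y`. -/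
def AlgTensor.toEnd {P : AlgTensor A B} (t : P ⟶ P) : End P.fst ⊗[ℂ] End P.snd := t

/-- The norm on the morphisms of the algebraic tensor product: on `End (X ⊠ Y)` it is the maximal
C*-norm, and in general it is determined by the C*-identity `‖t‖ ^ 2 = ‖t* ∘ t‖`. -/
def maxTensorNorm {P Q : AlgTensor A B} (t : P ⟶ Q) : ℝ :=
  Real.sqrt (maxNorm (AlgTensor.toEnd (t ≫ dag t)))

end

variable [CStarCategory A] [CStarCategory B]

attribute [local instance] CStarAlgebra.spectralOrder CStarAlgebra.spectralOrderedRing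

theorem exists_norm_sq_sub {X Y : A} (f : X ⟶ Y) :
    ∃ c : X ⟶ X, f ≫ dag f + c ≫ dag c = ((‖f‖ ^ 2 : ℝ) : ℂ) • 𝟙 X := by
  obtain ⟨g, hg⟩ := CStarCategory.exists_comp_adj_eq f
  change f ≫ dag f = g ≫ dag g at hg
  have hn : ‖f‖ ^ 2 = ‖End.of g‖ ^ 2 := by
    rw [← norm_comp_dag f, hg, norm_comp_dag g]
  have h := CStarAlgebra.star_mul_le_algebraMap_norm_sq (a := End.of g)
  rw [← sub_nonneg, CStarAlgebra.nonneg_iff_eq_star_mul_self] at h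
  obtain ⟨c, hc⟩ := h
  refine ⟨c, ?_⟩
  rw [hg, hn]
  have h2 := sub_eq_iff_eq_add.mp hc
  have h3 : (algebraMap ℝ (End X)) (‖End.of g‖ ^ 2) =
      (((‖End.of g‖ ^ 2 : ℝ) : ℂ) • 𝟙 X : X ⟶ X) := by
    rw [IsScalarTower.algebraMap_apply ℝ ℂ (End X), Algebra.algebraMap_eq_smul_one]
    rfl
  rw [← h3, h2, add_comm]
  rfl

instance : SqBounded (AlgTensor A B) where
  exists_bound {P Q} t := by
    induction t using AlgTensor.hom_ind with
    | zero =>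
      refine ⟨1, one_pos, ?_⟩
      unfold SqBound
      simpa using sq_mem (𝟙 P)
    | add s t hs ht =>
      obtain ⟨a, ha, hs⟩ := hs
      obtain ⟨b, hb, ht⟩ := ht
      exact ⟨a + b, by positivity, hs.add ha hb ht⟩
    | tmul f g =>
      obtain ⟨c, hc⟩ := exists_norm_sq_sub f
      obtain ⟨d, hd⟩ := exists_norm_sq_sub g
      have hb : SqBound (AlgTensor.tmul f g : P ⟶ Q) (‖f‖ * ‖g‖) := by
        have h1 : ((((‖f‖ * ‖g‖) ^ 2 : ℝ) : ℂ) • 𝟙 P -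
            (AlgTensor.tmul f g : P ⟶ Q) ≫ dag (AlgTensor.tmul f g : P ⟶ Q)) =
            ((‖f‖ ^ 2 : ℝ) : ℂ) • ((AlgTensor.tmul (𝟙 P.fst) d : P ⟶ P) ≫
              dag (AlgTensor.tmul (𝟙 P.fst) d : P ⟶ P)) +
            (AlgTensor.tmul c g : P ⟶ ⟨P.fst, Q.snd⟩) ≫
              dag (AlgTensor.tmul c g : P ⟶ ⟨P.fst, Q.snd⟩) := by
          simp only [AlgTensor.dag_tmul, AlgTensor.tmul_comp, dag_id, Category.comp_id]
          have hc' := eq_sub_of_add_eq' hc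
          have hd' := eq_sub_of_add_eq' hd
          rw [hc', hd', AlgTensor.id_eq]
          rw [mul_pow, Complex.ofReal_mul, mul_smul, AlgTensor.sub_tmul, AlgTensor.tmul_sub,
            AlgTensor.smul_tmul, AlgTensor.tmul_smul, smul_sub]
          abel
        unfold SqBound
        rw [h1]
        exact add_mem (smul_mem_sqCone (by positivity) (sq_mem _)) (sq_mem _)
      exact ⟨‖f‖ * ‖g‖ + 1, by positivity, hb.mono (by positivity) (by linarith)⟩

variable [HasDirectSums A] [HasDirectSums B]

/-- In the algebraic tensor product of C*-categories with direct sums, every `u* ∘ u` is a sum of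
squares of endomorphisms. -/
theorem AlgTensor.exists_sum_sq {P Q : AlgTensor A B} (u : P ⟶ Q) :
    ∃ (k : ℕ) (g : Fin k → (P ⟶ P)), u ≫ dag u = ∑ i, g i ≫ dag (g i) := by
  obtain ⟨n, f, g, rfl⟩ := AlgTensor.exists_sum u
  obtain ⟨a, ha⟩ := exists_gram f
  obtain ⟨b, hb⟩ := exists_gram g
  let w : Fin n × Fin n → (P ⟶ P) := fun x => ∑ p, AlgTensor.tmul (a p x.1) (b p x.2)
  refine ⟨Fintype.card (Fin n × Fin n), fun i => w ((Fintype.equivFin _).symm i), ?_⟩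
  rw [(Fintype.equivFin (Fin n × Fin n)).symm.sum_comp (fun x => w x ≫ dag (w x))]
  have hL : (∑ p, (AlgTensor.tmul (f p) (g p) : P ⟶ Q)) ≫
      dag (∑ p, (AlgTensor.tmul (f p) (g p) : P ⟶ Q)) =
      ∑ p, ∑ q, (AlgTensor.tmul (∑ k, a p k ≫ dag (a q k)) (∑ l, b p l ≫ dag (b q l)) :
        P ⟶ P) := by
    rw [dag_sum, Preadditive.sum_comp]
    refine Finset.sum_congr rfl fun p _ => ?_
    rw [Preadditive.comp_sum]
    refine Finset.sum_congr rfl fun q _ => ?_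
    rw [AlgTensor.dag_tmul, AlgTensor.tmul_comp, ha, hb]
  have hS : ∀ (p q : Fin n),
      (AlgTensor.tmul (∑ k, a p k ≫ dag (a q k)) (∑ l, b p l ≫ dag (b q l)) : P ⟶ P) =
      ∑ x : Fin n × Fin n, AlgTensor.tmul (a p x.1 ≫ dag (a q x.1)) (b p x.2 ≫ dag (b q x.2)) := by
    intro p q
    rw [Fintype.sum_prod_type]
    refine (TensorProduct.sum_tmul _ _ _).trans (Finset.sum_congr rfl fun k _ => ?_)
    exact TensorProduct.tmul_sum _ _ _
  rw [hL]
  simp only [hS]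
  have hR : ∀ x, w x ≫ dag (w x) =
      ∑ p, ∑ q, AlgTensor.tmul (a p x.1 ≫ dag (a q x.1)) (b p x.2 ≫ dag (b q x.2)) := by
    intro x
    simp only [w]
    rw [dag_sum, Preadditive.sum_comp]
    refine Finset.sum_congr rfl fun p _ => ?_
    rw [Preadditive.comp_sum]
    rfl
  simp only [hR]
  rw [Finset.sum_comm]
  have h5 : ∀ q : Fin n, (∑ p, ∑ x : Fin n × Fin n, (AlgTensor.tmul (a p x.1 ≫ dag (a q x.1))
      (b p x.2 ≫ dag (b q x.2)) : P ⟶ P)) = ∑ x : Fin n × Fin n, ∑ p,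
      AlgTensor.tmul (a p x.1 ≫ dag (a q x.1)) (b p x.2 ≫ dag (b q x.2)) :=
    fun q => Finset.sum_comm
  simp only [h5]
  rw [Finset.sum_comm]
  refine Finset.sum_congr rfl fun x _ => Finset.sum_comm

/-- The seminorm given by the sums of squares, as a C*-seminorm. -/
def sqSeminorm (A : Type u) [Category.{v} A] [CStarCategory A] [HasDirectSums A]
    (B : Type u') [Category.{v} B] [CStarCategory B] [HasDirectSums B] :
    CStarSeminorm (AlgTensor A B) where
  nrm := sqNorm
  nonneg := sqNorm_nonneg
  add_le := sqNorm_add_le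
  smul_eq := sqNorm_smul
  comp_le := sqNorm_comp_le
  comp_dag := sqNorm_comp_dag
  sum_sq := AlgTensor.exists_sum_sq

section

variable {A : Type u} [Category.{v} A] [CStarCategoryCore A]
  {B : Type u'} [Category.{v} B] [CStarCategoryCore B]

theorem AlgTensor.end_mul {P : AlgTensor A B} (x y : End P.fst ⊗[ℂ] End P.snd) :
    x * y = (show P ⟶ P from y) ≫ (show P ⟶ P from x) := by
  induction x using TensorProduct.induction_on with
  | zero =>
    rw [zero_mul]
    exact (Limits.comp_zero (f := (show P ⟶ P from y)) (Z := P)).symm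
  | add x x' hx hx' =>
    rw [add_mul, hx, hx']
    exact (Preadditive.comp_add _ _ _ (show P ⟶ P from y) (show P ⟶ P from x) x').symm
  | tmul a b =>
    induction y using TensorProduct.induction_on with
    | zero =>
      rw [mul_zero]
      exact (Limits.zero_comp (X := P) (f := (show P ⟶ P from a ⊗ₜ[ℂ] b))).symm
    | add y y' hy hy' =>
      rw [mul_add, hy, hy']
      exact (Preadditive.add_comp _ _ _ (show P ⟶ P from y) y' _).symm
    | tmul c d => exact Algebra.TensorProduct.tmul_mul_tmul a c b d

theorem AlgTensor.end_star {P : AlgTensor A B} (x : End P.fst ⊗[ℂ] End P.snd) :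
    star x = dag (X := P) (Y := P) x := by
  induction x using TensorProduct.induction_on with
  | zero =>
    rw [star_zero]
    exact (dag_zero P P).symm
  | add x x' hx hx' =>
    rw [star_add, hx, hx']
    exact (dag_add (X := P) (Y := P) x x').symm
  | tmul a b => rfl

end

/-- The canonical `*`-homomorphism from `End X ⊗ End Y` to the completion. -/
def toSqCompletion (P : AlgTensor A B) : End P.fst ⊗[ℂ] End P.snd →⋆ₐ[ℂ]
    End (CStarCompletion.mk P : CStarCompletion (sqSeminorm A B)) where
  toFun x := CStarCompletion.ofHom (X := P) (Y := P) x
  map_one' := rfl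
  map_mul' x y := by
    rw [AlgTensor.end_mul]
    exact CStarCompletion.ofHom_comp _ _
  map_zero' := CStarCompletion.ofHom_zero
  map_add' x y := CStarCompletion.ofHom_add (X := P) (Y := P) x y
  commutes' c := by
    rw [Algebra.algebraMap_eq_smul_one, Algebra.algebraMap_eq_smul_one]
    exact CStarCompletion.ofHom_smul (X := P) (Y := P) c (𝟙 P)
  map_star' x := by
    rw [AlgTensor.end_star]
    exact CStarCompletion.ofHom_dag (X := P) (Y := P) x

theorem norm_le_sqNorm {P : AlgTensor A B} {D : Type w} [CStarAlgebra D]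
    (π : End P.fst ⊗[ℂ] End P.snd →⋆ₐ[ℂ] D) (t : P ⟶ P) :
    ‖π (AlgTensor.toEnd t)‖ ≤ sqNorm t := by
  have key : ∀ x ∈ sqCone P, 0 ≤ π (AlgTensor.toEnd x) := by
    intro x hx
    induction hx using AddSubmonoid.closure_induction with
    | mem x hx =>
      obtain ⟨Q, w, rfl⟩ := hx
      obtain ⟨k, g, hg⟩ := AlgTensor.exists_sum_sq w
      rw [hg]
      have : AlgTensor.toEnd (∑ i, g i ≫ dag (g i)) =
          ∑ i, star (AlgTensor.toEnd (g i)) * AlgTensor.toEnd (g i) := by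
        refine Finset.sum_congr rfl fun i _ => ?_
        rw [AlgTensor.end_mul, AlgTensor.end_star]
        rfl
      rw [this, map_sum]
      refine Finset.sum_nonneg fun i _ => ?_
      rw [map_mul, map_star]
      exact star_mul_self_nonneg _
    | zero => exact (map_zero π).ge
    | add x y _ _ hx hy => exact (add_nonneg hx hy).trans (map_add π _ _).ge
  refine le_of_forall_pos_le_add fun ε hε => ?_
  have h0 := sqNorm_nonneg t
  have hb : SqBound t (sqNorm t + ε) := .of_lt (by linarith)
  have h := key _ hb
  have h1 : AlgTensor.toEnd ((((sqNorm t + ε) ^ 2 : ℝ) : ℂ) • 𝟙 P - t ≫ dag t) =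
      (((sqNorm t + ε) ^ 2 : ℝ) : ℂ) • (1 : End P.fst ⊗[ℂ] End P.snd) -
        star (AlgTensor.toEnd t) * AlgTensor.toEnd t := by
    rw [AlgTensor.end_mul, AlgTensor.end_star]
    rfl
  rw [h1, map_sub, map_smul, map_one, map_mul, map_star, sub_nonneg] at h
  have h2 : ((((sqNorm t + ε) ^ 2 : ℝ) : ℂ) • (1 : D)) =
      algebraMap ℝ D ((sqNorm t + ε) ^ 2) := by
    rw [IsScalarTower.algebraMap_apply ℝ ℂ D, Algebra.algebraMap_eq_smul_one]
    rfl
  rw [h2, ← CStarAlgebra.norm_le_iff_le_algebraMap _ (by positivity) (star_mul_self_nonneg _),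
    CStarRing.norm_star_mul_self, ← sq] at h
  exact (pow_le_pow_iff_left₀ (norm_nonneg _) (by positivity) two_ne_zero).mp h

/-- The maximal C*-norm of an endomorphism, in terms of sums of squares. -/
theorem maxNorm_eq_sqNorm {P : AlgTensor A B} (t : P ⟶ P) :
    maxNorm (AlgTensor.toEnd t) = sqNorm t := by
  apply le_antisymm
  · refine csSup_le ⟨_, _, _, toSqCompletion P, rfl⟩ ?_
    rintro _ ⟨D, _, π, rfl⟩
    exact norm_le_sqNorm π t
  · refine le_csSup ⟨sqNorm t, ?_⟩ ⟨_, _, toSqCompletion P, ?_⟩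
    · rintro _ ⟨D, _, π, rfl⟩
      exact norm_le_sqNorm π t
    · exact (CStarCompletion.norm_ofHom (N := sqSeminorm A B) t).symm

theorem maxTensorNorm_eq_sqNorm {P Q : AlgTensor A B} (t : P ⟶ Q) :
    maxTensorNorm t = sqNorm t := by
  rw [maxTensorNorm, maxNorm_eq_sqNorm, sqNorm_comp_dag, Real.sqrt_sq (sqNorm_nonneg t)]

theorem sqNorm_isometry_le {P Q : AlgTensor A B} (v : P ⟶ Q) (hv : v ≫ dag v = 𝟙 P) :
    sqNorm v ≤ 1 := by
  have h1 : sqNorm (𝟙 P) ≤ 1 := sqNorm_le one_pos (by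
    unfold SqBound
    simp)
  have h2 := sqNorm_comp_dag v
  rw [hv] at h2
  nlinarith [sqNorm_nonneg v]

/-- The norm on `Hom (X ⊠ Y, X' ⊠ Y')` is induced by the maximal C*-norm through the embedding
into `End (X ⊕ X') ⊗ End (Y ⊕ Y')`, for any choice of direct sums. -/
theorem maxTensorNorm_eq_maxNorm_embed {P Q : AlgTensor A B} {S : A} {S' : B}
    {i : P.fst ⟶ S} {j : Q.fst ⟶ S} (h : IsDirectSum i j)
    {i' : P.snd ⟶ S'} {j' : Q.snd ⟶ S'} (h' : IsDirectSum i' j')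
    (t : P ⟶ Q) :
    maxTensorNorm t = maxNorm (AlgTensor.toEnd
      (dag (AlgTensor.tmul i i' : P ⟶ ⟨S, S'⟩) ≫ t ≫ (AlgTensor.tmul j j' : Q ⟶ ⟨S, S'⟩))) := by
  rw [maxTensorNorm_eq_sqNorm, maxNorm_eq_sqNorm]
  set v : P ⟶ (⟨S, S'⟩ : AlgTensor A B) := AlgTensor.tmul i i'
  set w : Q ⟶ (⟨S, S'⟩ : AlgTensor A B) := AlgTensor.tmul j j'
  have hv : v ≫ dag v = 𝟙 P := by
    rw [AlgTensor.dag_tmul, AlgTensor.tmul_comp, h.left, h'.left, AlgTensor.id_eq]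
  have hw : w ≫ dag w = 𝟙 Q := by
    rw [AlgTensor.dag_tmul, AlgTensor.tmul_comp, h.right, h'.right, AlgTensor.id_eq]
  have nv := sqNorm_isometry_le v hv
  have nw := sqNorm_isometry_le w hw
  have key : ∀ {X Y Z : AlgTensor A B} (f : X ⟶ Y) (g : Y ⟶ Z), sqNorm f ≤ 1 →
      sqNorm (f ≫ g) ≤ sqNorm g := fun f g hf =>
    (sqNorm_comp_le f g).trans (mul_le_of_le_one_left (sqNorm_nonneg g) hf)
  have key' : ∀ {X Y Z : AlgTensor A B} (f : X ⟶ Y) (g : Y ⟶ Z), sqNorm g ≤ 1 →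
      sqNorm (f ≫ g) ≤ sqNorm f := fun f g hg =>
    (sqNorm_comp_le f g).trans (mul_le_of_le_one_right (sqNorm_nonneg f) hg)
  apply le_antisymm
  · have ht : t = v ≫ (dag v ≫ t ≫ w) ≫ dag w := by
      simp only [Category.assoc]
      rw [hw, Category.comp_id, ← Category.assoc, hv, Category.id_comp]
    conv_lhs => rw [ht]
    exact (key _ _ nv).trans (key' _ _ (by rwa [sqNorm_dag]))
  · exact (key _ _ (by rwa [sqNorm_dag])).trans (key' _ _ nw)

/-- The norm `maxTensorNorm`, as a C*-seminorm. -/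
def maxSeminorm (A : Type u) [Category.{v} A] [CStarCategory A] [HasDirectSums A]
    (B : Type u') [Category.{v} B] [CStarCategory B] [HasDirectSums B] :
    CStarSeminorm (AlgTensor A B) where
  nrm := maxTensorNorm
  nonneg t := Real.sqrt_nonneg _
  add_le s t := by simpa only [maxTensorNorm_eq_sqNorm] using sqNorm_add_le s t
  smul_eq c t := by simpa only [maxTensorNorm_eq_sqNorm] using sqNorm_smul c t
  comp_le s t := by simpa only [maxTensorNorm_eq_sqNorm] using sqNorm_comp_le s t
  comp_dag t := by simpa only [maxTensorNorm_eq_sqNorm] using sqNorm_comp_dag t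
  sum_sq := AlgTensor.exists_sum_sq

end MaxNorm

section Karoubi

/-- Karoubi completeness: every projection `p = p* = p ∘ p` splits through an isometry. -/
class IsKaroubiComplete (C : Type u) [Category.{v} C] [Preadditive C] [Linear ℂ C]
    [StarCategory C] : Prop where
  exists_splitting {X : C} (p : X ⟶ X) (idem : p ≫ p = p) (sa : dag p = p) :
    ∃ (Y : C) (i : Y ⟶ X), i ≫ dag i = 𝟙 Y ∧ dag i ≫ i = p

/-- The objects of the Karoubi completion of a C*-category: objects equipped with a projection. -/
structure Karoubi (C : Type u) [Category.{v} C] [Preadditive C] [Linear ℂ C]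
    [StarCategory C] : Type (max u v) where
  X : C
  p : X ⟶ X
  idem : p ≫ p = p
  sa : dag p = p

namespace Karoubi

variable {C : Type u} [Category.{v} C] [CStarCategoryCore C]

attribute [simp] idem sa

@[simp] theorem idem_assoc (P : Karoubi C) {Y : C} (f : P.X ⟶ Y) : P.p ≫ P.p ≫ f = P.p ≫ f := by
  rw [← Category.assoc, P.idem]

/-- The morphisms `f` with `p ≫ f = f` and `f ≫ q = f`. -/
def homSub (P Q : Karoubi C) : Submodule ℂ (P.X ⟶ Q.X) where
  carrier := {f | P.p ≫ f = f ∧ f ≫ Q.p = f}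
  add_mem' {f g} hf hg := by
    refine ⟨?_, ?_⟩
    · rw [Preadditive.comp_add, hf.1, hg.1]
    · rw [Preadditive.add_comp, hf.2, hg.2]
  zero_mem' := by simp
  smul_mem' c f hf := by
    refine ⟨?_, ?_⟩
    · rw [Linear.comp_smul, hf.1]
    · rw [Linear.smul_comp, hf.2]

theorem isClosed_homSub (P Q : Karoubi C) : IsClosed (homSub P Q : Set (P.X ⟶ Q.X)) := by
  have h : (homSub P Q : Set (P.X ⟶ Q.X)) = {f | P.p ≫ f = f} ∩ {f | f ≫ Q.p = f} := rfl
  rw [h]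
  exact (isClosed_eq (by fun_prop) (by fun_prop)).inter (isClosed_eq (by fun_prop) (by fun_prop))

instance : Category.{v} (Karoubi C) where
  Hom P Q := homSub P Q
  id P := ⟨P.p, P.idem, P.idem⟩
  comp {P Q R} f g := ⟨f.1 ≫ g.1, by rw [← Category.assoc, f.2.1], by rw [Category.assoc, g.2.2]⟩
  id_comp f := Subtype.ext f.2.1
  comp_id f := Subtype.ext f.2.2
  assoc f g h := Subtype.ext (Category.assoc f.1 g.1 h.1)

/-- The underlying morphism of a morphism in the Karoubi completion. -/
def val {P Q : Karoubi C} (f : P ⟶ Q) : P.X ⟶ Q.X := f.1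

/-- Construct a morphism in the Karoubi completion. -/
def mkHom {P Q : Karoubi C} (f : P.X ⟶ Q.X) (h : P.p ≫ f = f) (h' : f ≫ Q.p = f) : P ⟶ Q :=
  ⟨f, h, h'⟩

@[simp] theorem val_mkHom {P Q : Karoubi C} (f : P.X ⟶ Q.X) (h : P.p ≫ f = f)
    (h' : f ≫ Q.p = f) : val (mkHom f h h') = f := rfl

@[ext] theorem hom_ext {P Q : Karoubi C} {f g : P ⟶ Q} (h : val f = val g) : f = g :=
  Subtype.ext h

@[simp] theorem p_val {P Q : Karoubi C} (f : P ⟶ Q) : P.p ≫ val f = val f := f.2.1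
@[simp] theorem val_p {P Q : Karoubi C} (f : P ⟶ Q) : val f ≫ Q.p = val f := f.2.2
@[simp] theorem p_val_assoc {P Q : Karoubi C} (f : P ⟶ Q) {Z : C} (g : Q.X ⟶ Z) :
    P.p ≫ val f ≫ g = val f ≫ g := by rw [← Category.assoc, p_val]
@[simp] theorem val_p_assoc {P Q : Karoubi C} (f : P ⟶ Q) {Z : C} (g : Q.X ⟶ Z) :
    val f ≫ Q.p ≫ g = val f ≫ g := by rw [← Category.assoc, val_p]
@[simp] theorem val_id (P : Karoubi C) : val (𝟙 P) = P.p := rfl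
@[simp] theorem val_comp {P Q R : Karoubi C} (f : P ⟶ Q) (g : Q ⟶ R) :
    val (f ≫ g) = val f ≫ val g := rfl

theorem dag_p_left {P Q : Karoubi C} (f : P ⟶ Q) : Q.p ≫ dag (val f) = dag (val f) := by
  conv_lhs => rw [← Q.sa, ← dag_comp, val_p]

theorem dag_p_right {P Q : Karoubi C} (f : P ⟶ Q) : dag (val f) ≫ P.p = dag (val f) := by
  conv_lhs => rw [← P.sa, ← dag_comp, p_val]

instance : CStarCategoryCore (Karoubi C) where
  homGroup P Q := inferInstanceAs (NormedAddCommGroup (homSub P Q))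
  homSpace P Q := inferInstanceAs (NormedSpace ℂ (homSub P Q))
  homComplete P Q := (isClosed_homSub P Q).completeSpace_coe
  add_comp f f' g := Subtype.ext (Preadditive.add_comp _ _ _ f.1 f'.1 g.1)
  comp_add f g g' := Subtype.ext (Preadditive.comp_add _ _ _ f.1 g.1 g'.1)
  smul_comp c f g := Subtype.ext (Linear.smul_comp _ _ _ c f.1 g.1)
  comp_smul c f g := Subtype.ext (Linear.comp_smul _ _ _ f.1 c g.1)
  adj f := mkHom (dag (val f)) (dag_p_left f) (dag_p_right f)
  adj_adj f := hom_ext (dag_dag (val f))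
  adj_comp f g := hom_ext (dag_comp (val f) (val g))
  adj_add f g := Subtype.ext (dag_add (val f) (val g))
  adj_smul c f := Subtype.ext (dag_smul c (val f))
  norm_comp_le f g := norm_comp_le (val f) (val g)
  norm_comp_adj f := norm_comp_dag (val f)

@[simp] theorem val_dag {P Q : Karoubi C} (f : P ⟶ Q) : val (dag f) = dag (val f) := rfl
@[simp] theorem val_add {P Q : Karoubi C} (f g : P ⟶ Q) : val (f + g) = val f + val g := rfl
@[simp] theorem val_smul {P Q : Karoubi C} (c : ℂ) (f : P ⟶ Q) : val (c • f) = c • val f := rfl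
@[simp] theorem val_zero (P Q : Karoubi C) : val (0 : P ⟶ Q) = 0 := rfl

instance : IsKaroubiComplete (Karoubi C) where
  exists_splitting {P} e idem sa := by
    have hi : val e ≫ val e = val e := congrArg val idem
    have hs : dag (val e) = val e := congrArg val sa
    let Q : Karoubi C := ⟨P.X, val e, hi, hs⟩
    let i : P.X ⟶ P.X := val (P := P) (Q := P) e
    refine ⟨Q, mkHom (P := Q) (Q := P) i hi (val_p e), ?_, ?_⟩
    · apply hom_ext
      change val e ≫ dag (val e) = val e
      rw [hs, hi]
    · apply hom_ext
      change dag (val e) ≫ val e = val e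
      rw [hs, hi]

end Karoubi

namespace Karoubi

variable {C : Type u} [Category.{v} C] [CStarCategory C]

attribute [local instance] CStarAlgebra.spectralOrder CStarAlgebra.spectralOrderedRing

theorem exists_sa_sqrt {X Y : C} (f : X ⟶ Y) : ∃ g : X ⟶ X, dag g = g ∧ f ≫ dag f = g ≫ g := by
  obtain ⟨g, hg⟩ := CStarCategory.exists_comp_adj_eq f
  change f ≫ dag f = g ≫ dag g at hg
  have h : (0 : End X) ≤ End.of (f ≫ dag f) := by
    rw [hg]
    exact star_mul_self_nonneg (End.of g)
  obtain ⟨k, hk, hk'⟩ := CStarAlgebra.nonneg_iff_exists_isSelfAdjoint_and_eq_mul_self.mp h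
  exact ⟨k, hk, hk'⟩

instance : CStarCategory (Karoubi C) where
  exists_comp_adj_eq {P Q} f := by
    obtain ⟨g, hg, hf⟩ := exists_sa_sqrt (val f)
    have h0 : (g - P.p ≫ g) ≫ dag (g - P.p ≫ g) = 0 := by
      have h1 : P.p ≫ g ≫ g = g ≫ g := by rw [← hf, ← Category.assoc, p_val]
      have h2 : g ≫ g ≫ P.p = g ≫ g := by
        rw [← Category.assoc, ← hf, Category.assoc, dag_p_right]
      simp only [dag_sub, dag_comp, hg, P.sa, Preadditive.sub_comp, Preadditive.comp_sub,
        Category.assoc, h2, h1, sub_self]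
    have h1 : g - P.p ≫ g = 0 := by
      rw [← norm_eq_zero]
      have := norm_comp_dag (g - P.p ≫ g)
      rw [h0, norm_zero] at this
      exact pow_eq_zero_iff two_ne_zero |>.mp this.symm
    have h2 : P.p ≫ g = g := (sub_eq_zero.mp h1).symm
    have h3 : g ≫ P.p = g := by
      have := congrArg dag h2
      rwa [dag_comp, hg, P.sa] at this
    refine ⟨mkHom g h2 h3, hom_ext ?_⟩
    change val f ≫ dag (val f) = g ≫ dag g
    rw [hf, hg]

end Karoubi
end Karoubi

section MaxTensor

variable (A : Type u) [Category.{v} A] [CStarCategory A] [HasDirectSums A]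
    (B : Type u') [Category.{v} B] [CStarCategory B] [HasDirectSums B]

/-- The category `A ⊠ B`: objects are pairs, `End (X ⊠ Y)` is the maximal tensor product of
`End X` and `End Y`, and the hom-spaces are the completions of the algebraic tensor products. -/
abbrev PreMaxTensor : Type (max u u') := CStarCompletion (maxSeminorm A B)

/-- The maximal tensor product of two C*-categories: the Karoubi completion of `A ⊠ B`. -/
abbrev MaxTensor : Type (max u u' v) := Karoubi (PreMaxTensor A B)

instance : HasDirectSums (MaxTensor A B) where
  exists_zero := by
    obtain ⟨Z, hZ⟩ := HasDirectSums.exists_zero (C := A)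
    obtain ⟨W, hW⟩ := HasDirectSums.exists_zero (C := B)
    refine ⟨⟨⟨⟨Z, W⟩⟩, 0, by simp, by simp⟩, ?_⟩
    apply Karoubi.hom_ext
    rfl
  exists_sum P Q := by
    obtain ⟨S, i, j, h⟩ := HasDirectSums.exists_sum P.X.as.fst Q.X.as.fst
    obtain ⟨S', i', j', h'⟩ := HasDirectSums.exists_sum P.X.as.snd Q.X.as.snd
    let Z : AlgTensor A B := ⟨S, S'⟩
    let v₀ : P.X.as ⟶ Z := AlgTensor.tmul i i'
    let w₀ : Q.X.as ⟶ Z := AlgTensor.tmul j j'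
    have hv₀ : v₀ ≫ dag v₀ = 𝟙 _ := by
      rw [AlgTensor.dag_tmul, AlgTensor.tmul_comp, h.left, h'.left, AlgTensor.id_eq]
    have hw₀ : w₀ ≫ dag w₀ = 𝟙 _ := by
      rw [AlgTensor.dag_tmul, AlgTensor.tmul_comp, h.right, h'.right, AlgTensor.id_eq]
    have ho₀ : v₀ ≫ dag w₀ = 0 := by
      rw [AlgTensor.dag_tmul, AlgTensor.tmul_comp, h.orth]
      exact TensorProduct.zero_tmul _ _
    let v : P.X ⟶ (⟨Z⟩ : PreMaxTensor A B) := CStarCompletion.ofHom v₀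
    let w : Q.X ⟶ (⟨Z⟩ : PreMaxTensor A B) := CStarCompletion.ofHom w₀
    have hv : v ≫ dag v = 𝟙 _ := by
      rw [← CStarCompletion.ofHom_dag, ← CStarCompletion.ofHom_comp, hv₀]; rfl
    have hw : w ≫ dag w = 𝟙 _ := by
      rw [← CStarCompletion.ofHom_dag, ← CStarCompletion.ofHom_comp, hw₀]; rfl
    have ho : v ≫ dag w = 0 := by
      rw [← CStarCompletion.ofHom_dag, ← CStarCompletion.ofHom_comp, ho₀]
      exact CStarCompletion.ofHom_zero
    have ho' : w ≫ dag v = 0 := by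
      have := congrArg dag ho
      simpa using this
    have av : ∀ {Y : PreMaxTensor A B} (f : P.X ⟶ Y), v ≫ dag v ≫ f = f := fun f => by
      rw [← Category.assoc, hv, Category.id_comp]
    have aw : ∀ {Y : PreMaxTensor A B} (f : Q.X ⟶ Y), w ≫ dag w ≫ f = f := fun f => by
      rw [← Category.assoc, hw, Category.id_comp]
    have ao : ∀ {Y : PreMaxTensor A B} (f : Q.X ⟶ Y), v ≫ dag w ≫ f = 0 := fun f => by
      rw [← Category.assoc, ho, Limits.zero_comp]
    have ao' : ∀ {Y : PreMaxTensor A B} (f : P.X ⟶ Y), w ≫ dag v ≫ f = 0 := fun f => by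
      rw [← Category.assoc, ho', Limits.zero_comp]
    let e : (⟨Z⟩ : PreMaxTensor A B) ⟶ ⟨Z⟩ := dag v ≫ P.p ≫ v + dag w ≫ Q.p ≫ w
    have he : e ≫ e = e := by
      simp [e, av, aw, ao, ao']
    have hse : dag e = e := by
      simp [e]
    refine ⟨⟨⟨Z⟩, e, he, hse⟩, Karoubi.mkHom (P.p ≫ v) (by simp) (by simp [e, av, ao]),
      Karoubi.mkHom (Q.p ≫ w) (by simp) (by simp [e, aw, ao']), ⟨?_, ?_, ?_, ?_⟩⟩
    · apply Karoubi.hom_ext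
      simp [av]
    · apply Karoubi.hom_ext
      simp [aw]
    · apply Karoubi.hom_ext
      simp [ao]
    · apply Karoubi.hom_ext
      simp [e]

end MaxTensor

section StarFunctors

/-- A `*`-functor: a `ℂ`-linear functor which preserves the adjoint. -/
structure StarFunctor (C : Type u) [Category.{v} C] [Preadditive C] [Linear ℂ C] [StarCategory C]
    (D : Type u') [Category.{w} D] [Preadditive D] [Linear ℂ D] [StarCategory D]
    extends Functor C D where
  map_add {X Y : C} (f g : X ⟶ Y) : map (f + g) = map f + map g
  map_smul {X Y : C} (c : ℂ) (f : X ⟶ Y) : map (c • f) = c • map f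
  map_dag {X Y : C} (f : X ⟶ Y) : map (dag f) = dag (map f)

section

variable {C : Type u} [Category.{v} C] [Preadditive C] [Linear ℂ C] [StarCategory C]
  {D : Type u'} [Category.{w} D] [Preadditive D] [Linear ℂ D] [StarCategory D]

/-- A unitary natural isomorphism between `*`-functors: a natural transformation all of whose
components are unitary. -/
@[ext]
structure UnitaryTrans (F G : StarFunctor C D) where
  app (X : C) : F.obj X ⟶ G.obj X
  naturality {X Y : C} (f : X ⟶ Y) : F.map f ≫ app Y = app X ≫ G.map f
  unitary (X : C) : IsUnitary (app X)

theorem IsUnitary.id (X : C) : IsUnitary (𝟙 X) := by simp [IsUnitary]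

theorem IsUnitary.comp {X Y Z : C} {f : X ⟶ Y} {g : Y ⟶ Z} (hf : IsUnitary f)
    (hg : IsUnitary g) : IsUnitary (f ≫ g) := by
  constructor
  · have h : (f ≫ g) ≫ dag (f ≫ g) = f ≫ (g ≫ dag g) ≫ dag f := by simp
    rw [h, hg.1, Category.id_comp, hf.1]
  · have h : dag (f ≫ g) ≫ (f ≫ g) = dag g ≫ (dag f ≫ f) ≫ g := by simp
    rw [h, hf.2, Category.id_comp, hg.2]

theorem IsUnitary.dag {X Y : C} {f : X ⟶ Y} (hf : IsUnitary f) : IsUnitary (dag f) :=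
  ⟨by rw [dag_dag]; exact hf.2, by rw [dag_dag]; exact hf.1⟩

theorem IsUnitary.map (F : StarFunctor C D) {X Y : C} {f : X ⟶ Y} (hf : IsUnitary f) :
    IsUnitary (F.map f) := by
  constructor
  · rw [← F.map_dag, ← F.map_comp, hf.1, F.map_id]
  · rw [← F.map_dag, ← F.map_comp, hf.2, F.map_id]

theorem UnitaryTrans.naturality_assoc {F G : StarFunctor C D} (α : UnitaryTrans F G) {X Y : C}
    (f : X ⟶ Y) {Z : D} (h : G.obj Y ⟶ Z) :
    F.map f ≫ α.app Y ≫ h = α.app X ≫ G.map f ≫ h := by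
  rw [← Category.assoc, α.naturality, Category.assoc]

instance : Category (StarFunctor C D) where
  Hom F G := UnitaryTrans F G
  id F := ⟨fun X => 𝟙 _, fun f => by simp, fun X => IsUnitary.id _⟩
  comp α β := ⟨fun X => α.app X ≫ β.app X,
    fun f => by rw [α.naturality_assoc, β.naturality, Category.assoc],
    fun X => (α.unitary X).comp (β.unitary X)⟩
  id_comp α := UnitaryTrans.ext (funext fun X => Category.id_comp _)
  comp_id α := UnitaryTrans.ext (funext fun X => Category.comp_id _)
  assoc α β γ := UnitaryTrans.ext (funext fun X => Category.assoc _ _ _)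

namespace StarFunctor

theorem map_zero (F : StarFunctor C D) (X Y : C) : F.map (0 : X ⟶ Y) = 0 := by
  have h := F.map_add (0 : X ⟶ Y) 0
  simpa using h

/-- The component of a unitary natural isomorphism at an object. -/
def app {F G : StarFunctor C D} (α : F ⟶ G) (X : C) : F.obj X ⟶ G.obj X :=
  UnitaryTrans.app α X

theorem unitary {F G : StarFunctor C D} (α : F ⟶ G) (X : C) : IsUnitary (app α X) :=
  UnitaryTrans.unitary α X

theorem naturality {F G : StarFunctor C D} (α : F ⟶ G) {X Y : C} (f : X ⟶ Y) :
    F.map f ≫ app α Y = app α X ≫ G.map f :=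
  UnitaryTrans.naturality α f

theorem hom_ext {F G : StarFunctor C D} {α β : F ⟶ G} (h : ∀ X, app α X = app β X) : α = β :=
  UnitaryTrans.ext (funext h)

@[simp] theorem id_app (F : StarFunctor C D) (X : C) : app (𝟙 F) X = 𝟙 (F.obj X) := rfl

@[simp] theorem comp_app {F G H : StarFunctor C D} (α : F ⟶ G) (β : G ⟶ H) (X : C) :
    app (α ≫ β) X = app α X ≫ app β X := rfl

/-- Construct an isomorphism of `*`-functors from a natural family of unitaries. -/
def mkIso {F G : StarFunctor C D} (φ : ∀ X, F.obj X ⟶ G.obj X)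
    (nat : ∀ {X Y : C} (f : X ⟶ Y), F.map f ≫ φ Y = φ X ≫ G.map f)
    (uni : ∀ X, IsUnitary (φ X)) : F ≅ G where
  hom := (⟨φ, nat, uni⟩ : UnitaryTrans F G)
  inv := (⟨fun X => dag (φ X), fun {X Y} f => by
    have h : dag (φ X) ≫ (φ X ≫ G.map f) ≫ dag (φ Y) =
        dag (φ X) ≫ (F.map f ≫ φ Y) ≫ dag (φ Y) := by rw [nat]
    rw [Category.assoc, ← Category.assoc, (uni X).2, Category.id_comp] at h
    rw [h, Category.assoc, (uni Y).1, Category.comp_id],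
    fun X => (uni X).dag⟩ : UnitaryTrans G F)
  hom_inv_id := hom_ext fun X => (uni X).1
  inv_hom_id := hom_ext fun X => (uni X).2

@[simp] theorem mkIso_hom_app {F G : StarFunctor C D} (φ : ∀ X, F.obj X ⟶ G.obj X)
    (nat : ∀ {X Y : C} (f : X ⟶ Y), F.map f ≫ φ Y = φ X ≫ G.map f)
    (uni : ∀ X, IsUnitary (φ X)) (X : C) : app (mkIso φ nat uni).hom X = φ X := rfl

@[simp] theorem mkIso_inv_app {F G : StarFunctor C D} (φ : ∀ X, F.obj X ⟶ G.obj X)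
    (nat : ∀ {X Y : C} (f : X ⟶ Y), F.map f ≫ φ Y = φ X ≫ G.map f)
    (uni : ∀ X, IsUnitary (φ X)) (X : C) : app (mkIso φ nat uni).inv X = dag (φ X) := rfl

instance : IsGroupoid (StarFunctor C D) where
  all_isIso {F G} α :=
    (mkIso (app α) (fun f => naturality α f) (unitary α)).isIso_hom

/-- The identity `*`-functor. -/
def id (C : Type u) [Category.{v} C] [Preadditive C] [Linear ℂ C] [StarCategory C] :
    StarFunctor C C where
  toFunctor := 𝟭 C
  map_add _ _ := rfl
  map_smul _ _ := rfl
  map_dag _ := rfl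

/-- Composition of `*`-functors. -/
def comp {E : Type*} [Category* E] [Preadditive E] [Linear ℂ E] [StarCategory E]
    (F : StarFunctor C D) (G : StarFunctor D E) : StarFunctor C E where
  toFunctor := F.toFunctor ⋙ G.toFunctor
  map_add f g := by
    change G.map (F.map (f + g)) = G.map (F.map f) + G.map (F.map g)
    rw [F.map_add, G.map_add]
  map_smul c f := by
    change G.map (F.map (c • f)) = c • G.map (F.map f)
    rw [F.map_smul, G.map_smul]
  map_dag f := by
    change G.map (F.map (dag f)) = dag (G.map (F.map f))
    rw [F.map_dag, G.map_dag]

/-- Left whiskering. -/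
def whiskerLeft {E : Type*} [Category* E] [Preadditive E] [Linear ℂ E] [StarCategory E]
    (F : StarFunctor C D) {G H : StarFunctor D E} (α : G ⟶ H) : F.comp G ⟶ F.comp H :=
  (⟨fun X => app α (F.obj X), fun f => naturality α (F.map f), fun _ => unitary α _⟩ :
    UnitaryTrans (F.comp G) (F.comp H))

/-- Right whiskering. -/
def whiskerRight {E : Type*} [Category* E] [Preadditive E] [Linear ℂ E] [StarCategory E]
    {F G : StarFunctor C D} (α : F ⟶ G) (H : StarFunctor D E) : F.comp H ⟶ G.comp H :=
  (⟨fun X => H.map (app α X), fun f => by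
      change H.map (F.map f) ≫ H.map _ = H.map _ ≫ H.map (G.map f)
      rw [← H.map_comp, ← H.map_comp, naturality],
    fun X => (unitary α X).map H⟩ : UnitaryTrans (F.comp H) (G.comp H))

end StarFunctor

end

end StarFunctors

section Clin

/-- The objects of `Clin`: small C*-categories with finite direct sums which are Karoubi
complete. -/
structure Clin : Type (u + 1) where
  carrier : Type u
  [category : Category.{u} carrier]
  [cstarCategory : CStarCategory carrier]
  [hasDirectSums : HasDirectSums carrier]
  [isKaroubiComplete : IsKaroubiComplete carrier]

namespace Clin

instance : CoeSort Clin.{u} (Type u) := ⟨carrier⟩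

attribute [instance] category cstarCategory hasDirectSums isKaroubiComplete

/-- The (2,1)-category `Clin`: 1-morphisms are the `*`-functors, 2-morphisms are the unitary
natural isomorphisms. -/
instance : Bicategory Clin.{u} where
  Hom C D := StarFunctor C D
  id C := StarFunctor.id C
  comp F G := F.comp G
  homCategory C D := inferInstanceAs (Category (StarFunctor C D))
  whiskerLeft F _ _ α := StarFunctor.whiskerLeft F α
  whiskerRight α H := StarFunctor.whiskerRight α H
  associator F G H := StarFunctor.mkIso (F := (F.comp G).comp H) (G := F.comp (G.comp H))
    (fun X => 𝟙 _) (fun f => (Category.comp_id _).trans (Category.id_comp _).symm)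
    (fun X => IsUnitary.id _)
  leftUnitor {C D} F := StarFunctor.mkIso (F := (StarFunctor.id C).comp F) (G := F)
    (fun X => 𝟙 _) (fun f => (Category.comp_id _).trans (Category.id_comp _).symm)
    (fun X => IsUnitary.id _)
  rightUnitor {C D} F := StarFunctor.mkIso (F := F.comp (StarFunctor.id D)) (G := F)
    (fun X => 𝟙 _) (fun f => (Category.comp_id _).trans (Category.id_comp _).symm)
    (fun X => IsUnitary.id _)
  whiskerLeft_id F G := rfl
  whiskerLeft_comp F _ _ _ α β := rfl
  id_whiskerLeft {C D} F G α := by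
    apply StarFunctor.hom_ext
    intro X
    change _ = 𝟙 _ ≫ StarFunctor.app α X ≫ dag (𝟙 _)
    rw [dag_id, Category.comp_id, Category.id_comp]
    rfl
  comp_whiskerLeft {C D E E'} F G H H' α := by
    apply StarFunctor.hom_ext
    intro X
    change _ = 𝟙 _ ≫ StarFunctor.app α (G.obj (F.obj X)) ≫ dag (𝟙 _)
    rw [dag_id, Category.comp_id, Category.id_comp]
    rfl
  id_whiskerRight {C D E} F G := by
    apply StarFunctor.hom_ext
    intro X
    exact G.map_id _
  comp_whiskerRight {C D E} F G H α β K := by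
    apply StarFunctor.hom_ext
    intro X
    exact K.map_comp _ _
  whiskerRight_id {C D} F G α := by
    apply StarFunctor.hom_ext
    intro X
    change _ = 𝟙 _ ≫ StarFunctor.app α X ≫ dag (𝟙 _)
    rw [dag_id, Category.comp_id, Category.id_comp]
    rfl
  whiskerRight_comp {C D E E'} F G α H K := by
    apply StarFunctor.hom_ext
    intro X
    change _ = dag (𝟙 _) ≫ K.map (H.map (StarFunctor.app α X)) ≫ 𝟙 _
    rw [dag_id, Category.comp_id, Category.id_comp]
    rfl
  whisker_assoc {C D E E'} F G H α K := by
    apply StarFunctor.hom_ext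
    intro X
    change _ = 𝟙 _ ≫ K.map (StarFunctor.app α (F.obj X)) ≫ dag (𝟙 _)
    rw [dag_id, Category.comp_id, Category.id_comp]
    rfl
  whisker_exchange {C D E} F G H K α β := by
    apply StarFunctor.hom_ext
    intro X
    exact (StarFunctor.naturality β (StarFunctor.app α X)).symm
  pentagon {C D E E' E''} F G H K := by
    apply StarFunctor.hom_ext
    intro X
    change K.map (𝟙 (H.obj (G.obj (F.obj X)))) ≫ 𝟙 _ ≫ 𝟙 _ = 𝟙 _ ≫ 𝟙 _
    rw [K.map_id, Category.comp_id, Category.id_comp]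
  triangle {C D E} F G := by
    apply StarFunctor.hom_ext
    intro X
    change 𝟙 _ ≫ 𝟙 _ = G.map (𝟙 (F.obj X))
    rw [G.map_id, Category.comp_id]

instance : Bicategory.IsLocallyGroupoid Clin.{u} := fun C D =>
  inferInstanceAs (IsGroupoid (StarFunctor C D))

end Clin

end Clin

section MapSq

variable {T : Type u} [Category.{v} T] [Preadditive T] [Linear ℂ T] [StarCategory T]
  {T' : Type u'} [Category.{w} T'] [Preadditive T'] [Linear ℂ T'] [StarCategory T']

theorem map_mem_sqCone (F : StarFunctor T T') {P : T} {x : P ⟶ P} (hx : x ∈ sqCone P) :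
    F.map x ∈ sqCone (F.obj P) := by
  induction hx using AddSubmonoid.closure_induction with
  | mem x hx =>
    obtain ⟨Q, w, rfl⟩ := hx
    rw [F.map_comp, F.map_dag]
    exact sq_mem _
  | zero => rw [F.map_zero]; exact zero_mem _
  | add x y _ _ hx hy => rw [F.map_add]; exact add_mem hx hy

theorem StarFunctor.map_sub (F : StarFunctor T T') {P Q : T} (s t : P ⟶ Q) :
    F.map (s - t) = F.map s - F.map t := by
  rw [eq_sub_iff_add_eq, ← F.map_add, sub_add_cancel]

theorem SqBound.map (F : StarFunctor T T') {P Q : T} {t : P ⟶ Q} {r : ℝ} (h : SqBound t r) :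
    SqBound (F.map t) r := by
  have h' := map_mem_sqCone F h
  rw [F.map_sub, F.map_smul, F.map_id, F.map_comp, F.map_dag] at h'
  exact h'

theorem sqNorm_map_le [SqBounded T] [SqBounded T'] (F : StarFunctor T T') {P Q : T} (t : P ⟶ Q) :
    sqNorm (F.map t) ≤ sqNorm t := by
  refine le_of_forall_pos_lt_add fun ε hε => ?_
  have h : SqBound t (sqNorm t + ε / 2) := SqBound.of_lt (by linarith)
  have := sqNorm_le (add_pos_of_nonneg_of_pos (sqNorm_nonneg t) (half_pos hε)) (h.map F)
  linarith

end MapSq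

namespace AlgTensor

variable {A : Type u} [Category.{v} A] [Preadditive A] [Linear ℂ A] [StarCategory A]
  {B : Type u'} [Category.{w} B] [Preadditive B] [Linear ℂ B] [StarCategory B]
  {A' : Type*} [Category* A'] [Preadditive A'] [Linear ℂ A'] [StarCategory A']
  {B' : Type*} [Category* B'] [Preadditive B'] [Linear ℂ B'] [StarCategory B']

/-- The action of a `*`-functor on a hom-space, as a linear map. -/
def mapLin {C : Type*} [Category* C] [Preadditive C] [Linear ℂ C] [StarCategory C]
    {D : Type*} [Category* D] [Preadditive D] [Linear ℂ D] [StarCategory D]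
    (F : StarFunctor C D) (X Y : C) : (X ⟶ Y) →ₗ[ℂ] (F.obj X ⟶ F.obj Y) where
  toFun f := F.map f
  map_add' := F.map_add
  map_smul' := F.map_smul

/-- The action of a pair of `*`-functors on a hom-space of the algebraic tensor product:
`f ⊗ g` is sent to `F f ⊗ G g`. -/
def mapT (F : StarFunctor A A') (G : StarFunctor B B') (P Q : AlgTensor A B) :
    (P ⟶ Q) →ₗ[ℂ] ((⟨F.obj P.fst, G.obj P.snd⟩ : AlgTensor A' B') ⟶
      ⟨F.obj Q.fst, G.obj Q.snd⟩) :=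
  TensorProduct.map (mapLin F P.fst Q.fst) (mapLin G P.snd Q.snd)

theorem mapT_tmul (F : StarFunctor A A') (G : StarFunctor B B') {P Q : AlgTensor A B}
    (f : P.fst ⟶ Q.fst) (g : P.snd ⟶ Q.snd) :
    mapT F G P Q (tmul f g) = tmul (F.map f) (G.map g) := rfl

/-- The `*`-functor `F ⊗ G` between algebraic tensor products. -/
def map (F : StarFunctor A A') (G : StarFunctor B B') :
    StarFunctor (AlgTensor A B) (AlgTensor A' B') where
  obj P := ⟨F.obj P.fst, G.obj P.snd⟩
  map {P Q} t := mapT F G P Q t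
  map_id P := by
    rw [id_eq, mapT_tmul, F.map_id, G.map_id]
    rfl
  map_comp {P Q R} s t := by
    induction s using hom_ind with
    | zero => simp
    | add s s' hs hs' => rw [Preadditive.add_comp, _root_.map_add, _root_.map_add, hs, hs', Preadditive.add_comp]
    | tmul f g =>
      induction t using hom_ind with
      | zero => simp
      | add s s' hs hs' => rw [Preadditive.comp_add, _root_.map_add, _root_.map_add, hs, hs', Preadditive.comp_add]
      | tmul f' g' =>
        rw [tmul_comp, mapT_tmul, mapT_tmul, mapT_tmul, F.map_comp, G.map_comp, tmul_comp]
  map_add s t := _root_.map_add _ s t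
  map_smul c t := _root_.map_smul _ c t
  map_dag {P Q} t := by
    induction t using hom_ind with
    | zero => simp
    | add s s' hs hs' => simp only [dag_add, _root_.map_add, hs, hs']
    | tmul f g => rw [dag_tmul, mapT_tmul, mapT_tmul, F.map_dag, G.map_dag, dag_tmul]

theorem map_tmul (F : StarFunctor A A') (G : StarFunctor B B') {P Q : AlgTensor A B}
    (f : P.fst ⟶ Q.fst) (g : P.snd ⟶ Q.snd) :
    (map F G).map (tmul f g : P ⟶ Q) = tmul (F.map f) (G.map g) := rfl

/-- The unitary natural isomorphism `η ⊗ θ` between `*`-functors of algebraic tensor products. -/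
def map₂ {F F' : StarFunctor A A'} {G G' : StarFunctor B B'} (η : F ⟶ F') (θ : G ⟶ G') :
    map F G ⟶ map F' G' :=
  (⟨fun P => tmul (StarFunctor.app η P.fst) (StarFunctor.app θ P.snd), fun {P Q} t => by
    induction t using hom_ind with
    | zero => rw [StarFunctor.map_zero, StarFunctor.map_zero, Limits.zero_comp, Limits.comp_zero]
    | add s t hs ht =>
      rw [StarFunctor.map_add, StarFunctor.map_add, Preadditive.add_comp, Preadditive.comp_add,
        hs, ht]
    | tmul f g =>
      rw [map_tmul, map_tmul]
      exact congrArg₂ tmul (StarFunctor.naturality η f) (StarFunctor.naturality θ g),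
    fun P => ⟨congrArg₂ tmul (StarFunctor.unitary η P.fst).1 (StarFunctor.unitary θ P.snd).1,
      congrArg₂ tmul (StarFunctor.unitary η P.fst).2 (StarFunctor.unitary θ P.snd).2⟩⟩ :
    UnitaryTrans (map F G) (map F' G'))

end AlgTensor

namespace CStarCompletion

variable {T : Type u} [Category.{v} T] [Preadditive T] [Linear ℂ T] [StarCategory T]
  {T' : Type u'} [Category.{w} T'] [Preadditive T'] [Linear ℂ T'] [StarCategory T']
  {N : CStarSeminorm T} {N' : CStarSeminorm T'}

/-- A contractive `*`-functor, as a continuous linear map on the uncompleted hom-spaces. -/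
def preMapL (F : StarFunctor T T') (hF : ∀ {X Y : T} (t : X ⟶ Y), N'.nrm (F.map t) ≤ N.nrm t)
    (X Y : T) : N.Hom X Y →L[ℂ] N'.CHom (F.obj X) (F.obj Y) :=
  LinearMap.mkContinuous
    { toFun := fun t => CStarSeminorm.coe (N := N') (F.map (show X ⟶ Y from t))
      map_add' := fun s t => by
        rw [← N'.coe_add, ← F.map_add]; rfl
      map_smul' := fun c t => by
        rw [RingHom.id_apply, ← N'.coe_smul, ← F.map_smul]; rfl } 1
    (fun t => by
      rw [one_mul]
      change ‖CStarSeminorm.coe (N := N') (F.map (show X ⟶ Y from t))‖ ≤ _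
      rw [N'.norm_coe]
      exact hF _)

/-- The continuous extension of a contractive `*`-functor to the completed hom-spaces. -/
def mapL (F : StarFunctor T T') (hF : ∀ {X Y : T} (t : X ⟶ Y), N'.nrm (F.map t) ≤ N.nrm t)
    (X Y : CStarCompletion N) : (X ⟶ Y) →L[ℂ]
      ((⟨F.obj X.as⟩ : CStarCompletion N') ⟶ ⟨F.obj Y.as⟩) :=
  CStarSeminorm.ext N (preMapL F hF X.as Y.as)

theorem mapL_ofHom (F : StarFunctor T T')
    (hF : ∀ {X Y : T} (t : X ⟶ Y), N'.nrm (F.map t) ≤ N.nrm t) {X Y : T} (t : X ⟶ Y) :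
    mapL F hF ⟨X⟩ ⟨Y⟩ (ofHom t) = ofHom (F.map t) :=
  CStarSeminorm.ext_coe N (preMapL F hF X Y) t

theorem continuous_mapL (F : StarFunctor T T')
    (hF : ∀ {X Y : T} (t : X ⟶ Y), N'.nrm (F.map t) ≤ N.nrm t) {α : Type*} [TopologicalSpace α]
    {X Y : CStarCompletion N} {f : α → (X ⟶ Y)} (hf : Continuous f) :
    Continuous fun a => mapL F hF X Y (f a) := (mapL F hF X Y).continuous.comp hf

attribute [local fun_prop] continuous_mapL

/-- The extension of a contractive `*`-functor to the completions. -/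
def map (F : StarFunctor T T') (hF : ∀ {X Y : T} (t : X ⟶ Y), N'.nrm (F.map t) ≤ N.nrm t) :
    StarFunctor (CStarCompletion N) (CStarCompletion N') where
  obj X := ⟨F.obj X.as⟩
  map {X Y} f := mapL F hF X Y f
  map_id X := by
    have h := mapL_ofHom F hF (𝟙 X.as)
    rw [F.map_id] at h
    exact h
  map_comp {X Y Z} f g := by
    refine hom_ind (p := fun f => mapL F hF X Z (f ≫ g) = mapL F hF X Y f ≫ mapL F hF Y Z g) f
      (isClosed_eq (by fun_prop) (by fun_prop)) fun f => ?_
    refine hom_ind (p := fun g => mapL F hF X Z (ofHom f ≫ g) =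
      mapL F hF X Y (ofHom f) ≫ mapL F hF Y Z g) g
      (isClosed_eq (by fun_prop) (by fun_prop)) fun g => ?_
    have h := mapL_ofHom (N := N) (N' := N') F hF (f ≫ g)
    rw [F.map_comp, ofHom_comp, ofHom_comp] at h
    refine h.trans ?_
    rw [← mapL_ofHom F hF, ← mapL_ofHom F hF]
  map_add f g := (mapL F hF _ _).map_add f g
  map_smul c f := (mapL F hF _ _).map_smul c f
  map_dag {X Y} f := by
    refine hom_ind (p := fun f => mapL F hF Y X (dag f) = dag (mapL F hF X Y f)) f
      (isClosed_eq (by fun_prop) (by fun_prop)) fun f => ?_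
    have h := mapL_ofHom (N := N) (N' := N') F hF (dag f)
    rw [F.map_dag, ofHom_dag, ofHom_dag] at h
    refine h.trans ?_
    rw [← mapL_ofHom F hF]

theorem map_ofHom (F : StarFunctor T T')
    (hF : ∀ {X Y : T} (t : X ⟶ Y), N'.nrm (F.map t) ≤ N.nrm t) {X Y : T} (t : X ⟶ Y) :
    (map (N := N) (N' := N') F hF).map (ofHom t) = ofHom (F.map t) :=
  mapL_ofHom F hF t

theorem isUnitary_ofHom {X Y : T} {f : X ⟶ Y} (hf : IsUnitary f) :
    IsUnitary (ofHom f : (⟨X⟩ : CStarCompletion N) ⟶ ⟨Y⟩) := by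
  constructor
  · rw [← ofHom_dag, ← ofHom_comp, hf.1]
    rfl
  · rw [← ofHom_dag, ← ofHom_comp, hf.2]
    rfl

/-- The extension of a unitary natural isomorphism to the completions. -/
def map₂ {F G : StarFunctor T T'}
    {hF : ∀ {X Y : T} (t : X ⟶ Y), N'.nrm (F.map t) ≤ N.nrm t}
    {hG : ∀ {X Y : T} (t : X ⟶ Y), N'.nrm (G.map t) ≤ N.nrm t} (η : F ⟶ G) :
    map (N := N) (N' := N') F hF ⟶ map G hG :=
  (⟨fun X => ofHom (StarFunctor.app η X.as), fun {X Y} f => by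
    refine hom_ind (p := fun f => mapL (N := N) (N' := N') F hF X Y f ≫
      ofHom (StarFunctor.app η Y.as) = ofHom (StarFunctor.app η X.as) ≫ mapL G hG X Y f) f
      (isClosed_eq (by fun_prop) (by fun_prop)) fun f => ?_
    refine (congrArg (fun t => t ≫ _) (mapL_ofHom F hF f)).trans ?_
    refine Eq.trans ?_ (congrArg (fun t => _ ≫ t) (mapL_ofHom G hG f)).symm
    rw [← ofHom_comp, ← ofHom_comp, StarFunctor.naturality],
    fun X => isUnitary_ofHom (StarFunctor.unitary η X.as)⟩ :
    UnitaryTrans (map (N := N) (N' := N') F hF) (map G hG))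

end CStarCompletion

namespace Karoubi

variable {C : Type u} [Category.{v} C] [CStarCategoryCore C]
  {D : Type u'} [Category.{w} D] [CStarCategoryCore D]

/-- The `*`-functor between Karoubi completions induced by a `*`-functor. -/
def map (F : StarFunctor C D) : StarFunctor (Karoubi C) (Karoubi D) where
  obj P := ⟨F.obj P.X, F.map P.p, by rw [← F.map_comp, P.idem], by rw [← F.map_dag, P.sa]⟩
  map {P Q} f := mkHom (F.map (val f)) ((F.map_comp _ _).symm.trans (congrArg _ (p_val f)))
    ((F.map_comp _ _).symm.trans (congrArg _ (val_p f)))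
  map_id P := rfl
  map_comp f g := hom_ext (F.map_comp _ _)
  map_add f g := hom_ext (F.map_add _ _)
  map_smul c f := hom_ext (F.map_smul _ _)
  map_dag f := hom_ext (F.map_dag _)

@[simp] theorem val_map (F : StarFunctor C D) {P Q : Karoubi C} (f : P ⟶ Q) :
    val ((map F).map f) = F.map (val f) := rfl

/-- The unitary natural isomorphism between Karoubi completions induced by a unitary natural
isomorphism. -/
def map₂ {F G : StarFunctor C D} (η : F ⟶ G) : map F ⟶ map G :=
  (⟨fun P => mkHom (P := (map F).obj P) (Q := (map G).obj P) (F.map P.p ≫ StarFunctor.app η P.X)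
      (by
        change F.map P.p ≫ F.map P.p ≫ StarFunctor.app η P.X = F.map P.p ≫ StarFunctor.app η P.X
        rw [← Category.assoc, ← F.map_comp, P.idem])
      (by
        change (F.map P.p ≫ StarFunctor.app η P.X) ≫ G.map P.p = F.map P.p ≫ StarFunctor.app η P.X
        rw [Category.assoc, ← StarFunctor.naturality, ← Category.assoc, ← F.map_comp, P.idem]),
    fun {P Q} f => by
      apply hom_ext
      change F.map (val f) ≫ F.map Q.p ≫ StarFunctor.app η Q.X =
        (F.map P.p ≫ StarFunctor.app η P.X) ≫ G.map (val f)
      rw [Category.assoc, ← StarFunctor.naturality, ← Category.assoc, ← Category.assoc,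
        ← F.map_comp, ← F.map_comp, p_val, val_p],
    fun P => by
      constructor
      · apply hom_ext
        change (F.map P.p ≫ StarFunctor.app η P.X) ≫ dag (F.map P.p ≫ StarFunctor.app η P.X) =
          F.map P.p
        rw [dag_comp, ← F.map_dag, P.sa, Category.assoc, ← Category.assoc (StarFunctor.app η P.X),
          (StarFunctor.unitary η P.X).1, Category.id_comp, ← F.map_comp, P.idem]
      · apply hom_ext
        change dag (F.map P.p ≫ StarFunctor.app η P.X) ≫ (F.map P.p ≫ StarFunctor.app η P.X) =
          G.map P.p
        rw [StarFunctor.naturality, dag_comp, ← G.map_dag, P.sa, Category.assoc,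
          ← Category.assoc _ _ (G.map P.p),
          (StarFunctor.unitary η P.X).2, Category.id_comp, ← G.map_comp, P.idem]⟩ :
    UnitaryTrans (map F) (map G))

@[simp] theorem val_map₂_app {F G : StarFunctor C D} (η : F ⟶ G) (P : Karoubi C) :
    val (StarFunctor.app (map₂ η) P) = F.map P.p ≫ StarFunctor.app η P.X := rfl

end Karoubi

section MaxTensorFunctor

variable {A : Type u} [Category.{v} A] [CStarCategory A] [HasDirectSums A]
  {B : Type u'} [Category.{v} B] [CStarCategory B] [HasDirectSums B]
  {A' : Type*} [Category.{w} A'] [CStarCategory A'] [HasDirectSums A']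
  {B' : Type*} [Category.{w} B'] [CStarCategory B'] [HasDirectSums B']

theorem maxTensorNorm_map_le (F : StarFunctor A A') (G : StarFunctor B B') {P Q : AlgTensor A B}
    (t : P ⟶ Q) : maxTensorNorm ((AlgTensor.map F G).map t) ≤ maxTensorNorm t := by
  rw [maxTensorNorm_eq_sqNorm, maxTensorNorm_eq_sqNorm]
  exact sqNorm_map_le _ t

/-- The `*`-functor `F ⊠ G`, before Karoubi completion. -/
def preMaxMap (F : StarFunctor A A') (G : StarFunctor B B') :
    StarFunctor (PreMaxTensor A B) (PreMaxTensor A' B') :=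
  CStarCompletion.map (AlgTensor.map F G) (maxTensorNorm_map_le F G)

theorem continuous_preMaxMap (F : StarFunctor A A') (G : StarFunctor B B')
    (P Q : PreMaxTensor A B) : Continuous fun t : P ⟶ Q => (preMaxMap F G).map t :=
  CStarCompletion.continuous_mapL (AlgTensor.map F G) (maxTensorNorm_map_le F G) continuous_id

/-- The unitary natural isomorphism `η ⊠ θ`, before Karoubi completion. -/
def preMaxMap₂ {F F' : StarFunctor A A'} {G G' : StarFunctor B B'} (η : F ⟶ F') (θ : G ⟶ G') :
    preMaxMap F G ⟶ preMaxMap F' G' :=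
  CStarCompletion.map₂ (AlgTensor.map₂ η θ)

theorem preMaxMap₂_app {F F' : StarFunctor A A'} {G G' : StarFunctor B B'} (η : F ⟶ F')
    (θ : G ⟶ G') (P : PreMaxTensor A B) : StarFunctor.app (preMaxMap₂ η θ) P =
      CStarCompletion.ofHom (AlgTensor.tmul (P := (AlgTensor.map F G).obj P.as)
        (Q := (AlgTensor.map F' G').obj P.as) (StarFunctor.app η P.as.fst)
        (StarFunctor.app θ P.as.snd)) := rfl

theorem preMaxMap_id {P Q : PreMaxTensor A B} (t : P ⟶ Q) :
    (preMaxMap (StarFunctor.id A) (StarFunctor.id B)).map t = t := by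
  refine CStarCompletion.hom_ind (p := fun t => (preMaxMap (StarFunctor.id A)
    (StarFunctor.id B)).map t = t) t
    (isClosed_eq (continuous_preMaxMap _ _ _ _) continuous_id) fun t => ?_
  refine (CStarCompletion.map_ofHom _ _ t).trans ?_
  induction t using AlgTensor.hom_ind with
  | zero => rw [StarFunctor.map_zero]; rfl
  | add s t hs ht =>
    rw [StarFunctor.map_add]
    exact (CStarCompletion.ofHom_add _ _).trans
      ((congrArg₂ (· + ·) hs ht).trans (CStarCompletion.ofHom_add _ _).symm)
  | tmul f g => rfl

theorem preMaxMap_comp {A'' : Type*} [Category.{w} A''] [CStarCategory A''] [HasDirectSums A'']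
    {B'' : Type*} [Category.{w} B''] [CStarCategory B''] [HasDirectSums B'']
    (F : StarFunctor A A') (G : StarFunctor B B') (F' : StarFunctor A' A'')
    (G' : StarFunctor B' B'') {P Q : PreMaxTensor A B} (t : P ⟶ Q) :
    (preMaxMap (F.comp F') (G.comp G')).map t = (preMaxMap F' G').map ((preMaxMap F G).map t) := by
  refine CStarCompletion.hom_ind (p := fun t => (preMaxMap (F.comp F') (G.comp G')).map t =
    (preMaxMap F' G').map ((preMaxMap F G).map t)) t
    (isClosed_eq (continuous_preMaxMap _ _ _ _)
      ((continuous_preMaxMap _ _ _ _).comp (continuous_preMaxMap _ _ _ _))) fun t => ?_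
  refine (CStarCompletion.map_ofHom _ _ t).trans ?_
  refine Eq.trans ?_ (congrArg (fun t => (preMaxMap F' G').map t)
    (CStarCompletion.map_ofHom (AlgTensor.map F G) (maxTensorNorm_map_le F G) t)).symm
  refine Eq.trans ?_ (CStarCompletion.map_ofHom (AlgTensor.map F' G')
    (maxTensorNorm_map_le F' G') ((AlgTensor.map F G).map t)).symm
  congr 1
  induction t using AlgTensor.hom_ind with
  | zero => simp only [StarFunctor.map_zero]; rfl
  | add s t hs ht => simp only [StarFunctor.map_add]; exact congrArg₂ (· + ·) hs ht
  | tmul f g => rfl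

/-- The `*`-functor `F ⊠ G` between maximal tensor products. -/
def maxMap (F : StarFunctor A A') (G : StarFunctor B B') :
    StarFunctor (MaxTensor A B) (MaxTensor A' B') :=
  Karoubi.map (preMaxMap F G)

/-- The unitary natural isomorphism `η ⊠ θ` between `*`-functors of maximal tensor products. -/
def maxMap₂ {F F' : StarFunctor A A'} {G G' : StarFunctor B B'} (η : F ⟶ F') (θ : G ⟶ G') :
    maxMap F G ⟶ maxMap F' G' :=
  Karoubi.map₂ (preMaxMap₂ η θ)

end MaxTensorFunctor

section MaxTensorPseudofunctor

open Bicategory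

namespace Clin

/-- The maximal tensor product of two objects of `Clin`. -/
def tensorObj (A B : Clin.{u}) : Clin.{u} := ⟨MaxTensor A B⟩

/-- The comparison of `F ⊠ G` followed by `F' ⊠ G'` with `(F' ∘ F) ⊠ (G' ∘ G)`, before Karoubi
completion: its components are identities. -/
def preMaxComp {A A' A'' B B' B'' : Clin.{u}} (F : StarFunctor A A') (G : StarFunctor B B')
    (F' : StarFunctor A' A'') (G' : StarFunctor B' B'') :
    preMaxMap (F.comp F') (G.comp G') ≅ (preMaxMap F G).comp (preMaxMap F' G') :=
  StarFunctor.mkIso (fun _ => 𝟙 _)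
    (fun f => ((Category.comp_id _).trans (preMaxMap_comp F G F' G' f)).trans
      (Category.id_comp _).symm) (fun _ => IsUnitary.id _)

/-- The comparison of the identity with the tensor product of identities, before Karoubi
completion: its components are identities. -/
def preMaxId (A B : Clin.{u}) :
    preMaxMap (StarFunctor.id A) (StarFunctor.id B) ≅ StarFunctor.id (PreMaxTensor A B) :=
  StarFunctor.mkIso (fun _ => 𝟙 _)
    (fun f => ((Category.comp_id _).trans (preMaxMap_id f)).trans
      (Category.id_comp _).symm) (fun _ => IsUnitary.id _)

end Clin

namespace Karoubi

variable {C : Type u} [Category.{v} C] [CStarCategoryCore C]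
  {D : Type u'} [Category.{w} D] [CStarCategoryCore D]

theorem map₂_id (F : StarFunctor C D) : map₂ (𝟙 F) = 𝟙 (map F) := by
  apply StarFunctor.hom_ext
  intro P
  apply hom_ext
  exact Category.comp_id _

theorem map₂_comp {F G H : StarFunctor C D} (η : F ⟶ G) (θ : G ⟶ H) :
    map₂ (η ≫ θ) = map₂ η ≫ map₂ θ := by
  apply StarFunctor.hom_ext
  intro P
  apply hom_ext
  change F.map P.p ≫ StarFunctor.app η P.X ≫ StarFunctor.app θ P.X =
    (F.map P.p ≫ StarFunctor.app η P.X) ≫ G.map P.p ≫ StarFunctor.app θ P.X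
  rw [Category.assoc, ← Category.assoc _ (G.map P.p), ← StarFunctor.naturality, Category.assoc,
    ← Category.assoc _ (F.map P.p), ← F.map_comp, P.idem]

/-- The isomorphism between Karoubi completions induced by an isomorphism of `*`-functors. -/
def mapIso {F G : StarFunctor C D} (η : F ≅ G) : map F ≅ map G where
  hom := map₂ η.hom
  inv := map₂ η.inv
  hom_inv_id := by rw [← map₂_comp, η.hom_inv_id, map₂_id]
  inv_hom_id := by rw [← map₂_comp, η.inv_hom_id, map₂_id]

theorem map₂_whiskerRight {E : Type*} [Category* E] [CStarCategoryCore E] {F G : StarFunctor C D}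
    (η : F ⟶ G) (H : StarFunctor D E) :
    map₂ (StarFunctor.whiskerRight η H) = StarFunctor.whiskerRight (map₂ η) (map H) := by
  apply StarFunctor.hom_ext
  intro P
  apply hom_ext
  exact (H.map_comp _ _).symm

end Karoubi

namespace Clin

section

variable {A A' A'' B B' B'' : Clin.{u}}

theorem idem_aux₅ {C : Type*} [Category* C] [Preadditive C] [Linear ℂ C] [StarCategory C] {X : C}
    (q a b c d : X ⟶ X) (hq : q ≫ q = q) (ha : a = q) (hb : b = q) (hc : c = q) (hd : d = q) :
    q ≫ 𝟙 X = (q ≫ 𝟙 X) ≫ a ≫ b ≫ (c ≫ dag (𝟙 X)) ≫ (d ≫ dag (𝟙 X)) := by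
  subst ha hb hc hd
  simp [hq]

theorem idem_aux₃ {C : Type*} [Category* C] [Preadditive C] [Linear ℂ C] [StarCategory C] {X : C}
    (q a b : X ⟶ X) (hq : q ≫ q = q) (ha : a = q) (hb : b = q) :
    q ≫ 𝟙 X = (q ≫ 𝟙 X) ≫ a ≫ b := by
  subst ha hb
  simp [hq]

theorem preMax_id (F : StarFunctor A A') (G : StarFunctor B B') :
    preMaxMap₂ (𝟙 F) (𝟙 G) = 𝟙 (preMaxMap F G) := by
  apply StarFunctor.hom_ext
  intro X
  rfl

theorem preMax_comp {F F' F'' : StarFunctor A A'} {G G' G'' : StarFunctor B B'} (η : F ⟶ F')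
    (η' : F' ⟶ F'') (θ : G ⟶ G') (θ' : G' ⟶ G'') :
    preMaxMap₂ (η ≫ η') (θ ≫ θ') = preMaxMap₂ η θ ≫ preMaxMap₂ η' θ' := by
  apply StarFunctor.hom_ext
  intro X
  exact CStarCompletion.ofHom_comp (N := maxSeminorm A' B')
    (StarFunctor.app (AlgTensor.map₂ η θ) X.as) (StarFunctor.app (AlgTensor.map₂ η' θ') X.as)

theorem preMax_whiskerLeft (F : StarFunctor A A') (G : StarFunctor B B')
    {H H' : StarFunctor A' A''} {K K' : StarFunctor B' B''} (η : H ⟶ H') (θ : K ⟶ K') :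
    preMaxMap₂ (StarFunctor.whiskerLeft F η) (StarFunctor.whiskerLeft G θ) =
      (preMaxComp F G H K).hom ≫
        StarFunctor.whiskerLeft (preMaxMap F G) (preMaxMap₂ η θ) ≫ (preMaxComp F G H' K').inv := by
  apply StarFunctor.hom_ext
  intro P
  symm
  refine (Category.id_comp _).trans ((congrArg (fun t => _ ≫ t) (dag_id _)).trans ?_)
  exact Category.comp_id _

theorem preMax_whiskerRight {F F' : StarFunctor A A'} {G G' : StarFunctor B B'} (η : F ⟶ F')
    (θ : G ⟶ G') (H : StarFunctor A' A'') (K : StarFunctor B' B'') :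
    preMaxMap₂ (StarFunctor.whiskerRight η H) (StarFunctor.whiskerRight θ K) =
      (preMaxComp F G H K).hom ≫
        StarFunctor.whiskerRight (preMaxMap₂ η θ) (preMaxMap H K) ≫
          (preMaxComp F' G' H K).inv := by
  apply StarFunctor.hom_ext
  intro P
  symm
  refine (Category.id_comp _).trans ((congrArg (fun t => _ ≫ t) (dag_id _)).trans ?_)
  refine (Category.comp_id _).trans ?_
  exact CStarCompletion.map_ofHom _ (maxTensorNorm_map_le H K) _

end

/-- The maximal tensor product, as a pseudofunctor of two variables. -/
def maxTensor : (Clin.{u} × Clin.{u}) ⥤ᵖ Clin.{u} where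
  obj P := tensorObj P.1 P.2
  map F := (maxMap F.1 F.2 : StarFunctor (MaxTensor _ _) (MaxTensor _ _))
  map₂ η := (maxMap₂ η.1 η.2 : _ ⟶ _)
  mapId P := (Karoubi.mapIso (preMaxId P.1 P.2) : _ ≅ _)
  mapComp F G := (Karoubi.mapIso (preMaxComp F.1 F.2 G.1 G.2) : _ ≅ _)
  map₂_id {P Q} F := by
    exact (congrArg Karoubi.map₂ (preMax_id F.1 F.2)).trans (Karoubi.map₂_id (preMaxMap F.1 F.2))
  map₂_comp {P Q F G H} η θ := by
    exact (congrArg Karoubi.map₂ (preMax_comp η.1 θ.1 η.2 θ.2)).trans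
      (Karoubi.map₂_comp (preMaxMap₂ η.1 η.2) (preMaxMap₂ θ.1 θ.2))
  map₂_whisker_left F G H η := by
    refine (congrArg Karoubi.map₂ (preMax_whiskerLeft F.1 F.2 η.1 η.2)).trans ?_
    rw [Karoubi.map₂_comp, Karoubi.map₂_comp]
    rfl
  map₂_whisker_right {_ _ _ F G} η H := by
    refine (congrArg Karoubi.map₂ (preMax_whiskerRight η.1 η.2 H.1 H.2)).trans ?_
    rw [Karoubi.map₂_comp, Karoubi.map₂_comp, Karoubi.map₂_whiskerRight]
    rfl
  map₂_associator {P Q R S} F G H := by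
    apply StarFunctor.hom_ext
    intro X
    apply Karoubi.hom_ext
    have h1 := preMaxMap_comp (F.1.comp G.1) (F.2.comp G.2) H.1 H.2 X.p
    have h2 := preMaxMap_comp F.1 F.2 G.1 G.2 X.p
    have h3 := preMaxMap_comp G.1 G.2 H.1 H.2 ((preMaxMap F.1 F.2).map X.p)
    have h5 := h1.trans (congrArg (fun t => (preMaxMap H.1 H.2).map t) h2)
    refine idem_aux₅ _ _ _ _ _ ?_ ?_ ?_ ?_ ?_
    · exact (Functor.map_comp (StarFunctor.toFunctor _) _ _).symm.trans (congrArg _ X.idem)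
    · refine Eq.trans ?_ h1.symm
      exact congrArg _ (Category.comp_id _)
    · exact h5.symm
    · exact h5.symm
    · exact h3.trans h5.symm
  map₂_left_unitor {P Q} F := by
    apply StarFunctor.hom_ext
    intro X
    apply Karoubi.hom_ext
    have h1 := preMaxMap_comp (StarFunctor.id P.1) (StarFunctor.id P.2) F.1 F.2 X.p
    refine idem_aux₃ _ _ _ ?_ ?_ ?_
    · exact (Functor.map_comp (StarFunctor.toFunctor _) _ _).symm.trans (congrArg _ X.idem)
    · refine Eq.trans ?_ h1.symm
      exact congrArg _ (Category.comp_id _)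
    · rfl
  map₂_right_unitor {P Q} F := by
    apply StarFunctor.hom_ext
    intro X
    apply Karoubi.hom_ext
    have h1 := preMaxMap_comp F.1 F.2 (StarFunctor.id Q.1) (StarFunctor.id Q.2) X.p
    refine idem_aux₃ _ _ _ ?_ ?_ ?_
    · exact (Functor.map_comp (StarFunctor.toFunctor _) _ _).symm.trans (congrArg _ X.idem)
    · exact (Category.comp_id _).trans h1.symm
    · rfl

end Clin

end MaxTensorPseudofunctor

section MonoidalBicategories

open Bicategory

universe w₁ v₁ u₁ w₂ v₂ u₂

/-- A 1-morphism of a bicategory is an equivalence if it has an inverse up to isomorphism. -/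
def IsEquivalence₁ {B : Type u} [Bicategory.{w, v} B] {a b : B} (f : a ⟶ b) : Prop :=
  ∃ g : b ⟶ a, Nonempty (f ≫ g ≅ 𝟙 a) ∧ Nonempty (g ≫ f ≅ 𝟙 b)

/-- The pseudofunctor to a product bicategory with given components. -/
def pair {B : Type u} [Bicategory.{w, v} B] {C : Type u₁} [Bicategory.{w₁, v₁} C]
    {D : Type u₂} [Bicategory.{w₂, v₂} D] (F : B ⥤ᵖ C) (G : B ⥤ᵖ D) : B ⥤ᵖ C × D where
  obj a := (F.obj a, G.obj a)
  map f := (F.map f, G.map f)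
  map₂ η := (F.map₂ η, G.map₂ η)
  map₂_id f := Prod.ext (F.map₂_id f) (G.map₂_id f)
  map₂_comp η θ := Prod.ext (F.map₂_comp η θ) (G.map₂_comp η θ)
  mapId a := Iso.prod (F.mapId a) (G.mapId a)
  mapComp f g := Iso.prod (F.mapComp f g) (G.mapComp f g)
  map₂_whisker_left f _ _ η := Prod.ext (F.map₂_whisker_left f η) (G.map₂_whisker_left f η)
  map₂_whisker_right η h := Prod.ext (F.map₂_whisker_right η h) (G.map₂_whisker_right η h)
  map₂_associator f g h := Prod.ext (F.map₂_associator f g h) (G.map₂_associator f g h)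
  map₂_left_unitor f := Prod.ext (F.map₂_left_unitor f) (G.map₂_left_unitor f)
  map₂_right_unitor f := Prod.ext (F.map₂_right_unitor f) (G.map₂_right_unitor f)

variable {B : Type u} [Bicategory.{w, v} B]

/-- The first projection, as a pseudofunctor. -/
def proj₁ (C D : Type u) [Bicategory.{w, v} C] [Bicategory.{w, v} D] : (C × D) ⥤ᵖ C where
  obj a := a.1
  map f := f.1
  map₂ η := η.1
  mapId a := Iso.refl _
  mapComp f g := Iso.refl _

/-- The second projection, as a pseudofunctor. -/
def proj₂ (C D : Type u) [Bicategory.{w, v} C] [Bicategory.{w, v} D] : (C × D) ⥤ᵖ D where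
  obj a := a.2
  map f := f.2
  map₂ η := η.2
  mapId a := Iso.refl _
  mapComp f g := Iso.refl _

section Tensor

variable (T : (B × B) ⥤ᵖ B)

/-- The pseudofunctor `(a, b, c) ↦ (a ⊗ b) ⊗ c`. -/
def tripleLeft : (B × (B × B)) ⥤ᵖ B :=
  (pair ((pair (proj₁ B (B × B)) ((proj₂ B (B × B)).comp (proj₁ B B))).comp T)
    ((proj₂ B (B × B)).comp (proj₂ B B))).comp T

/-- The pseudofunctor `(a, b, c) ↦ a ⊗ (b ⊗ c)`. -/
def tripleRight : (B × (B × B)) ⥤ᵖ B :=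
  (pair (proj₁ B (B × B)) ((proj₂ B (B × B)).comp T)).comp T

/-- The pseudofunctor `a ⊗ -`. -/
def tensorLeft (a : B) : B ⥤ᵖ B := (Prod.sectR a B).toPseudofunctor.comp T

/-- The pseudofunctor `- ⊗ b`. -/
def tensorRight (b : B) : B ⥤ᵖ B := (Prod.sectL B b).toPseudofunctor.comp T

/-- The tensor product of objects. -/
abbrev tob (a b : B) : B := T.obj (a, b)

/-- The tensor product of 1-morphisms. -/
abbrev tmap {a a' b b' : B} (f : a ⟶ a') (g : b ⟶ b') : tob T a b ⟶ tob T a' b' :=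
  T.map (X := (a, b)) (Y := (a', b')) (f, g)

/-- The tensor product of invertible 2-morphisms. -/
abbrev tmapIso {a a' b b' : B} {f f' : a ⟶ a'} {g g' : b ⟶ b'} (η : f ≅ f') (θ : g ≅ g') :
    tmap T f g ≅ tmap T f' g' :=
  T.map₂Iso (Iso.prod η θ : Iso (C := ((a, b) : B × B) ⟶ (a', b')) (f, g) (f', g'))

/-- Compatibility of the tensor product with composition. -/
abbrev tcomp {a a' a'' b b' b'' : B} (f : a ⟶ a') (g : b ⟶ b') (f' : a' ⟶ a'') (g' : b' ⟶ b'') :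
    tmap T (f ≫ f') (g ≫ g') ≅ tmap T f g ≫ tmap T f' g' :=
  T.mapComp (a := (a, b)) (b := (a', b')) (c := (a'', b'')) (f, g) (f', g')

/-- Compatibility of the tensor product with identities. -/
abbrev tid (a b : B) : tmap T (𝟙 a) (𝟙 b) ≅ 𝟙 (tob T a b) := T.mapId (a, b)

end Tensor

section Squares

/-- The vertical composition of invertible squares. -/
def pasteSq {a b c a' b' c' : B} {p : a ⟶ a'} {q : b ⟶ b'} {r : c ⟶ c'} {f : a ⟶ b}
    {f' : a' ⟶ b'} {g : b ⟶ c} {g' : b' ⟶ c'} (s : p ≫ f' ≅ f ≫ q) (t : q ≫ g' ≅ g ≫ r) :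
    p ≫ f' ≫ g' ≅ (f ≫ g) ≫ r :=
  (α_ _ _ _).symm ≪≫ whiskerRightIso s g' ≪≫ α_ _ _ _ ≪≫ whiskerLeftIso f t ≪≫ (α_ _ _ _).symm

/-- The identity square. -/
def idSq {a a' : B} (p : a ⟶ a') : p ≫ 𝟙 a' ≅ 𝟙 a ≫ p := ρ_ p ≪≫ (λ_ p).symm

/-- The tensor product of invertible squares. -/
def tensorSq (T : (B × B) ⥤ᵖ B) {a b a' b' : B} {p : a ⟶ a'} {q : b ⟶ b'} {f : a ⟶ b}
    {f' : a' ⟶ b'} {c d c' d' : B} {r : c ⟶ c'} {s : d ⟶ d'} {g : c ⟶ d} {g' : c' ⟶ d'}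
    (σ : p ≫ f' ≅ f ≫ q) (τ : r ≫ g' ≅ g ≫ s) :
    tmap T p r ≫ tmap T f' g' ≅ tmap T f g ≫ tmap T q s :=
  (tcomp T _ _ _ _).symm ≪≫ tmapIso T σ τ ≪≫ tcomp T _ _ _ _

/-- The modification condition: the invertible 2-morphisms `m : f ≅ g` and `m' : f' ≅ g'` are
compatible with the naturality squares of `f` and `g` over the same 1-morphisms. -/
def SqCompat {a b a' b' : B} {p : a ⟶ a'} {q : b ⟶ b'} {f g : a ⟶ b} {f' g' : a' ⟶ b'}
    (m : f ≅ g) (m' : f' ≅ g') (s : p ≫ f' ≅ f ≫ q) (t : p ≫ g' ≅ g ≫ q) : Prop :=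
  p ◁ m'.hom ≫ t.hom = s.hom ≫ m.hom ▷ q

end Squares

/-- A unit object, and pseudonatural associators and unitors, for a tensor product `T` on a
bicategory. -/
structure TensorData (T : (B × B) ⥤ᵖ B) where
  unit : B
  assoc : Pseudofunctor.StrongTrans (tripleLeft T) (tripleRight T)
  leftUnitor : Pseudofunctor.StrongTrans (tensorLeft T unit) (Pseudofunctor.id B)
  rightUnitor : Pseudofunctor.StrongTrans (tensorRight T unit) (Pseudofunctor.id B)

namespace TensorData

variable {T : (B × B) ⥤ᵖ B} (M : TensorData T)

/-- The associator `(a ⊗ b) ⊗ c ⟶ a ⊗ (b ⊗ c)`. -/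
def asc (a b c : B) : tob T (tob T a b) c ⟶ tob T a (tob T b c) := M.assoc.app (a, b, c)

/-- The left unitor `1 ⊗ a ⟶ a`. -/
def lun (a : B) : tob T M.unit a ⟶ a := M.leftUnitor.app a

/-- The right unitor `a ⊗ 1 ⟶ a`. -/
def run (a : B) : tob T a M.unit ⟶ a := M.rightUnitor.app a

/-- The naturality square of the associator. -/
def ascSq {a a' b b' c c' : B} (f : a ⟶ a') (g : b ⟶ b') (h : c ⟶ c') :
    tmap T (tmap T f g) h ≫ M.asc a' b' c' ≅ M.asc a b c ≫ tmap T f (tmap T g h) :=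
  M.assoc.naturality (a := (a, b, c)) (b := (a', b', c')) (f, g, h)

/-- The naturality square of the left unitor. -/
def lunSq {a a' : B} (f : a ⟶ a') :
    tmap T (𝟙 M.unit) f ≫ M.lun a' ≅ M.lun a ≫ f :=
  M.leftUnitor.naturality f

/-- The naturality square of the right unitor. -/
def runSq {a a' : B} (f : a ⟶ a') :
    tmap T f (𝟙 M.unit) ≫ M.run a' ≅ M.run a ≫ f :=
  M.rightUnitor.naturality f

/-- The naturality of the associator in the first variable. -/
def ascSq₁ {a a' : B} (f : a ⟶ a') (b c : B) :
    tmap T (tmap T f (𝟙 b)) (𝟙 c) ≫ M.asc a' b c ≅ M.asc a b c ≫ tmap T f (𝟙 (tob T b c)) :=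
  M.ascSq f (𝟙 b) (𝟙 c) ≪≫ whiskerLeftIso _ (tmapIso T (Iso.refl f) (tid T b c))

/-- The naturality of the associator in the second variable. -/
abbrev ascSq₂ (a : B) {b b' : B} (f : b ⟶ b') (c : B) :
    tmap T (tmap T (𝟙 a) f) (𝟙 c) ≫ M.asc a b' c ≅
      M.asc a b c ≫ tmap T (𝟙 a) (tmap T f (𝟙 c)) :=
  M.ascSq (𝟙 a) f (𝟙 c)

/-- The naturality of the associator in the third variable. -/
def ascSq₃ (a b : B) {c c' : B} (f : c ⟶ c') :
    tmap T (𝟙 (tob T a b)) f ≫ M.asc a b c' ≅ M.asc a b c ≫ tmap T (𝟙 a) (tmap T (𝟙 b) f) :=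
  whiskerRightIso (tmapIso T (tid T a b).symm (Iso.refl f)) _ ≪≫ M.ascSq (𝟙 a) (𝟙 b) f

/-- `a ⊗ -` preserves composition. -/
def leftComp (a : B) {b c d : B} (f : b ⟶ c) (g : c ⟶ d) :
    tmap T (𝟙 a) (f ≫ g) ≅ tmap T (𝟙 a) f ≫ tmap T (𝟙 a) g :=
  (tensorLeft T a).mapComp f g

/-- `- ⊗ a` preserves composition. -/
def rightComp (a : B) {b c d : B} (f : b ⟶ c) (g : c ⟶ d) :
    tmap T (f ≫ g) (𝟙 a) ≅ tmap T f (𝟙 a) ≫ tmap T g (𝟙 a) :=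
  (tensorRight T a).mapComp f g

end TensorData

/-- The invertible 2-morphisms filling the pentagon and the three triangles. -/
structure TensorFillers {T : (B × B) ⥤ᵖ B} (M : TensorData T) where
  pent (a b c d : B) :
    tmap T (M.asc a b c) (𝟙 d) ≫ M.asc a (tob T b c) d ≫ tmap T (𝟙 a) (M.asc b c d) ≅
      M.asc (tob T a b) c d ≫ M.asc a b (tob T c d)
  midTri (a b : B) :
    M.asc a M.unit b ≫ tmap T (𝟙 a) (M.lun b) ≅ tmap T (M.run a) (𝟙 b)
  leftTri (a b : B) :
    tmap T (M.lun a) (𝟙 b) ≅ M.asc M.unit a b ≫ M.lun (tob T a b)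
  rightTri (a b : B) :
    M.run (tob T a b) ≅ M.asc a b M.unit ≫ tmap T (𝟙 a) (M.run b)

namespace TensorFillers

open TensorData

variable {T : (B × B) ⥤ᵖ B} {M : TensorData T} (F : TensorFillers M)

/-- The tensor product `π ⊗ e` with the pentagonator. -/
def pentRight (a b c d e : B) :
    tmap T (tmap T (M.asc a b c) (𝟙 d)) (𝟙 e) ≫ tmap T (M.asc a (tob T b c) d) (𝟙 e) ≫
      tmap T (tmap T (𝟙 a) (M.asc b c d)) (𝟙 e) ≅
    tmap T (M.asc (tob T a b) c d) (𝟙 e) ≫ tmap T (M.asc a b (tob T c d)) (𝟙 e) :=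
  (rightComp e _ _ ≪≫ whiskerLeftIso _ (rightComp e _ _)).symm ≪≫
    tmapIso T (F.pent a b c d) (Iso.refl (𝟙 e)) ≪≫ rightComp e _ _

/-- The tensor product `a ⊗ π` with the pentagonator. -/
def pentLeft (a b c d e : B) :
    tmap T (𝟙 a) (tmap T (M.asc b c d) (𝟙 e)) ≫ tmap T (𝟙 a) (M.asc b (tob T c d) e) ≫
      tmap T (𝟙 a) (tmap T (𝟙 b) (M.asc c d e)) ≅
    tmap T (𝟙 a) (M.asc (tob T b c) d e) ≫ tmap T (𝟙 a) (M.asc b c (tob T d e)) :=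
  (leftComp a _ _ ≪≫ whiskerLeftIso _ (leftComp a _ _)).symm ≪≫
    tmapIso T (Iso.refl (𝟙 a)) (F.pent b c d e) ≪≫ leftComp a _ _

/-- `- ⊗ c` applied to the filler of the middle triangle. -/
def midTriRight (a b c : B) :
    tmap T (M.asc a M.unit b) (𝟙 c) ≫ tmap T (tmap T (𝟙 a) (M.lun b)) (𝟙 c) ≅
      tmap T (tmap T (M.run a) (𝟙 b)) (𝟙 c) :=
  (rightComp c _ _).symm ≪≫ tmapIso T (F.midTri a b) (Iso.refl (𝟙 c))

/-- `a ⊗ -` applied to the filler of the middle triangle. -/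
def midTriLeft (a b c : B) :
    tmap T (𝟙 a) (M.asc b M.unit c) ≫ tmap T (𝟙 a) (tmap T (𝟙 b) (M.lun c)) ≅
      tmap T (𝟙 a) (tmap T (M.run b) (𝟙 c)) :=
  (leftComp a _ _).symm ≪≫ tmapIso T (Iso.refl (𝟙 a)) (F.midTri b c)

/-- `a ⊗ -` applied to the filler of the left triangle. -/
def leftTriLeft (a b c : B) :
    tmap T (𝟙 a) (tmap T (M.lun b) (𝟙 c)) ≅
      tmap T (𝟙 a) (M.asc M.unit b c) ≫ tmap T (𝟙 a) (M.lun (tob T b c)) :=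
  tmapIso T (Iso.refl (𝟙 a)) (F.leftTri b c) ≪≫ leftComp a _ _

/-- `- ⊗ c` applied to the filler of the right triangle. -/
def rightTriRight (a b c : B) :
    tmap T (M.run (tob T a b)) (𝟙 c) ≅
      tmap T (M.asc a b M.unit) (𝟙 c) ≫ tmap T (tmap T (𝟙 a) (M.run b)) (𝟙 c) :=
  tmapIso T (F.rightTri a b) (Iso.refl (𝟙 c)) ≪≫ rightComp c _ _

end TensorFillers

/-- The fillers of the pentagon and of the triangles are modifications, and they satisfy the
nonabelian cocycle condition for five objects and the two normalization conditions. -/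
structure TensorFillers.IsCoherent {T : (B × B) ⥤ᵖ B} {M : TensorData T} (F : TensorFillers M) :
    Prop where
  pent_natural {a a' b b' c c' d d' : B} (f : a ⟶ a') (g : b ⟶ b') (h : c ⟶ c') (k : d ⟶ d') :
    SqCompat (F.pent a b c d) (F.pent a' b' c' d')
      (pasteSq (tensorSq T (M.ascSq f g h) (idSq k))
        (pasteSq (M.ascSq f (tmap T g h) k)
          (tensorSq T (idSq f) (M.ascSq g h k))))
      (pasteSq (M.ascSq (tmap T f g) h k) (M.ascSq f g (tmap T h k)))
  midTri_natural {a a' b b' : B} (f : a ⟶ a') (g : b ⟶ b') :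
    SqCompat (F.midTri a b) (F.midTri a' b')
      (pasteSq (M.ascSq f (𝟙 M.unit) g)
        (tensorSq T (idSq f) (M.lunSq g)))
      (tensorSq T (M.runSq f) (idSq g))
  leftTri_natural {a a' b b' : B} (f : a ⟶ a') (g : b ⟶ b') :
    SqCompat (F.leftTri a b) (F.leftTri a' b')
      (tensorSq T (M.lunSq f) (idSq g))
      (pasteSq (M.ascSq (𝟙 M.unit) f g) (M.lunSq (tmap T f g)))
  rightTri_natural {a a' b b' : B} (f : a ⟶ a') (g : b ⟶ b') :
    SqCompat (F.rightTri a b) (F.rightTri a' b')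
      (M.runSq (tmap T f g))
      (pasteSq (M.ascSq f g (𝟙 M.unit))
        (tensorSq T (idSq f) (M.runSq g)))
  cocycle (a b c d e : B) :
    𝟙 (tmap T (tmap T (M.asc a b c) (𝟙 d)) (𝟙 e) ≫
        tmap T (M.asc a (tob T b c) d) (𝟙 e) ≫
        tmap T (tmap T (𝟙 a) (M.asc b c d)) (𝟙 e) ≫
        M.asc a (tob T b (tob T c d)) e ≫
        tmap T (𝟙 a) (M.asc b (tob T c d) e) ≫
        tmap T (𝟙 a) (tmap T (𝟙 b) (M.asc c d e))) ⊗≫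
      (F.pentRight a b c d e).hom ▷
        (M.asc a (tob T b (tob T c d)) e ≫
          tmap T (𝟙 a) (M.asc b (tob T c d) e) ≫
          tmap T (𝟙 a) (tmap T (𝟙 b) (M.asc c d e))) ⊗≫
      tmap T (M.asc (tob T a b) c d) (𝟙 e) ◁
        (F.pent a b (tob T c d) e).hom ▷
          tmap T (𝟙 a) (tmap T (𝟙 b) (M.asc c d e)) ⊗≫
      (tmap T (M.asc (tob T a b) c d) (𝟙 e) ≫
          M.asc (tob T a b) (tob T c d) e) ◁
        (M.ascSq₃ a b (M.asc c d e)).inv ⊗≫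
      (F.pent (tob T a b) c d e).hom ▷
        M.asc a b (tob T c (tob T d e)) ⊗≫
      𝟙 (M.asc (tob T (tob T a b) c) d e ≫
        M.asc (tob T a b) c (tob T d e) ≫
        M.asc a b (tob T c (tob T d e))) =
    𝟙 (tmap T (tmap T (M.asc a b c) (𝟙 d)) (𝟙 e) ≫
        tmap T (M.asc a (tob T b c) d) (𝟙 e) ≫
        tmap T (tmap T (𝟙 a) (M.asc b c d)) (𝟙 e) ≫
        M.asc a (tob T b (tob T c d)) e ≫
        tmap T (𝟙 a) (M.asc b (tob T c d) e) ≫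
        tmap T (𝟙 a) (tmap T (𝟙 b) (M.asc c d e))) ⊗≫
      (tmap T (tmap T (M.asc a b c) (𝟙 d)) (𝟙 e) ≫
          tmap T (M.asc a (tob T b c) d) (𝟙 e)) ◁
        (M.ascSq₂ a (M.asc b c d) e).hom ▷
          (tmap T (𝟙 a) (M.asc b (tob T c d) e) ≫
            tmap T (𝟙 a) (tmap T (𝟙 b) (M.asc c d e))) ⊗≫
      (tmap T (tmap T (M.asc a b c) (𝟙 d)) (𝟙 e) ≫
          tmap T (M.asc a (tob T b c) d) (𝟙 e) ≫
          M.asc a (tob T (tob T b c) d) e) ◁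
        (F.pentLeft a b c d e).hom ⊗≫
      tmap T (tmap T (M.asc a b c) (𝟙 d)) (𝟙 e) ◁
        (F.pent a (tob T b c) d e).hom ▷
          tmap T (𝟙 a) (M.asc b c (tob T d e)) ⊗≫
      (M.ascSq₁ (M.asc a b c) d e).hom ▷
        (M.asc a (tob T b c) (tob T d e) ≫
          tmap T (𝟙 a) (M.asc b c (tob T d e))) ⊗≫
      M.asc (tob T (tob T a b) c) d e ◁
        (F.pent a b c (tob T d e)).hom ⊗≫
      𝟙 (M.asc (tob T (tob T a b) c) d e ≫
        M.asc (tob T a b) c (tob T d e) ≫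
        M.asc a b (tob T c (tob T d e)))
  normal_left (a b c : B) :
    𝟙 (tmap T (tmap T (M.run a) (𝟙 b)) (𝟙 c) ≫ M.asc a b c) ⊗≫
      (M.ascSq₁ (M.run a) b c).hom ⊗≫
      M.asc (tob T a M.unit) b c ◁ (F.midTri a (tob T b c)).inv ⊗≫
      𝟙 (M.asc (tob T a M.unit) b c ≫ M.asc a M.unit (tob T b c) ≫
        tmap T (𝟙 a) (M.lun (tob T b c))) =
    𝟙 (tmap T (tmap T (M.run a) (𝟙 b)) (𝟙 c) ≫ M.asc a b c) ⊗≫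
      (F.midTriRight a b c).inv ▷ M.asc a b c ⊗≫
      tmap T (M.asc a M.unit b) (𝟙 c) ◁
        (M.ascSq₂ a (M.lun b) c).hom ⊗≫
      (tmap T (M.asc a M.unit b) (𝟙 c) ≫ M.asc a (tob T M.unit b) c) ◁
        (F.leftTriLeft a b c).hom ⊗≫
      (F.pent a M.unit b c).hom ▷ tmap T (𝟙 a) (M.lun (tob T b c)) ⊗≫
      𝟙 (M.asc (tob T a M.unit) b c ≫ M.asc a M.unit (tob T b c) ≫
        tmap T (𝟙 a) (M.lun (tob T b c)))
  normal_right (a b c : B) :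
    𝟙 (tmap T (M.run (tob T a b)) (𝟙 c) ≫ M.asc a b c) ⊗≫
      (F.midTri (tob T a b) c).inv ▷ M.asc a b c ⊗≫
      M.asc (tob T a b) M.unit c ◁
        (M.ascSq₃ a b (M.lun c)).hom ⊗≫
      𝟙 (M.asc (tob T a b) M.unit c ≫ M.asc a b (tob T M.unit c) ≫
        tmap T (𝟙 a) (tmap T (𝟙 b) (M.lun c))) =
    𝟙 (tmap T (M.run (tob T a b)) (𝟙 c) ≫ M.asc a b c) ⊗≫
      (F.rightTriRight a b c).hom ▷ M.asc a b c ⊗≫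
      tmap T (M.asc a b M.unit) (𝟙 c) ◁
        (M.ascSq₂ a (M.run b) c).hom ⊗≫
      (tmap T (M.asc a b M.unit) (𝟙 c) ≫ M.asc a (tob T b M.unit) c) ◁
        (F.midTriLeft a b c).inv ⊗≫
      (F.pent a b M.unit c).hom ▷
        tmap T (𝟙 a) (tmap T (𝟙 b) (M.lun c)) ⊗≫
      𝟙 (M.asc (tob T a b) M.unit c ≫ M.asc a b (tob T M.unit c) ≫
        tmap T (𝟙 a) (tmap T (𝟙 b) (M.lun c)))

/-- A monoidal structure on a bicategory with tensor product `T`, i.e. the structure of a monoidal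
bicategory: a unit object, associators and unitors which are pseudonatural equivalences, and
coherent fillers of the pentagon and of the triangles. -/
structure MonoidalStructure (T : (B × B) ⥤ᵖ B) extends TensorData T where
  asc_equiv (a b c : B) : IsEquivalence₁ (toTensorData.asc a b c)
  lun_equiv (a : B) : IsEquivalence₁ (toTensorData.lun a)
  run_equiv (a : B) : IsEquivalence₁ (toTensorData.run a)
  fillers : TensorFillers toTensorData
  coherent : fillers.IsCoherent

end MonoidalBicategories

section Bicolimits

open Bicategory
open scoped Pseudofunctor.StrongTrans

universe s w₁ v₁ u₁ w₂ v₂ u₂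

variable {J : Type u₁} [Bicategory.{w₁, v₁} J] {B : Type u} [Bicategory.{w, v} B]
  {C : Type u₂} [Bicategory.{w₂, v₂} C]

/-- The constant diagram with value `W`. -/
def constDiagram (J : Type u₁) [Bicategory.{w₁, v₁} J] (W : B) : J ⥤ᵖ B where
  obj _ := W
  map _ := 𝟙 W
  map₂ _ := 𝟙 (𝟙 W)
  mapId _ := Iso.refl _
  mapComp _ _ := (λ_ (𝟙 W)).symm
  map₂_associator f g h := by simp
  map₂_right_unitor f := by simp

/-- The transformation of constant diagrams induced by a 1-morphism. -/
def constTrans (J : Type u₁) [Bicategory.{w₁, v₁} J] {W Z : B} (f : W ⟶ Z) :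
    constDiagram J W ⟶ constDiagram J Z :=
  ({ app := fun _ => f
     naturality := fun _ => λ_ f ≪≫ (ρ_ f).symm
     naturality_naturality := fun {a b g h} η => by
       change 𝟙 (𝟙 W) ▷ f ≫ (λ_ f ≪≫ (ρ_ f).symm).hom = (λ_ f ≪≫ (ρ_ f).symm).hom ≫ f ◁ 𝟙 (𝟙 Z)
       rw [id_whiskerRight, whiskerLeft_id, Category.id_comp, Category.comp_id]
     naturality_id := fun a => by
       change ((λ_ f).hom ≫ (ρ_ f).inv) ≫ f ◁ 𝟙 (𝟙 Z) = 𝟙 (𝟙 W) ▷ f ≫ (λ_ f).hom ≫ (ρ_ f).inv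
       rw [id_whiskerRight, whiskerLeft_id, Category.id_comp, Category.comp_id]
     naturality_comp := fun {a b c} g h => by
       change ((λ_ f).hom ≫ (ρ_ f).inv) ≫ f ◁ (λ_ (𝟙 Z)).inv =
         (λ_ (𝟙 W)).inv ▷ f ≫ (α_ _ _ _).hom ≫ 𝟙 W ◁ ((λ_ f).hom ≫ (ρ_ f).inv) ≫
           (α_ _ _ _).inv ≫ ((λ_ f).hom ≫ (ρ_ f).inv) ▷ 𝟙 Z ≫ (α_ _ _ _).hom
       bicategory } :
    Pseudofunctor.StrongTrans (constDiagram J W) (constDiagram J Z))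

/-- The modification induced by a 2-morphism. -/
def constMod (J : Type u₁) [Bicategory.{w₁, v₁} J] {W Z : B} {f g : W ⟶ Z} (η : f ⟶ g) :
    constTrans J f ⟶ constTrans J g where
  as :=
  { app := fun _ => η
    naturality := fun {a b} h => by
      change 𝟙 W ◁ η ≫ (λ_ g).hom ≫ (ρ_ g).inv = ((λ_ f).hom ≫ (ρ_ f).inv) ≫ η ▷ 𝟙 Z
      simp }

/-- A cocone under the diagram `V` with vertex `X` induces a functor from the 1-morphisms `X ⟶ W`
to the category of cocones under `V` with vertex `W`. -/
def coconeFunctor {V : J ⥤ᵖ B} {X : B} (σ : V ⟶ constDiagram J X) (W : B) :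
    (X ⟶ W) ⥤ (V ⟶ constDiagram J W) where
  obj f := σ ≫ constTrans J f
  map η := σ ◁ constMod J η
  map_id f := by
    have h : constMod J (𝟙 f) = 𝟙 (constTrans J f) := rfl
    rw [h, whiskerLeft_id]
  map_comp η θ := by
    have h : constMod J (η ≫ θ) = constMod J η ≫ constMod J θ := rfl
    rw [h, whiskerLeft_comp]

/-- A cocone `σ` under `V` with vertex `X` exhibits `X` as a colimit of `V` if it induces
equivalences between the categories of 1-morphisms `X ⟶ W` and of cocones under `V` with
vertex `W`. -/
def IsBicolimit {V : J ⥤ᵖ B} {X : B} (σ : V ⟶ constDiagram J X) : Prop :=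
  ∀ W : B, (coconeFunctor σ W).IsEquivalence

section Cocones

variable {V : J ⥤ᵖ B} {X : B}

/-- The legs of a cocone. -/
def leg (σ : V ⟶ constDiagram J X) (i : J) : V.obj i ⟶ X := σ.app i

/-- The naturality 2-morphisms of a cocone. -/
def legNat (σ : V ⟶ constDiagram J X) {i j : J} (f : i ⟶ j) : V.map f ≫ leg σ j ≅ leg σ i :=
  (σ.naturality f : V.map f ≫ leg σ j ≅ leg σ i ≫ 𝟙 X) ≪≫ ρ_ (leg σ i)

/-- Construct a cocone from its legs and naturality 2-morphisms. -/
def mkCocone (l : ∀ i, V.obj i ⟶ X) (n : ∀ {i j : J} (f : i ⟶ j), V.map f ≫ l j ≅ l i)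
    (nat : ∀ {i j : J} {f g : i ⟶ j} (η : f ⟶ g), V.map₂ η ▷ l j ≫ (n g).hom = (n f).hom)
    (nat_id : ∀ i : J, (n (𝟙 i)).hom = (V.mapId i).hom ▷ l i ≫ (λ_ (l i)).hom)
    (nat_comp : ∀ {i j k : J} (f : i ⟶ j) (g : j ⟶ k), (n (f ≫ g)).hom =
      (V.mapComp f g).hom ▷ l k ≫ (α_ _ _ _).hom ≫ V.map f ◁ (n g).hom ≫ (n f).hom) :
    V ⟶ constDiagram J X :=
  ({ app := l
     naturality := fun {i j} f => n f ≪≫ (ρ_ (l i)).symm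
     naturality_naturality := fun {i j f g} η => by
       change V.map₂ η ▷ l j ≫ (n g).hom ≫ (ρ_ (l i)).inv =
         ((n f).hom ≫ (ρ_ (l i)).inv) ≫ l i ◁ 𝟙 (𝟙 X)
       rw [whiskerLeft_id, Category.comp_id, ← Category.assoc, nat]
     naturality_id := fun i => by
       change ((n (𝟙 i)).hom ≫ (ρ_ (l i)).inv) ≫ l i ◁ 𝟙 (𝟙 X) =
         (V.mapId i).hom ▷ l i ≫ (λ_ (l i)).hom ≫ (ρ_ (l i)).inv
       rw [whiskerLeft_id, Category.comp_id, nat_id, Category.assoc]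
     naturality_comp := fun {i j k} f g => by
       change ((n (f ≫ g)).hom ≫ (ρ_ (l i)).inv) ≫ l i ◁ (λ_ (𝟙 X)).inv =
         (V.mapComp f g).hom ▷ l k ≫ (α_ _ _ _).hom ≫ V.map f ◁ ((n g).hom ≫ (ρ_ (l j)).inv) ≫
           (α_ _ _ _).inv ≫ ((n f).hom ≫ (ρ_ (l i)).inv) ▷ 𝟙 X ≫ (α_ _ _ _).hom
       rw [nat_comp]
       simp only [whiskerLeft_comp, whiskerRight_id, Category.assoc]
       simp } :
    Pseudofunctor.StrongTrans V (constDiagram J X))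

theorem legNat_naturality (σ : V ⟶ constDiagram J X) {i j : J} {f g : i ⟶ j} (η : f ⟶ g) :
    V.map₂ η ▷ leg σ j ≫ (legNat σ g).hom = (legNat σ f).hom := by
  let s {i j : J} (f : i ⟶ j) : V.map f ≫ leg σ j ⟶ leg σ i ≫ 𝟙 X := (σ.naturality f).hom
  have h : V.map₂ η ▷ leg σ j ≫ s g = s f ≫ leg σ i ◁ 𝟙 (𝟙 X) := σ.naturality_naturality η
  change V.map₂ η ▷ leg σ j ≫ s g ≫ (ρ_ (leg σ i)).hom = s f ≫ (ρ_ (leg σ i)).hom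
  rw [← Category.assoc, h]
  simp

theorem legNat_id (σ : V ⟶ constDiagram J X) (i : J) :
    (legNat σ (𝟙 i)).hom = (V.mapId i).hom ▷ leg σ i ≫ (λ_ (leg σ i)).hom := by
  let s {i j : J} (f : i ⟶ j) : V.map f ≫ leg σ j ⟶ leg σ i ≫ 𝟙 X := (σ.naturality f).hom
  have h : s (𝟙 i) ≫ leg σ i ◁ 𝟙 (𝟙 X) =
    (V.mapId i).hom ▷ leg σ i ≫ (λ_ (leg σ i)).hom ≫ (ρ_ (leg σ i)).inv := σ.naturality_id i
  rw [whiskerLeft_id, Category.comp_id] at h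
  change s (𝟙 i) ≫ (ρ_ (leg σ i)).hom = _
  rw [h]
  simp

theorem legNat_comp (σ : V ⟶ constDiagram J X) {i j k : J} (f : i ⟶ j) (g : j ⟶ k) :
    (legNat σ (f ≫ g)).hom = (V.mapComp f g).hom ▷ leg σ k ≫ (α_ _ _ _).hom ≫
      V.map f ◁ (legNat σ g).hom ≫ (legNat σ f).hom := by
  let s {i j : J} (f : i ⟶ j) : V.map f ≫ leg σ j ⟶ leg σ i ≫ 𝟙 X := (σ.naturality f).hom
  have h : s (f ≫ g) ≫ leg σ i ◁ (λ_ (𝟙 X)).inv =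
    (V.mapComp f g).hom ▷ leg σ k ≫ (α_ _ _ _).hom ≫ V.map f ◁ s g ≫
        (α_ _ _ _).inv ≫ s f ▷ 𝟙 X ≫ (α_ _ _ _).hom := σ.naturality_comp f g
  have h3 := congrArg (fun t => t ≫ leg σ i ◁ (λ_ (𝟙 X)).hom ≫ (ρ_ (leg σ i)).hom) h
  change s (f ≫ g) ≫ (ρ_ (leg σ i)).hom = (V.mapComp f g).hom ▷ leg σ k ≫ (α_ _ _ _).hom ≫
      V.map f ◁ (s g ≫ (ρ_ (leg σ j)).hom) ≫ s f ≫ (ρ_ (leg σ i)).hom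
  generalize s (f ≫ g) = x at *
  generalize s f = y at *
  generalize s g = z at *
  simp only [Category.assoc, whiskerLeft_inv_hom_assoc] at h3
  rw [h3]
  simp

/-- The image of a cocone under a pseudofunctor: the legs are the images of the legs. -/
def mapCocone (F : B ⥤ᵖ C) (σ : V ⟶ constDiagram J X) :
    V.comp F ⟶ constDiagram J (F.obj X) :=
  mkCocone (V := V.comp F) (fun i => F.map (leg σ i))
    (fun {i j} f => (F.mapComp (V.map f) (leg σ j)).symm ≪≫ F.map₂Iso (legNat σ f))
    (fun {i j f g} η => by
      change F.map₂ (V.map₂ η) ▷ F.map (leg σ j) ≫ (F.mapComp (V.map g) (leg σ j)).inv ≫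
        F.map₂ (legNat σ g).hom = (F.mapComp (V.map f) (leg σ j)).inv ≫ F.map₂ (legNat σ f).hom
      rw [← legNat_naturality σ η, F.map₂_comp, F.map₂_whisker_right]
      simp)
    (fun i => by
      change (F.mapComp (V.map (𝟙 i)) (leg σ i)).inv ≫ F.map₂ (legNat σ (𝟙 i)).hom =
        (F.map₂ (V.mapId i).hom ≫ (F.mapId (V.obj i)).hom) ▷ F.map (leg σ i) ≫
          (λ_ (F.map (leg σ i))).hom
      rw [legNat_id, F.map₂_comp, F.map₂_whisker_right, F.map₂_left_unitor]
      simp)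
    (fun {i j k} f g => by
      change (F.mapComp (V.map (f ≫ g)) (leg σ k)).inv ≫ F.map₂ (legNat σ (f ≫ g)).hom =
        (F.map₂ (V.mapComp f g).hom ≫ (F.mapComp (V.map f) (V.map g)).hom) ▷ F.map (leg σ k) ≫
          (α_ _ _ _).hom ≫ F.map (V.map f) ◁ ((F.mapComp (V.map g) (leg σ k)).inv ≫
            F.map₂ (legNat σ g).hom) ≫ (F.mapComp (V.map f) (leg σ j)).inv ≫
              F.map₂ (legNat σ f).hom
      rw [legNat_comp, F.map₂_comp, F.map₂_comp, F.map₂_comp, F.map₂_whisker_right,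
        F.map₂_whisker_left, F.map₂_associator]
      simp)

end Cocones

/-- `F` preserves the colimits of all diagrams indexed by small categories: if `σ` exhibits `X` as
a colimit of `V`, then the image of `σ` exhibits `F X` as a colimit of `F V`. -/
def PreservesSmallColimits (F : B ⥤ᵖ C) : Prop :=
  ∀ (I : Type s) [Category.{s} I] (V : LocallyDiscrete I ⥤ᵖ B) (X : B)
    (σ : V ⟶ constDiagram (LocallyDiscrete I) X), IsBicolimit σ → IsBicolimit (mapCocone F σ)

end Bicolimits

end CStarLin

end

/-!
The maximal tensor product is governed by a universal property: `*`-functors `A ⊠ B ⟶ W` into an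
object of `Clin` correspond to functors of two variables, bilinear on hom-spaces and compatible
with `*`. Indeed a `*`-functor from a linear `*`-category to a C*-category maps sums of squares to
positive elements, so it is bounded by the norm which sums of squares define
(`StarFunctor.norm_map_le_sqNorm`), and the maximal norm is of this form. It therefore extends to
the completion by continuity and to the Karoubi completion by chosen splittings (`BiStar.lift`).
Bounded natural transformations make the `*`-functors `B ⟶ W` an object `ihom B W` of `Clin`, and a
functor of two variables is the same as a 1-morphism `A ⟶ ihom B W` (`BiStar.curry`,
`BiStar.uncurry`).

The structure morphisms are consequences. A functor `(a, b, c) ↦ a ⊠ (b ⊠ c)` of three variables is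
extended in two steps, through the internal hom, to the associator; the unit is the category of
finite-dimensional Hilbert spaces, and `pick x : one ⟶ V` is the essentially unique `*`-functor
which maps the one-dimensional space to `x`, so that the unitors are the extensions attached to
`pick (𝟙 A) : one ⟶ ihom A A`. All 2-morphisms are constructed and compared at elementary objects:
the elementary objects and the elementary tensors of morphisms form a generating family
(`Gen.tensor`), a 2-morphism is determined by its components at a generating family (`Gen.hom_ext`),
and compatible unitaries at a generating family extend to a 2-morphism (`Gen.iso`).

The coherence axioms are compared at generators without computing components. A trivialization
`Tr f x y` is a unitary from `f x` to a prescribed object `y`; trivializations compose, tensor, and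
exist canonically for the associator and the unitors, with values such as
`(a ⊠ b) ⊠ c ↦ a ⊠ (b ⊠ c)`. Every structural 2-morphism (associativity and unit constraints of the
bicategory, constraints of the pseudofunctor `⊠`, naturality squares, fillers of the pentagon and of
the triangles, and everything pasted from them) carries the canonical trivialization of its source
to that of its target; the class `RespectsTo` propagates this by instance resolution. Since a component
is determined by the trivializations which it respects, both sides of each axiom agree at the
generators and hence everywhere (`Gen.ext_of_respects`, `isCoherent`).

Preservation of colimits is a form of closedness. Composition with the evaluation
`ihom B W ⊠ B ⟶ W` induces equivalences between the categories of 1-morphisms `X ⟶ ihom B W` and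
`X ⊠ B ⟶ W` (`isEquivalence_of_eval`), so `- ⊠ B` has a right biadjoint, and likewise `A ⊠ -`. For
any pseudofunctor `F` with such equivalences `transpose F q X`, transposition is an equivalence
between the cocones under `V` with vertex `R` and the cocones under `V.comp F` with vertex `W`
(`coconeTranspose_isEquivalence`), from which `F` preserves bicolimits (`preserves_isBicolimit`).
-/

noncomputable section

open CategoryTheory
open scoped TensorProduct

namespace CStarLin

open StarCategory

local infixr:70 " ⊠ " => tob Clin.maxTensor

/-! ### Unitaries and isometries -/

section Unitary

variable {C : Type*} [Category* C] [Preadditive C] [Linear ℂ C] [StarCategory C]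

theorem IsUnitary.hom_dag_assoc {X Y Z : C} {f : X ⟶ Y} (hf : IsUnitary f) (g : X ⟶ Z) :
    f ≫ StarCategory.dag f ≫ g = g := by rw [← Category.assoc, hf.1, Category.id_comp]

theorem IsUnitary.dag_hom_assoc {X Y Z : C} {f : X ⟶ Y} (hf : IsUnitary f) (g : Y ⟶ Z) :
    StarCategory.dag f ≫ f ≫ g = g := by rw [← Category.assoc, hf.2, Category.id_comp]

theorem IsUnitary.cancel_right {X Y Z : C} {u : Y ⟶ Z} (hu : IsUnitary u) {f g : X ⟶ Y}
    (h : f ≫ u = g ≫ u) : f = g := by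
  have h' := congrArg (fun t => t ≫ StarCategory.dag u) h
  simpa only [Category.assoc, hu.1, Category.comp_id] using h'

theorem IsUnitary.cancel_left {X Y Z : C} {u : X ⟶ Y} (hu : IsUnitary u) {f g : Y ⟶ Z}
    (h : u ≫ f = u ≫ g) : f = g := by
  have h' := congrArg (fun t => StarCategory.dag u ≫ t) h
  simpa only [hu.dag_hom_assoc] using h'

/-- An intertwining relation passes to the adjoints of the unitaries. -/
theorem IsUnitary.dag_comm {X Y X' Y' : C} {u : X ⟶ Y} {u' : X' ⟶ Y'} (hu : IsUnitary u)
    (hu' : IsUnitary u') {f : X ⟶ X'} {g : Y ⟶ Y'} (h : f ≫ u' = u ≫ g) :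
    g ≫ StarCategory.dag u' = StarCategory.dag u ≫ f := by
  refine hu.cancel_left (hu'.cancel_right ?_)
  simp only [Category.assoc, hu'.2, Category.comp_id, hu.hom_dag_assoc, h]

end Unitary

/-! ### Contractivity of `*`-functors -/

section Contractive

variable {C : Type*} [Category* C] [CStarCategoryCore C] {D : Type*} [Category* D]
  [CStarCategoryCore D]

/-- The `*`-homomorphism between endomorphism algebras given by a `*`-functor. -/
def StarFunctor.endHom (F : StarFunctor C D) (X : C) : End X →⋆ₐ[ℂ] End (F.obj X) where
  toFun f := F.map (show X ⟶ X from f)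
  map_one' := F.map_id X
  map_mul' f g := F.map_comp (X := X) (Y := X) (Z := X) g f
  map_zero' := F.map_zero X X
  map_add' f g := F.map_add (X := X) (Y := X) f g
  commutes' c := by
    rw [Algebra.algebraMap_eq_smul_one, Algebra.algebraMap_eq_smul_one]
    exact (F.map_smul c (𝟙 X)).trans (congrArg _ (F.map_id X))
  map_star' f := F.map_dag (X := X) (Y := X) f

/-- A `*`-functor between C*-categories is contractive, because `*`-homomorphisms between
C*-algebras are. -/
theorem StarFunctor.norm_map_le (F : StarFunctor C D) {X Y : C} (f : X ⟶ Y) :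
    ‖F.map f‖ ≤ ‖f‖ := by
  have h : ‖F.map (f ≫ dag f)‖ ≤ ‖f ≫ dag f‖ :=
    NonUnitalStarAlgHom.norm_apply_le (F.endHom X) (End.of (f ≫ dag f))
  rw [F.map_comp, F.map_dag, norm_comp_dag, norm_comp_dag] at h
  exact (pow_le_pow_iff_left₀ (norm_nonneg _) (norm_nonneg _) two_ne_zero).mp h

/-- The action of a `*`-functor on a hom-space, as a continuous linear map. -/
def StarFunctor.mapCLM (F : StarFunctor C D) (X Y : C) : (X ⟶ Y) →L[ℂ] (F.obj X ⟶ F.obj Y) :=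
  LinearMap.mkContinuous
    { toFun := fun f => F.map f, map_add' := F.map_add, map_smul' := F.map_smul } 1
    (fun f => by rw [one_mul]; exact F.norm_map_le f)

theorem StarFunctor.continuous_map (F : StarFunctor C D) (X Y : C) :
    Continuous fun f : X ⟶ Y => F.map f := (F.mapCLM X Y).continuous

end Contractive

section SqBoundNorm

variable {W : Type*} [Category* W] [CStarCategory W]

attribute [local instance] CStarAlgebra.spectralOrder CStarAlgebra.spectralOrderedRing

/-- Each square `f* ∘ f` with `f` between different objects is of the form `g* ∘ g` with an
endomorphism `g`, hence positive in the C*-algebra of endomorphisms. -/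
theorem nonneg_of_mem_sqCone {P : W} {x : P ⟶ P} (hx : x ∈ sqCone P) :
    (0 : End P) ≤ End.of x := by
  induction hx using AddSubmonoid.closure_induction with
  | mem x hx =>
    obtain ⟨Q, w, rfl⟩ := hx
    obtain ⟨g, hg⟩ := CStarCategory.exists_comp_adj_eq w
    change w ≫ dag w = g ≫ dag g at hg
    rw [hg]
    exact star_mul_self_nonneg (End.of g)
  | zero => exact le_rfl
  | add x y _ _ hx hy => exact add_nonneg hx hy

/-- In a C*-category, sums of squares are positive, so the bounds that they define bound the
norm. -/
theorem SqBound.norm_le {P Q : W} {t : P ⟶ Q} {r : ℝ} (hr : 0 ≤ r) (h : SqBound t r) :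
    ‖t‖ ≤ r := by
  obtain ⟨g, hg⟩ := CStarCategory.exists_comp_adj_eq t
  change t ≫ dag t = g ≫ dag g at hg
  have h1 := nonneg_of_mem_sqCone h
  have h2 : End.of (((r ^ 2 : ℝ) : ℂ) • 𝟙 P - t ≫ dag t) =
      algebraMap ℝ (End P) (r ^ 2) - star (End.of g) * End.of g := by
    rw [IsScalarTower.algebraMap_apply ℝ ℂ (End P), Algebra.algebraMap_eq_smul_one, hg]
    rfl
  rw [h2, sub_nonneg, ← CStarAlgebra.norm_le_iff_le_algebraMap _ (by positivity)
    (star_mul_self_nonneg _), CStarRing.norm_star_mul_self, ← sq] at h1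
  have h3 : ‖t‖ ^ 2 = ‖End.of g‖ ^ 2 := by
    rw [← norm_comp_dag t, hg]
    exact norm_comp_dag g
  rw [← h3] at h1
  exact (pow_le_pow_iff_left₀ (norm_nonneg _) hr two_ne_zero).mp h1

/-- A `*`-functor from a linear `*`-category to a C*-category is bounded by the sums of squares. -/
theorem StarFunctor.norm_map_le_sqNorm {T : Type*} [Category* T] [Preadditive T] [Linear ℂ T]
    [StarCategory T] [SqBounded T] (F : StarFunctor T W) {P Q : T} (t : P ⟶ Q) :
    ‖F.map t‖ ≤ sqNorm t := by
  refine le_of_forall_pos_le_add fun ε hε => ?_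
  exact ((SqBound.of_lt (by linarith)).map F).norm_le
    (add_nonneg (sqNorm_nonneg t) hε.le)

end SqBoundNorm

/-! ### Extension of `*`-functors to completions and Karoubi completions -/

namespace CStarCompletion

variable {T : Type u} [Category.{v} T] [Preadditive T] [Linear ℂ T] [StarCategory T]
  {N : CStarSeminorm T} {W : Type*} [Category* W] [CStarCategoryCore W]

/-- The action of a contractive `*`-functor on the uncompleted hom-spaces. -/
def preLiftL (F : StarFunctor T W) (hF : ∀ {X Y : T} (t : X ⟶ Y), ‖F.map t‖ ≤ N.nrm t)
    (X Y : T) : N.Hom X Y →L[ℂ] (F.obj X ⟶ F.obj Y) :=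
  LinearMap.mkContinuous
    { toFun := fun t => F.map (show X ⟶ Y from t)
      map_add' := fun s t => F.map_add (X := X) (Y := Y) s t
      map_smul' := fun c t => F.map_smul (X := X) (Y := Y) c t } 1
    (fun t => by rw [one_mul]; exact hF (X := X) (Y := Y) t)

/-- The continuous extension of a contractive `*`-functor to the completed hom-spaces. -/
def liftL (F : StarFunctor T W) (hF : ∀ {X Y : T} (t : X ⟶ Y), ‖F.map t‖ ≤ N.nrm t)
    (X Y : CStarCompletion N) : (X ⟶ Y) →L[ℂ] (F.obj X.as ⟶ F.obj Y.as) :=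
  CStarSeminorm.ext N (preLiftL F hF X.as Y.as)

theorem liftL_ofHom (F : StarFunctor T W) (hF : ∀ {X Y : T} (t : X ⟶ Y), ‖F.map t‖ ≤ N.nrm t)
    {X Y : T} (t : X ⟶ Y) : liftL F hF ⟨X⟩ ⟨Y⟩ (ofHom t) = F.map t :=
  CStarSeminorm.ext_coe N (preLiftL F hF X Y) t

theorem continuous_liftL (F : StarFunctor T W)
    (hF : ∀ {X Y : T} (t : X ⟶ Y), ‖F.map t‖ ≤ N.nrm t) {α : Type*} [TopologicalSpace α]
    {X Y : CStarCompletion N} {f : α → (X ⟶ Y)} (hf : Continuous f) :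
    Continuous fun a => liftL F hF X Y (f a) := (liftL F hF X Y).continuous.comp hf

attribute [local fun_prop] continuous_liftL

/-- The extension to the completion of a contractive `*`-functor to a C*-category. -/
def lift (F : StarFunctor T W) (hF : ∀ {X Y : T} (t : X ⟶ Y), ‖F.map t‖ ≤ N.nrm t) :
    StarFunctor (CStarCompletion N) W where
  obj X := F.obj X.as
  map {X Y} f := liftL F hF X Y f
  map_id X := by
    have h := liftL_ofHom F hF (𝟙 X.as)
    rw [F.map_id] at h
    exact h
  map_comp {X Y Z} f g := by
    refine hom_ind (p := fun f => liftL F hF X Z (f ≫ g) = liftL F hF X Y f ≫ liftL F hF Y Z g) f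
      (isClosed_eq (by fun_prop) (by fun_prop)) fun f => ?_
    refine hom_ind (p := fun g => liftL F hF X Z (ofHom f ≫ g) =
      liftL F hF X Y (ofHom f) ≫ liftL F hF Y Z g) g
      (isClosed_eq (by fun_prop) (by fun_prop)) fun g => ?_
    have h := liftL_ofHom (N := N) F hF (f ≫ g)
    rw [F.map_comp, ofHom_comp] at h
    refine h.trans ?_
    rw [← liftL_ofHom F hF, ← liftL_ofHom F hF]
  map_add f g := (liftL F hF _ _).map_add f g
  map_smul c f := (liftL F hF _ _).map_smul c f
  map_dag {X Y} f := by
    refine hom_ind (p := fun f => liftL F hF Y X (dag f) = dag (liftL F hF X Y f)) f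
      (isClosed_eq (by fun_prop) (by fun_prop)) fun f => ?_
    have h := liftL_ofHom (N := N) F hF (dag f)
    rw [F.map_dag, ofHom_dag] at h
    refine h.trans ?_
    rw [← liftL_ofHom F hF]

theorem lift_ofHom (F : StarFunctor T W)
    (hF : ∀ {X Y : T} (t : X ⟶ Y), ‖F.map t‖ ≤ N.nrm t) {X Y : T} (t : X ⟶ Y) :
    (lift (N := N) F hF).map (ofHom t) = F.map t :=
  liftL_ofHom F hF t

end CStarCompletion

namespace Karoubi

variable {C : Type*} [Category* C] [CStarCategoryCore C] {W : Type*} [Category* W]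
  [CStarCategoryCore W] [IsKaroubiComplete W]

theorem exists_splitting_map (F : StarFunctor C W) (P : Karoubi C) :
    ∃ (Y : W) (i : Y ⟶ F.obj P.X), i ≫ dag i = 𝟙 Y ∧ dag i ≫ i = F.map P.p :=
  IsKaroubiComplete.exists_splitting (F.map P.p) (by rw [← F.map_comp, P.idem])
    (by rw [← F.map_dag, P.sa])

/-- A chosen splitting of the image of a projection. -/
def splitObj (F : StarFunctor C W) (P : Karoubi C) : W := (exists_splitting_map F P).choose

/-- The isometry of a chosen splitting. -/
def splitMap (F : StarFunctor C W) (P : Karoubi C) : splitObj F P ⟶ F.obj P.X :=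
  (exists_splitting_map F P).choose_spec.choose

theorem splitMap_dag (F : StarFunctor C W) (P : Karoubi C) :
    splitMap F P ≫ dag (splitMap F P) = 𝟙 _ :=
  (exists_splitting_map F P).choose_spec.choose_spec.1

theorem dag_splitMap (F : StarFunctor C W) (P : Karoubi C) :
    dag (splitMap F P) ≫ splitMap F P = F.map P.p :=
  (exists_splitting_map F P).choose_spec.choose_spec.2

/-- The extension of a `*`-functor to the Karoubi completion, given by chosen splittings. -/
def lift (F : StarFunctor C W) : StarFunctor (Karoubi C) W where
  obj P := splitObj F P
  map {P Q} f := splitMap F P ≫ F.map (val f) ≫ dag (splitMap F Q)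
  map_id P := by
    rw [val_id, ← dag_splitMap, Category.assoc, splitMap_dag, Category.comp_id, splitMap_dag]
  map_comp {P Q R} f g := by
    have h : dag (splitMap F Q) ≫ splitMap F Q ≫ F.map (val g) ≫ dag (splitMap F R) =
        F.map (val g) ≫ dag (splitMap F R) := by
      rw [← Category.assoc, dag_splitMap, ← Category.assoc, ← F.map_comp, p_val]
    rw [Category.assoc, Category.assoc, h, val_comp, F.map_comp, Category.assoc]
  map_add f g := by
    rw [val_add, F.map_add, Preadditive.add_comp, Preadditive.comp_add]
  map_smul c f := by
    rw [val_smul, F.map_smul, Linear.smul_comp, Linear.comp_smul]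
  map_dag f := by
    rw [val_dag, F.map_dag]
    simp only [dag_comp, dag_dag, Category.assoc]

/-- Where the projection is an identity, the chosen splitting does not change the value of the
functor up to a unitary. -/
theorem isUnitary_splitMap (F : StarFunctor C W) (P : Karoubi C) (hP : P.p = 𝟙 P.X) :
    IsUnitary (splitMap F P) := by
  refine ⟨splitMap_dag F P, ?_⟩
  rw [dag_splitMap, hP, F.map_id]

theorem lift_map_comp_splitMap (F : StarFunctor C W) {P Q : Karoubi C} (f : P ⟶ Q) :
    (lift F).map f ≫ splitMap F Q = splitMap F P ≫ F.map (val f) := by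
  change (splitMap F P ≫ F.map (val f) ≫ dag (splitMap F Q)) ≫ splitMap F Q = _
  rw [Category.assoc, Category.assoc, dag_splitMap, ← F.map_comp, val_p]

end Karoubi

/-! ### The internal hom -/

theorem norm_id_le {C : Type*} [Category* C] [CStarCategoryCore C] (X : C) : ‖𝟙 X‖ ≤ 1 := by
  have h := norm_comp_dag (𝟙 X)
  rw [dag_id, Category.comp_id] at h
  nlinarith [norm_nonneg (𝟙 X)]

open scoped ENNReal lp

/-- The internal hom `[A, W]`: its objects are the `*`-functors from `A` to `W`, its morphisms
are the bounded natural transformations. A wrapper is needed because the unitary natural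
isomorphisms already serve as the morphisms of `StarFunctor A W`. -/
structure IHom (A W : Type u) [Category.{u} A] [CStarCategory A] [Category.{u} W]
    [CStarCategory W] : Type u where
  fn : StarFunctor A W

namespace IHom

variable {A W : Type u} [Category.{u} A] [CStarCategory A] [Category.{u} W] [CStarCategory W]

/-- Bounded families of morphisms, normed by the supremum. -/
abbrev Fam (F G : IHom A W) : Type u := lp (fun a : A => F.fn.obj a ⟶ G.fn.obj a) ∞

/-- The bounded natural transformations, as a subspace of the bounded families. -/
def homSub (F G : IHom A W) : Submodule ℂ (Fam F G) where
  carrier := {η | ∀ {a b : A} (f : a ⟶ b), F.fn.map f ≫ η b = η a ≫ G.fn.map f}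
  add_mem' {η θ} hη hθ a b f := by
    change F.fn.map f ≫ (η b + θ b) = (η a + θ a) ≫ G.fn.map f
    rw [Preadditive.comp_add, Preadditive.add_comp, hη, hθ]
  zero_mem' {a b} f := by
    change F.fn.map f ≫ 0 = 0 ≫ G.fn.map f
    simp
  smul_mem' c η hη a b f := by
    change F.fn.map f ≫ (c • η b) = (c • η a) ≫ G.fn.map f
    rw [Linear.comp_smul, Linear.smul_comp, hη]

theorem continuous_eval (F G : IHom A W) (a : A) : Continuous fun η : Fam F G => η a := by
  have h : LipschitzWith 1 (fun η : Fam F G => η a) := by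
    refine LipschitzWith.of_dist_le_mul fun η θ => ?_
    rw [dist_eq_norm, dist_eq_norm, NNReal.coe_one, one_mul]
    exact lp.norm_apply_le_norm ENNReal.top_ne_zero (η - θ) a
  exact h.continuous

theorem isClosed_homSub (F G : IHom A W) : IsClosed (homSub F G : Set (Fam F G)) := by
  have h : (homSub F G : Set (Fam F G)) = ⋂ (a : A) (b : A) (f : a ⟶ b),
      {η | F.fn.map f ≫ η b = η a ≫ G.fn.map f} := by
    ext η
    simp only [Set.mem_iInter]
    exact ⟨fun h a b f => h f, fun h a b f => h a b f⟩
  rw [h]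
  refine isClosed_iInter fun a => isClosed_iInter fun b => isClosed_iInter fun f => ?_
  exact isClosed_eq (CStarCompletion.continuous_comp continuous_const (continuous_eval F G b))
    (CStarCompletion.continuous_comp (continuous_eval F G a) continuous_const)

/-- A natural transformation with a bound. -/
def mkSub {F G : IHom A W} (c : ∀ a, F.fn.obj a ⟶ G.fn.obj a) (C : ℝ) (hC : ∀ a, ‖c a‖ ≤ C)
    (nat : ∀ {a b : A} (f : a ⟶ b), F.fn.map f ≫ c b = c a ≫ G.fn.map f) : homSub F G :=
  ⟨⟨c, memℓp_infty ⟨C, by rintro _ ⟨a, rfl⟩; exact hC a⟩⟩, nat⟩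

theorem norm_le_sub {F G : IHom A W} (η : homSub F G) (a : A) : ‖η.1 a‖ ≤ ‖η‖ :=
  lp.norm_apply_le_norm ENNReal.top_ne_zero η.1 a

instance : Category.{u} (IHom A W) where
  Hom F G := homSub F G
  id F := mkSub (fun a => 𝟙 _) 1 (fun a => norm_id_le _) (fun f => by simp)
  comp η θ := mkSub (fun a => η.1 a ≫ θ.1 a) (‖η‖ * ‖θ‖)
    (fun a => (CStarLin.norm_comp_le _ _).trans (mul_le_mul (norm_le_sub η a) (norm_le_sub θ a)
      (norm_nonneg _) (norm_nonneg _)))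
    (fun {a b} f => by rw [← Category.assoc, η.2, Category.assoc, θ.2, Category.assoc])
  id_comp η := Subtype.ext (lp.ext (funext fun a => Category.id_comp (η.1 a)))
  comp_id η := Subtype.ext (lp.ext (funext fun a => Category.comp_id (η.1 a)))
  assoc η θ κ := Subtype.ext (lp.ext (funext fun a => Category.assoc (η.1 a) (θ.1 a) (κ.1 a)))

/-- The component of a bounded natural transformation. -/
def app {F G : IHom A W} (η : F ⟶ G) (a : A) : F.fn.obj a ⟶ G.fn.obj a := η.1 a

/-- Construct a morphism of `[A, W]` from a bounded natural family. -/
def mkHom {F G : IHom A W} (c : ∀ a, F.fn.obj a ⟶ G.fn.obj a) (C : ℝ) (hC : ∀ a, ‖c a‖ ≤ C)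
    (nat : ∀ {a b : A} (f : a ⟶ b), F.fn.map f ≫ c b = c a ≫ G.fn.map f) : F ⟶ G :=
  mkSub c C hC nat

theorem hom_ext {F G : IHom A W} {η θ : F ⟶ G} (h : ∀ a, app η a = app θ a) : η = θ :=
  Subtype.ext (lp.ext (funext h))

theorem naturality {F G : IHom A W} (η : F ⟶ G) {a b : A} (f : a ⟶ b) :
    F.fn.map f ≫ app η b = app η a ≫ G.fn.map f := η.2 f

@[simp] theorem app_id (F : IHom A W) (a : A) : app (𝟙 F) a = 𝟙 (F.fn.obj a) := rfl

@[simp] theorem app_comp {F G H : IHom A W} (η : F ⟶ G) (θ : G ⟶ H) (a : A) :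
    app (η ≫ θ) a = app η a ≫ app θ a := rfl

theorem dag_naturality {F G : IHom A W} (η : F ⟶ G) {a b : A} (f : a ⟶ b) :
    G.fn.map f ≫ dag (app η b) = dag (app η a) ≫ F.fn.map f := by
  have h := congrArg dag (naturality η (dag f))
  simp only [dag_comp, ← StarFunctor.map_dag, dag_dag] at h
  exact h.symm

theorem norm_app_le_sub {F G : IHom A W} (η : F ⟶ G) (a : A) :
    ‖app η a‖ ≤ ‖(show homSub F G from η)‖ := norm_le_sub η a

theorem norm_sub_le {F G : IHom A W} (η : homSub F G) {C : ℝ} (hC : 0 ≤ C)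
    (h : ∀ a, ‖η.1 a‖ ≤ C) : ‖η‖ ≤ C := lp.norm_le_of_forall_le hC h

/-- The pointwise adjoint. -/
def adjHom {F G : IHom A W} (η : F ⟶ G) : G ⟶ F :=
  mkHom (fun a => dag (app η a)) ‖(show homSub F G from η)‖
    (fun a => by rw [norm_dag]; exact norm_app_le_sub η a) (fun f => dag_naturality η f)

/-- The linear structure and the adjoints are pointwise, the norm is the supremum norm. -/
instance : CStarCategoryCore (IHom A W) where
  homGroup F G := inferInstanceAs (NormedAddCommGroup (homSub F G))
  homSpace F G := inferInstanceAs (NormedSpace ℂ (homSub F G))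
  homComplete F G := (isClosed_homSub F G).completeSpace_coe
  add_comp η η' θ := hom_ext fun a => Preadditive.add_comp _ _ _ (η.1 a) (η'.1 a) (θ.1 a)
  comp_add η θ θ' := hom_ext fun a => Preadditive.comp_add _ _ _ (η.1 a) (θ.1 a) (θ'.1 a)
  smul_comp c η θ := hom_ext fun a => Linear.smul_comp _ _ _ c (η.1 a) (θ.1 a)
  comp_smul c η θ := hom_ext fun a => Linear.comp_smul _ _ _ (η.1 a) c (θ.1 a)
  adj η := adjHom η
  adj_adj η := hom_ext fun a => dag_dag (app η a)
  adj_comp η θ := hom_ext fun a => dag_comp (app η a) (app θ a)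
  adj_add η θ := hom_ext fun a => dag_add (app η a) (app θ a)
  adj_smul c η := hom_ext fun a => dag_smul c (app η a)
  norm_comp_le {F G H} η θ := norm_sub_le (F := F) (G := H) (η ≫ θ)
    (mul_nonneg (norm_nonneg (show homSub F G from η)) (norm_nonneg (show homSub G H from θ)))
    fun a => (CStarLin.norm_comp_le _ _).trans (mul_le_mul (norm_le_sub η a) (norm_le_sub θ a)
      (norm_nonneg _) (norm_nonneg (show homSub F G from η)))
  norm_comp_adj {F G} η := by
    set x : homSub F G := η
    have hx : ∀ a, ‖x.1 a‖ ^ 2 = ‖app (η ≫ adjHom η) a‖ := fun a => (norm_comp_dag (app η a)).symm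
    set y : homSub F F := η ≫ adjHom η
    change ‖y‖ = ‖x‖ ^ 2
    apply le_antisymm
    · refine norm_sub_le y (by positivity) fun a => ?_
      refine (hx a).symm.le.trans ?_
      gcongr
      exact norm_le_sub x a
    · have h : ‖x‖ ≤ Real.sqrt ‖y‖ := norm_sub_le x (Real.sqrt_nonneg _) fun a => by
        apply Real.le_sqrt_of_sq_le
        rw [hx]
        exact norm_le_sub y a
      calc ‖x‖ ^ 2 ≤ Real.sqrt ‖y‖ ^ 2 := by gcongr
        _ = ‖y‖ := Real.sq_sqrt (norm_nonneg _)

@[simp] theorem app_dag {F G : IHom A W} (η : F ⟶ G) (a : A) : app (dag η) a = dag (app η a) := rfl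
@[simp] theorem app_add {F G : IHom A W} (η θ : F ⟶ G) (a : A) :
    app (η + θ) a = app η a + app θ a := rfl
@[simp] theorem app_smul {F G : IHom A W} (c : ℂ) (η : F ⟶ G) (a : A) :
    app (c • η) a = c • app η a := rfl

theorem norm_app_le {F G : IHom A W} (η : F ⟶ G) (a : A) : ‖app η a‖ ≤ ‖η‖ := norm_le_sub η a

theorem norm_le {F G : IHom A W} (η : F ⟶ G) {C : ℝ} (hC : 0 ≤ C) (h : ∀ a, ‖app η a‖ ≤ C) :
    ‖η‖ ≤ C := norm_sub_le (F := F) (G := G) η hC h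

section

attribute [local instance] CStarAlgebra.spectralOrder CStarAlgebra.spectralOrderedRing

open scoped NNReal

/-- A self-adjoint element `x` of a C*-algebra is positive if and only if `‖ ‖x‖ - x ‖ ≤ ‖x‖`.
For the supremum norm this can be checked on the components, so `f* ∘ f` is positive
in the C*-algebra of endomorphisms. -/
theorem comp_dag_nonneg {F G : IHom A W} (η : F ⟶ G) : (0 : End F) ≤ End.of (η ≫ dag η) := by
  set x : End F := End.of (η ≫ dag η)
  have hx : IsSelfAdjoint x := by
    change dag (η ≫ dag η) = η ≫ dag η
    rw [dag_comp, dag_dag]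
  refine nonneg_iff_isSelfAdjoint_and_quasispectrumRestricts.mpr ⟨hx, ?_⟩
  refine (SpectrumRestricts.nnreal_iff_nnnorm (t := ‖x‖₊) hx le_rfl).mpr ?_
  refine norm_le (F := F) (G := F) (algebraMap ℝ (End F) ‖x‖₊ - x) (norm_nonneg x) fun a => ?_
  set y : End (F.fn.obj a) := End.of (app η a ≫ dag (app η a))
  have hy0 : 0 ≤ y := nonneg_of_mem_sqCone (sq_mem (app η a))
  obtain ⟨hy, hy'⟩ := nonneg_iff_isSelfAdjoint_and_quasispectrumRestricts.mp hy0
  have hle : ‖y‖₊ ≤ ‖x‖₊ := norm_app_le (F := F) (G := F) x a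
  have h := (SpectrumRestricts.nnreal_iff_nnnorm hy hle).mp hy'
  have h2 : app (F := F) (G := F) (algebraMap ℝ (End F) ‖x‖₊ - x) a =
      algebraMap ℝ (End (F.fn.obj a)) ‖x‖₊ - y := by
    rw [IsScalarTower.algebraMap_apply ℝ ℂ (End F), Algebra.algebraMap_eq_smul_one,
      IsScalarTower.algebraMap_apply ℝ ℂ (End (F.fn.obj a)), Algebra.algebraMap_eq_smul_one]
    rfl
  rw [h2]
  exact h

/-- Since `f* ∘ f` is positive, it has a positive square root in the endomorphisms of the source. -/
instance : CStarCategory (IHom A W) where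
  exists_comp_adj_eq f := by
    obtain ⟨g, hg⟩ := CStarAlgebra.nonneg_iff_eq_star_mul_self.mp (comp_dag_nonneg f)
    exact ⟨g, hg⟩

end

/-- The pointwise modification of a `*`-functor along a family of isometries whose range
projections commute with it. -/
def compress (F : StarFunctor A W) (Y : A → W) (i : ∀ a, Y a ⟶ F.obj a)
    (hi : ∀ a, i a ≫ dag (i a) = 𝟙 _)
    (hp : ∀ {a b : A} (f : a ⟶ b), (dag (i a) ≫ i a) ≫ F.map f = F.map f ≫ dag (i b) ≫ i b) :
    StarFunctor A W where
  obj := Y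
  map {a b} f := i a ≫ F.map f ≫ dag (i b)
  map_id a := by rw [F.map_id, Category.id_comp, hi]
  map_comp {a b c} f g := by
    have h := congrArg (fun t => t ≫ F.map g ≫ dag (i c)) (hp f)
    simp only [Category.assoc] at h
    rw [F.map_comp]
    simp only [Category.assoc]
    rw [← h, ← Category.assoc (i a) (dag (i a)), hi, Category.id_comp]
  map_add f g := by rw [F.map_add, Preadditive.add_comp, Preadditive.comp_add]
  map_smul c f := by rw [F.map_smul, Linear.smul_comp, Linear.comp_smul]
  map_dag f := by rw [F.map_dag]; simp

theorem norm_isometry_le {X Y : W} {i : X ⟶ Y} (hi : i ≫ dag i = 𝟙 X) : ‖i‖ ≤ 1 := by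
  have h := norm_comp_dag i
  rw [hi] at h
  nlinarith [norm_id_le X, norm_nonneg i]

/-- A projection in `[A, W]` is split pointwise; the functor is compressed along the chosen
isometries. -/
instance [IsKaroubiComplete W] : IsKaroubiComplete (IHom A W) where
  exists_splitting {F} p idem sa := by
    have h (a : A) := IsKaroubiComplete.exists_splitting (app p a)
      (congrArg (fun t => app t a) idem) (congrArg (fun t => app t a) sa)
    choose Y i hi hi' using h
    let G : IHom A W := ⟨compress F.fn Y i hi fun f => by
      rw [hi', hi', naturality]⟩
    have nat : ∀ {a b : A} (f : a ⟶ b), G.fn.map f ≫ i b = i a ≫ F.fn.map f := fun {a b} f => by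
      change (i a ≫ F.fn.map f ≫ dag (i b)) ≫ i b = _
      rw [Category.assoc, Category.assoc, hi', naturality, ← hi', Category.assoc,
        ← Category.assoc (i a) (dag (i a)), hi, Category.id_comp]
    refine ⟨G, mkHom (F := G) (G := F) i 1 (fun a => norm_isometry_le (hi a)) nat,
      hom_ext fun a => hi a, hom_ext fun a => hi' a⟩

/-- Orthogonal sums in `[A, W]` are pointwise. -/
instance [HasDirectSums W] : HasDirectSums (IHom A W) where
  exists_zero := by
    obtain ⟨Z, hZ⟩ := HasDirectSums.exists_zero (C := W)
    let H : IHom A W := ⟨{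
      obj := fun _ => Z
      map := fun _ => 0
      map_id := fun _ => hZ.symm
      map_comp := fun _ _ => by simp
      map_add := fun _ _ => by simp
      map_smul := fun _ _ => by simp
      map_dag := fun _ => by simp }⟩
    exact ⟨H, hom_ext fun _ => hZ⟩
  exists_sum F G := by
    have h (a : A) := HasDirectSums.exists_sum (F.fn.obj a) (G.fn.obj a)
    choose S i j hS using h
    have hl : ∀ a {Z : W} (g : F.fn.obj a ⟶ Z), i a ≫ dag (i a) ≫ g = g := fun a Z g => by
      rw [← Category.assoc, (hS a).left, Category.id_comp]
    have hr : ∀ a {Z : W} (g : G.fn.obj a ⟶ Z), j a ≫ dag (j a) ≫ g = g := fun a Z g => by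
      rw [← Category.assoc, (hS a).right, Category.id_comp]
    have ho : ∀ a {Z : W} (g : G.fn.obj a ⟶ Z), i a ≫ dag (j a) ≫ g = 0 := fun a Z g => by
      rw [← Category.assoc, (hS a).orth, Limits.zero_comp]
    have ho' : ∀ a {Z : W} (g : F.fn.obj a ⟶ Z), j a ≫ dag (i a) ≫ g = 0 := fun a Z g => by
      rw [← Category.assoc, (hS a).orth', Limits.zero_comp]
    let H : IHom A W := ⟨{
      obj := S
      map := fun {a b} f => dag (i a) ≫ F.fn.map f ≫ i b + dag (j a) ≫ G.fn.map f ≫ j b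
      map_id := fun a => by simp [(hS a).total]
      map_comp := fun f g => by simp [hl, hr, ho, ho']
      map_add := fun f g => by
        simp only [StarFunctor.map_add, Preadditive.add_comp, Preadditive.comp_add]
        abel
      map_smul := fun c f => by simp [StarFunctor.map_smul]
      map_dag := fun f => by simp [StarFunctor.map_dag] }⟩
    refine ⟨H, mkHom (F := F) (G := H) i 1 (fun a => norm_isometry_le (hS a).left)
        (fun f => by simp [H, hl, ho]),
      mkHom (F := G) (G := H) j 1 (fun a => norm_isometry_le (hS a).right)
        (fun f => by simp [H, hr, ho']), ⟨hom_ext fun a => (hS a).left,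
        hom_ext fun a => (hS a).right, hom_ext fun a => (hS a).orth,
        hom_ext fun a => (hS a).total⟩⟩

end IHom

namespace Clin

/-- The internal hom of `Clin`. -/
def ihom (A W : Clin.{u}) : Clin.{u} := ⟨IHom A W⟩

end Clin

/-! ### Elementary objects of the maximal tensor product -/

namespace Clin

variable {A B C D W A' B' : Clin.{u}}

/-- The `*`-functor underlying a 1-morphism of `Clin`. -/
abbrev fn (f : A ⟶ B) : StarFunctor A B := f

/-- The component of a 2-morphism of `Clin`. -/
def cell {f g : A ⟶ B} (η : f ⟶ g) (x : A) : (fn f).obj x ⟶ (fn g).obj x := StarFunctor.app η x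

/-- The object `a ⊠ b`, equipped with the identity projection. -/
def eltK (a : A) (b : B) : MaxTensor A B := ⟨⟨⟨a, b⟩⟩, 𝟙 _, Category.id_comp _, dag_id _⟩

/-- A morphism between objects with identity projections. -/
def homK {P Q : MaxTensor A B} (hP : P.p = 𝟙 _) (hQ : Q.p = 𝟙 _) (f : P.X ⟶ Q.X) : P ⟶ Q :=
  Karoubi.mkHom f (by rw [hP, Category.id_comp]) (by rw [hQ, Category.comp_id])

/-- The elementary tensor `f ⊗ g` in the completion. -/
def preTmul {a a' : A} {b b' : B} (f : a ⟶ a') (g : b ⟶ b') :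
    (⟨⟨a, b⟩⟩ : PreMaxTensor A B) ⟶ ⟨⟨a', b'⟩⟩ :=
  CStarCompletion.ofHom (AlgTensor.tmul (P := ⟨a, b⟩) (Q := ⟨a', b'⟩) f g)

/-- The object `a ⊠ b` of the maximal tensor product. -/
def elt (a : A) (b : B) : (A ⊠ B : Clin.{u}) := eltK a b

/-- The morphism `f ⊗ g` between elementary objects of the maximal tensor product. -/
def eltHom {a a' : A} {b b' : B} (f : a ⟶ a') (g : b ⟶ b') : elt a b ⟶ elt a' b' :=
  homK (P := eltK a b) (Q := eltK a' b') rfl rfl (preTmul f g)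

theorem eltHom_id (a : A) (b : B) : eltHom (𝟙 a) (𝟙 b) = 𝟙 (elt a b) := rfl

theorem preTmul_comp {a a' a'' : A} {b b' b'' : B} (f : a ⟶ a') (g : b ⟶ b') (f' : a' ⟶ a'')
    (g' : b' ⟶ b'') : preTmul f g ≫ preTmul f' g' = preTmul (f ≫ f') (g ≫ g') :=
  (CStarCompletion.ofHom_comp (N := maxSeminorm A B)
    (AlgTensor.tmul (P := ⟨a, b⟩) (Q := ⟨a', b'⟩) f g)
    (AlgTensor.tmul (P := ⟨a', b'⟩) (Q := ⟨a'', b''⟩) f' g')).symm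

theorem eltHom_comp {a a' a'' : A} {b b' b'' : B} (f : a ⟶ a') (g : b ⟶ b') (f' : a' ⟶ a'')
    (g' : b' ⟶ b'') : eltHom f g ≫ eltHom f' g' = eltHom (f ≫ f') (g ≫ g') :=
  Karoubi.hom_ext (preTmul_comp f g f' g')

theorem dag_eltHom {a a' : A} {b b' : B} (f : a ⟶ a') (g : b ⟶ b') :
    dag (eltHom f g) = eltHom (dag f) (dag g) :=
  Karoubi.hom_ext (CStarCompletion.ofHom_dag (N := maxSeminorm A B)
    (AlgTensor.tmul (P := ⟨a, b⟩) (Q := ⟨a', b'⟩) f g)).symm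

theorem preTmul_add_left {a a' : A} {b b' : B} (f f' : a ⟶ a') (g : b ⟶ b') :
    preTmul (f + f') g = preTmul f g + preTmul f' g := by
  refine Eq.trans ?_ (CStarCompletion.ofHom_add (N := maxSeminorm A B)
    (AlgTensor.tmul (P := ⟨a, b⟩) (Q := ⟨a', b'⟩) f g) (AlgTensor.tmul f' g))
  rw [← AlgTensor.add_tmul]
  rfl

theorem preTmul_add_right {a a' : A} {b b' : B} (f : a ⟶ a') (g g' : b ⟶ b') :
    preTmul f (g + g') = preTmul f g + preTmul f g' := by
  refine Eq.trans ?_ (CStarCompletion.ofHom_add (N := maxSeminorm A B)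
    (AlgTensor.tmul (P := ⟨a, b⟩) (Q := ⟨a', b'⟩) f g) (AlgTensor.tmul f g'))
  rw [← AlgTensor.tmul_add]
  rfl

theorem preTmul_smul_left {a a' : A} {b b' : B} (c : ℂ) (f : a ⟶ a') (g : b ⟶ b') :
    preTmul (c • f) g = c • preTmul f g := by
  refine Eq.trans ?_ (CStarCompletion.ofHom_smul (N := maxSeminorm A B) c
    (AlgTensor.tmul (P := ⟨a, b⟩) (Q := ⟨a', b'⟩) f g))
  rw [← AlgTensor.smul_tmul]
  rfl

theorem preTmul_smul_right {a a' : A} {b b' : B} (c : ℂ) (f : a ⟶ a') (g : b ⟶ b') :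
    preTmul f (c • g) = c • preTmul f g := by
  refine Eq.trans ?_ (CStarCompletion.ofHom_smul (N := maxSeminorm A B) c
    (AlgTensor.tmul (P := ⟨a, b⟩) (Q := ⟨a', b'⟩) f g))
  rw [← AlgTensor.tmul_smul]
  rfl

theorem eltHom_add_left {a a' : A} {b b' : B} (f f' : a ⟶ a') (g : b ⟶ b') :
    eltHom (f + f') g = eltHom f g + eltHom f' g :=
  Karoubi.hom_ext (preTmul_add_left f f' g)

theorem eltHom_add_right {a a' : A} {b b' : B} (f : a ⟶ a') (g g' : b ⟶ b') :
    eltHom f (g + g') = eltHom f g + eltHom f g' :=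
  Karoubi.hom_ext (preTmul_add_right f g g')

theorem eltHom_smul_left {a a' : A} {b b' : B} (c : ℂ) (f : a ⟶ a') (g : b ⟶ b') :
    eltHom (c • f) g = c • eltHom f g :=
  Karoubi.hom_ext (preTmul_smul_left c f g)

theorem eltHom_smul_right {a a' : A} {b b' : B} (c : ℂ) (f : a ⟶ a') (g : b ⟶ b') :
    eltHom f (c • g) = c • eltHom f g :=
  Karoubi.hom_ext (preTmul_smul_right c f g)

theorem isUnitary_eltHom {a a' : A} {b b' : B} {f : a ⟶ a'} {g : b ⟶ b'} (hf : IsUnitary f)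
    (hg : IsUnitary g) : IsUnitary (eltHom f g) := by
  constructor
  · rw [dag_eltHom, eltHom_comp, hf.1, hg.1, eltHom_id]
  · rw [dag_eltHom, eltHom_comp, hf.2, hg.2, eltHom_id]

/-- The embedding `a ↦ a ⊠ b`. -/
def eltLeft (b : B) : StarFunctor A (A ⊠ B : Clin.{u}) where
  obj a := elt a b
  map f := eltHom f (𝟙 b)
  map_id a := eltHom_id a b
  map_comp f g := by rw [eltHom_comp, Category.comp_id]
  map_add f g := eltHom_add_left f g _
  map_smul c f := eltHom_smul_left c f _
  map_dag f := by rw [dag_eltHom, dag_id]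

/-- The embedding `b ↦ a ⊠ b`. -/
def eltRight (a : A) : StarFunctor B (A ⊠ B : Clin.{u}) where
  obj b := elt a b
  map g := eltHom (𝟙 a) g
  map_id b := eltHom_id a b
  map_comp f g := by rw [eltHom_comp, Category.comp_id]
  map_add f g := eltHom_add_right _ f g
  map_smul c f := eltHom_smul_right c _ f
  map_dag f := by rw [dag_eltHom, dag_id]

end Clin

open Clin

/-! ### Functors of two variables and their extension to the maximal tensor product -/

/-- A bilinear functor of two variables which preserves the adjoint. -/
structure BiStar (A B W : Clin.{u}) where
  obj : A → B → W
  map {a a' : A} {b b' : B} (f : a ⟶ a') (g : b ⟶ b') : obj a b ⟶ obj a' b'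
  map_id (a : A) (b : B) : map (𝟙 a) (𝟙 b) = 𝟙 (obj a b)
  map_comp {a a' a'' : A} {b b' b'' : B} (f : a ⟶ a') (g : b ⟶ b') (f' : a' ⟶ a'')
    (g' : b' ⟶ b'') : map (f ≫ f') (g ≫ g') = map f g ≫ map f' g'
  map_add_left {a a' : A} {b b' : B} (f f' : a ⟶ a') (g : b ⟶ b') :
    map (f + f') g = map f g + map f' g
  map_add_right {a a' : A} {b b' : B} (f : a ⟶ a') (g g' : b ⟶ b') :
    map f (g + g') = map f g + map f g'
  map_smul_left {a a' : A} {b b' : B} (c : ℂ) (f : a ⟶ a') (g : b ⟶ b') :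
    map (c • f) g = c • map f g
  map_smul_right {a a' : A} {b b' : B} (c : ℂ) (f : a ⟶ a') (g : b ⟶ b') :
    map f (c • g) = c • map f g
  map_dag {a a' : A} {b b' : B} (f : a ⟶ a') (g : b ⟶ b') : map (dag f) (dag g) = dag (map f g)

namespace BiStar

variable {A B C W : Clin.{u}}

/-- Exchange of the two variables. -/
def flip (H : BiStar A B W) : BiStar B A W where
  obj b a := H.obj a b
  map g f := H.map f g
  map_id b a := H.map_id a b
  map_comp g f g' f' := H.map_comp f g f' g'
  map_add_left g g' f := H.map_add_right f g g'
  map_add_right g f f' := H.map_add_left f f' g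
  map_smul_left c g f := H.map_smul_right c f g
  map_smul_right c g f := H.map_smul_left c f g
  map_dag g f := H.map_dag f g

/-- The second variable is fixed. -/
def fixRight (H : BiStar A B W) (b : B) : StarFunctor A W where
  obj a := H.obj a b
  map f := H.map f (𝟙 b)
  map_id a := H.map_id a b
  map_comp f g := by rw [← H.map_comp, Category.comp_id]
  map_add f g := H.map_add_left f g _
  map_smul c f := H.map_smul_left c f _
  map_dag f := by rw [← H.map_dag, dag_id]

/-- The first variable is fixed. -/
def fixLeft (H : BiStar A B W) (a : A) : StarFunctor B W := H.flip.fixRight a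

theorem map_id_comp (H : BiStar A B W) {a a' : A} {b b' : B} (f : a ⟶ a') (g : b ⟶ b') :
    H.map f (𝟙 b) ≫ H.map (𝟙 a') g = H.map f g := by
  rw [← H.map_comp, Category.comp_id, Category.id_comp]

theorem map_comp_id (H : BiStar A B W) {a a' : A} {b b' : B} (f : a ⟶ a') (g : b ⟶ b') :
    H.map (𝟙 a) g ≫ H.map f (𝟙 b') = H.map f g := by
  rw [← H.map_comp, Category.comp_id, Category.id_comp]

/-- The functor of two variables, as a bilinear map on hom-spaces. -/
def mapLin (H : BiStar A B W) (a a' : A) (b b' : B) :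
    (a ⟶ a') →ₗ[ℂ] (b ⟶ b') →ₗ[ℂ] (H.obj a b ⟶ H.obj a' b') :=
  LinearMap.mk₂ ℂ (fun f g => H.map f g) H.map_add_left H.map_smul_left H.map_add_right
    (fun c f g => H.map_smul_right c f g)

/-- The induced linear map on the hom-spaces of the algebraic tensor product. -/
def algLin (H : BiStar A B W) (P Q : AlgTensor A B) :
    (P ⟶ Q) →ₗ[ℂ] (H.obj P.fst P.snd ⟶ H.obj Q.fst Q.snd) :=
  TensorProduct.lift (H.mapLin P.fst Q.fst P.snd Q.snd)

theorem algLin_tmul (H : BiStar A B W) {P Q : AlgTensor A B} (f : P.fst ⟶ Q.fst)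
    (g : P.snd ⟶ Q.snd) : H.algLin P Q (AlgTensor.tmul f g) = H.map f g := rfl

/-- The induced `*`-functor on the algebraic tensor product. -/
def alg (H : BiStar A B W) : StarFunctor (AlgTensor A B) W where
  obj P := H.obj P.fst P.snd
  map {P Q} t := H.algLin P Q t
  map_id P := H.map_id P.fst P.snd
  map_comp {P Q R} s t := by
    induction s using AlgTensor.hom_ind with
    | zero => simp
    | add s s' hs hs' =>
      rw [Preadditive.add_comp, _root_.map_add, _root_.map_add, hs, hs', Preadditive.add_comp]
    | tmul f g =>
      induction t using AlgTensor.hom_ind with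
      | zero => simp
      | add s s' hs hs' =>
        rw [Preadditive.comp_add, _root_.map_add, _root_.map_add, hs, hs', Preadditive.comp_add]
      | tmul f' g' =>
        rw [AlgTensor.tmul_comp, algLin_tmul, algLin_tmul, algLin_tmul, H.map_comp]
  map_add s t := _root_.map_add _ s t
  map_smul c t := _root_.map_smul _ c t
  map_dag {P Q} t := by
    induction t using AlgTensor.hom_ind with
    | zero => simp
    | add s s' hs hs' => simp only [dag_add, _root_.map_add, hs, hs']
    | tmul f g => rw [AlgTensor.dag_tmul, algLin_tmul, algLin_tmul, H.map_dag]

theorem norm_alg_map_le (H : BiStar A B W) {P Q : AlgTensor A B} (t : P ⟶ Q) :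
    ‖H.alg.map t‖ ≤ (maxSeminorm A B).nrm t :=
  (H.alg.norm_map_le_sqNorm t).trans (maxTensorNorm_eq_sqNorm t).ge

/-- The induced `*`-functor on the completed tensor product; the bound holds for every `*`-functor
to a C*-category, because the maximal norm is given by sums of squares. -/
def pre (H : BiStar A B W) : StarFunctor (PreMaxTensor A B) W :=
  CStarCompletion.lift H.alg H.norm_alg_map_le

theorem pre_map_preTmul (H : BiStar A B W) {a a' : A} {b b' : B} (f : a ⟶ a') (g : b ⟶ b') :
    H.pre.map (preTmul f g) = H.map f g :=
  CStarCompletion.lift_ofHom H.alg H.norm_alg_map_le _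

/-- The extension of a functor of two variables to the maximal tensor product. -/
def lift (H : BiStar A B W) : A ⊠ B ⟶ W :=
  (Karoubi.lift H.pre : StarFunctor (MaxTensor A B) W)

/-- The comparison of the extension with the original functor on elementary objects. -/
def liftIso (H : BiStar A B W) (a : A) (b : B) : (fn H.lift).obj (elt a b) ⟶ H.obj a b :=
  Karoubi.splitMap H.pre (eltK a b)

theorem isUnitary_liftIso (H : BiStar A B W) (a : A) (b : B) : IsUnitary (H.liftIso a b) :=
  Karoubi.isUnitary_splitMap H.pre (eltK a b) rfl

theorem lift_map (H : BiStar A B W) {a a' : A} {b b' : B} (f : a ⟶ a') (g : b ⟶ b') :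
    (fn H.lift).map (eltHom f g) ≫ H.liftIso a' b' = H.liftIso a b ≫ H.map f g := by
  rw [← H.pre_map_preTmul f g]
  exact Karoubi.lift_map_comp_splitMap H.pre (P := eltK a b) (Q := eltK a' b')
    (homK rfl rfl (preTmul f g))

/-- Currying: `a ↦ H (a, -)`. -/
def curry (H : BiStar A B W) : A ⟶ ihom B W :=
  ({ obj := fun a => (⟨H.fixLeft a⟩ : IHom B W)
     map := fun {a a'} f => IHom.mkHom (F := ⟨H.fixLeft a⟩) (G := ⟨H.fixLeft a'⟩)
      (fun b => H.map f (𝟙 b)) ‖f‖ (fun b => (H.fixRight b).norm_map_le f)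
      (fun g => (H.map_comp_id f g).trans (H.map_id_comp f g).symm)
     map_id := fun a => IHom.hom_ext fun b => H.map_id a b
     map_comp := fun f g => IHom.hom_ext fun b => (H.fixRight b).map_comp f g
     map_add := fun f g => IHom.hom_ext fun b => (H.fixRight b).map_add f g
     map_smul := fun c f => IHom.hom_ext fun b => (H.fixRight b).map_smul c f
     map_dag := fun f => IHom.hom_ext fun b => (H.fixRight b).map_dag f } :
    StarFunctor A (IHom B W))

/-- Uncurrying: `(a, b) ↦ G (a) (b)`, where a pair of morphisms acts through the diagonal of the
naturality square. -/
def uncurry (G : StarFunctor A (IHom B W)) : BiStar A B W where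
  obj a b := (G.obj a).fn.obj b
  map {a a' b b'} f g := IHom.app (G.map f) b ≫ (G.obj a').fn.map g
  map_id a b := by rw [G.map_id, IHom.app_id, (G.obj a).fn.map_id, Category.comp_id]
  map_comp {a a' a'' b b' b''} f g f' g' := by
    rw [G.map_comp, IHom.app_comp, (G.obj a'').fn.map_comp]
    simp only [Category.assoc]
    rw [← Category.assoc (IHom.app (G.map f') b), ← IHom.naturality, Category.assoc]
  map_add_left f f' g := by rw [G.map_add, IHom.app_add, Preadditive.add_comp]
  map_add_right f g g' := by rw [StarFunctor.map_add, Preadditive.comp_add]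
  map_smul_left c f g := by rw [G.map_smul, IHom.app_smul, Linear.smul_comp]
  map_smul_right c f g := by rw [StarFunctor.map_smul, Linear.comp_smul]
  map_dag f g := by
    rw [G.map_dag, IHom.app_dag, StarFunctor.map_dag, ← dag_comp, IHom.naturality]

end BiStar

open Clin Bicategory

/-! ### Pointed 1-morphisms -/

section Pointed

variable {A B C D A' B' A'' B'' : Clin.{u}}

/-- A trivialization of the 1-morphism `f` at `x`: a unitary from the image of `x` to the
prescribed object `y`. The pairs `(f, s)` are the 1-morphisms of the bicategory of objects of
`Clin` with a base point. -/
structure Tr (f : A ⟶ B) (x : A) (y : B) where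
  hom : (fn f).obj x ⟶ y
  unitary : IsUnitary hom

/-- A 2-morphism is compatible with trivializations of its source and target at a point. -/
def Respects {f g : A ⟶ B} {x : A} {y : B} (η : f ⟶ g) (s : Tr f x y) (t : Tr g x y) : Prop :=
  cell η x ≫ t.hom = s.hom

/-- Trivializations at two points intertwine the action of `f` on `m` with `m'`. -/
def Conj {f : A ⟶ B} {x x' : A} {y y' : B} (s : Tr f x y) (s' : Tr f x' y') (m : x ⟶ x')
    (m' : y ⟶ y') : Prop :=
  (fn f).map m ≫ s'.hom = s.hom ≫ m'

namespace Tr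

/-- The tautological trivialization. -/
def rfl' (f : A ⟶ B) (x : A) : Tr f x ((fn f).obj x) := ⟨𝟙 _, IsUnitary.id _⟩

/-- The trivialization of an identity. -/
def idt (x : A) : Tr (𝟙 A) x x := ⟨𝟙 x, IsUnitary.id x⟩

/-- The trivialization of a composition. -/
def cmp {f : A ⟶ B} {g : B ⟶ C} {x : A} {y : B} {z : C} (s : Tr f x y) (t : Tr g y z) :
    Tr (f ≫ g) x z :=
  ⟨(fn g).map s.hom ≫ t.hom, (s.unitary.map (fn g)).comp t.unitary⟩

/-- The comparison of the value of `f ⊠ g` at an elementary object with an elementary object. -/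
def kap (f : A ⟶ A') (g : B ⟶ B') (a : A) (b : B) :
    (fn (tmap maxTensor f g)).obj (elt a b) ⟶ elt ((fn f).obj a) ((fn g).obj b) :=
  homK (P := (maxMap (fn f) (fn g)).obj (eltK a b))
    (Q := eltK ((fn f).obj a) ((fn g).obj b)) ((preMaxMap (fn f) (fn g)).map_id _) rfl (𝟙 _)

theorem isUnitary_kap (f : A ⟶ A') (g : B ⟶ B') (a : A) (b : B) : IsUnitary (kap f g a b) := by
  constructor
  · refine Karoubi.hom_ext (C := PreMaxTensor A' B') ?_
    change 𝟙 _ ≫ dag (𝟙 _) = (preMaxMap (fn f) (fn g)).map (𝟙 _)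
    rw [(preMaxMap (fn f) (fn g)).map_id, dag_id, Category.id_comp]
  · refine Karoubi.hom_ext (C := PreMaxTensor A' B') ?_
    change dag (𝟙 _) ≫ 𝟙 _ = 𝟙 _
    rw [dag_id, Category.id_comp]

theorem preMaxMap_preTmul (f : A ⟶ A') (g : B ⟶ B') {a a' : A} {b b' : B} (m : a ⟶ a')
    (n : b ⟶ b') : (preMaxMap (fn f) (fn g)).map (preTmul m n) =
      preTmul ((fn f).map m) ((fn g).map n) :=
  CStarCompletion.map_ofHom (AlgTensor.map (fn f) (fn g)) (maxTensorNorm_map_le (fn f) (fn g)) _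

/-- The comparisons `kap` are natural in both variables. -/
theorem map_kap (f : A ⟶ A') (g : B ⟶ B') {a a' : A} {b b' : B} (m : a ⟶ a') (n : b ⟶ b') :
    (fn (tmap maxTensor f g)).map (eltHom m n) ≫ kap f g a' b' =
      kap f g a b ≫ eltHom ((fn f).map m) ((fn g).map n) := by
  refine Karoubi.hom_ext (C := PreMaxTensor A' B') ?_
  exact (Category.comp_id _).trans ((preMaxMap_preTmul f g m n).trans (Category.id_comp _).symm)

/-- The trivialization of a tensor product at an elementary object. -/
def tns {f : A ⟶ A'} {g : B ⟶ B'} {a : A} {a' : A'} {b : B} {b' : B'} (s : Tr f a a')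
    (t : Tr g b b') : Tr (tmap maxTensor f g) (elt a b) (elt a' b') :=
  ⟨kap f g a b ≫ eltHom s.hom t.hom,
    (isUnitary_kap f g a b).comp (isUnitary_eltHom s.unitary t.unitary)⟩

theorem cmp_hom {f : A ⟶ B} {g : B ⟶ C} {x : A} {y : B} {z : C} (s : Tr f x y) (t : Tr g y z) :
    (cmp s t).hom = (fn g).map s.hom ≫ t.hom := rfl

theorem tns_hom {f : A ⟶ A'} {g : B ⟶ B'} {a : A} {a' : A'} {b : B} {b' : B'} (s : Tr f a a')
    (t : Tr g b b') : (tns s t).hom = kap f g a b ≫ eltHom s.hom t.hom := rfl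

end Tr

open Tr

namespace Conj

theorem rfl' (f : A ⟶ B) {x x' : A} (m : x ⟶ x') :
    Conj (Tr.rfl' f x) (Tr.rfl' f x') m ((fn f).map m) :=
  (Category.comp_id _).trans (Category.id_comp _).symm

theorem idt {x x' : A} (m : x ⟶ x') : Conj (idt x) (idt x') m m :=
  (Category.comp_id _).trans (Category.id_comp _).symm

theorem cmp {f : A ⟶ B} {g : B ⟶ C} {x x' : A} {y y' : B} {z z' : C} {s : Tr f x y}
    {s' : Tr f x' y'} {t : Tr g y z} {t' : Tr g y' z'} {m : x ⟶ x'} {n : y ⟶ y'} {p : z ⟶ z'}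
    (h : Conj s s' m n) (k : Conj t t' n p) : Conj (cmp s t) (cmp s' t') m p := by
  change (fn g).map ((fn f).map m) ≫ (fn g).map s'.hom ≫ t'.hom =
    ((fn g).map s.hom ≫ t.hom) ≫ p
  rw [← Category.assoc, ← (fn g).map_comp, h, (fn g).map_comp, Category.assoc, k,
    Category.assoc]

theorem tns {f : A ⟶ A'} {g : B ⟶ B'} {a₁ a₂ : A} {a₁' a₂' : A'} {b₁ b₂ : B} {b₁' b₂' : B'}
    {s₁ : Tr f a₁ a₁'} {s₂ : Tr f a₂ a₂'} {t₁ : Tr g b₁ b₁'} {t₂ : Tr g b₂ b₂'} {m : a₁ ⟶ a₂}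
    {m' : a₁' ⟶ a₂'} {n : b₁ ⟶ b₂} {n' : b₁' ⟶ b₂'} (h : Conj s₁ s₂ m m') (k : Conj t₁ t₂ n n') :
    Conj (tns s₁ t₁) (tns s₂ t₂) (eltHom m n) (eltHom m' n') := by
  change (fn (tmap maxTensor f g)).map (eltHom m n) ≫ kap f g a₂ b₂ ≫ eltHom s₂.hom t₂.hom =
    (kap f g a₁ b₁ ≫ eltHom s₁.hom t₁.hom) ≫ eltHom m' n'
  rw [← Category.assoc, map_kap, Category.assoc, Category.assoc, eltHom_comp, eltHom_comp, h, k]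

end Conj

namespace Respects

variable {f g h : A ⟶ B} {x : A} {y : B}

theorem id (s : Tr f x y) : Respects (𝟙 f) s s := Category.id_comp _

theorem comp {η : f ⟶ g} {θ : g ⟶ h} {s : Tr f x y} {t : Tr g x y} {r : Tr h x y}
    (h₁ : Respects η s t) (h₂ : Respects θ t r) : Respects (η ≫ θ) s r := by
  change (cell η x ≫ cell θ x) ≫ r.hom = s.hom
  rw [Category.assoc, h₂, h₁]

theorem inv {η : f ≅ g} {s : Tr f x y} {t : Tr g x y} (h₁ : Respects η.hom s t) :
    Respects η.inv t s := by
  have h₂ : cell η.inv x ≫ cell η.hom x = 𝟙 _ :=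
    congrArg (fun θ => cell θ x) η.inv_hom_id
  change cell η.inv x ≫ s.hom = t.hom
  rw [← h₁, ← Category.assoc, h₂, Category.id_comp]

theorem whiskerLeft {k : C ⟶ A} {z : C} (r : Tr k z x) {η : f ⟶ g} {s : Tr f x y} {t : Tr g x y}
    (h₁ : Respects η s t) : Respects (k ◁ η) (cmp r s) (cmp r t) := by
  change cell η ((fn k).obj z) ≫ (fn g).map r.hom ≫ t.hom = (fn f).map r.hom ≫ s.hom
  rw [← h₁, ← Category.assoc, ← Category.assoc]
  exact congrArg (fun m => m ≫ t.hom) (StarFunctor.naturality η r.hom).symm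

theorem whiskerRight {k : B ⟶ C} {z : C} {η : f ⟶ g} {s : Tr f x y} {t : Tr g x y}
    (h₁ : Respects η s t) (r : Tr k y z) : Respects (η ▷ k) (cmp s r) (cmp t r) := by
  change (fn k).map (cell η x) ≫ (fn k).map t.hom ≫ r.hom = (fn k).map s.hom ≫ r.hom
  rw [← h₁, ← Category.assoc, (fn k).map_comp]

theorem assoc {f : A ⟶ B} {g : B ⟶ C} {h : C ⟶ D} {z : C} {w : D} (r : Tr f x y) (s : Tr g y z)
    (t : Tr h z w) : Respects (α_ f g h).hom (cmp (cmp r s) t) (cmp r (cmp s t)) := by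
  change 𝟙 _ ≫ (fn h).map ((fn g).map r.hom) ≫ (fn h).map s.hom ≫ t.hom =
    (fn h).map ((fn g).map r.hom ≫ s.hom) ≫ t.hom
  rw [Category.id_comp, (fn h).map_comp, Category.assoc]

theorem leftUnitor (s : Tr f x y) : Respects (λ_ f).hom (cmp (idt x) s) s := by
  change 𝟙 _ ≫ s.hom = (fn f).map (𝟙 x) ≫ s.hom
  rw [(fn f).map_id]

theorem rightUnitor (s : Tr f x y) : Respects (ρ_ f).hom (cmp s (idt y)) s := by
  change 𝟙 _ ≫ s.hom = s.hom ≫ 𝟙 _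
  rw [Category.id_comp, Category.comp_id]

/-- The component of a 2-morphism is determined by the trivializations which it respects. -/
theorem cell_eq {η θ : f ⟶ g} {s : Tr f x y} {t : Tr g x y} (h₁ : Respects η s t)
    (h₂ : Respects θ s t) : cell η x = cell θ x :=
  t.unitary.cancel_right (h₁.trans h₂.symm)

theorem tmap₂ {f f' : A ⟶ A'} {g g' : B ⟶ B'} {a : A} {a' : A'} {b : B} {b' : B'} {η : f ⟶ f'}
    {θ : g ⟶ g'} {s : Tr f a a'} {s' : Tr f' a a'} {t : Tr g b b'} {t' : Tr g' b b'}
    (h₁ : Respects η s s') (h₂ : Respects θ t t') :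
    Respects (maxTensor.map₂ (a := (A, B)) (b := (A', B')) (f := (f, g)) (g := (f', g')) (η, θ))
      (tns s t) (tns s' t') := by
  have h : cell (maxTensor.map₂ (a := (A, B)) (b := (A', B')) (f := (f, g)) (g := (f', g'))
      (η, θ)) (elt a b) ≫ kap f' g' a b = kap f g a b ≫ eltHom (cell η a) (cell θ b) := by
    refine Karoubi.hom_ext (C := PreMaxTensor A' B') ?_
    exact (Category.comp_id _).trans (congrArg (fun t => t ≫ preTmul (cell η a) (cell θ b))
      ((preMaxMap (fn f) (fn g)).map_id _))
  change cell _ (elt a b) ≫ kap f' g' a b ≫ eltHom s'.hom t'.hom =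
    kap f g a b ≫ eltHom s.hom t.hom
  rw [← Category.assoc, h, Category.assoc, eltHom_comp, h₁, h₂]

theorem id_comp_aux {T : Type*} [Category* T] {X : T} {a b : X ⟶ X} (ha : a = 𝟙 X)
    (hb : b = 𝟙 X) : (a ≫ 𝟙 X) ≫ b ≫ 𝟙 X = 𝟙 X := by simp [ha, hb]

theorem tcomp {f : A ⟶ A'} {g : B ⟶ B'} {f' : A' ⟶ A''} {g' : B' ⟶ B''} {a : A} {a' : A'}
    {a'' : A''} {b : B} {b' : B'} {b'' : B''} (s : Tr f a a') (s' : Tr f' a' a'')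
    (t : Tr g b b') (t' : Tr g' b' b'') :
    Respects (CStarLin.tcomp maxTensor f g f' g').hom (tns (cmp s s') (cmp t t'))
      (cmp (tns s t) (tns s' t')) := by
  have h : cell (CStarLin.tcomp maxTensor f g f' g').hom (elt a b) ≫
      (fn (tmap maxTensor f' g')).map (kap f g a b) ≫ kap f' g' ((fn f).obj a) ((fn g).obj b) =
      kap (f ≫ f') (g ≫ g') a b := by
    refine Karoubi.hom_ext (C := PreMaxTensor A'' B'') ?_
    have h₁ := (preMaxMap ((fn f).comp (fn f')) ((fn g).comp (fn g'))).map_id ⟨⟨a, b⟩⟩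
    have h₂ := (preMaxMap (fn f') (fn g')).map_id ⟨⟨(fn f).obj a, (fn g).obj b⟩⟩
    exact id_comp_aux (T := PreMaxTensor A'' B'') h₁ h₂
  rw [Respects, cmp_hom, tns_hom, tns_hom, tns_hom, cmp_hom, cmp_hom, ← h,
    (fn (tmap maxTensor f' g')).map_comp, Category.assoc, ← Category.assoc _ (kap f' g' a' b'),
    map_kap, Category.assoc, eltHom_comp]
  exact ((Category.assoc _ _ _).trans (congrArg _ (Category.assoc _ _ _))).symm

theorem tid (a : A) (b : B) :
    Respects (CStarLin.tid maxTensor A B).hom (tns (idt a) (idt b)) (idt (elt a b)) := by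
  refine Karoubi.hom_ext (C := PreMaxTensor A B) ?_
  refine (Category.comp_id _).trans ((Category.comp_id _).trans ?_)
  exact ((preMaxMap (StarFunctor.id A) (StarFunctor.id B)).map_id _).trans
    (Category.id_comp _).symm

end Respects

end Pointed

/-! ### Generating families -/

theorem StarFunctor.map_sum {C D : Clin.{u}} (F : StarFunctor C D) {X Y : C} {κ : Type*}
    (s : Finset κ) (f : κ → (X ⟶ Y)) : F.map (∑ a ∈ s, f a) = ∑ a ∈ s, F.map (f a) :=
  _root_.map_sum (F.mapCLM X Y) f s

/-- A generating family of a C*-category: a family of objects and of morphisms between them,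
such that every identity is a finite sum of morphisms which factor through objects of the family,
and such that the linear combinations of the given morphisms are dense. A unitary natural
isomorphism between `*`-functors is determined by its components at the objects of the family, and
naturality has to be checked only on the given morphisms. -/
structure Gen {C : Clin.{u}} {ι : Type*} (S : ι → C) (M : ∀ i j, Set (S i ⟶ S j)) : Prop where
  gen (X : C) : ∃ (κ : Type) (_ : Fintype κ) (k : κ → ι) (v : ∀ a, X ⟶ S (k a))
    (w : ∀ a, S (k a) ⟶ X), ∑ a, v a ≫ w a = 𝟙 X
  dense {i j : ι} (f : S i ⟶ S j) : f ∈ (Submodule.span ℂ (M i j)).topologicalClosure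

namespace Gen

/-- All objects and all morphisms form a generating family. -/
theorem all (C : Clin.{u}) : Gen (fun X : C => X) (fun _ _ => Set.univ) where
  gen X := ⟨Unit, inferInstance, fun _ => X, fun _ => 𝟙 X, fun _ => 𝟙 X, by simp⟩
  dense f := Submodule.le_topologicalClosure _ (Submodule.subset_span trivial)

variable {C W : Clin.{u}} {ι : Type*} {S : ι → C} {M : ∀ i j, Set (S i ⟶ S j)}

/-- A closed linear condition on the morphisms between objects of the family has to be checked
only on the given morphisms. -/
theorem hom_ind (G : Gen S M) {i j : ι} (K : Submodule ℂ (S i ⟶ S j))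
    (hK : IsClosed (K : Set (S i ⟶ S j))) (h : ∀ m ∈ M i j, m ∈ K) (f : S i ⟶ S j) : f ∈ K :=
  Submodule.topologicalClosure_minimal _ (Submodule.span_le.mpr h) hK (G.dense f)

/-- A component at any object is recovered from components at generating objects, along a
decomposition of the identity. -/
theorem cell_eq_sum {H K : C ⟶ W} (α : H ⟶ K) {X : C} {κ : Type} [Fintype κ] {k : κ → ι}
    {v : ∀ a, X ⟶ S (k a)} {w : ∀ a, S (k a) ⟶ X} (h : ∑ a, v a ≫ w a = 𝟙 X) :
    cell α X = ∑ a, (fn H).map (v a) ≫ cell α (S (k a)) ≫ (fn K).map (w a) := by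
  have h₁ : ∀ a, (fn H).map (v a) ≫ cell α (S (k a)) ≫ (fn K).map (w a) =
      cell α X ≫ (fn K).map (v a ≫ w a) := fun a => by
    rw [← Category.assoc, (fn K).map_comp, ← Category.assoc]
    exact congrArg (fun t => t ≫ _) (StarFunctor.naturality α (v a))
  rw [Finset.sum_congr rfl fun a _ => h₁ a, ← Preadditive.comp_sum, ← StarFunctor.map_sum, h,
    (fn K).map_id, Category.comp_id]

/-- 2-morphisms are determined by their components at a generating family. -/
theorem hom_ext (G : Gen S M) {H K : C ⟶ W} {α β : H ⟶ K}
    (h : ∀ i, cell α (S i) = cell β (S i)) : α = β := by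
  refine StarFunctor.hom_ext fun X => ?_
  obtain ⟨κ, _, k, v, w, hvw⟩ := G.gen X
  refine (cell_eq_sum α hvw).trans (Eq.trans ?_ (cell_eq_sum β hvw).symm)
  simp only [h]

section Construction

variable (G : Gen S M) {H K : C ⟶ W} (φ : ∀ i, (fn H).obj (S i) ⟶ (fn K).obj (S i))

/-- Naturality is a closed linear condition, so it has to be checked only on the given morphisms. -/
theorem naturality (G : Gen S M) {H K : C ⟶ W} (φ : ∀ i, (fn H).obj (S i) ⟶ (fn K).obj (S i))
    (nat : ∀ i j, ∀ m ∈ M i j, (fn H).map m ≫ φ j = φ i ≫ (fn K).map m) {i j : ι}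
    (f : S i ⟶ S j) : (fn H).map f ≫ φ j = φ i ≫ (fn K).map f := by
  let L : Submodule ℂ (S i ⟶ S j) :=
    { carrier := {f | (fn H).map f ≫ φ j = φ i ≫ (fn K).map f}
      add_mem' := fun {f g} hf hg => by
        change (fn H).map (f + g) ≫ φ j = φ i ≫ (fn K).map (f + g)
        rw [StarFunctor.map_add, StarFunctor.map_add, Preadditive.add_comp, Preadditive.comp_add,
          hf, hg]
      zero_mem' := by
        change (fn H).map 0 ≫ φ j = φ i ≫ (fn K).map 0
        rw [StarFunctor.map_zero, StarFunctor.map_zero, Limits.zero_comp, Limits.comp_zero]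
      smul_mem' := fun c f hf => by
        change (fn H).map (c • f) ≫ φ j = φ i ≫ (fn K).map (c • f)
        rw [StarFunctor.map_smul, StarFunctor.map_smul, Linear.smul_comp, Linear.comp_smul, hf] }
  refine G.hom_ind L (isClosed_eq ?_ ?_) (nat i j) f
  · exact CStarCompletion.continuous_comp (StarFunctor.continuous_map (fn H) _ _) continuous_const
  · exact CStarCompletion.continuous_comp continuous_const (StarFunctor.continuous_map (fn K) _ _)

/-- The index set of a chosen decomposition of an identity. -/
def idx (X : C) : Type := (G.gen X).choose

instance (X : C) : Fintype (G.idx X) := (G.gen X).choose_spec.choose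

/-- The objects through which a chosen decomposition of an identity factors. -/
def idxObj (X : C) : G.idx X → ι := (G.gen X).choose_spec.choose_spec.choose

/-- The first factors of a chosen decomposition of an identity. -/
def inc (X : C) : ∀ a, X ⟶ S (G.idxObj X a) :=
  (G.gen X).choose_spec.choose_spec.choose_spec.choose

/-- The second factors of a chosen decomposition of an identity. -/
def ret (X : C) : ∀ a, S (G.idxObj X a) ⟶ X :=
  (G.gen X).choose_spec.choose_spec.choose_spec.choose_spec.choose

theorem sum_inc_ret (X : C) : ∑ a, G.inc X a ≫ G.ret X a = 𝟙 X :=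
  (G.gen X).choose_spec.choose_spec.choose_spec.choose_spec.choose_spec

/-- The extension of a family of morphisms from the generating objects to all objects. -/
def extApp (X : C) : (fn H).obj X ⟶ (fn K).obj X :=
  ∑ a, (fn H).map (G.inc X a) ≫ φ (G.idxObj X a) ≫ (fn K).map (G.ret X a)

theorem map_comp_extApp
    (nat : ∀ i j, ∀ m ∈ M i j, (fn H).map m ≫ φ j = φ i ≫ (fn K).map m)
    {i : ι} {X : C} (f : S i ⟶ X) :
    (fn H).map f ≫ G.extApp φ X = φ i ≫ (fn K).map f := by
  have h : ∀ a, (fn H).map f ≫ (fn H).map (G.inc X a) ≫ φ (G.idxObj X a) ≫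
      (fn K).map (G.ret X a) = φ i ≫ (fn K).map f ≫ (fn K).map (G.inc X a ≫ G.ret X a) :=
      fun a => by
    rw [← Category.assoc, ← (fn H).map_comp, ← Category.assoc, G.naturality φ nat,
      (fn K).map_comp, (fn K).map_comp]
    simp only [Category.assoc]
  rw [extApp, Preadditive.comp_sum, Finset.sum_congr rfl fun a _ => h a, ← Preadditive.comp_sum,
    ← Preadditive.comp_sum, ← StarFunctor.map_sum, G.sum_inc_ret, (fn K).map_id, Category.comp_id]

theorem extApp_naturality
    (nat : ∀ i j, ∀ m ∈ M i j, (fn H).map m ≫ φ j = φ i ≫ (fn K).map m)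
    {X Y : C} (f : X ⟶ Y) :
    (fn H).map f ≫ G.extApp φ Y = G.extApp φ X ≫ (fn K).map f := by
  have h : (fn H).map f = ∑ a, (fn H).map (G.inc X a) ≫ (fn H).map (G.ret X a ≫ f) := by
    have h₁ : ∀ a, (fn H).map (G.inc X a) ≫ (fn H).map (G.ret X a ≫ f) =
        (fn H).map (G.inc X a ≫ G.ret X a) ≫ (fn H).map f := fun a => by
      rw [← (fn H).map_comp, ← (fn H).map_comp, Category.assoc]
    rw [Finset.sum_congr rfl fun a _ => h₁ a, ← Preadditive.sum_comp, ← StarFunctor.map_sum,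
      G.sum_inc_ret, (fn H).map_id, Category.id_comp]
  rw [h, Preadditive.sum_comp]
  conv_rhs => rw [extApp, Preadditive.sum_comp]
  refine Finset.sum_congr rfl fun a _ => ?_
  rw [Category.assoc, G.map_comp_extApp φ nat, (fn K).map_comp]
  simp only [Category.assoc]

theorem extApp_self
    (nat : ∀ i j, ∀ m ∈ M i j, (fn H).map m ≫ φ j = φ i ≫ (fn K).map m)
    (i : ι) : G.extApp φ (S i) = φ i := by
  have h := G.map_comp_extApp φ nat (𝟙 (S i))
  rwa [(fn H).map_id, (fn K).map_id, Category.id_comp, Category.comp_id] at h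

/-- The adjoint of `extApp` is computed with the adjoint decomposition of the identity; both
decompositions cancel by naturality. -/
theorem isUnitary_extApp
    (nat : ∀ i j, ∀ m ∈ M i j, (fn H).map m ≫ φ j = φ i ≫ (fn K).map m)
    (uni : ∀ i, IsUnitary (φ i)) (X : C) : IsUnitary (G.extApp φ X) := by
  have hd : dag (G.extApp φ X) = ∑ a, (fn K).map (dag (G.ret X a)) ≫ dag (φ (G.idxObj X a)) ≫
      (fn H).map (dag (G.inc X a)) := by
    rw [extApp, dag_sum]
    simp only [dag_comp, StarFunctor.map_dag, Category.assoc]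
  have hs : ∑ a, dag (G.ret X a) ≫ dag (G.inc X a) = 𝟙 X := by
    have h := congrArg dag (G.sum_inc_ret X)
    rw [dag_sum, dag_id] at h
    simpa only [dag_comp] using h
  constructor
  · have h : ∀ a, G.extApp φ X ≫ (fn K).map (dag (G.ret X a)) ≫ dag (φ (G.idxObj X a)) ≫
        (fn H).map (dag (G.inc X a)) = (fn H).map (dag (G.ret X a) ≫ dag (G.inc X a)) := fun a => by
      rw [← Category.assoc, ← G.extApp_naturality φ nat, G.extApp_self φ nat, Category.assoc,
        (uni _).hom_dag_assoc, (fn H).map_comp]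
    rw [hd, Preadditive.comp_sum, Finset.sum_congr rfl fun a _ => h a, ← StarFunctor.map_sum, hs,
      (fn H).map_id]
  · have h : ∀ a, ((fn K).map (dag (G.ret X a)) ≫ dag (φ (G.idxObj X a)) ≫
        (fn H).map (dag (G.inc X a))) ≫ G.extApp φ X =
        (fn K).map (dag (G.ret X a) ≫ dag (G.inc X a)) := fun a => by
      simp only [Category.assoc]
      rw [G.map_comp_extApp φ nat, (uni _).dag_hom_assoc, (fn K).map_comp]
    rw [hd, Preadditive.sum_comp, Finset.sum_congr rfl fun a _ => h a, ← StarFunctor.map_sum, hs,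
      (fn K).map_id]

end Construction

/-- Two `*`-functors with trivializations at a generating family which intertwine their values on
the generating morphisms with the same morphisms are isomorphic. -/
def iso (G : Gen S M) {H K : C ⟶ W} {y : ι → W} (s : ∀ i, Tr H (S i) (y i))
    (t : ∀ i, Tr K (S i) (y i))
    (nat : ∀ i j, ∀ m ∈ M i j, ∃ m', Conj (s i) (s j) m m' ∧ Conj (t i) (t j) m m') : H ≅ K :=
  have nat' : ∀ i j, ∀ m ∈ M i j, (fn H).map m ≫ (s j).hom ≫ dag (t j).hom =
      ((s i).hom ≫ dag (t i).hom) ≫ (fn K).map m := fun i j m hm => by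
    obtain ⟨m', h, h'⟩ := nat i j m hm
    rw [← Category.assoc, h, Category.assoc, Category.assoc,
      (t i).unitary.dag_comm (t j).unitary h']
  StarFunctor.mkIso (F := fn H) (G := fn K) (G.extApp fun i => (s i).hom ≫ dag (t i).hom)
    (G.extApp_naturality _ nat')
    (G.isUnitary_extApp _ nat' fun i => (s i).unitary.comp (t i).unitary.dag)

/-- The 2-morphism `Gen.iso` is compatible with the trivializations from which it is constructed. -/
theorem respects_iso (G : Gen S M) {H K : C ⟶ W} {y : ι → W} (s : ∀ i, Tr H (S i) (y i))
    (t : ∀ i, Tr K (S i) (y i))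
    (nat : ∀ i j, ∀ m ∈ M i j, ∃ m', Conj (s i) (s j) m m' ∧ Conj (t i) (t j) m m') (i : ι) :
    Respects (G.iso s t nat).hom (s i) (t i) := by
  have nat' : ∀ i j, ∀ m ∈ M i j, (fn H).map m ≫ (s j).hom ≫ dag (t j).hom =
      ((s i).hom ≫ dag (t i).hom) ≫ (fn K).map m := fun i j m hm => by
    obtain ⟨m', h, h'⟩ := nat i j m hm
    rw [← Category.assoc, h, Category.assoc, Category.assoc,
      (t i).unitary.dag_comm (t j).unitary h']
  change (G.extApp fun i => (s i).hom ≫ dag (t i).hom) (S i) ≫ (t i).hom = (s i).hom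
  rw [G.extApp_self _ nat', Category.assoc, (t i).unitary.2, Category.comp_id]

/-- 2-morphisms which respect the same trivializations at a generating family are equal. -/
theorem ext_of_respects (G : Gen S M) {H K : C ⟶ W} {α β : H ⟶ K} {y : ι → W}
    {s : ∀ i, Tr H (S i) (y i)} {t : ∀ i, Tr K (S i) (y i)} (hα : ∀ i, Respects α (s i) (t i))
    (hβ : ∀ i, Respects β (s i) (t i)) : α = β :=
  G.hom_ext fun i => (hα i).cell_eq (hβ i)

/-! The elementary tensors of generating families generate the maximal tensor product. -/

section Tensor

variable {A B : Clin.{u}}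

/-- Every object of the maximal tensor product is a retract of an elementary object. -/
theorem exists_retract (P : (A ⊠ B : Clin.{u})) :
    ∃ (a : A) (b : B) (v : P ⟶ elt a b) (w : elt a b ⟶ P), v ≫ w = 𝟙 P := by
  let P' : MaxTensor A B := P
  let Q : MaxTensor A B := eltK P'.X.as.fst P'.X.as.snd
  exact ⟨P'.X.as.fst, P'.X.as.snd,
    Karoubi.mkHom (P := P') (Q := Q) P'.p P'.idem (Category.comp_id _),
    Karoubi.mkHom (P := Q) (Q := P') P'.p (Category.id_comp _) P'.idem,
    Karoubi.hom_ext (C := PreMaxTensor A B) P'.idem⟩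

theorem continuous_homK (a a' : A) (b b' : B) :
    Continuous fun f : (⟨⟨a, b⟩⟩ : PreMaxTensor A B) ⟶ ⟨⟨a', b'⟩⟩ =>
      (homK (P := eltK a b) (Q := eltK a' b') rfl rfl f : eltK a b ⟶ eltK a' b') :=
  Continuous.subtype_mk continuous_id _

/-- The elementary tensors span a dense subspace. -/
theorem elt_hom_ind {a a' : A} {b b' : B} (K : Submodule ℂ (elt a b ⟶ elt a' b'))
    (hK : IsClosed (K : Set (elt a b ⟶ elt a' b'))) (h : ∀ f g, eltHom f g ∈ K)
    (f : elt a b ⟶ elt a' b') : f ∈ K := by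
  refine CStarCompletion.hom_ind (N := maxSeminorm A B) (X := ⟨⟨a, b⟩⟩) (Y := ⟨⟨a', b'⟩⟩)
    (p := fun f => (homK (P := eltK a b) (Q := eltK a' b') rfl rfl f : elt a b ⟶ elt a' b') ∈ K)
    (Karoubi.val (P := eltK a b) (Q := eltK a' b') f)
    (hK.preimage (continuous_homK a a' b b')) fun t => ?_
  induction t using AlgTensor.hom_ind with
  | zero =>
    rw [CStarCompletion.ofHom_zero]
    exact K.zero_mem
  | tmul f g => exact h f g
  | add s t hs ht =>
    rw [CStarCompletion.ofHom_add]
    exact K.add_mem hs ht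

/-- The elementary objects and elementary tensors of two generating families generate the maximal
tensor product: decompositions of identities are tensored, and density is checked in one variable
at a time. -/
theorem tensor {ι' : Type*} {S : ι → A} {M : ∀ i j, Set (S i ⟶ S j)} {S' : ι' → B}
    {M' : ∀ i j, Set (S' i ⟶ S' j)} (G : Gen S M) (G' : Gen S' M') :
    Gen (C := A ⊠ B) (fun p : ι × ι' => elt (S p.1) (S' p.2))
      (fun p q => {h | ∃ f ∈ M p.1 q.1, ∃ g ∈ M' p.2 q.2, eltHom f g = h}) where
  gen P := by
    obtain ⟨a, b, v, w, hvw⟩ := exists_retract P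
    refine ⟨G.idx a × G'.idx b, inferInstance, fun x => (G.idxObj a x.1, G'.idxObj b x.2),
      fun x => v ≫ eltHom (G.inc a x.1) (G'.inc b x.2),
      fun x => eltHom (G.ret a x.1) (G'.ret b x.2) ≫ w, ?_⟩
    have h : ∑ x : G.idx a × G'.idx b, eltHom (G.inc a x.1) (G'.inc b x.2) ≫
        eltHom (G.ret a x.1) (G'.ret b x.2) = 𝟙 (elt a b) := by
      have h₁ : ∀ x : G.idx a, ∑ y : G'.idx b, eltHom (G.inc a x) (G'.inc b y) ≫
          eltHom (G.ret a x) (G'.ret b y) = eltHom (G.inc a x ≫ G.ret a x) (𝟙 b) := fun x => by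
        simp only [eltHom_comp]
        rw [← G'.sum_inc_ret b]
        exact (_root_.map_sum (AddMonoidHom.mk' (fun g => eltHom (G.inc a x ≫ G.ret a x) g)
          (eltHom_add_right _)) _ _).symm
      rw [Fintype.sum_prod_type, Finset.sum_congr rfl fun x _ => h₁ x, ← eltHom_id,
        ← G.sum_inc_ret a]
      exact (_root_.map_sum (AddMonoidHom.mk' (fun f => eltHom f (𝟙 b))
          (fun f f' => eltHom_add_left f f' _)) _ _).symm
    have h₂ : ∀ x : G.idx a × G'.idx b, (v ≫ eltHom (G.inc a x.1) (G'.inc b x.2)) ≫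
        eltHom (G.ret a x.1) (G'.ret b x.2) ≫ w = v ≫ (eltHom (G.inc a x.1) (G'.inc b x.2) ≫
        eltHom (G.ret a x.1) (G'.ret b x.2)) ≫ w := fun x => by simp only [Category.assoc]
    rw [Finset.sum_congr rfl fun x _ => h₂ x, ← Preadditive.comp_sum, ← Preadditive.sum_comp, h,
      Category.id_comp, hvw]
  dense {p q} f := by
    set K := (Submodule.span ℂ {h : elt (S p.1) (S' p.2) ⟶ elt (S q.1) (S' q.2) |
      ∃ f ∈ M p.1 q.1, ∃ g ∈ M' p.2 q.2, eltHom f g = h}).topologicalClosure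
    have hK : IsClosed (K : Set (elt (S p.1) (S' p.2) ⟶ elt (S q.1) (S' q.2))) :=
      Submodule.isClosed_topologicalClosure _
    refine elt_hom_ind K hK (fun f g => ?_) f
    have h₁ : ∀ (f : S p.1 ⟶ S q.1) (g), g ∈ M' p.2 q.2 → eltHom f g ∈ K := fun f g hg => by
      let L : (S p.1 ⟶ S q.1) →ₗ[ℂ] (elt (S p.1) (S' p.2) ⟶ elt (S q.1) (S' q.2)) :=
        { toFun := fun f => eltHom f g
          map_add' := fun f f' => eltHom_add_left f f' g
          map_smul' := fun c f => eltHom_smul_left c f g }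
      have hL : Continuous L := by
        have h : ∀ f, L f = (eltLeft (A := A) (S' p.2)).map f ≫ eltHom (𝟙 _) g := fun f => by
          change eltHom f g = eltHom f (𝟙 _) ≫ eltHom (𝟙 _) g
          rw [eltHom_comp, Category.comp_id, Category.id_comp]
        rw [show (L : _ → _) = _ from funext h]
        exact CStarCompletion.continuous_comp (StarFunctor.continuous_map _ _ _) continuous_const
      exact G.hom_ind (K.comap L) (hK.preimage hL) (fun f hf =>
        Submodule.le_topologicalClosure _ (Submodule.subset_span ⟨f, hf, g, hg, rfl⟩)) f
    let L : (S' p.2 ⟶ S' q.2) →ₗ[ℂ] (elt (S p.1) (S' p.2) ⟶ elt (S q.1) (S' q.2)) :=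
      { toFun := fun g => eltHom f g
        map_add' := fun g g' => eltHom_add_right f g g'
        map_smul' := fun c g => eltHom_smul_right c f g }
    have hL : Continuous L := by
      have h : ∀ g, L g = eltHom f (𝟙 _) ≫ (eltRight (B := B) (S q.1)).map g := fun g => by
        change eltHom f g = eltHom f (𝟙 _) ≫ eltHom (𝟙 _) g
        rw [eltHom_comp, Category.comp_id, Category.id_comp]
      rw [show (L : _ → _) = _ from funext h]
      exact CStarCompletion.continuous_comp continuous_const (StarFunctor.continuous_map _ _ _)
    exact G'.hom_ind (K.comap L) (hK.preimage hL) (fun g hg => h₁ f g hg) g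

end Tensor

end Gen

/-! ### The category of finite-dimensional Hilbert spaces -/

/-- The natural numbers, as the objects of a skeleton of the category of finite-dimensional Hilbert
spaces. -/
structure Hilb : Type u where
  dim : ULift.{u} ℕ

namespace Hilb

/-- The standard basis of the Hilbert space of a given dimension. -/
abbrev Ix (n : Hilb.{u}) : Type u := ULift.{u} (Fin n.dim.down)

/-- The Hilbert space of a given dimension. -/
abbrev space (n : Hilb.{u}) : Type u := EuclideanSpace ℂ n.Ix

instance : Category.{u} Hilb.{u} where
  Hom n m := n.space →L[ℂ] m.space
  id n := ContinuousLinearMap.id ℂ n.space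
  comp f g := g ∘L f

/-- The linear map underlying a morphism. -/
abbrev lin {n m : Hilb.{u}} (f : n ⟶ m) : n.space →L[ℂ] m.space := f

theorem exists_isometryEquiv (F : Type*) [NormedAddCommGroup F] [InnerProductSpace ℂ F]
    [FiniteDimensional ℂ F] : ∃ n : Hilb.{u}, Nonempty (n.space ≃ₗᵢ[ℂ] F) :=
  ⟨⟨⟨Module.finrank ℂ F⟩⟩,
    ⟨((stdOrthonormalBasis ℂ F).reindex Equiv.ulift.symm).repr.symm⟩⟩

instance : CStarCategory Hilb.{u} where
  homGroup n m := inferInstanceAs (NormedAddCommGroup (n.space →L[ℂ] m.space))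
  homSpace n m := inferInstanceAs (NormedSpace ℂ (n.space →L[ℂ] m.space))
  homComplete n m := inferInstanceAs (CompleteSpace (n.space →L[ℂ] m.space))
  add_comp {n m k} f f' g := ContinuousLinearMap.comp_add (lin g) f f'
  comp_add {n m k} f g g' := ContinuousLinearMap.add_comp (lin g) g' f
  smul_comp {n m k} c f g := ContinuousLinearMap.ext fun x =>
    (lin g).map_smul c ((lin f) x)
  comp_smul {n m k} f c g := rfl
  adj {n m} f := ContinuousLinearMap.adjoint (lin f)
  adj_adj f := ContinuousLinearMap.adjoint_adjoint _
  adj_comp {n m k} f g := ContinuousLinearMap.adjoint_comp (lin g) f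
  adj_add f g := _root_.map_add ContinuousLinearMap.adjoint _ _
  adj_smul c f := LinearIsometryEquiv.map_smulₛₗ ContinuousLinearMap.adjoint _ _
  norm_comp_le {n m k} f g := by
    rw [mul_comm]
    exact ContinuousLinearMap.opNorm_comp_le (lin g) f
  norm_comp_adj {n m} f := by
    rw [sq]
    exact ContinuousLinearMap.norm_adjoint_comp_self (lin f)
  exists_comp_adj_eq {n m} f := by
    have h : (0 : n.space →L[ℂ] n.space) ≤ ContinuousLinearMap.adjoint
        (lin f) ∘L (lin f) := by
      rw [ContinuousLinearMap.nonneg_iff_isPositive]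
      exact ContinuousLinearMap.isPositive_adjoint_comp_self _
    obtain ⟨g, hg⟩ := CStarAlgebra.nonneg_iff_eq_star_mul_self.mp h
    exact ⟨g, hg⟩

theorem isometry_comp_dag {n m : Hilb.{u}} (f : n.space →ₗᵢ[ℂ] m.space) :
    (f.toContinuousLinearMap : n ⟶ m) ≫ dag (f.toContinuousLinearMap : n ⟶ m) = 𝟙 n :=
  f.adjoint_comp_self

instance : HasDirectSums Hilb.{u} where
  exists_zero := ⟨⟨⟨0⟩⟩, ContinuousLinearMap.ext fun x => Subsingleton.elim _ _⟩
  exists_sum n m := by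
    obtain ⟨k, ⟨e⟩⟩ := exists_isometryEquiv.{u} (WithLp 2 (n.space × m.space))
    let i : n.space →ₗᵢ[ℂ] k.space := e.symm.toLinearIsometry.comp
      ⟨(WithLp.linearEquiv 2 ℂ (n.space × m.space)).symm.toLinearMap ∘ₗ LinearMap.inl ℂ _ _,
        fun x => by simp⟩
    let j : m.space →ₗᵢ[ℂ] k.space := e.symm.toLinearIsometry.comp
      ⟨(WithLp.linearEquiv 2 ℂ (n.space × m.space)).symm.toLinearMap ∘ₗ LinearMap.inr ℂ _ _,
        fun x => by simp⟩
    have hij : ∀ z : k.space, ∃ x y, z = i x + j y := fun z => by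
      refine ⟨(e z).fst, (e z).snd, ?_⟩
      apply e.injective
      rw [_root_.map_add]
      change e z = e (e.symm _) + e (e.symm _)
      rw [e.apply_symm_apply, e.apply_symm_apply]
      apply (WithLp.linearEquiv 2 ℂ (n.space × m.space)).injective
      rw [_root_.map_add]
      ext <;> simp
    let i' : n ⟶ k := i.toContinuousLinearMap
    let j' : m ⟶ k := j.toContinuousLinearMap
    have ho : i' ≫ dag j' = 0 := by
      refine ContinuousLinearMap.ext fun x => ext_inner_right ℂ fun y => ?_
      refine (ContinuousLinearMap.adjoint_inner_left j.toContinuousLinearMap y (i x)).trans ?_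
      refine (e.symm.inner_map_map _ _).trans ?_
      simp [WithLp.prod_inner_apply]
    have ho' : j' ≫ dag i' = 0 := by
      simpa only [dag_comp, dag_dag, dag_zero] using congrArg dag ho
    refine ⟨k, i', j', isometry_comp_dag i,
      isometry_comp_dag j, ho, ContinuousLinearMap.ext fun z => ?_⟩
    obtain ⟨x, y, rfl⟩ := hij z
    have h₁ := DFunLike.congr_fun (F := n.space →L[ℂ] n.space) (isometry_comp_dag i)
    have h₂ := DFunLike.congr_fun (F := m.space →L[ℂ] m.space) (isometry_comp_dag j)
    have h₃ := DFunLike.congr_fun (F := n.space →L[ℂ] m.space) ho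
    have h₄ := DFunLike.congr_fun (F := m.space →L[ℂ] n.space) ho'
    exact congrArg₂ (fun a b => i a + j b)
      (((lin (dag i')).map_add (i x) (j y)).trans
        ((congrArg₂ (· + ·) (h₁ x) (h₄ y)).trans (add_zero x)))
      (((lin (dag j')).map_add (i x) (j y)).trans
        ((congrArg₂ (· + ·) (h₃ x) (h₂ y)).trans (zero_add y)))

instance : IsKaroubiComplete Hilb.{u} where
  exists_splitting {n} p idem sa := by
    let q : n.space →L[ℂ] n.space := p
    obtain ⟨k, ⟨e⟩⟩ := exists_isometryEquiv.{u} (LinearMap.range (q : n.space →ₗ[ℂ] n.space))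
    let i : k.space →ₗᵢ[ℂ] n.space := (Submodule.subtypeₗᵢ _).comp e.toLinearIsometry
    let i' : k ⟶ n := i.toContinuousLinearMap
    have hi : i' ≫ dag i' = 𝟙 k := isometry_comp_dag i
    have h₁ : i' ≫ p = i' := ContinuousLinearMap.ext fun x => by
      obtain ⟨y, hy⟩ := (e x).2
      change q (e x : n.space) = (e x : n.space)
      rw [← hy]
      exact DFunLike.congr_fun (F := n.space →L[ℂ] n.space) idem y
    have h₂ : p ≫ dag i' ≫ i' = p := ContinuousLinearMap.ext fun x => by
      have hx : i (e.symm ⟨q x, x, rfl⟩) = q x := congrArg Subtype.val (e.apply_symm_apply _)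
      change i (lin (dag i') (q x)) = q x
      rw [← hx]
      exact congrArg i (DFunLike.congr_fun (F := k.space →L[ℂ] k.space) hi _)
    have h₃ : p ≫ dag i' = dag i' := by
      have := congrArg dag h₁
      rwa [dag_comp, sa] at this
    refine ⟨k, i', hi, ?_⟩
    rw [← h₃, Category.assoc, h₂]

/-- The coefficients of a linear map with respect to the standard bases. -/
def coeff {n m : Hilb.{u}} (f : n ⟶ m) (a : n.Ix) (b : m.Ix) : ℂ :=
  (lin f) (EuclideanSpace.single a 1) b

theorem coeff_comp {n m k : Hilb.{u}} (f : n ⟶ m) (g : m ⟶ k) (a : n.Ix) (c : k.Ix) :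
    coeff (f ≫ g) a c = ∑ b, coeff f a b * coeff g b c := by
  let g' : m.space →L[ℂ] k.space := g
  have h : ∀ x : m.space, g' x c = ∑ b, x b * coeff g b c := fun x => by
    conv_lhs => rw [← (EuclideanSpace.basisFun m.Ix ℂ).sum_repr x]
    simp [coeff, g']
  exact h _

theorem coeff_id (n : Hilb.{u}) (a b : n.Ix) : coeff (𝟙 n) a b = if a = b then 1 else 0 := by
  refine (PiLp.single_apply 2 ℂ a (1 : ℂ) b).trans ?_
  simp only [eq_comm]

theorem coeff_dag {n m : Hilb.{u}} (f : n ⟶ m) (a : n.Ix) (b : m.Ix) :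
    coeff (dag f) b a = star (coeff f a b) := by
  have h := ContinuousLinearMap.adjoint_inner_right (lin f)
    (EuclideanSpace.single a 1) (EuclideanSpace.single b 1)
  simp only [EuclideanSpace.inner_single_left, EuclideanSpace.inner_single_right, map_one,
    one_mul] at h
  exact h

/-- The one-dimensional Hilbert space. -/
def point : Hilb.{u} := ⟨⟨1⟩⟩

/-- The index of the basis vector of the one-dimensional Hilbert space. -/
def pointIx : point.{u}.Ix := ⟨(0 : Fin 1)⟩

theorem eq_pointIx (a : point.{u}.Ix) : a = pointIx :=
  congrArg ULift.up (Subsingleton.elim (α := Fin 1) _ _)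

end Hilb

/-- The unit of the maximal tensor product. -/
def one : Clin.{u} := ⟨Hilb.{u}⟩

/-- The one-dimensional Hilbert space, as an object of the unit. -/
def pt : one.{u} := Hilb.point

section Pick

variable {V : Clin.{u}}

/-- The index-wise chosen orthogonal sum of copies of an object. -/
def copies (x : V) (n : Hilb.{u}) : V := (exists_copies x n.dim.down).choose

/-- The inclusions of the copies. -/
def copyInc (x : V) (n : Hilb.{u}) (a : n.Ix) : x ⟶ copies x n :=
  (exists_copies x n.dim.down).choose_spec.choose a.down

theorem copyInc_comp_dag (x : V) (n : Hilb.{u}) (a b : n.Ix) :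
    copyInc x n a ≫ dag (copyInc x n b) = if a = b then 𝟙 x else 0 := by
  refine ((exists_copies x n.dim.down).choose_spec.choose_spec.1 a.down b.down).trans ?_
  simp only [ULift.ext_iff]

theorem sum_dag_comp_copyInc (x : V) (n : Hilb.{u}) :
    ∑ a, dag (copyInc x n a) ≫ copyInc x n a = 𝟙 (copies x n) :=
  (Equiv.sum_comp Equiv.ulift fun a => dag ((exists_copies x n.dim.down).choose_spec.choose a) ≫
    (exists_copies x n.dim.down).choose_spec.choose a).trans
    (exists_copies x n.dim.down).choose_spec.choose_spec.2

/-- The morphism between orthogonal sums of copies with a given matrix. -/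
def copyMap (x : V) {n m : Hilb.{u}} (c : n.Ix → m.Ix → ℂ) : copies x n ⟶ copies x m :=
  ∑ a, ∑ b, c a b • dag (copyInc x n a) ≫ copyInc x m b

theorem copyMap_comp (x : V) {n m k : Hilb.{u}} (c : n.Ix → m.Ix → ℂ) (d : m.Ix → k.Ix → ℂ) :
    copyMap x c ≫ copyMap x d = copyMap x fun a e => ∑ b, c a b * d b e := by
  have h : ∀ a b, (c a b • dag (copyInc x n a) ≫ copyInc x m b) ≫ copyMap x d =
      ∑ e, (c a b * d b e) • dag (copyInc x n a) ≫ copyInc x k e := fun a b => by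
    have h₁ : copyInc x m b ≫ copyMap x d = ∑ e, d b e • copyInc x k e := by
      have h₂ : ∀ b' e, copyInc x m b ≫ (d b' e • dag (copyInc x m b') ≫ copyInc x k e) =
          if b = b' then d b' e • copyInc x k e else 0 := fun b' e => by
        rw [Linear.comp_smul, ← Category.assoc, copyInc_comp_dag]
        split_ifs <;> simp
      simp only [copyMap, Preadditive.comp_sum, h₂]
      rw [Finset.sum_comm]
      simp
    rw [Linear.smul_comp, Category.assoc, h₁]
    simp only [Preadditive.comp_sum, Finset.smul_sum, Linear.comp_smul, smul_smul]
  have h₃ : copyMap x c ≫ copyMap x d =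
      ∑ a, ∑ b, (c a b • dag (copyInc x n a) ≫ copyInc x m b) ≫ copyMap x d := by
    conv_lhs => rw [copyMap]
    simp only [Preadditive.sum_comp]
  rw [h₃]
  simp only [h]
  simp only [copyMap, Finset.sum_smul]
  exact Finset.sum_congr rfl fun a _ => Finset.sum_comm

theorem copyMap_id (x : V) (n : Hilb.{u}) :
    copyMap x (fun a b : n.Ix => if a = b then (1 : ℂ) else 0) = 𝟙 (copies x n) := by
  rw [← sum_dag_comp_copyInc]
  simp [copyMap]

/-- The essentially unique `*`-functor from finite-dimensional Hilbert spaces which maps the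
one-dimensional space to a given object. -/
def pick (x : V) : one.{u} ⟶ V :=
  ({ obj := fun n => copies x n
     map := fun f => copyMap x (Hilb.coeff f)
     map_id := fun n => by
      rw [← copyMap_id]
      exact congrArg (copyMap x) (funext fun a => funext fun b => Hilb.coeff_id n a b)
     map_comp := fun f g => by
      rw [copyMap_comp]
      exact congrArg (copyMap x) (funext fun a => funext fun b => Hilb.coeff_comp f g a b)
     map_add := fun f g => by
      simp only [copyMap, ← Finset.sum_add_distrib, ← add_smul]
      rfl
     map_smul := fun c f => by
      simp only [copyMap, Finset.smul_sum, smul_smul]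
      rfl
     map_dag := fun {n m} f => by
      simp only [copyMap, dag_sum, dag_smul, dag_comp, dag_dag, ← Hilb.coeff_dag]
      exact Finset.sum_comm } :
    StarFunctor Hilb.{u} V)

/-- The value of `pick x` at the one-dimensional space is the given object. -/
def pickTr (x : V) : Tr (pick x) pt x := by
  refine ⟨(dag (copyInc x Hilb.point Hilb.pointIx) : copies x Hilb.point ⟶ x), ?_, ?_⟩
  · refine Eq.trans ?_ (sum_dag_comp_copyInc x Hilb.point)
    refine (congrArg (fun t => dag (copyInc x Hilb.point Hilb.pointIx) ≫ t) (dag_dag _)).trans ?_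
    exact (Fintype.sum_eq_single (f := fun a => dag (copyInc x Hilb.point a) ≫
      copyInc x Hilb.point a) Hilb.pointIx fun a ha => absurd (Hilb.eq_pointIx a) ha).symm
  · refine (congrArg (fun t => t ≫ dag (copyInc x Hilb.point Hilb.pointIx)) (dag_dag _)).trans ?_
    rw [copyInc_comp_dag, if_pos rfl]

end Pick

/-- The one-dimensional Hilbert space and its identity are a generating family. -/
theorem Gen.pt : Gen (C := one.{u}) (fun _ : Unit => pt.{u}) (fun _ _ => {𝟙 pt}) where
  gen n := by
    let n' : Hilb.{u} := n
    -- The coordinates and the standard basis vectors.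
    let v : Fin n'.dim.down → (n'.space →L[ℂ] Hilb.point.space) := fun a =>
      (EuclideanSpace.proj (⟨a⟩ : n'.Ix)).smulRight (EuclideanSpace.single Hilb.pointIx (1 : ℂ))
    let w : Fin n'.dim.down → (Hilb.point.space →L[ℂ] n'.space) := fun a =>
      (EuclideanSpace.proj Hilb.pointIx).smulRight (EuclideanSpace.single (⟨a⟩ : n'.Ix) (1 : ℂ))
    refine ⟨Fin n'.dim.down, inferInstance, fun _ => (), v, w, ?_⟩
    change ∑ a, (w a) ∘L (v a) = ContinuousLinearMap.id ℂ n'.space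
    ext x b
    rw [sum_apply]
    obtain ⟨b⟩ := b
    simp [v, w, Finset.sum_apply, Pi.single_apply]
  dense {_ _} f := by
    refine Submodule.le_topologicalClosure _ (Submodule.mem_span_singleton.mpr
      ⟨Hilb.coeff f Hilb.pointIx Hilb.pointIx, ?_⟩)
    let g : Hilb.point.space →L[ℂ] Hilb.point.space := f
    refine ContinuousLinearMap.ext fun (x : Hilb.point.space) => ?_
    change g (EuclideanSpace.single Hilb.pointIx 1) Hilb.pointIx • x = g x
    have hx : x = x Hilb.pointIx • EuclideanSpace.single Hilb.pointIx (1 : ℂ) := by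
      ext a
      rw [Hilb.eq_pointIx a]
      simp
    have hg : g x = x Hilb.pointIx • g (EuclideanSpace.single Hilb.pointIx 1) := by
      conv_lhs => rw [hx, _root_.map_smul]
    rw [hg]
    ext a
    rw [Hilb.eq_pointIx a]
    exact mul_comm _ _

/-! ### The associator and the unitors -/

theorem Conj.congr {A B : Clin.{u}} {f : A ⟶ B} {x x' : A} {y y' : B} {s : Tr f x y}
    {s' : Tr f x' y'} {m : x ⟶ x'} {m' m'' : y ⟶ y'} (h : Conj s s' m m') (e : m' = m'') :
    Conj s s' m m'' := e ▸ h

theorem Conj.id' {A B : Clin.{u}} {f : A ⟶ B} {x : A} {y : B} (s : Tr f x y) :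
    Conj s s (𝟙 x) (𝟙 y) :=
  ((congrArg (fun t => t ≫ s.hom) ((fn f).map_id x)).trans (Category.id_comp _)).trans
    (Category.comp_id _).symm

namespace BiStar

variable {A B C W X : Clin.{u}}

/-- The value of the extension at an elementary object. -/
def liftTr (H : BiStar A B W) (a : A) (b : B) : Tr H.lift (elt a b) (H.obj a b) :=
  ⟨H.liftIso a b, H.isUnitary_liftIso a b⟩

theorem conj_liftTr (H : BiStar A B W) {a a' : A} {b b' : B} (f : a ⟶ a') (g : b ⟶ b') :
    Conj (H.liftTr a b) (H.liftTr a' b') (eltHom f g) (H.map f g) :=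
  H.lift_map f g

theorem isUnitary_app {F G : IHom A W} {f : F ⟶ G} (hf : IsUnitary f) (a : A) :
    IsUnitary (IHom.app f a) := by
  constructor
  · rw [← IHom.app_dag, ← IHom.app_comp, hf.1, IHom.app_id]
  · rw [← IHom.app_dag, ← IHom.app_comp, hf.2, IHom.app_id]

/-- The extension of the functor of two variables given by a functor to an internal hom. -/
def ev (G : A ⟶ ihom B W) : A ⊠ B ⟶ W := (uncurry (fn G)).lift

/-- The extension of the functor of two variables given by a functor to an internal hom, with the
variables exchanged. -/
def evFlip (G : A ⟶ ihom B W) : B ⊠ A ⟶ W := (uncurry (fn G)).flip.lift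

variable {G : A ⟶ ihom B W}

/-- The value of `ev G` at `a ⊠ b` is the value at `b` of `G a`. -/
def evTr {a : A} {F : IHom B W} (s : Tr G a F) (b : B) : Tr (ev G) (elt a b) (F.fn.obj b) :=
  ⟨(uncurry (fn G)).liftIso a b ≫ IHom.app (G := F) s.hom b,
    ((uncurry (fn G)).isUnitary_liftIso a b).comp (isUnitary_app s.unitary b)⟩

/-- The value of `evFlip G` at `b ⊠ a` is the value at `b` of `G a`. -/
def evFlipTr {a : A} {F : IHom B W} (s : Tr G a F) (b : B) :
    Tr (evFlip G) (elt b a) (F.fn.obj b) :=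
  ⟨(uncurry (fn G)).flip.liftIso b a ≫ IHom.app (G := F) s.hom b,
    ((uncurry (fn G)).flip.isUnitary_liftIso b a).comp (isUnitary_app s.unitary b)⟩

theorem uncurry_map_comp {a a' : A} {F F' : IHom B W} {s : Tr G a F} {s' : Tr G a' F'} {m : a ⟶ a'}
    {m' : F ⟶ F'} (h : Conj s s' m m') {b b' : B} (n : b ⟶ b') :
    (uncurry (fn G)).map m n ≫ IHom.app (G := F') s'.hom b' =
      IHom.app (G := F) s.hom b ≫ IHom.app m' b ≫ F'.fn.map n := by
  have h₁ : IHom.app ((fn G).map m) b ≫ IHom.app (G := F') s'.hom b =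
      IHom.app (G := F) s.hom b ≫ IHom.app m' b := congrArg (fun t => IHom.app t b) h
  refine (Category.assoc _ _ _).trans ?_
  refine (congrArg (fun t => IHom.app ((fn G).map m) b ≫ t)
    (IHom.naturality (G := F') s'.hom n)).trans ?_
  rw [← Category.assoc, h₁, Category.assoc]

/-- The value of `ev G` at `m ⊗ n` is the diagonal of the naturality square of `G m` at `n`. -/
theorem conj_evTr {a a' : A} {F F' : IHom B W} {s : Tr G a F} {s' : Tr G a' F'} {m : a ⟶ a'}
    {m' : F ⟶ F'} (h : Conj s s' m m') {b b' : B} (n : b ⟶ b') :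
    Conj (evTr s b) (evTr s' b') (eltHom m n) (IHom.app m' b ≫ F'.fn.map n) :=
  (Category.assoc _ _ _).symm.trans ((congrArg (fun t => t ≫ IHom.app (G := F') s'.hom b')
    ((uncurry (fn G)).lift_map m n)).trans ((Category.assoc _ _ _).trans
      ((congrArg (fun t => (uncurry (fn G)).liftIso a b ≫ t) (uncurry_map_comp h n)).trans
        (Category.assoc _ _ _).symm)))

theorem conj_evFlipTr {a a' : A} {F F' : IHom B W} {s : Tr G a F} {s' : Tr G a' F'} {m : a ⟶ a'}
    {m' : F ⟶ F'} (h : Conj s s' m m') {b b' : B} (n : b ⟶ b') :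
    Conj (evFlipTr s b) (evFlipTr s' b') (eltHom n m) (IHom.app m' b ≫ F'.fn.map n) :=
  (Category.assoc _ _ _).symm.trans ((congrArg (fun t => t ≫ IHom.app (G := F') s'.hom b')
    ((uncurry (fn G)).flip.lift_map n m)).trans ((Category.assoc _ _ _).trans
      ((congrArg (fun t => (uncurry (fn G)).flip.liftIso b a ≫ t) (uncurry_map_comp h n)).trans
        (Category.assoc _ _ _).symm)))

/-- The functor `(a, b) ↦ a ⊠ b`. -/
def elts (A B : Clin.{u}) : BiStar A B (A ⊠ B) where
  obj a b := elt a b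
  map f g := eltHom f g
  map_id a b := eltHom_id a b
  map_comp f g f' g' := (eltHom_comp f g f' g').symm
  map_add_left f f' g := eltHom_add_left f f' g
  map_add_right f g g' := eltHom_add_right f g g'
  map_smul_left c f g := eltHom_smul_left c f g
  map_smul_right c f g := eltHom_smul_right c f g
  map_dag f g := (dag_eltHom f g).symm

/-- The functor of two variables with values in an internal hom obtained from the functor
`(a, b, c) ↦ K (a, H (b, c))` of three variables. -/
def nest (K : BiStar A X W) (H : BiStar B C X) : BiStar A B (ihom C W) where
  obj a b := (⟨(H.fixLeft b).comp (K.fixLeft a)⟩ : IHom C W)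
  map {a a' b b'} f g := IHom.mkHom (F := ⟨(H.fixLeft b).comp (K.fixLeft a)⟩)
    (G := ⟨(H.fixLeft b').comp (K.fixLeft a')⟩) (fun c => K.map f (H.map g (𝟙 c))) (‖f‖ * ‖g‖)
    (fun c => by
      refine (congrArg norm (K.map_id_comp f (H.map g (𝟙 c))).symm).le.trans ?_
      exact (norm_comp_le _ _).trans (mul_le_mul ((K.fixRight _).norm_map_le f)
        (((K.fixLeft a').norm_map_le _).trans ((H.fixRight c).norm_map_le g)) (norm_nonneg _)
        (norm_nonneg _)))
    (fun {c c'} h => by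
      change K.map (𝟙 a) (H.map (𝟙 b) h) ≫ K.map f (H.map g (𝟙 c')) =
        K.map f (H.map g (𝟙 c)) ≫ K.map (𝟙 a') (H.map (𝟙 b') h)
      rw [← K.map_comp, ← K.map_comp, H.map_comp_id, H.map_id_comp, Category.comp_id,
        Category.id_comp])
  map_id a b := IHom.hom_ext fun c => (congrArg (K.map (𝟙 a)) (H.map_id b c)).trans (K.map_id _ _)
  map_comp f g f' g' := IHom.hom_ext fun c => (congrArg (K.map (f ≫ f'))
    ((congrArg (H.map (g ≫ g')) (Category.comp_id (𝟙 c)).symm).trans (H.map_comp _ _ _ _))).trans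
      (K.map_comp _ _ _ _)
  map_add_left f f' g := IHom.hom_ext fun c => K.map_add_left _ _ _
  map_add_right f g g' := IHom.hom_ext fun c =>
    (congrArg (K.map f) (H.map_add_left _ _ _)).trans (K.map_add_right _ _ _)
  map_smul_left r f g := IHom.hom_ext fun c => K.map_smul_left _ _ _
  map_smul_right r f g := IHom.hom_ext fun c =>
    (congrArg (K.map f) (H.map_smul_left _ _ _)).trans (K.map_smul_right _ _ _)
  map_dag f g := IHom.hom_ext fun c => (congrArg (K.map (dag f))
    ((congrArg (H.map (dag g)) (dag_id c).symm).trans (H.map_dag _ _))).trans (K.map_dag _ _)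

theorem nest_map_comp (K : BiStar A X W) (H : BiStar B C X) {a a' : A} {b b' : B} {c c' : C}
    (f : a ⟶ a') (g : b ⟶ b') (h : c ⟶ c') :
    IHom.app (show (⟨(H.fixLeft b).comp (K.fixLeft a)⟩ : IHom C W) ⟶
      ⟨(H.fixLeft b').comp (K.fixLeft a')⟩ from (nest K H).map f g) c ≫
      ((H.fixLeft b').comp (K.fixLeft a')).map h = K.map f (H.map g h) := by
  change K.map f (H.map g (𝟙 c)) ≫ K.map (𝟙 a') (H.map (𝟙 b') h) = _
  rw [← K.map_comp, H.map_id_comp, Category.comp_id]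

end BiStar

open BiStar

section Structure

variable {A B C D A' B' C' : Clin.{u}}

/-- The associator. -/
def asc (A B C : Clin.{u}) : (A ⊠ B) ⊠ C ⟶ A ⊠ (B ⊠ C) :=
  ev (nest (elts A (B ⊠ C)) (elts B C)).lift

/-- The value of the associator at elementary objects. -/
def ascTr (a : A) (b : B) (c : C) : Tr (asc A B C) (elt (elt a b) c) (elt a (elt b c)) :=
  evTr ((nest (elts A (B ⊠ C)) (elts B C)).liftTr a b) c

theorem conj_ascTr {a a' : A} {b b' : B} {c c' : C} (f : a ⟶ a') (g : b ⟶ b') (h : c ⟶ c') :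
    Conj (ascTr a b c) (ascTr a' b' c') (eltHom (eltHom f g) h) (eltHom f (eltHom g h)) := by
  exact (conj_evTr ((nest (elts A (B ⊠ C)) (elts B C)).conj_liftTr f g) h).congr
    (nest_map_comp (elts A (B ⊠ C)) (elts B C) f g h)

/-- The inverse of the associator. -/
def ascInv (A B C : Clin.{u}) : A ⊠ (B ⊠ C) ⟶ (A ⊠ B) ⊠ C :=
  evFlip (nest (elts (A ⊠ B) C).flip (elts A B).flip).flip.lift

/-- The value of the inverse of the associator at elementary objects. -/
def ascInvTr (a : A) (b : B) (c : C) : Tr (ascInv A B C) (elt a (elt b c)) (elt (elt a b) c) :=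
  evFlipTr ((nest (elts (A ⊠ B) C).flip (elts A B).flip).flip.liftTr b c) a

theorem conj_ascInvTr {a a' : A} {b b' : B} {c c' : C} (f : a ⟶ a') (g : b ⟶ b') (h : c ⟶ c') :
    Conj (ascInvTr a b c) (ascInvTr a' b' c') (eltHom f (eltHom g h)) (eltHom (eltHom f g) h) := by
  exact (conj_evFlipTr ((nest (elts (A ⊠ B) C).flip (elts A B).flip).flip.conj_liftTr g h) f).congr
    (nest_map_comp (elts (A ⊠ B) C).flip (elts A B).flip h g f)

/-- The identity, as a point of the internal hom. -/
def idPt (A : Clin.{u}) : IHom A A := ⟨StarFunctor.id A⟩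

/-- The left unitor. -/
def lun (A : Clin.{u}) : one ⊠ A ⟶ A := ev (pick (V := ihom A A) (idPt A))

/-- The right unitor. -/
def run (A : Clin.{u}) : A ⊠ one ⟶ A := evFlip (pick (V := ihom A A) (idPt A))

/-- The value of the left unitor at elementary objects. -/
def lunTr (a : A) : Tr (lun A) (elt pt a) a := evTr (F := idPt A) (pickTr (V := ihom A A) _) a

/-- The value of the right unitor at elementary objects. -/
def runTr (a : A) : Tr (run A) (elt a pt) a := evFlipTr (F := idPt A) (pickTr (V := ihom A A) _) a

theorem conj_lunTr {a a' : A} (f : a ⟶ a') : Conj (lunTr a) (lunTr a') (eltHom (𝟙 pt) f) f := by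
  have h : IHom.app (𝟙 (idPt A)) a ≫ (idPt A).fn.map f = f :=
    (congrArg (fun t => t ≫ f) (IHom.app_id (idPt A) a)).trans (Category.id_comp f)
  exact (conj_evTr (Conj.id' (pickTr (V := ihom A A) (idPt A))) f).congr h

theorem conj_runTr {a a' : A} (f : a ⟶ a') : Conj (runTr a) (runTr a') (eltHom f (𝟙 pt)) f := by
  have h : IHom.app (𝟙 (idPt A)) a ≫ (idPt A).fn.map f = f :=
    (congrArg (fun t => t ≫ f) (IHom.app_id (idPt A) a)).trans (Category.id_comp f)
  exact (conj_evFlipTr (Conj.id' (pickTr (V := ihom A A) (idPt A))) f).congr h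

end Structure

/-! ### Propagation of trivializations along structural 2-morphisms -/

section RespectsTo

variable {A B C D A' B' A'' B'' : Clin.{u}}

/-- The 2-morphism `η` is compatible with `s` and `t`, where `t` is computed from `η` and `s` by
instance resolution. -/
class RespectsTo {f g : A ⟶ B} {x : A} {y : B} (η : f ⟶ g) (s : Tr f x y)
    (t : outParam (Tr g x y)) : Prop where
  out : Respects η s t

namespace RespectsTo

open Tr

variable {f g h : A ⟶ B} {x : A} {y : B} {s : Tr f x y} {t : Tr g x y} {r : Tr h x y}

instance id : RespectsTo (𝟙 f) s s := ⟨Respects.id s⟩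

instance comp {η : f ⟶ g} {θ : g ⟶ h} [h₁ : RespectsTo η s t] [h₂ : RespectsTo θ t r] :
    RespectsTo (η ≫ θ) s r := ⟨h₁.out.comp h₂.out⟩

instance refl_hom : RespectsTo (Iso.refl f).hom s s := ⟨Respects.id s⟩

instance refl_inv : RespectsTo (Iso.refl f).inv s s := ⟨Respects.id s⟩

instance trans_hom {η : f ≅ g} {θ : g ≅ h} [h₁ : RespectsTo η.hom s t] [h₂ : RespectsTo θ.hom t r] :
    RespectsTo (η ≪≫ θ).hom s r := ⟨h₁.out.comp h₂.out⟩

instance trans_inv {η : g ≅ f} {θ : h ≅ g} [h₁ : RespectsTo η.inv s t] [h₂ : RespectsTo θ.inv t r] :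
    RespectsTo (θ ≪≫ η).inv s r := ⟨h₁.out.comp h₂.out⟩

instance symm_hom {η : g ≅ f} [h₁ : RespectsTo η.inv s t] : RespectsTo η.symm.hom s t := ⟨h₁.out⟩

instance symm_inv {η : f ≅ g} [h₁ : RespectsTo η.hom s t] : RespectsTo η.symm.inv s t := ⟨h₁.out⟩

instance whiskerLeft {k : C ⟶ A} {z : C} {q : Tr k z x} {η : f ⟶ g} [h₁ : RespectsTo η s t] :
    RespectsTo (k ◁ η) (cmp q s) (cmp q t) := ⟨h₁.out.whiskerLeft q⟩

instance whiskerRight {k : B ⟶ C} {z : C} {q : Tr k y z} {η : f ⟶ g} [h₁ : RespectsTo η s t] :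
    RespectsTo (η ▷ k) (cmp s q) (cmp t q) := ⟨h₁.out.whiskerRight q⟩

instance whiskerLeftIso_hom {k : C ⟶ A} {z : C} {q : Tr k z x} {η : f ≅ g}
    [h₁ : RespectsTo η.hom s t] : RespectsTo (whiskerLeftIso k η).hom (cmp q s) (cmp q t) :=
  ⟨h₁.out.whiskerLeft q⟩

instance whiskerLeftIso_inv {k : C ⟶ A} {z : C} {q : Tr k z x} {η : g ≅ f}
    [h₁ : RespectsTo η.inv s t] : RespectsTo (whiskerLeftIso k η).inv (cmp q s) (cmp q t) :=
  ⟨h₁.out.whiskerLeft q⟩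

instance whiskerRightIso_hom {k : B ⟶ C} {z : C} {q : Tr k y z} {η : f ≅ g}
    [h₁ : RespectsTo η.hom s t] : RespectsTo (whiskerRightIso η k).hom (cmp s q) (cmp t q) :=
  ⟨h₁.out.whiskerRight q⟩

instance whiskerRightIso_inv {k : B ⟶ C} {z : C} {q : Tr k y z} {η : g ≅ f}
    [h₁ : RespectsTo η.inv s t] : RespectsTo (whiskerRightIso η k).inv (cmp s q) (cmp t q) :=
  ⟨h₁.out.whiskerRight q⟩

section

variable {g : B ⟶ C} {h : C ⟶ D} {z : C} {w : D} {p : Tr g y z} {q : Tr h z w}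

instance assoc_hom : RespectsTo (α_ f g h).hom (cmp (cmp s p) q) (cmp s (cmp p q)) :=
  ⟨Respects.assoc s p q⟩

instance assoc_inv : RespectsTo (α_ f g h).inv (cmp s (cmp p q)) (cmp (cmp s p) q) :=
  ⟨(Respects.assoc s p q).inv⟩

end

instance leftUnitor_hom : RespectsTo (λ_ f).hom (cmp (idt x) s) s := ⟨Respects.leftUnitor s⟩

instance leftUnitor_inv : RespectsTo (λ_ f).inv s (cmp (idt x) s) := ⟨(Respects.leftUnitor s).inv⟩

instance rightUnitor_hom : RespectsTo (ρ_ f).hom (cmp s (idt y)) s := ⟨Respects.rightUnitor s⟩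

instance rightUnitor_inv : RespectsTo (ρ_ f).inv s (cmp s (idt y)) :=
  ⟨(Respects.rightUnitor s).inv⟩

section Tensor

variable {f f' : A ⟶ A'} {g g' : B ⟶ B'} {a : A} {a' : A'} {b : B} {b' : B'}
  {s : Tr f a a'} {s' : Tr f' a a'} {t : Tr g b b'} {t' : Tr g' b b'}

instance tmapIso_hom {η : f ≅ f'} {θ : g ≅ g'} [h₁ : RespectsTo η.hom s s']
    [h₂ : RespectsTo θ.hom t t'] :
    RespectsTo (tmapIso maxTensor η θ).hom (tns s t) (tns s' t') := ⟨h₁.out.tmap₂ h₂.out⟩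

instance tmapIso_inv {η : f' ≅ f} {θ : g' ≅ g} [h₁ : RespectsTo η.inv s s']
    [h₂ : RespectsTo θ.inv t t'] :
    RespectsTo (tmapIso maxTensor η θ).inv (tns s t) (tns s' t') := ⟨h₁.out.tmap₂ h₂.out⟩

instance tid_hom : RespectsTo (tid maxTensor A B).hom (tns (idt a) (idt b)) (idt (elt a b)) :=
  ⟨Respects.tid a b⟩

instance tid_inv : RespectsTo (tid maxTensor A B).inv (idt (elt a b)) (tns (idt a) (idt b)) :=
  ⟨(Respects.tid a b).inv⟩

variable {k : A' ⟶ A''} {l : B' ⟶ B''} {a'' : A''} {b'' : B''} {p : Tr k a' a''} {q : Tr l b' b''}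

instance tcomp_hom : RespectsTo (tcomp maxTensor f g k l).hom (tns (cmp s p) (cmp t q))
    (cmp (tns s t) (tns p q)) := ⟨Respects.tcomp s p t q⟩

instance tcomp_inv : RespectsTo (tcomp maxTensor f g k l).inv (cmp (tns s t) (tns p q))
    (tns (cmp s p) (cmp t q)) := ⟨(Respects.tcomp s p t q).inv⟩

instance leftComp_hom {a : A} : RespectsTo (TensorData.leftComp (T := maxTensor) A g l).hom
    (tns (idt a) (cmp t q)) (cmp (tns (idt a) t) (tns (idt a) q)) :=
  inferInstanceAs (RespectsTo (tmapIso maxTensor (ρ_ (𝟙 A)).symm (Iso.refl (g ≫ l)) ≪≫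
    tcomp maxTensor (𝟙 A) g (𝟙 A) l).hom _ _)

instance leftComp_inv {a : A} : RespectsTo (TensorData.leftComp (T := maxTensor) A g l).inv
    (cmp (tns (idt a) t) (tns (idt a) q)) (tns (idt a) (cmp t q)) :=
  inferInstanceAs (RespectsTo (tmapIso maxTensor (ρ_ (𝟙 A)).symm (Iso.refl (g ≫ l)) ≪≫
    tcomp maxTensor (𝟙 A) g (𝟙 A) l).inv _ _)

instance rightComp_hom {b : B} : RespectsTo (TensorData.rightComp (T := maxTensor) B f k).hom
    (tns (cmp s p) (idt b)) (cmp (tns s (idt b)) (tns p (idt b))) :=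
  inferInstanceAs (RespectsTo (tmapIso maxTensor (Iso.refl (f ≫ k)) (λ_ (𝟙 B)).symm ≪≫
    tcomp maxTensor f (𝟙 B) k (𝟙 B)).hom _ _)

instance rightComp_inv {b : B} : RespectsTo (TensorData.rightComp (T := maxTensor) B f k).inv
    (cmp (tns s (idt b)) (tns p (idt b))) (tns (cmp s p) (idt b)) :=
  inferInstanceAs (RespectsTo (tmapIso maxTensor (Iso.refl (f ≫ k)) (λ_ (𝟙 B)).symm ≪≫
    tcomp maxTensor f (𝟙 B) k (𝟙 B)).inv _ _)

end Tensor

/-! The coherence isomorphisms which are inserted into compositions of 2-morphisms. -/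

section Coherence

open BicategoricalCoherence

instance coherence_refl : RespectsTo (BicategoricalCoherence.iso (self := refl f)).hom s s :=
  ⟨Respects.id s⟩

instance coherence_whiskerLeft {k : C ⟶ A} {z : C} {q : Tr k z x} [c : BicategoricalCoherence f g]
    [RespectsTo c.iso.hom s t] :
    RespectsTo (BicategoricalCoherence.iso (self := BicategoricalCoherence.whiskerLeft k f g)).hom
      (cmp q s) (cmp q t) :=
  inferInstanceAs (RespectsTo (whiskerLeftIso k c.iso).hom _ _)

instance coherence_whiskerRight {k : B ⟶ C} {z : C} {q : Tr k y z} [c : BicategoricalCoherence f g]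
    [RespectsTo c.iso.hom s t] :
    RespectsTo (BicategoricalCoherence.iso (self := BicategoricalCoherence.whiskerRight f g k)).hom
      (cmp s q) (cmp t q) :=
  inferInstanceAs (RespectsTo (whiskerRightIso c.iso k).hom _ _)

instance coherence_comp {e : A ⟶ B} {q : Tr e x y} {η : f ⟶ g} {θ : h ⟶ e}
    [c : BicategoricalCoherence g h] [RespectsTo η s t] [RespectsTo c.iso.hom t r]
    [RespectsTo θ r q] : RespectsTo (η ⊗≫ θ) s q :=
  inferInstanceAs (RespectsTo (η ≫ c.iso.hom ≫ θ) s q)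

variable {k : B ⟶ C} {l : C ⟶ D} {m : A ⟶ D} {z : C} {w : D} {p : Tr k y z} {q : Tr l z w}
  {o : Tr m x w}

instance coherence_assoc [c : BicategoricalCoherence (f ≫ k ≫ l) m]
    [RespectsTo c.iso.hom (cmp s (cmp p q)) o] :
    RespectsTo (BicategoricalCoherence.iso (self := assoc f k l m)).hom (cmp (cmp s p) q) o :=
  inferInstanceAs (RespectsTo (α_ f k l ≪≫ c.iso).hom _ _)

instance coherence_assoc' [c : BicategoricalCoherence m (f ≫ k ≫ l)]
    [RespectsTo c.iso.hom o (cmp s (cmp p q))] :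
    RespectsTo (BicategoricalCoherence.iso (self := assoc' f k l m)).hom o (cmp (cmp s p) q) :=
  inferInstanceAs (RespectsTo (c.iso ≪≫ (α_ f k l).symm).hom _ _)

end Coherence

/-! Pasting of squares. -/

section Squares

instance idSq_hom : RespectsTo (idSq f).hom (cmp s (idt y)) (cmp (idt x) s) :=
  inferInstanceAs (RespectsTo (ρ_ f ≪≫ (λ_ f).symm).hom _ _)

instance pasteSq_hom {a b c a' b' c' : Clin.{u}} {p : a ⟶ a'} {q : b ⟶ b'} {r : c ⟶ c'} {f : a ⟶ b}
    {f' : a' ⟶ b'} {g : b ⟶ c} {g' : b' ⟶ c'} {σ : p ≫ f' ≅ f ≫ q} {τ : q ≫ g' ≅ g ≫ r}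
    {x : a} {y : b} {z : c} {x' : a'} {y' : b'} {z' : c'} {P : Tr p x x'} {Q : Tr q y y'}
    {R : Tr r z z'} {F : Tr f x y} {F' : Tr f' x' y'} {G : Tr g y z} {G' : Tr g' y' z'}
    [RespectsTo σ.hom (cmp P F') (cmp F Q)] [RespectsTo τ.hom (cmp Q G') (cmp G R)] :
    RespectsTo (pasteSq σ τ).hom (cmp P (cmp F' G')) (cmp (cmp F G) R) :=
  inferInstanceAs (RespectsTo ((α_ _ _ _).symm ≪≫ whiskerRightIso σ g' ≪≫ α_ _ _ _ ≪≫
    whiskerLeftIso f τ ≪≫ (α_ _ _ _).symm).hom _ _)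

instance tensorSq_hom {a b a' b' c d c' d' : Clin.{u}} {p : a ⟶ a'} {q : b ⟶ b'} {f : a ⟶ b}
    {f' : a' ⟶ b'} {r : c ⟶ c'} {s : d ⟶ d'} {g : c ⟶ d} {g' : c' ⟶ d'}
    {σ : p ≫ f' ≅ f ≫ q} {τ : r ≫ g' ≅ g ≫ s} {x : a} {y : b} {x' : a'} {y' : b'} {z : c} {w : d}
    {z' : c'} {w' : d'} {P : Tr p x x'} {Q : Tr q y y'} {F : Tr f x y} {F' : Tr f' x' y'}
    {R : Tr r z z'} {S : Tr s w w'} {G : Tr g z w} {G' : Tr g' z' w'}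
    [RespectsTo σ.hom (cmp P F') (cmp F Q)] [RespectsTo τ.hom (cmp R G') (cmp G S)] :
    RespectsTo (tensorSq maxTensor σ τ).hom (cmp (tns P R) (tns F' G')) (cmp (tns F G) (tns Q S)) :=
  inferInstanceAs (RespectsTo ((tcomp maxTensor _ _ _ _).symm ≪≫ tmapIso maxTensor σ τ ≪≫
    tcomp maxTensor _ _ _ _).hom _ _)

end Squares

end RespectsTo

end RespectsTo

open Tr RespectsTo

/-! ### Naturality of the associator and of the unitors -/

section Changes

variable {A B : Clin.{u}} {f g : A ⟶ B} {x : A} {y y' : B}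

/-- Every trivialization is obtained from the tautological one. -/
theorem Conj.taut (s : Tr f x y) : Conj (Tr.rfl' f x) s (𝟙 x) s.hom :=
  ((congrArg (fun t => t ≫ s.hom) ((fn f).map_id x)).trans (Category.id_comp _)).trans
    (Category.id_comp _).symm

/-- Changes of trivializations are compatible with tensor products. -/
theorem Conj.tns_one {A' B' : Clin.{u}} {f : A ⟶ A'} {g : B ⟶ B'} {a : A} {b : B} {a₁ a₂ : A'}
    {b₁ b₂ : B'} {s₁ : Tr f a a₁} {s₂ : Tr f a a₂} {t₁ : Tr g b b₁} {t₂ : Tr g b b₂} {m : a₁ ⟶ a₂}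
    {n : b₁ ⟶ b₂} (h : Conj s₁ s₂ (𝟙 a) m) (k : Conj t₁ t₂ (𝟙 b) n) :
    Conj (Tr.tns s₁ t₁) (Tr.tns s₂ t₂) (𝟙 (elt a b)) (eltHom m n) := by
  rw [← eltHom_id]
  exact h.tns k

/-- Compatibility with trivializations is preserved if both are changed by the same morphism. -/
theorem Respects.change {η : f ⟶ g} {s : Tr f x y} {t : Tr g x y} {s' : Tr f x y'} {t' : Tr g x y'}
    {d : y ⟶ y'} (h : Respects η s t) (hs : Conj s s' (𝟙 x) d) (ht : Conj t t' (𝟙 x) d) :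
    Respects η s' t' := by
  have hs' : s'.hom = s.hom ≫ d := by
    rw [← hs, (fn f).map_id, Category.id_comp]
  have ht' : t'.hom = t.hom ≫ d := by
    rw [← ht, (fn g).map_id, Category.id_comp]
  rw [Respects, hs', ht', ← Category.assoc, h]

/-- The trivialization which makes a 2-morphism compatible with the tautological trivialization
of its target. -/
def Tr.pull (η : f ⟶ g) (x : A) : Tr f x ((fn g).obj x) := ⟨cell η x, StarFunctor.unitary η x⟩

instance RespectsTo.pull (η : f ⟶ g) (x : A) : RespectsTo η (Tr.pull η x) (Tr.rfl' g x) :=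
  ⟨Category.comp_id _⟩

/-- 2-morphisms with equal propagation of trivializations at a generating family are equal. -/
theorem Gen.ext_of_respectsTo {ι : Type*} {S : ι → A} {M : ∀ i j, Set (S i ⟶ S j)} (G : Gen S M)
    {α β : f ⟶ g} {y : ι → B} (s : ∀ i, Tr f (S i) (y i)) {t : ∀ i, Tr g (S i) (y i)}
    [hα : ∀ i, RespectsTo α (s i) (t i)] [hβ : ∀ i, RespectsTo β (s i) (t i)] : α = β :=
  G.ext_of_respects (fun i => (hα i).out) fun i => (hβ i).out

end Changes

section Squares

variable {A B C D A' B' C' : Clin.{u}}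

/-- The naturality square of the associator. -/
def ascSq (f : A ⟶ A') (g : B ⟶ B') (h : C ⟶ C') :
    tmap maxTensor (tmap maxTensor f g) h ≫ asc A' B' C' ≅
      asc A B C ≫ tmap maxTensor f (tmap maxTensor g h) :=
  Gen.iso (((Gen.all A).tensor (Gen.all B)).tensor (Gen.all C))
    (fun p => cmp (tns (tns (rfl' f p.1.1) (rfl' g p.1.2)) (rfl' h p.2)) (ascTr _ _ _))
    (fun p => cmp (ascTr p.1.1 p.1.2 p.2) (tns (rfl' f _) (tns (rfl' g _) (rfl' h _))))
    (by
      rintro i j _ ⟨_, ⟨m, -, n, -, rfl⟩, k, -, rfl⟩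
      exact ⟨_, (((Conj.rfl' f m).tns (Conj.rfl' g n)).tns (Conj.rfl' h k)).cmp (conj_ascTr _ _ _),
        (conj_ascTr m n k).cmp ((Conj.rfl' f m).tns ((Conj.rfl' g n).tns (Conj.rfl' h k)))⟩)

/-- The square is constructed from the tautological trivializations of `f`, `g` and `h`; both sides
change in the same way if these are replaced. -/
theorem respects_ascSq {f : A ⟶ A'} {g : B ⟶ B'} {h : C ⟶ C'} {a : A} {b : B} {c : C} {a' : A'}
    {b' : B'} {c' : C'} (s : Tr f a a') (t : Tr g b b') (r : Tr h c c') :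
    Respects (ascSq f g h).hom (cmp (tns (tns s t) r) (ascTr a' b' c'))
      (cmp (ascTr a b c) (tns s (tns t r))) :=
  Respects.change (Gen.respects_iso _ _ _ _ ((a, b), c))
    ((((Conj.taut s).tns_one (Conj.taut t)).tns_one (Conj.taut r)).cmp (conj_ascTr _ _ _))
    ((Conj.id' (ascTr a b c)).cmp ((Conj.taut s).tns_one ((Conj.taut t).tns_one (Conj.taut r))))

instance ascSq_hom {f : A ⟶ A'} {g : B ⟶ B'} {h : C ⟶ C'} {a : A} {b : B} {c : C} {a' : A'}
    {b' : B'} {c' : C'} {s : Tr f a a'} {t : Tr g b b'} {r : Tr h c c'} :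
    RespectsTo (ascSq f g h).hom (cmp (tns (tns s t) r) (ascTr a' b' c'))
      (cmp (ascTr a b c) (tns s (tns t r))) := ⟨respects_ascSq s t r⟩

/-- The naturality square of the left unitor. -/
def lunSq (f : A ⟶ A') : tmap maxTensor (𝟙 one) f ≫ lun A' ≅ lun A ≫ f :=
  Gen.iso (Gen.pt.tensor (Gen.all A)) (fun p => cmp (tns (idt pt) (rfl' f p.2)) (lunTr _))
    (fun p => cmp (lunTr p.2) (rfl' f _))
    (by
      rintro i j _ ⟨_, rfl, m, -, rfl⟩
      exact ⟨_, ((Conj.idt (𝟙 pt)).tns (Conj.rfl' f m)).cmp (conj_lunTr _),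
        (conj_lunTr m).cmp (Conj.rfl' f m)⟩)

instance lunSq_hom {f : A ⟶ A'} {a : A} {a' : A'} {s : Tr f a a'} :
    RespectsTo (lunSq f).hom (cmp (tns (idt pt) s) (lunTr a')) (cmp (lunTr a) s) :=
  ⟨Respects.change (Gen.respects_iso _ _ _ _ ((), a))
    (((Conj.idt (𝟙 pt)).tns_one (Conj.taut s)).cmp (conj_lunTr _))
    ((Conj.id' (lunTr a)).cmp (Conj.taut s))⟩

/-- The naturality square of the right unitor. -/
def runSq (f : A ⟶ A') : tmap maxTensor f (𝟙 one) ≫ run A' ≅ run A ≫ f :=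
  Gen.iso ((Gen.all A).tensor Gen.pt) (fun p => cmp (tns (rfl' f p.1) (idt pt)) (runTr _))
    (fun p => cmp (runTr p.1) (rfl' f _))
    (by
      rintro i j _ ⟨m, -, _, rfl, rfl⟩
      exact ⟨_, ((Conj.rfl' f m).tns (Conj.idt (𝟙 pt))).cmp (conj_runTr _),
        (conj_runTr m).cmp (Conj.rfl' f m)⟩)

instance runSq_hom {f : A ⟶ A'} {a : A} {a' : A'} {s : Tr f a a'} :
    RespectsTo (runSq f).hom (cmp (tns s (idt pt)) (runTr a')) (cmp (runTr a) s) :=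
  ⟨Respects.change (Gen.respects_iso _ _ _ _ (a, ()))
    (((Conj.taut s).tns_one (Conj.idt (𝟙 pt))).cmp (conj_runTr _))
    ((Conj.id' (runTr a)).cmp (Conj.taut s))⟩

end Squares

section Transformations

/-- The tensor product of 2-morphisms. -/
abbrev tmap₂ {A A' B B' : Clin.{u}} {f f' : A ⟶ A'} {g g' : B ⟶ B'} (η : f ⟶ f') (θ : g ⟶ g') :
    tmap maxTensor f g ⟶ tmap maxTensor f' g' :=
  maxTensor.map₂ (a := (A, B)) (b := (A', B')) (f := (f, g)) (g := (f', g')) (η, θ)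

instance tmap₂_respectsTo {A A' B B' : Clin.{u}} {f f' : A ⟶ A'} {g g' : B ⟶ B'} {a : A} {a' : A'}
    {b : B} {b' : B'} {η : f ⟶ f'} {θ : g ⟶ g'} {s : Tr f a a'} {s' : Tr f' a a'} {t : Tr g b b'}
    {t' : Tr g' b b'} [h₁ : RespectsTo η s s'] [h₂ : RespectsTo θ t t'] :
    RespectsTo (tmap₂ η θ) (tns s t) (tns s' t') := ⟨h₁.out.tmap₂ h₂.out⟩

/-- The naturality of `ascSq` with respect to 2-morphisms. -/
theorem ascSq_naturality {A A' B B' C C' : Clin.{u}} {f f' : A ⟶ A'} {g g' : B ⟶ B'}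
    {h h' : C ⟶ C'} (η : f ⟶ f') (θ : g ⟶ g') (κ : h ⟶ h') :
    tmap₂ (tmap₂ η θ) κ ▷ asc A' B' C' ≫ (ascSq f' g' h').hom =
      (ascSq f g h).hom ≫ asc A B C ◁ tmap₂ η (tmap₂ θ κ) :=
  (((Gen.all A).tensor (Gen.all B)).tensor (Gen.all C)).ext_of_respectsTo
    (fun p => cmp (tns (tns (pull η p.1.1) (pull θ p.1.2)) (pull κ p.2)) (ascTr _ _ _))
    (t := fun p => cmp (ascTr p.1.1 p.1.2 p.2) (tns (rfl' f' _) (tns (rfl' g' _) (rfl' h' _))))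

/-- The unit axiom of the pseudonatural transformation with components `asc`. -/
theorem ascSq_id (A B C : Clin.{u}) :
    (ascSq (𝟙 A) (𝟙 B) (𝟙 C)).hom ≫ asc A B C ◁ (tmapIso maxTensor (Iso.refl (𝟙 A))
      (tmapIso maxTensor (Iso.refl (𝟙 B)) (Iso.refl (𝟙 C)) ≪≫ tid maxTensor B C) ≪≫
        tid maxTensor A (B ⊠ C)).hom =
    (tmapIso maxTensor (tmapIso maxTensor (Iso.refl (𝟙 A)) (Iso.refl (𝟙 B) ≪≫ Iso.refl _) ≪≫
      tid maxTensor A B) (Iso.refl (𝟙 C) ≪≫ Iso.refl _) ≪≫ tid maxTensor (A ⊠ B) C).hom ▷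
        asc A B C ≫ (λ_ (asc A B C)).hom ≫ (ρ_ (asc A B C)).inv :=
  (((Gen.all A).tensor (Gen.all B)).tensor (Gen.all C)).ext_of_respectsTo
    (fun p => cmp (tns (tns (idt p.1.1) (idt p.1.2)) (idt p.2)) (ascTr _ _ _))
    (t := fun p => cmp (ascTr p.1.1 p.1.2 p.2) (idt _))

/-- The composition axiom of the pseudonatural transformation with components `asc`. -/
theorem ascSq_comp {A A' A'' B B' B'' C C' C'' : Clin.{u}} (f : A ⟶ A') (g : B ⟶ B') (h : C ⟶ C')
    (f' : A' ⟶ A'') (g' : B' ⟶ B'') (h' : C' ⟶ C'') :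
    (ascSq (f ≫ f') (g ≫ g') (h ≫ h')).hom ≫ asc A B C ◁ (tmapIso maxTensor (Iso.refl (f ≫ f'))
      (tmapIso maxTensor (Iso.refl (g ≫ g')) (Iso.refl (h ≫ h')) ≪≫ tcomp maxTensor g h g' h') ≪≫
        tcomp maxTensor f (tmap maxTensor g h) f' (tmap maxTensor g' h')).hom =
    (tmapIso maxTensor (tmapIso maxTensor (Iso.refl (f ≫ f')) (Iso.refl (g ≫ g') ≪≫ Iso.refl _) ≪≫
      tcomp maxTensor f g f' g') (Iso.refl (h ≫ h') ≪≫ Iso.refl _) ≪≫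
        tcomp maxTensor (tmap maxTensor f g) h (tmap maxTensor f' g') h').hom ▷ asc A'' B'' C'' ≫
      (α_ _ _ _).hom ≫ tmap maxTensor (tmap maxTensor f g) h ◁ (ascSq f' g' h').hom ≫
        (α_ _ _ _).inv ≫ (ascSq f g h).hom ▷ tmap maxTensor f' (tmap maxTensor g' h') ≫
          (α_ _ _ _).hom :=
  (((Gen.all A).tensor (Gen.all B)).tensor (Gen.all C)).ext_of_respectsTo
    (fun p => cmp (tns (tns (cmp (rfl' f p.1.1) (rfl' f' _)) (cmp (rfl' g p.1.2) (rfl' g' _)))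
      (cmp (rfl' h p.2) (rfl' h' _))) (ascTr _ _ _))
    (t := fun p => cmp (ascTr p.1.1 p.1.2 p.2) (cmp (tns (rfl' f _) (tns (rfl' g _) (rfl' h _)))
      (tns (rfl' f' _) (tns (rfl' g' _) (rfl' h' _)))))

/-- The associator, as a pseudonatural transformation. -/
def assocTrans : Pseudofunctor.StrongTrans (tripleLeft maxTensor.{u}) (tripleRight maxTensor.{u})
    where
  app P := asc P.1 P.2.1 P.2.2
  naturality f := ascSq f.1 f.2.1 f.2.2
  naturality_naturality η := ascSq_naturality η.1 η.2.1 η.2.2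
  naturality_id P := ascSq_id P.1 P.2.1 P.2.2
  naturality_comp f g := ascSq_comp f.1 f.2.1 f.2.2 g.1 g.2.1 g.2.2

theorem lunSq_naturality {A A' : Clin.{u}} {f f' : A ⟶ A'} (η : f ⟶ f') :
    tmap₂ (𝟙 (𝟙 one)) η ▷ lun A' ≫ (lunSq f').hom = (lunSq f).hom ≫ lun A ◁ η :=
  (Gen.pt.tensor (Gen.all A)).ext_of_respectsTo
    (fun p => cmp (tns (idt pt) (pull η p.2)) (lunTr _)) (t := fun p => cmp (lunTr p.2) (rfl' f' _))

theorem lunSq_id (A : Clin.{u}) :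
    (lunSq (𝟙 A)).hom ≫ lun A ◁ (Iso.refl (𝟙 A)).hom =
      (tmapIso maxTensor (Iso.refl (𝟙 one)) (Iso.refl (𝟙 A)) ≪≫ tid maxTensor one A).hom ▷ lun A ≫
        (λ_ (lun A)).hom ≫ (ρ_ (lun A)).inv :=
  (Gen.pt.tensor (Gen.all A)).ext_of_respectsTo
    (fun p => cmp (tns (idt pt) (idt p.2)) (lunTr _)) (t := fun p => cmp (lunTr p.2) (idt _))

theorem lunSq_comp {A A' A'' : Clin.{u}} (f : A ⟶ A') (g : A' ⟶ A'') :
    (lunSq (f ≫ g)).hom ≫ lun A ◁ (Iso.refl (f ≫ g)).hom =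
      (TensorData.leftComp (T := maxTensor) one f g).hom ▷ lun A'' ≫ (α_ _ _ _).hom ≫
        tmap maxTensor (𝟙 one) f ◁ (lunSq g).hom ≫ (α_ _ _ _).inv ≫ (lunSq f).hom ▷ g ≫
          (α_ _ _ _).hom :=
  (Gen.pt.tensor (Gen.all A)).ext_of_respectsTo
    (fun p => cmp (tns (idt pt) (cmp (rfl' f p.2) (rfl' g _))) (lunTr _))
    (t := fun p => cmp (lunTr p.2) (cmp (rfl' f _) (rfl' g _)))

/-- The left unitor, as a pseudonatural transformation. -/
def lunTrans : Pseudofunctor.StrongTrans (tensorLeft maxTensor.{u} one) (Pseudofunctor.id Clin.{u})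
    where
  app A := lun A
  naturality f := lunSq f
  naturality_naturality η := lunSq_naturality η
  naturality_id A := lunSq_id A
  naturality_comp f g := lunSq_comp f g

theorem runSq_naturality {A A' : Clin.{u}} {f f' : A ⟶ A'} (η : f ⟶ f') :
    tmap₂ η (𝟙 (𝟙 one)) ▷ run A' ≫ (runSq f').hom = (runSq f).hom ≫ run A ◁ η :=
  ((Gen.all A).tensor Gen.pt).ext_of_respectsTo
    (fun p => cmp (tns (pull η p.1) (idt pt)) (runTr _)) (t := fun p => cmp (runTr p.1) (rfl' f' _))

theorem runSq_id (A : Clin.{u}) :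
    (runSq (𝟙 A)).hom ≫ run A ◁ (Iso.refl (𝟙 A)).hom =
      (tmapIso maxTensor (Iso.refl (𝟙 A)) (Iso.refl (𝟙 one)) ≪≫ tid maxTensor A one).hom ▷ run A ≫
        (λ_ (run A)).hom ≫ (ρ_ (run A)).inv :=
  ((Gen.all A).tensor Gen.pt).ext_of_respectsTo
    (fun p => cmp (tns (idt p.1) (idt pt)) (runTr _)) (t := fun p => cmp (runTr p.1) (idt _))

theorem runSq_comp {A A' A'' : Clin.{u}} (f : A ⟶ A') (g : A' ⟶ A'') :
    (runSq (f ≫ g)).hom ≫ run A ◁ (Iso.refl (f ≫ g)).hom =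
      (TensorData.rightComp (T := maxTensor) one f g).hom ▷ run A'' ≫ (α_ _ _ _).hom ≫
        tmap maxTensor f (𝟙 one) ◁ (runSq g).hom ≫ (α_ _ _ _).inv ≫ (runSq f).hom ▷ g ≫
          (α_ _ _ _).hom :=
  ((Gen.all A).tensor Gen.pt).ext_of_respectsTo
    (fun p => cmp (tns (cmp (rfl' f p.1) (rfl' g _)) (idt pt)) (runTr _))
    (t := fun p => cmp (runTr p.1) (cmp (rfl' f _) (rfl' g _)))

/-- The right unitor, as a pseudonatural transformation. -/
def runTrans : Pseudofunctor.StrongTrans (tensorRight maxTensor.{u} one) (Pseudofunctor.id Clin.{u})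
    where
  app A := run A
  naturality f := runSq f
  naturality_naturality η := runSq_naturality η
  naturality_id A := runSq_id A
  naturality_comp f g := runSq_comp f g

/-- The unit, the associator and the unitors of the maximal tensor product. -/
def data : TensorData maxTensor.{u} := ⟨one, assocTrans, lunTrans, runTrans⟩

end Transformations

/-! ### The pentagon and the triangles -/

section Data

variable {A B C D E A' B' C' : Clin.{u}}

/-- The one-dimensional Hilbert space, as an object of the unit. -/
def upt : (data.{u}.unit) := pt

/-- The one-dimensional Hilbert space generates the unit. -/
theorem Gen.upt : Gen (C := data.{u}.unit) (fun _ : Unit => upt.{u}) (fun _ _ => {𝟙 upt}) := Gen.pt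

/-- The value of the associator at elementary objects. -/
def aTr (a : A) (b : B) (c : C) : Tr (data.asc A B C) (elt (elt a b) c) (elt a (elt b c)) :=
  ascTr a b c

/-- The value of the left unitor at elementary objects. -/
def lTr (a : A) : Tr (data.lun A) (elt upt a) a := lunTr a

/-- The value of the right unitor at elementary objects. -/
def rTr (a : A) : Tr (data.run A) (elt a upt) a := runTr a

theorem conj_aTr {a a' : A} {b b' : B} {c c' : C} (f : a ⟶ a') (g : b ⟶ b') (h : c ⟶ c') :
    Conj (aTr a b c) (aTr a' b' c') (eltHom (eltHom f g) h) (eltHom f (eltHom g h)) :=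
  conj_ascTr f g h

theorem conj_lTr {a a' : A} (f : a ⟶ a') : Conj (lTr a) (lTr a') (eltHom (𝟙 upt) f) f :=
  conj_lunTr f

theorem conj_rTr {a a' : A} (f : a ⟶ a') : Conj (rTr a) (rTr a') (eltHom f (𝟙 upt)) f :=
  conj_runTr f

section

variable {f : A ⟶ A'} {g : B ⟶ B'} {h : C ⟶ C'} {a : A} {b : B} {c : C} {a' : A'} {b' : B'}
  {c' : C'} {s : Tr f a a'} {t : Tr g b b'} {r : Tr h c c'}

instance data_ascSq_hom : RespectsTo (data.ascSq f g h).hom (cmp (tns (tns s t) r) (aTr a' b' c'))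
    (cmp (aTr a b c) (tns s (tns t r))) := ⟨respects_ascSq s t r⟩

instance data_ascSq_inv : RespectsTo (data.ascSq f g h).inv (cmp (aTr a b c) (tns s (tns t r)))
    (cmp (tns (tns s t) r) (aTr a' b' c')) := ⟨(respects_ascSq s t r).inv⟩

instance data_lunSq_hom : RespectsTo (data.lunSq f).hom (cmp (tns (idt upt) s) (lTr a'))
    (cmp (lTr a) s) :=
  inferInstanceAs (RespectsTo (lunSq f).hom (cmp (tns (idt pt) s) (lunTr a')) _)

instance data_runSq_hom : RespectsTo (data.runSq f).hom (cmp (tns s (idt upt)) (rTr a'))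
    (cmp (rTr a) s) :=
  inferInstanceAs (RespectsTo (runSq f).hom (cmp (tns s (idt pt)) (runTr a')) _)

instance data_ascSq₁_hom : RespectsTo (data.ascSq₁ f B C).hom
    (cmp (tns (tns s (idt b)) (idt c)) (aTr a' b c)) (cmp (aTr a b c) (tns s (idt (elt b c)))) :=
  inferInstanceAs (RespectsTo (data.ascSq f (𝟙 B) (𝟙 C) ≪≫ whiskerLeftIso _
    (tmapIso maxTensor (Iso.refl f) (tid maxTensor B C))).hom _ _)

instance data_ascSq₃_hom : RespectsTo (data.ascSq₃ A B h).hom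
    (cmp (tns (idt (elt a b)) r) (aTr a b c')) (cmp (aTr a b c) (tns (idt a) (tns (idt b) r))) :=
  inferInstanceAs (RespectsTo (whiskerRightIso (tmapIso maxTensor (tid maxTensor A B).symm
    (Iso.refl h)) _ ≪≫ data.ascSq (𝟙 A) (𝟙 B) h).hom _ _)

instance data_ascSq₃_inv : RespectsTo (data.ascSq₃ A B h).inv
    (cmp (aTr a b c) (tns (idt a) (tns (idt b) r))) (cmp (tns (idt (elt a b)) r) (aTr a b c')) :=
  inferInstanceAs (RespectsTo (whiskerRightIso (tmapIso maxTensor (tid maxTensor A B).symm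
    (Iso.refl h)) _ ≪≫ data.ascSq (𝟙 A) (𝟙 B) h).inv _ _)

end

/-- The filler of the pentagon. -/
def pentCell (A B C D : Clin.{u}) :
    tmap maxTensor (data.asc A B C) (𝟙 D) ≫ data.asc A (B ⊠ C) D ≫
      tmap maxTensor (𝟙 A) (data.asc B C D) ≅ data.asc (A ⊠ B) C D ≫ data.asc A B (C ⊠ D) :=
  Gen.iso ((((Gen.all A).tensor (Gen.all B)).tensor (Gen.all C)).tensor (Gen.all D))
    (fun p => cmp (tns (aTr p.1.1.1 p.1.1.2 p.1.2) (idt p.2))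
      (cmp (aTr _ _ _) (tns (idt _) (aTr _ _ _))))
    (fun p => cmp (aTr (elt p.1.1.1 p.1.1.2) p.1.2 p.2) (aTr _ _ _))
    (by
      rintro i j _ ⟨_, ⟨_, ⟨m, -, n, -, rfl⟩, k, -, rfl⟩, l, -, rfl⟩
      exact ⟨_, ((conj_aTr m n k).tns (Conj.idt l)).cmp ((conj_aTr m _ l).cmp
        ((Conj.idt m).tns (conj_aTr n k l))), (conj_aTr _ k l).cmp (conj_aTr m n _)⟩)

/-- The filler of the middle triangle. -/
def midTriCell (A B : Clin.{u}) :
    data.asc A data.unit B ≫ tmap maxTensor (𝟙 A) (data.lun B) ≅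
      tmap maxTensor (data.run A) (𝟙 B) :=
  Gen.iso (((Gen.all A).tensor Gen.upt).tensor (Gen.all B))
    (fun p => cmp (aTr p.1.1 upt p.2) (tns (idt _) (lTr _)))
    (fun p => tns (rTr p.1.1) (idt p.2))
    (by
      rintro i j _ ⟨_, ⟨m, -, _, rfl, rfl⟩, n, -, rfl⟩
      exact ⟨_, (conj_aTr m (𝟙 upt) n).cmp ((Conj.idt m).tns (conj_lTr n)),
        (conj_rTr m).tns (Conj.idt n)⟩)

/-- The filler of the left triangle. -/
def leftTriCell (A B : Clin.{u}) :
    tmap maxTensor (data.lun A) (𝟙 B) ≅ data.asc data.unit A B ≫ data.lun (A ⊠ B) :=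
  Gen.iso ((Gen.upt.tensor (Gen.all A)).tensor (Gen.all B))
    (fun p => tns (lTr p.1.2) (idt p.2)) (fun p => cmp (aTr upt p.1.2 p.2) (lTr _))
    (by
      rintro i j _ ⟨_, ⟨_, rfl, m, -, rfl⟩, n, -, rfl⟩
      exact ⟨_, (conj_lTr m).tns (Conj.idt n), (conj_aTr (𝟙 upt) m n).cmp (conj_lTr _)⟩)

/-- The filler of the right triangle. -/
def rightTriCell (A B : Clin.{u}) :
    data.run (A ⊠ B) ≅ data.asc A B data.unit ≫ tmap maxTensor (𝟙 A) (data.run B) :=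
  Gen.iso (((Gen.all A).tensor (Gen.all B)).tensor Gen.upt)
    (fun p => rTr (elt p.1.1 p.1.2)) (fun p => cmp (aTr p.1.1 p.1.2 upt) (tns (idt _) (rTr _)))
    (by
      rintro i j _ ⟨_, ⟨m, -, n, -, rfl⟩, _, rfl, rfl⟩
      exact ⟨_, conj_rTr _, (conj_aTr m n (𝟙 upt)).cmp ((Conj.idt m).tns (conj_rTr n))⟩)

/-- The fillers of the pentagon and of the triangles. -/
def coherenceCells : TensorFillers data.{u} := ⟨pentCell, midTriCell, leftTriCell, rightTriCell⟩

section

variable {a : A} {b : B} {c : C} {d : D} {e : E}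

theorem respects_pent (a : A) (b : B) (c : C) (d : D) :
    Respects (pentCell A B C D).hom
    (cmp (tns (aTr a b c) (idt d)) (cmp (aTr a (elt b c) d) (tns (idt a) (aTr b c d))))
    (cmp (aTr (elt a b) c d) (aTr a b (elt c d))) := Gen.respects_iso _ _ _ _ (((a, b), c), d)

instance pent_hom : RespectsTo (coherenceCells.pent A B C D).hom
    (cmp (tns (aTr a b c) (idt d)) (cmp (aTr a (elt b c) d) (tns (idt a) (aTr b c d))))
    (cmp (aTr (elt a b) c d) (aTr a b (elt c d))) := ⟨respects_pent a b c d⟩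

theorem respects_midTri (a : A) (b : B) :
    Respects (midTriCell A B).hom
    (cmp (aTr a upt b) (tns (idt a) (lTr b))) (tns (rTr a) (idt b)) :=
  Gen.respects_iso _ _ _ _ ((a, ()), b)

instance midTri_hom : RespectsTo (coherenceCells.midTri A B).hom
    (cmp (aTr a upt b) (tns (idt a) (lTr b))) (tns (rTr a) (idt b)) := ⟨respects_midTri a b⟩

instance midTri_inv : RespectsTo (coherenceCells.midTri A B).inv (tns (rTr a) (idt b))
    (cmp (aTr a upt b) (tns (idt a) (lTr b))) := ⟨(respects_midTri a b).inv⟩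

theorem respects_leftTri (a : A) (b : B) :
    Respects (leftTriCell A B).hom (tns (lTr a) (idt b)) (cmp (aTr upt a b) (lTr (elt a b))) :=
  Gen.respects_iso _ _ _ _ (((), a), b)

instance leftTri_hom : RespectsTo (coherenceCells.leftTri A B).hom (tns (lTr a) (idt b))
    (cmp (aTr upt a b) (lTr (elt a b))) := ⟨respects_leftTri a b⟩

theorem respects_rightTri (a : A) (b : B) :
    Respects (rightTriCell A B).hom (rTr (elt a b)) (cmp (aTr a b upt) (tns (idt a) (rTr b))) :=
  Gen.respects_iso _ _ _ _ ((a, b), ())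

instance rightTri_hom : RespectsTo (coherenceCells.rightTri A B).hom (rTr (elt a b))
    (cmp (aTr a b upt) (tns (idt a) (rTr b))) := ⟨respects_rightTri a b⟩

instance pentRight_hom : RespectsTo (coherenceCells.pentRight A B C D E).hom
    (cmp (tns (tns (aTr a b c) (idt d)) (idt e)) (cmp (tns (aTr a (elt b c) d) (idt e))
      (tns (tns (idt a) (aTr b c d)) (idt e))))
    (cmp (tns (aTr (elt a b) c d) (idt e)) (tns (aTr a b (elt c d)) (idt e))) :=
  inferInstanceAs (RespectsTo ((TensorData.rightComp E _ _ ≪≫ whiskerLeftIso _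
    (TensorData.rightComp E _ _)).symm ≪≫ tmapIso maxTensor (coherenceCells.pent A B C D)
      (Iso.refl (𝟙 E)) ≪≫ TensorData.rightComp E _ _).hom _ _)

instance pentLeft_hom : RespectsTo (coherenceCells.pentLeft A B C D E).hom
    (cmp (tns (idt a) (tns (aTr b c d) (idt e))) (cmp (tns (idt a) (aTr b (elt c d) e))
      (tns (idt a) (tns (idt b) (aTr c d e)))))
    (cmp (tns (idt a) (aTr (elt b c) d e)) (tns (idt a) (aTr b c (elt d e)))) :=
  inferInstanceAs (RespectsTo ((TensorData.leftComp A _ _ ≪≫ whiskerLeftIso _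
    (TensorData.leftComp A _ _)).symm ≪≫ tmapIso maxTensor (Iso.refl (𝟙 A))
      (coherenceCells.pent B C D E) ≪≫ TensorData.leftComp A _ _).hom _ _)

instance midTriRight_inv : RespectsTo (coherenceCells.midTriRight A B C).inv
    (tns (tns (rTr a) (idt b)) (idt c))
    (cmp (tns (aTr a upt b) (idt c)) (tns (tns (idt a) (lTr b)) (idt c))) :=
  inferInstanceAs (RespectsTo ((TensorData.rightComp C _ _).symm ≪≫
    tmapIso maxTensor (coherenceCells.midTri A B) (Iso.refl (𝟙 C))).inv _ _)

instance midTriLeft_inv : RespectsTo (coherenceCells.midTriLeft A B C).inv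
    (tns (idt a) (tns (rTr b) (idt c)))
    (cmp (tns (idt a) (aTr b upt c)) (tns (idt a) (tns (idt b) (lTr c)))) :=
  inferInstanceAs (RespectsTo ((TensorData.leftComp A _ _).symm ≪≫
    tmapIso maxTensor (Iso.refl (𝟙 A)) (coherenceCells.midTri B C)).inv _ _)

instance leftTriLeft_hom : RespectsTo (coherenceCells.leftTriLeft A B C).hom
    (tns (idt a) (tns (lTr b) (idt c)))
    (cmp (tns (idt a) (aTr upt b c)) (tns (idt a) (lTr (elt b c)))) :=
  inferInstanceAs (RespectsTo (tmapIso maxTensor (Iso.refl (𝟙 A)) (coherenceCells.leftTri B C) ≪≫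
    TensorData.leftComp A _ _).hom _ _)

instance rightTriRight_hom : RespectsTo (coherenceCells.rightTriRight A B C).hom
    (tns (rTr (elt a b)) (idt c))
    (cmp (tns (aTr a b upt) (idt c)) (tns (tns (idt a) (rTr b)) (idt c))) :=
  inferInstanceAs (RespectsTo (tmapIso maxTensor (coherenceCells.rightTri A B) (Iso.refl (𝟙 C)) ≪≫
    TensorData.rightComp C _ _).hom _ _)

end

end Data

/-! ### The coherence axioms -/

section Coherence

variable {A B C D A' B' C' D' : Clin.{u}}

/-- The fillers of the pentagon form a modification. -/
theorem pent_natural (f : A ⟶ A') (g : B ⟶ B') (h : C ⟶ C') (k : D ⟶ D') :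
    SqCompat (coherenceCells.pent A B C D) (coherenceCells.pent A' B' C' D')
      (pasteSq (tensorSq maxTensor (data.ascSq f g h) (idSq k))
        (pasteSq (data.ascSq f (tmap maxTensor g h) k)
          (tensorSq maxTensor (idSq f) (data.ascSq g h k))))
      (pasteSq (data.ascSq (tmap maxTensor f g) h k) (data.ascSq f g (tmap maxTensor h k))) :=
  ((((Gen.all A).tensor (Gen.all B)).tensor (Gen.all C)).tensor (Gen.all D)).ext_of_respectsTo
    (fun p => cmp (tns (tns (tns (rfl' f p.1.1.1) (rfl' g p.1.1.2)) (rfl' h p.1.2)) (rfl' k p.2))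
      (cmp (tns (aTr _ _ _) (idt _)) (cmp (aTr _ _ _) (tns (idt _) (aTr _ _ _)))))
    (t := fun p => cmp (cmp (aTr (elt p.1.1.1 p.1.1.2) p.1.2 p.2) (aTr _ _ _))
      (tns (rfl' f _) (tns (rfl' g _) (tns (rfl' h _) (rfl' k _)))))

theorem midTri_natural (f : A ⟶ A') (g : B ⟶ B') :
    SqCompat (coherenceCells.midTri A B) (coherenceCells.midTri A' B')
      (pasteSq (data.ascSq f (𝟙 data.unit) g) (tensorSq maxTensor (idSq f) (data.lunSq g)))
      (tensorSq maxTensor (data.runSq f) (idSq g)) :=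
  (((Gen.all A).tensor Gen.upt).tensor (Gen.all B)).ext_of_respectsTo
    (fun p => cmp (tns (tns (rfl' f p.1.1) (idt upt)) (rfl' g p.2))
      (cmp (aTr _ _ _) (tns (idt _) (lTr _))))
    (t := fun p => cmp (tns (rTr p.1.1) (idt p.2)) (tns (rfl' f _) (rfl' g _)))

theorem leftTri_natural (f : A ⟶ A') (g : B ⟶ B') :
    SqCompat (coherenceCells.leftTri A B) (coherenceCells.leftTri A' B')
      (tensorSq maxTensor (data.lunSq f) (idSq g))
      (pasteSq (data.ascSq (𝟙 data.unit) f g) (data.lunSq (tmap maxTensor f g))) :=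
  ((Gen.upt.tensor (Gen.all A)).tensor (Gen.all B)).ext_of_respectsTo
    (fun p => cmp (tns (tns (idt upt) (rfl' f p.1.2)) (rfl' g p.2)) (tns (lTr _) (idt _)))
    (t := fun p => cmp (cmp (aTr upt p.1.2 p.2) (lTr _)) (tns (rfl' f _) (rfl' g _)))

theorem rightTri_natural (f : A ⟶ A') (g : B ⟶ B') :
    SqCompat (coherenceCells.rightTri A B) (coherenceCells.rightTri A' B')
      (data.runSq (tmap maxTensor f g))
      (pasteSq (data.ascSq f g (𝟙 data.unit)) (tensorSq maxTensor (idSq f) (data.runSq g))) :=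
  (((Gen.all A).tensor (Gen.all B)).tensor Gen.upt).ext_of_respectsTo
    (fun p => cmp (tns (tns (rfl' f p.1.1) (rfl' g p.1.2)) (idt upt)) (rTr _))
    (t := fun p => cmp (cmp (aTr p.1.1 p.1.2 upt) (tns (idt _) (rTr _)))
      (tns (rfl' f _) (rfl' g _)))

/-- In each axiom both pastings respect the trivializations of their source and target by the
canonical identifications of iterated tensors of elementary objects. -/
theorem isCoherent : coherenceCells.{u}.IsCoherent where
  pent_natural := pent_natural
  midTri_natural := midTri_natural
  leftTri_natural := leftTri_natural
  rightTri_natural := rightTri_natural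
  cocycle A B C D E := by
    refine (((((Gen.all A).tensor (Gen.all B)).tensor (Gen.all C)).tensor (Gen.all D)).tensor
      (Gen.all E)).ext_of_respects
      (y := fun p => elt p.1.1.1.1 (elt p.1.1.1.2 (elt p.1.1.2 (elt p.1.2 p.2))))
      (s := fun p => cmp (tns (tns (aTr p.1.1.1.1 p.1.1.1.2 p.1.1.2) (idt p.1.2)) (idt p.2))
        (cmp (tns (aTr p.1.1.1.1 (elt p.1.1.1.2 p.1.1.2) p.1.2) (idt p.2))
          (cmp (tns (tns (idt p.1.1.1.1) (aTr p.1.1.1.2 p.1.1.2 p.1.2)) (idt p.2))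
            (cmp (aTr p.1.1.1.1 (elt p.1.1.1.2 (elt p.1.1.2 p.1.2)) p.2)
              (cmp (tns (idt p.1.1.1.1) (aTr p.1.1.1.2 (elt p.1.1.2 p.1.2) p.2))
                (tns (idt p.1.1.1.1) (tns (idt p.1.1.1.2) (aTr p.1.1.2 p.1.2 p.2))))))))
      (t := fun p => cmp (aTr (elt (elt p.1.1.1.1 p.1.1.1.2) p.1.1.2) p.1.2 p.2)
        (cmp (aTr (elt p.1.1.1.1 p.1.1.1.2) p.1.1.2 (elt p.1.2 p.2))
          (aTr p.1.1.1.1 p.1.1.1.2 (elt p.1.1.2 (elt p.1.2 p.2))))) ?_ ?_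
    · exact fun p => RespectsTo.out
    · exact fun p => RespectsTo.out
  normal_left A B C := by
    refine ((((Gen.all A).tensor Gen.upt).tensor (Gen.all B)).tensor (Gen.all C)).ext_of_respects
      (y := fun p => elt p.1.1.1 (elt p.1.2 p.2))
      (s := fun p => cmp (tns (tns (rTr p.1.1.1) (idt p.1.2)) (idt p.2)) (aTr p.1.1.1 p.1.2 p.2))
      (t := fun p => cmp (aTr (elt p.1.1.1 upt) p.1.2 p.2)
        (cmp (aTr p.1.1.1 upt (elt p.1.2 p.2)) (tns (idt p.1.1.1) (lTr (elt p.1.2 p.2))))) ?_ ?_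
    · exact fun p => RespectsTo.out
    · exact fun p => RespectsTo.out
  normal_right A B C := by
    refine ((((Gen.all A).tensor (Gen.all B)).tensor Gen.upt).tensor (Gen.all C)).ext_of_respects
      (y := fun p => elt p.1.1.1 (elt p.1.1.2 p.2))
      (s := fun p => cmp (tns (rTr (elt p.1.1.1 p.1.1.2)) (idt p.2)) (aTr p.1.1.1 p.1.1.2 p.2))
      (t := fun p => cmp (aTr (elt p.1.1.1 p.1.1.2) upt p.2)
        (cmp (aTr p.1.1.1 p.1.1.2 (elt upt p.2))
          (tns (idt p.1.1.1) (tns (idt p.1.1.2) (lTr p.2))))) ?_ ?_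
    · exact fun p => RespectsTo.out
    · exact fun p => RespectsTo.out

end Coherence

/-! ### The associator and the unitors are equivalences -/

theorem isEquivalence₁_asc (A B C : Clin.{u}) : IsEquivalence₁ (asc A B C) := by
  refine ⟨ascInv A B C,
    ⟨(((Gen.all A).tensor (Gen.all B)).tensor (Gen.all C)).iso
      (fun p => cmp (ascTr p.1.1 p.1.2 p.2) (ascInvTr p.1.1 p.1.2 p.2)) (fun p => idt _) ?_⟩,
    ⟨((Gen.all A).tensor ((Gen.all B).tensor (Gen.all C))).iso
      (fun p => cmp (ascInvTr p.1 p.2.1 p.2.2) (ascTr p.1 p.2.1 p.2.2)) (fun p => idt _) ?_⟩⟩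
  · rintro i j _ ⟨_, ⟨f, -, g, -, rfl⟩, h, -, rfl⟩
    exact ⟨_, (conj_ascTr f g h).cmp (conj_ascInvTr f g h), Conj.idt _⟩
  · rintro i j _ ⟨f, -, _, ⟨g, -, h, -, rfl⟩, rfl⟩
    exact ⟨_, (conj_ascInvTr f g h).cmp (conj_ascTr f g h), Conj.idt _⟩

/-- An inverse is `a ↦ pt ⊠ a`. -/
theorem isEquivalence₁_lun (A : Clin.{u}) : IsEquivalence₁ (lun A) := by
  let g : A ⟶ one ⊠ A := eltRight pt
  refine ⟨g, ⟨(Gen.pt.tensor (Gen.all A)).iso (fun p => cmp (lunTr p.2) (rfl' g p.2))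
    (fun p => idt _) ?_⟩, ⟨(Gen.all A).iso (fun a => cmp (rfl' g a) (lunTr a)) (fun a => idt a) ?_⟩⟩
  · rintro i j _ ⟨_, rfl, f, -, rfl⟩
    exact ⟨_, (conj_lunTr f).cmp (Conj.rfl' g f), Conj.idt _⟩
  · intro i j f _
    exact ⟨f, (Conj.rfl' g f).cmp (conj_lunTr f), Conj.idt f⟩

/-- An inverse is `a ↦ a ⊠ pt`. -/
theorem isEquivalence₁_run (A : Clin.{u}) : IsEquivalence₁ (run A) := by
  let g : A ⟶ A ⊠ one := eltLeft pt
  refine ⟨g, ⟨((Gen.all A).tensor Gen.pt).iso (fun p => cmp (runTr p.1) (rfl' g p.1))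
    (fun p => idt _) ?_⟩, ⟨(Gen.all A).iso (fun a => cmp (rfl' g a) (runTr a)) (fun a => idt a) ?_⟩⟩
  · rintro i j _ ⟨f, -, _, rfl, rfl⟩
    exact ⟨_, (conj_runTr f).cmp (Conj.rfl' g f), Conj.idt _⟩
  · intro i j f _
    exact ⟨f, (Conj.rfl' g f).cmp (conj_runTr f), Conj.idt f⟩

/-- The maximal tensor product is a monoidal structure. -/
def monoidalStructure : MonoidalStructure maxTensor.{u} where
  toTensorData := data
  asc_equiv := isEquivalence₁_asc
  lun_equiv := isEquivalence₁_lun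
  run_equiv := isEquivalence₁_run
  fillers := coherenceCells
  coherent := isCoherent

/-! ### Pseudofunctors with a right biadjoint preserve bicolimits -/

section Bicolimits

open scoped Pseudofunctor.StrongTrans

universe w₁ v₁ u₁ w₂ v₂ u₂

section CoconeHom

variable {J : Type u₁} [Bicategory.{w₁, v₁} J] {B : Type u} [Bicategory.{w, v} B]
  {V : J ⥤ᵖ B} {X : B}

/-- The component of a morphism of cocones at a leg. -/
def legHom {σ τ : V ⟶ constDiagram J X} (m : σ ⟶ τ) (i : J) : leg σ i ⟶ leg τ i := m.as.app i

theorem legHom_naturality {σ τ : V ⟶ constDiagram J X} (m : σ ⟶ τ) {i j : J} (f : i ⟶ j) :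
    V.map f ◁ legHom m j ≫ (legNat τ f).hom = (legNat σ f).hom ≫ legHom m i := by
  let s : V.map f ≫ leg σ j ⟶ leg σ i ≫ 𝟙 X := (σ.naturality f).hom
  let t : V.map f ≫ leg τ j ⟶ leg τ i ≫ 𝟙 X := (τ.naturality f).hom
  have h : V.map f ◁ legHom m j ≫ t = s ≫ legHom m i ▷ 𝟙 X := m.as.naturality f
  change V.map f ◁ legHom m j ≫ t ≫ (ρ_ (leg τ i)).hom = (s ≫ (ρ_ (leg σ i)).hom) ≫ legHom m i
  rw [← Category.assoc, h]
  simp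

/-- Construct a morphism of cocones from 2-cells between the legs. -/
def mkCoconeHom {σ τ : V ⟶ constDiagram J X} (m : ∀ i, leg σ i ⟶ leg τ i)
    (nat : ∀ {i j : J} (f : i ⟶ j),
      V.map f ◁ m j ≫ (legNat τ f).hom = (legNat σ f).hom ≫ m i) : σ ⟶ τ where
  as :=
  { app := m
    naturality := fun {i j} f => by
      let s : V.map f ≫ leg σ j ⟶ leg σ i ≫ 𝟙 X := (σ.naturality f).hom
      let t : V.map f ≫ leg τ j ⟶ leg τ i ≫ 𝟙 X := (τ.naturality f).hom
      have h : V.map f ◁ m j ≫ t ≫ (ρ_ (leg τ i)).hom = (s ≫ (ρ_ (leg σ i)).hom) ≫ m i := nat f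
      change V.map f ◁ m j ≫ t = s ≫ m i ▷ 𝟙 X
      rw [← cancel_mono (ρ_ (leg τ i)).hom, Category.assoc, h]
      simp }

theorem coconeHom_ext {σ τ : V ⟶ constDiagram J X} {m n : σ ⟶ τ}
    (h : ∀ i, legHom m i = legHom n i) : m = n :=
  Pseudofunctor.StrongTrans.homCategory.ext h

/-- Construct an isomorphism of cocones from invertible 2-cells between the legs. -/
def mkCoconeIso {σ τ : V ⟶ constDiagram J X} (m : ∀ i, leg σ i ≅ leg τ i)
    (nat : ∀ {i j : J} (f : i ⟶ j),
      V.map f ◁ (m j).hom ≫ (legNat τ f).hom = (legNat σ f).hom ≫ (m i).hom) : σ ≅ τ where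
  hom := mkCoconeHom (fun i => (m i).hom) nat
  inv := mkCoconeHom (fun i => (m i).inv) fun {i j} f => by
    rw [← cancel_mono (m i).hom, Category.assoc, Category.assoc, ← nat f, Iso.inv_hom_id,
      Category.comp_id, whiskerLeft_inv_hom_assoc]
  hom_inv_id := coconeHom_ext fun i => (m i).hom_inv_id
  inv_hom_id := coconeHom_ext fun i => (m i).inv_hom_id

/-- The naturality 2-cells of a cocone composed with a 1-morphism on the vertex. -/
theorem legNat_comp_constTrans (σ : V ⟶ constDiagram J X) {W : B} (f : X ⟶ W) {i j : J}
    (h : i ⟶ j) : (legNat (σ ≫ constTrans J f) h).hom =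
      (α_ (V.map h) (leg σ j) f).inv ≫ (legNat σ h).hom ▷ f := by
  let s : V.map h ≫ leg σ j ⟶ leg σ i ≫ 𝟙 X := (σ.naturality h).hom
  change ((α_ (V.map h) (leg σ j) f).inv ≫ s ▷ f ≫ (α_ (leg σ i) (𝟙 X) f).hom ≫
    leg σ i ◁ ((λ_ f).hom ≫ (ρ_ f).inv) ≫ (α_ (leg σ i) f (𝟙 W)).inv) ≫
      (ρ_ (leg σ i ≫ f)).hom = (α_ _ _ _).inv ≫ (s ≫ (ρ_ (leg σ i)).hom) ▷ f
  simp

theorem legNat_mkCocone (l : ∀ i, V.obj i ⟶ X) (n : ∀ {i j : J} (f : i ⟶ j), V.map f ≫ l j ≅ l i)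
    (nat nat_id nat_comp) {i j : J} (f : i ⟶ j) :
    (legNat (mkCocone (V := V) l n nat nat_id nat_comp) f).hom = (n f).hom := by
  change ((n f).hom ≫ (ρ_ (l i)).inv) ≫ (ρ_ (l i)).hom = _
  simp

end CoconeHom

variable {J : Type u₁} [Bicategory.{w₁, v₁} J] {B : Type u} [Bicategory.{w, v} B]
  {C : Type u₂} [Bicategory.{w₂, v₂} C] (F : B ⥤ᵖ C) {R : B} {W : C} (q : F.obj R ⟶ W)

/-- The functor sending `f : X ⟶ R` to `F f ≫ q : F X ⟶ W`. -/
def transpose (X : B) : (X ⟶ R) ⥤ (F.obj X ⟶ W) where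
  obj f := F.map f ≫ q
  map η := F.map₂ η ▷ q

/-- The functors `transpose` are natural with respect to precomposition. -/
def transposeComp {X Y : B} (h : X ⟶ Y) (f : Y ⟶ R) :
    (transpose F q X).obj (h ≫ f) ≅ F.map h ≫ (transpose F q Y).obj f :=
  whiskerRightIso (F.mapComp h f) q ≪≫ α_ _ _ _

theorem transpose_whiskerLeft {X Y : B} (h : X ⟶ Y) {f g : Y ⟶ R} (η : f ⟶ g) :
    (transpose F q X).map (h ◁ η) ≫ (transposeComp F q h g).hom =
      (transposeComp F q h f).hom ≫ F.map h ◁ (transpose F q Y).map η := by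
  change F.map₂ (h ◁ η) ▷ q ≫ (F.mapComp h g).hom ▷ q ≫ (α_ _ _ _).hom =
    ((F.mapComp h f).hom ▷ q ≫ (α_ _ _ _).hom) ≫ F.map h ◁ F.map₂ η ▷ q
  simp [F.map₂_whisker_left]

theorem transpose_whiskerRight {X Y : B} {h k : X ⟶ Y} (η : h ⟶ k) (f : Y ⟶ R) :
    (transpose F q X).map (η ▷ f) ≫ (transposeComp F q k f).hom =
      (transposeComp F q h f).hom ≫ F.map₂ η ▷ (transpose F q Y).obj f := by
  change F.map₂ (η ▷ f) ▷ q ≫ (F.mapComp k f).hom ▷ q ≫ (α_ _ _ _).hom =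
    ((F.mapComp h f).hom ▷ q ≫ (α_ _ _ _).hom) ≫ F.map₂ η ▷ (F.map f ≫ q)
  simp [F.map₂_whisker_right]

theorem transpose_leftUnitor {X : B} (f : X ⟶ R) :
    (transpose F q X).map (λ_ f).hom = (transposeComp F q (𝟙 X) f).hom ≫
      (F.mapId X).hom ▷ (transpose F q X).obj f ≫ (λ_ _).hom := by
  change F.map₂ (λ_ f).hom ▷ q = ((F.mapComp (𝟙 X) f).hom ▷ q ≫ (α_ _ _ _).hom) ≫
    (F.mapId X).hom ▷ (F.map f ≫ q) ≫ (λ_ (F.map f ≫ q)).hom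
  simp [F.map₂_left_unitor]

theorem transpose_associator {X Y Z : B} (h : X ⟶ Y) (k : Y ⟶ Z) (f : Z ⟶ R) :
    (transpose F q X).map (α_ h k f).hom ≫ (transposeComp F q h (k ≫ f)).hom ≫
      F.map h ◁ (transposeComp F q k f).hom = (transposeComp F q (h ≫ k) f).hom ≫
        (F.mapComp h k).hom ▷ (transpose F q Z).obj f ≫ (α_ _ _ _).hom := by
  change F.map₂ (α_ h k f).hom ▷ q ≫ ((F.mapComp h (k ≫ f)).hom ▷ q ≫ (α_ _ _ _).hom) ≫
    F.map h ◁ ((F.mapComp k f).hom ▷ q ≫ (α_ _ _ _).hom) =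
      ((F.mapComp (h ≫ k) f).hom ▷ q ≫ (α_ _ _ _).hom) ≫
        (F.mapComp h k).hom ▷ (F.map f ≫ q) ≫ (α_ (F.map h) (F.map k) (F.map f ≫ q)).hom
  simp [F.map₂_associator]

/-- Transposition of `f` along the naturality 2-cell `s` of a cocone, compared with the 2-cell of
the image cocone under `F`. -/
theorem transpose_comp_assoc {X Y Z : B} (h : X ⟶ Y) (k : Y ⟶ Z) {l : X ⟶ Z} (s : h ≫ k ⟶ l)
    (f : Z ⟶ R) :
    F.map h ◁ (transposeComp F q k f).inv ≫ (transposeComp F q h (k ≫ f)).inv ≫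
        (transpose F q X).map ((α_ h k f).inv ≫ s ▷ f) =
      ((α_ _ _ _).inv ≫ ((F.mapComp h k).inv ≫ F.map₂ s) ▷ (transpose F q Z).obj f) ≫
        (transposeComp F q l f).inv := by
  have h1 := transpose_associator F q h k f
  have h2 := transpose_whiskerRight F q s f
  rw [← Iso.eq_comp_inv] at h2
  rw [← cancel_epi ((transposeComp F q (h ≫ k) f).hom ≫
    (F.mapComp h k).hom ▷ (transpose F q Z).obj f ≫ (α_ _ _ _).hom)]
  refine Eq.trans (congrArg (fun t => t ≫ _) h1.symm) ?_
  simp only [Category.assoc, whiskerLeft_hom_inv_assoc, Iso.hom_inv_id_assoc,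
    ← Functor.map_comp, comp_whiskerRight, hom_inv_whiskerRight_assoc]
  rw [h2, Category.assoc]

/-- A square of 2-cells commutes after transposition if and only if the transposed square
commutes. -/
theorem transpose_square_iff {X Y : B} (f : X ⟶ Y) {a a' : Y ⟶ R} {b b' : X ⟶ R}
    (s : f ≫ a ⟶ b) (s' : f ≫ a' ⟶ b') (m : a ⟶ a') (m' : b ⟶ b') :
    (F.map f ◁ (transpose F q Y).map m ≫ (transposeComp F q f a').inv ≫
        (transpose F q X).map s' =
      ((transposeComp F q f a).inv ≫ (transpose F q X).map s) ≫ (transpose F q X).map m') ↔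
    (transpose F q X).map (f ◁ m ≫ s') = (transpose F q X).map (s ≫ m') := by
  rw [Category.assoc, Iso.eq_inv_comp, ← Category.assoc, ← transpose_whiskerLeft,
    Category.assoc, Iso.hom_inv_id_assoc, Functor.map_comp, Functor.map_comp]

/-- The naturality 2-cells of a transposed cocone are the transposes of the naturality 2-cells. -/
theorem legNat_mapCocone_comp {V : J ⥤ᵖ B} (σ : V ⟶ constDiagram J R) {i j : J} (f : i ⟶ j) :
    (legNat (mapCocone F σ ≫ constTrans J q) f).hom =
      (transposeComp F q (V.map f) (leg σ j)).inv ≫ (transpose F q _).map (legNat σ f).hom := by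
  refine (legNat_comp_constTrans _ _ _).trans ?_
  have h : (legNat (mapCocone F σ) f).hom =
      (F.mapComp (V.map f) (leg σ j)).inv ≫ F.map₂ (legNat σ f).hom :=
    legNat_mkCocone _ _ _ _ _ _
  refine (congrArg (fun t => (α_ (F.map (V.map f)) (F.map (leg σ j)) q).inv ≫ t ▷ q) h).trans ?_
  change _ = ((α_ _ _ _).inv ≫ (F.mapComp (V.map f) (leg σ j)).inv ▷ q) ≫
    F.map₂ (legNat σ f).hom ▷ q
  exact (congrArg (fun t => (α_ (F.map (V.map f)) (F.map (leg σ j)) q).inv ≫ t)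
    (comp_whiskerRight _ _ _)).trans (Category.assoc _ _ _).symm

/-- Compatibility of 2-cells `transpose (leg σ i) ⟶ transpose (leg τ i)` with the naturality
2-cells of the transposed cocones. -/
theorem transpose_legNat_iff {V : J ⥤ᵖ B} {σ τ : V ⟶ constDiagram J R} {i j : J} (f : i ⟶ j)
    (m : leg σ j ⟶ leg τ j) (m' : leg σ i ⟶ leg τ i) :
    (F.map (V.map f) ◁ (transpose F q (V.obj j)).map m ≫
        (legNat (mapCocone F τ ≫ constTrans J q) f).hom =
      (legNat (mapCocone F σ ≫ constTrans J q) f).hom ≫ (transpose F q (V.obj i)).map m') ↔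
    (transpose F q (V.obj i)).map (V.map f ◁ m ≫ (legNat τ f).hom) =
      (transpose F q (V.obj i)).map ((legNat σ f).hom ≫ m') :=
  Iff.trans (Eq.to_iff (congrArg₂ (fun s t => F.map (V.map f) ◁ (transpose F q (V.obj j)).map m ≫
    s = t ≫ (transpose F q (V.obj i)).map m') (legNat_mapCocone_comp F q τ f)
      (legNat_mapCocone_comp F q σ f))) (transpose_square_iff F q _ _ _ _ _)

/-- The functor from cocones under `V` with vertex `R` to cocones under `V.comp F` with vertex `W`
which is `transpose` on the legs. -/
def coconeTranspose (V : J ⥤ᵖ B) :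
    (V ⟶ constDiagram J R) ⥤ (V.comp F ⟶ constDiagram J W) where
  obj σ := mapCocone F σ ≫ constTrans J q
  map m := mkCoconeHom (fun i => (transpose F q (V.obj i)).map (legHom m i))
    fun f => (transpose_legNat_iff F q f _ _).2 (congrArg _ (legHom_naturality m f))
  map_id _ := coconeHom_ext fun i => (transpose F q (V.obj i)).map_id _
  map_comp _ _ := coconeHom_ext fun i => (transpose F q (V.obj i)).map_comp _ _

variable {F q}

/-- Cocones correspond under `transpose`: legs and naturality 2-cells of cocones with vertex `W`
are transposes of legs and of naturality 2-cells, and the cocone axioms may be tested after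
transposition. -/
theorem coconeTranspose_isEquivalence (V : J ⥤ᵖ B)
    (h : ∀ X, (transpose F q X).IsEquivalence) : (coconeTranspose F q V).IsEquivalence where
  faithful := ⟨fun e => coconeHom_ext fun i =>
    (transpose F q (V.obj i)).map_injective (congrArg (fun t => legHom t i) e)⟩
  full := ⟨fun {σ τ} n => by
    let m (i : J) : leg σ i ⟶ leg τ i := (transpose F q (V.obj i)).preimage (legHom n i)
    have hm (i : J) : (transpose F q (V.obj i)).map (m i) = legHom n i :=
      (transpose F q (V.obj i)).map_preimage _
    refine ⟨mkCoconeHom m fun {i _} f => (transpose F q (V.obj i)).map_injective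
      ((transpose_legNat_iff F q f _ _).1 ?_), coconeHom_ext hm⟩
    rw [hm, hm]
    exact legHom_naturality n f⟩
  essSurj := ⟨fun κ => by
    let l (i : J) : F.obj (V.obj i) ⟶ W := leg κ i
    let t {i j : J} (f : i ⟶ j) : F.map (V.map f) ≫ l j ≅ l i := legNat κ f
    let m (i : J) : V.obj i ⟶ R := (transpose F q (V.obj i)).objPreimage (l i)
    let e (i : J) : (transpose F q (V.obj i)).obj (m i) ≅ l i :=
      (transpose F q (V.obj i)).objObjPreimageIso (l i)
    let n {i j : J} (f : i ⟶ j) : V.map f ≫ m j ≅ m i := (transpose F q (V.obj i)).preimageIso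
      (transposeComp F q (V.map f) (m j) ≪≫ whiskerLeftIso (F.map (V.map f)) (e j) ≪≫
        t f ≪≫ (e i).symm)
    have hn {i j : J} (f : i ⟶ j) : (transpose F q (V.obj i)).map (n f).hom =
        (transposeComp F q (V.map f) (m j)).hom ≫ F.map (V.map f) ◁ (e j).hom ≫
          (t f).hom ≫ (e i).inv :=
      (transpose F q (V.obj i)).map_preimage _
    let τ : V ⟶ constDiagram J R := mkCocone m n ?_ ?_ ?_
    · refine ⟨τ, ⟨mkCoconeIso e fun {i j} f => ?_⟩⟩
      have hτ : (legNat τ f).hom = (n f).hom := legNat_mkCocone _ _ _ _ _ _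
      refine Eq.trans ?_ (congrArg (fun t => t ≫ (e i).hom)
        ((legNat_mapCocone_comp F q τ f).trans (congrArg
          (fun s => (transposeComp F q (V.map f) (m j)).inv ≫ (transpose F q (V.obj i)).map s)
            hτ))).symm
      change F.map (V.map f) ◁ (e j).hom ≫ (t f).hom =
        ((transposeComp F q (V.map f) (m j)).inv ≫ (transpose F q (V.obj i)).map (n f).hom) ≫
          (e i).hom
      rw [hn]
      simp
    · intro i j f g η
      have ht : F.map₂ (V.map₂ η) ▷ l j ≫ (t g).hom = (t f).hom := legNat_naturality κ η
      apply (transpose F q (V.obj i)).map_injective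
      rw [Functor.map_comp, hn, hn, ← Category.assoc, transpose_whiskerRight, Category.assoc,
        ← whisker_exchange_assoc, ← Category.assoc (F.map₂ _ ▷ _), ht]
    · intro i
      have ht : (t (𝟙 i)).hom = (F.map₂ (V.mapId i).hom ≫ (F.mapId (V.obj i)).hom) ▷ l i ≫
          (λ_ (l i)).hom := legNat_id κ i
      apply (transpose F q (V.obj i)).map_injective
      have h1 := transpose_whiskerRight F q (V.mapId i).hom (m i)
      rw [← Iso.eq_comp_inv] at h1
      rw [Functor.map_comp, hn, transpose_leftUnitor, h1, ht]
      simp [whisker_exchange_assoc]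
    · intro i j k f g
      have ht : (t (f ≫ g)).hom = (F.map₂ (V.mapComp f g).hom ≫
          (F.mapComp (V.map f) (V.map g)).hom) ▷ l k ≫ (α_ _ _ _).hom ≫
            F.map (V.map f) ◁ (t g).hom ≫ (t f).hom := legNat_comp κ f g
      apply (transpose F q (V.obj i)).map_injective
      have h1 := transpose_whiskerLeft F q (V.map f) (n g).hom
      have h2 := transpose_associator F q (V.map f) (V.map g) (m k)
      have h3 := transpose_whiskerRight F q (V.mapComp f g).hom (m k)
      rw [← Iso.eq_comp_inv] at h1 h3
      rw [← Category.assoc, ← Bicategory.whiskerLeftIso_hom, ← Iso.eq_comp_inv,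
        ← Iso.eq_comp_inv] at h2
      rw [Functor.map_comp, Functor.map_comp, Functor.map_comp, hn, hn f, ht, h1, h2, h3, hn]
      simp [whisker_exchange_assoc]⟩

/-- If every object `W` of `C` admits a 1-morphism `q : F R ⟶ W` such that composition with `q`
induces equivalences between the 1-morphisms `X ⟶ R` and `F X ⟶ W`, then `F` preserves colimits. -/
theorem preserves_isBicolimit (F : B ⥤ᵖ C)
    (h : ∀ W : C, ∃ (R : B) (q : F.obj R ⟶ W), ∀ X, (transpose F q X).IsEquivalence)
    {V : J ⥤ᵖ B} {X : B} (σ : V ⟶ constDiagram J X) (hσ : IsBicolimit σ) :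
    IsBicolimit (mapCocone F σ) := fun W => by
  obtain ⟨R, q, hq⟩ := h W
  have := hσ R
  have := hq X
  have := coconeTranspose_isEquivalence V hq
  have nat (f : X ⟶ R) {i j : J} (g : i ⟶ j) :
      F.map (V.map g) ◁ (transposeComp F q (leg σ j) f).inv ≫
        (legNat (mapCocone F (σ ≫ constTrans J f) ≫ constTrans J q) g).hom =
      (legNat (mapCocone F σ ≫ constTrans J (F.map f ≫ q)) g).hom ≫
        (transposeComp F q (leg σ i) f).inv := by
    have h1 : (legNat (mapCocone F σ ≫ constTrans J (F.map f ≫ q)) g).hom =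
        (α_ (F.map (V.map g)) (F.map (leg σ j)) (F.map f ≫ q)).inv ≫
          ((F.mapComp (V.map g) (leg σ j)).inv ≫ F.map₂ (legNat σ g).hom) ▷ (F.map f ≫ q) :=
      (legNat_comp_constTrans _ _ _).trans (congrArg
        (fun t => (α_ (F.map (V.map g)) (F.map (leg σ j)) (F.map f ≫ q)).inv ≫ t ▷ (F.map f ≫ q))
        (legNat_mkCocone _ _ _ _ _ _))
    have h2 := (legNat_mapCocone_comp F q (σ ≫ constTrans J f) g).trans (congrArg (fun t =>
      (transposeComp F q (V.map g) (leg σ j ≫ f)).inv ≫ (transpose F q (V.obj i)).map t)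
        (legNat_comp_constTrans _ _ _))
    refine (congrArg (fun t => F.map (V.map g) ◁ (transposeComp F q (leg σ j) f).inv ≫ t) h2).trans
      (Eq.trans ?_ (congrArg (fun t => t ≫ (transposeComp F q (leg σ i) f).inv) h1).symm)
    exact transpose_comp_assoc F q (V.map g) (leg σ j) (legNat σ g).hom f
  let i : transpose F q X ⋙ coconeFunctor (mapCocone F σ) W ≅
      coconeFunctor σ R ⋙ coconeTranspose F q V :=
    NatIso.ofComponents (fun f => mkCoconeIso
      (fun i => (transposeComp F q (leg σ i) f).symm) (nat f)) (fun η => coconeHom_ext fun i => ?_)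
  · have := Functor.isEquivalence_of_iso i.symm
    exact Functor.isEquivalence_of_comp_left (transpose F q X) _
  · have h1 := transpose_whiskerLeft F q (leg σ i) η
    rw [← Iso.eq_comp_inv, Category.assoc, ← Iso.inv_comp_eq] at h1
    exact h1.symm

end Bicolimits

/-! ### The maximal tensor product preserves bicolimits in each variable -/

section Closed

open BiStar

variable {A B W X P Q : Clin.{u}}

/-- Postcomposition of a functor of two variables with a `*`-functor. -/
def BiStar.post (K : BiStar A B P) (H : P ⟶ W) : BiStar A B W where
  obj a b := (fn H).obj (K.obj a b)
  map f g := (fn H).map (K.map f g)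
  map_id a b := (congrArg (fn H).map (K.map_id a b)).trans ((fn H).map_id _)
  map_comp f g f' g' := (congrArg (fn H).map (K.map_comp f g f' g')).trans ((fn H).map_comp _ _)
  map_add_left f f' g := (congrArg (fn H).map (K.map_add_left f f' g)).trans ((fn H).map_add _ _)
  map_add_right f g g' := (congrArg (fn H).map (K.map_add_right f g g')).trans ((fn H).map_add _ _)
  map_smul_left c f g := (congrArg (fn H).map (K.map_smul_left c f g)).trans ((fn H).map_smul _ _)
  map_smul_right c f g :=
    (congrArg (fn H).map (K.map_smul_right c f g)).trans ((fn H).map_smul _ _)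
  map_dag f g := (congrArg (fn H).map (K.map_dag f g)).trans ((fn H).map_dag _)

/-- A 2-morphism between 1-morphisms to an internal hom, from unitary components which are natural
in both variables. -/
def ihomCell {f g : X ⟶ ihom B W}
    (φ : ∀ (x : X) (b : B), (uncurry (fn f)).obj x b ⟶ (uncurry (fn g)).obj x b)
    (uni : ∀ x b, IsUnitary (φ x b))
    (nat : ∀ {x x' : X} {b b' : B} (m : x ⟶ x') (n : b ⟶ b'),
      (uncurry (fn f)).map m n ≫ φ x' b' = φ x b ≫ (uncurry (fn g)).map m n) : f ⟶ g :=
  have id_map (f : X ⟶ ihom B W) (x : X) {b b' : B} (n : b ⟶ b') :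
      (uncurry (fn f)).map (𝟙 x) n = (IHom.fn ((fn f).obj x)).map n :=
    (congrArg (fun t => IHom.app t b ≫ (IHom.fn ((fn f).obj x)).map n) ((fn f).map_id x)).trans
      (Category.id_comp _)
  have map_id (f : X ⟶ ihom B W) {x x' : X} (m : x ⟶ x') (b : B) :
      (uncurry (fn f)).map m (𝟙 b) = IHom.app ((fn f).map m) b :=
    (congrArg (fun t => IHom.app ((fn f).map m) b ≫ t)
      ((IHom.fn ((fn f).obj x')).map_id b)).trans (Category.comp_id _)
  (⟨fun x => IHom.mkHom (F := (fn f).obj x) (G := (fn g).obj x) (φ x) 1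
      (fun b => IHom.norm_isometry_le (uni x b).1)
      (fun {b b'} n => (congrArg (fun t => t ≫ φ x b') (id_map f x n)).symm.trans
        ((nat (𝟙 x) n).trans (congrArg (fun t => φ x b ≫ t) (id_map g x n)))),
    fun {x x'} m => IHom.hom_ext fun b => (congrArg (fun t => t ≫ φ x' b) (map_id f m b)).symm.trans
      ((nat m (𝟙 b)).trans (congrArg (fun t => φ x b ≫ t) (map_id g m b))),
    fun x => ⟨IHom.hom_ext fun b => (uni x b).1, IHom.hom_ext fun b => (uni x b).2⟩⟩ :
    UnitaryTrans (fn f : StarFunctor X (IHom B W)) (fn g))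

theorem app_ihomCell {f g : X ⟶ ihom B W}
    (φ : ∀ (x : X) (b : B), (uncurry (fn f)).obj x b ⟶ (uncurry (fn g)).obj x b)
    (uni : ∀ x b, IsUnitary (φ x b))
    (nat : ∀ {x x' : X} {b b' : B} (m : x ⟶ x') (n : b ⟶ b'),
      (uncurry (fn f)).map m n ≫ φ x' b' = φ x b ≫ (uncurry (fn g)).map m n) (x : X) (b : B) :
    IHom.app (cell (ihomCell φ uni nat) x) b = φ x b := rfl

/-- A commutative square remains commutative after its corners have been changed by unitaries. -/
theorem conj_unitary_square {T : Type*} [Category* T] [Preadditive T] [Linear ℂ T] [StarCategory T]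
    {a a' b b' c c' d d' : T}
    {p : a ⟶ a'} {q : b ⟶ b'} {u : c ⟶ c'} {v : d ⟶ d'} {z : a ⟶ b} {z' : a' ⟶ b'} {s : a ⟶ c}
    {s' : a' ⟶ c'} {t : b ⟶ d} {t' : b' ⟶ d'} (hs : IsUnitary s) (hs' : IsUnitary s')
    (h₁ : p ≫ z' = z ≫ q) (h₂ : p ≫ s' = s ≫ u) (h₃ : q ≫ t' = t ≫ v) :
    u ≫ dag s' ≫ z' ≫ t' = (dag s ≫ z ≫ t) ≫ v := by
  refine hs.cancel_left ?_
  rw [← Category.assoc, ← h₂, Category.assoc, hs'.hom_dag_assoc, ← Category.assoc, h₁,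
    Category.assoc, Category.assoc, Category.assoc, hs.hom_dag_assoc, h₃]

theorem respects_conj {f g : A ⟶ B} {x : A} {y y' : B} {η : f ⟶ g} {s : Tr f x y'} {t : Tr g x y'}
    {r : Tr f x y} {m : x ⟶ x} {d e : y ⟶ y'} (h₁ : Respects η s t) (h₂ : Conj r s m d)
    (hm : m = 𝟙 x) (hd : d = e) : cell η x ≫ t.hom = r.hom ≫ e := by
  subst hm hd
  rw [h₁, ← h₂, (fn f).map_id, Category.id_comp]

/-- If the objects `K x b` generate `P`, then a functor from 1-morphisms `X ⟶ ihom B W` to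
1-morphisms `P ⟶ W` is an equivalence as soon as the value of the image of `f` at `K x b` is, up to
a natural unitary, the value at `b` of `f x`. -/
theorem isEquivalence_of_eval (E : (X ⟶ ihom B W) ⥤ (P ⟶ W)) (K : BiStar X B P)
    {M : ∀ p q : X × B, Set (K.obj p.1 p.2 ⟶ K.obj q.1 q.2)}
    (G : Gen (fun p : X × B => K.obj p.1 p.2) M) (hM : ∀ p q, ∀ h ∈ M p q, ∃ f g, K.map f g = h)
    (T : ∀ (f : X ⟶ ihom B W) (x : X) (b : B), Tr (E.obj f) (K.obj x b) ((uncurry (fn f)).obj x b))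
    (conj_T : ∀ (f : X ⟶ ihom B W) {x x' : X} {b b' : B} (m : x ⟶ x') (n : b ⟶ b'),
      Conj (T f x b) (T f x' b') (K.map m n) ((uncurry (fn f)).map m n))
    (cell_T : ∀ {f g : X ⟶ ihom B W} (η : f ⟶ g) (x : X) (b : B),
      cell (E.map η) (K.obj x b) ≫ (T g x b).hom = (T f x b).hom ≫ IHom.app (cell η x) b) :
    E.IsEquivalence where
  faithful := ⟨fun {f g η θ} h => StarFunctor.hom_ext fun x => IHom.hom_ext fun b =>
    (T f x b).unitary.cancel_left ((cell_T η x b).symm.trans ((congrArg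
      (fun t => cell t (K.obj x b) ≫ (T g x b).hom) h).trans (cell_T θ x b)))⟩
  full := ⟨fun {f g} ζ => by
    let φ (x : X) (b : B) : (uncurry (fn f)).obj x b ⟶ (uncurry (fn g)).obj x b :=
      dag (T f x b).hom ≫ cell ζ (K.obj x b) ≫ (T g x b).hom
    have hφ (x b) : (T f x b).hom ≫ φ x b = cell ζ (K.obj x b) ≫ (T g x b).hom :=
      (T f x b).unitary.hom_dag_assoc _
    refine ⟨ihomCell φ (fun x b => (T f x b).unitary.dag.comp
      ((StarFunctor.unitary ζ _).comp (T g x b).unitary)) fun {x x' b b'} m n => ?_,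
      G.hom_ext fun p => (T g p.1 p.2).unitary.cancel_right ?_⟩
    · exact conj_unitary_square (T f x b).unitary (T f x' b').unitary
        (StarFunctor.naturality ζ (K.map m n)) (conj_T f m n) (conj_T g m n)
    · refine (cell_T _ p.1 p.2).trans (Eq.trans ?_ (hφ p.1 p.2))
      exact congrArg (fun t => (T f p.1 p.2).hom ≫ t) (app_ihomCell _ _ _ _ _)⟩
  -- A preimage of `H` is `x ↦ (b ↦ H (K x b))`.
  essSurj := ⟨fun H => ⟨(K.post H).curry, ⟨G.iso (fun p => T (K.post H).curry p.1 p.2)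
    (fun p => rfl' H (K.obj p.1 p.2)) (by
      intro p q h hh
      obtain ⟨m, n, rfl⟩ := hM p q h hh
      exact ⟨_, (conj_T _ m n).congr ((K.post H).map_id_comp m n), Conj.rfl' H _⟩)⟩⟩⟩

/-- The internal hom is a right biadjoint of `- ⊠ B`, with the evaluation as counit. -/
theorem transpose_tensorRight_isEquivalence (B W X : Clin.{u}) :
    (transpose (tensorRight maxTensor B) (ev (𝟙 (ihom B W))) X).IsEquivalence :=
  isEquivalence_of_eval _ (elts X B) ((Gen.all X).tensor (Gen.all B))
    (fun _ _ _ ⟨f, _, g, _, h⟩ => ⟨f, g, h⟩)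
    (fun f x b => cmp (tns (rfl' f x) (idt b)) (evTr (idt ((fn f).obj x)) b))
    (fun f x x' b b' m n => ((Conj.rfl' f m).tns (Conj.idt n)).cmp (conj_evTr (Conj.idt _) n))
    (fun {f g} η x b => by
      have h₁ := (Respects.tmap₂ (RespectsTo.pull η x).out (Respects.id (idt b))).whiskerRight
        (evTr (idt ((fn g).obj x)) b)
      have h₂ := ((Conj.taut (Tr.pull η x)).tns (Conj.idt (𝟙 b))).cmp
        (conj_evTr (Conj.idt (cell η x)) (𝟙 b))
      exact respects_conj h₁ h₂ (eltHom_id x b)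
        ((congrArg (fun t => IHom.app (cell η x) b ≫ t) ((IHom.fn ((fn g).obj x)).map_id b)).trans
          (Category.comp_id _)))

/-- The internal hom is a right biadjoint of `A ⊠ -`. -/
theorem transpose_tensorLeft_isEquivalence (A W X : Clin.{u}) :
    (transpose (tensorLeft maxTensor A) (evFlip (𝟙 (ihom A W))) X).IsEquivalence :=
  have G := (Gen.all A).tensor (Gen.all X)
  isEquivalence_of_eval _ (elts A X).flip
    (M := fun p q => {h | ∃ f ∈ Set.univ, ∃ g ∈ Set.univ, eltHom f g = h})
    ⟨fun P => (G.gen P).imp fun _ ⟨i, k, h⟩ => ⟨i, fun a => (k a).swap, h⟩,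
      fun {i j} f => G.dense (i := i.swap) (j := j.swap) f⟩
    (fun _ _ _ ⟨f, _, g, _, h⟩ => ⟨g, f, h⟩)
    (fun f x a => cmp (tns (idt a) (rfl' f x)) (evFlipTr (idt ((fn f).obj x)) a))
    (fun f x x' a a' m n => ((Conj.idt n).tns (Conj.rfl' f m)).cmp (conj_evFlipTr (Conj.idt _) n))
    (fun {f g} η x a => by
      have h₁ := (Respects.tmap₂ (Respects.id (idt a)) (RespectsTo.pull η x).out).whiskerRight
        (evFlipTr (idt ((fn g).obj x)) a)
      have h₂ := ((Conj.idt (𝟙 a)).tns (Conj.taut (Tr.pull η x))).cmp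
        (conj_evFlipTr (Conj.idt (cell η x)) (𝟙 a))
      exact respects_conj h₁ h₂ (eltHom_id a x)
        ((congrArg (fun t => IHom.app (cell η x) a ≫ t) ((IHom.fn ((fn g).obj x)).map_id a)).trans
          (Category.comp_id _)))

theorem preservesSmallColimits_tensorLeft (A : Clin.{u}) :
    PreservesSmallColimits.{u, u, u + 1, u} (tensorLeft maxTensor A) :=
  fun _ _ _ _ σ hσ => preserves_isBicolimit _
    (fun W => ⟨ihom A W, evFlip (𝟙 (ihom A W)), transpose_tensorLeft_isEquivalence A W⟩) σ hσ

theorem preservesSmallColimits_tensorRight (B : Clin.{u}) :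
    PreservesSmallColimits.{u, u, u + 1, u} (tensorRight maxTensor B) :=
  fun _ _ _ _ σ hσ => preserves_isBicolimit _
    (fun W => ⟨ihom B W, ev (𝟙 (ihom B W)), transpose_tensorRight_isEquivalence B W⟩) σ hσ

end Closed

end CStarLin

end

/-- The maximal tensor product of C*-categories is a monoidal structure on the (2,1)-category `Clin`,
and it preserves small colimits in each variable. -/
theorem theoremA :
    Nonempty (CStarLin.MonoidalStructure CStarLin.Clin.maxTensor.{u}) ∧
      (∀ A : CStarLin.Clin.{u}, CStarLin.PreservesSmallColimits.{u, u, u + 1, u}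
        (CStarLin.tensorLeft CStarLin.Clin.maxTensor A)) ∧
      ∀ B : CStarLin.Clin.{u}, CStarLin.PreservesSmallColimits.{u, u, u + 1, u}
        (CStarLin.tensorRight CStarLin.Clin.maxTensor B) :=
  ⟨⟨CStarLin.monoidalStructure⟩, CStarLin.preservesSmallColimits_tensorLeft,
    CStarLin.preservesSmallColimits_tensorRight⟩
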